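/- Let $\Gamma$ be a finite directed graph with non-empty vertex set $V\Gamma$, such that every vertex has out-degree at least $1$ and, whenever a vertex has out-degree $1$, its only outgoing edge is a loop. For each vertex $v$ fix a linear order $e_1<\dots<e_d$ of the edges originating from $v$; call $\mathrm{ter}(e_1),\dots,\mathrm{ter}(e_d)$ the children of $v$. A $\Gamma$-strand diagram is a finite acyclic directed graph (with vertices called points and edges called strands), colored on points and strands by $V\Gamma$, with a linear order of its sources, a linear order of its sinks, and left-to-right orders of the strands entering and leaving each point, such that each point $p$ of color $c$ is of one of the following types: a source with exactly one outgoing strand or a sink with exactly one incoming strand (called univalent), that strand having color $c$; a split, with at most one incoming strand (of color $c$) and at least two outgoing strands, colored in order by the children of $c$; a merge, with at most one outgoing strand (of color $c$) and at least two incoming strands, colored in order by the children of $c$; a degenerate point, with one incoming and one outgoing strand, both of color $c$, where $c$ has a single outgoing edge, which is a loop. A split (merge) is internal if it is not a source (sink). Diagrams are considered up to isomorphism. If the tuples of colors of the sources and of the sinks of $F$ are equal, the closed diagram $\mathcal C(F)$ is obtained from $F$ by identifying the $i$-th source with the $i$-th sink for all $i$ (if these are a split and a merge, a strand from the merge to the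 split is added); the resulting base points, in their order, form the base line, which is part of the data of $\mathcal C(F)$ (so $\mathcal C(F)$ determines $F$). Similarities of closed diagrams are compositions of the following moves. (a) Base line permutations: the same permutation is applied to the sources and to the sinks of $F$. (b) Base line shifts: if the $i$-th source of $F$ is a split or is univalent and followed immediately by an internal split, this split is moved to below the $i$-th sink, so that the $i$-th base point is replaced by one base point for each strand originating from the split, in order; or, upside-down, the same is done with a merge at a sink; or the converse of one of these moves. Reductions of closed diagrams are the following moves. Type 0: a degenerate point of $F$ is removed and its two strands become a single strand. Type 1: if the outgoing strands of a split $v$ of $F$ are, in the same order, the incoming strands of a merge $w$ of the same color, then these strands are removed, and $v$ (or, if $v$ is internal, its incoming strand, $v$ being removed) and $w$ (or, if $w$ is internal, its outgoing strand, $w$ being removed) are attached through a single strand. Type 2: if a strand $s$ of $F$ goes from a merge $v$ to a split $w$, then $v$, $w$ and $s$ are removed and the $i$-th incoming strand of $v$ is attached to the $i$-th outgoing strand of $w$, for all $i$. Type 3: let $v\in V\Gamma$ have children $v_1,\dots,v_d$ and let $k\ge 1$. If $y_{i+1},\dots,y_{i+kd}$ are consecutive base points of $\mathcal C(F)$, none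 of which is a split or a merge, such that for each $j\in\{1,\dots,d\}$ the points $y_{i+j},y_{i+j+d},\dots,y_{i+j+(k-1)d}$ have color $v_j$ and, in this order, form a directed cycle, then these $d$ cycles are replaced by a single directed cycle of color $v$ through $k$ consecutive base points $y'_{i+1},\dots,y'_{i+k}$, in this order. Two closed diagrams are equivalent if they are related by a finite sequence of similarities, reductions of types 0, 1, 2, 3 and inverses of reductions, and 3-equivalent if they are related by a finite sequence of similarities, type 3 reductions and inverses of type 3 reductions. A closed diagram is semi-reduced if no reduction of type 0, 1 or 2 can be performed on it nor on any closed diagram related to it by similarities. Proposition. If two $\Gamma$-closed strand diagrams $\mathcal C(F)$ and $\mathcal C(G)$ are semi-reduced and equivalent, then they are 3-equivalent. -/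

import Mathlib

/-- A directed graph with vertex set `V` and edge set `E` (loops and parallel edges are allowed),
together with a linear order `e₁ < ⋯ < eₖ` of the edges originating from each vertex `v`,
recorded as the list `out v = [e₁, …, eₖ]`. -/
structure OrderedGraph (V E : Type*) where
  ini : E → V
  ter : E → V
  out : V → List E
  out_nodup : ∀ v, (out v).Nodup
  mem_out : ∀ v e, e ∈ out v ↔ ini e = v

namespace OrderedGraph

variable {V E : Type*}

/-- No vertex has out-degree `0`. -/
def NoDeadEnds (Γ : OrderedGraph V E) : Prop :=
  ∀ v, ∃ e, Γ.ini e = v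

/-- If a vertex has out-degree `1`, then its unique outgoing edge is a loop. -/
def NoRedundantEdges (Γ : OrderedGraph V E) : Prop :=
  ∀ e, (∀ e', Γ.ini e' = Γ.ini e → e' = e) → Γ.ter e = Γ.ini e

/-- The colors `[ter e₁, …, ter eₖ]` of the children of `v`, in order. -/
def children (Γ : OrderedGraph V E) (v : V) : List V :=
  (Γ.out v).map Γ.ter

end OrderedGraph

/-- The data underlying a strand diagram: a finite graph, whose vertices are called points and
whose edges are called strands, both colored by `C`, with a linear order of its sources and of its
sinks, and with the strands that originate from (`outs p`) and terminate at (`ins p`) each point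
`p` listed from left to right. For a point with one incoming strand `s` and outgoing strands
`outs p = [s₁, …, sₖ]`, this amounts to the cyclic order `(s, s₁, …, sₖ)` around `p`; for a point
with one outgoing strand `s` and incoming strands `ins p = [s₁, …, sₖ]`, it amounts to the cyclic
order `(s, sₖ, …, s₁)`. -/
structure StrandGraph (C : Type*) where
  Point : Type
  Strand : Type
  finite_point : Finite Point
  finite_strand : Finite Strand
  ini : Strand → Point
  ter : Strand → Point
  pcol : Point → C
  scol : Strand → C
  outs : Point → List Strand
  outs_nodup : ∀ p, (outs p).Nodup
  mem_outs : ∀ p s, s ∈ outs p ↔ ini s = p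
  ins : Point → List Strand
  ins_nodup : ∀ p, (ins p).Nodup
  mem_ins : ∀ p s, s ∈ ins p ↔ ter s = p
  sources : List Point
  sources_nodup : sources.Nodup
  mem_sources : ∀ p, p ∈ sources ↔ ins p = []
  sinks : List Point
  sinks_nodup : sinks.Nodup
  mem_sinks : ∀ p, p ∈ sinks ↔ outs p = []

namespace StrandGraph

variable {C : Type*} (F : StrandGraph C)

/-- There is a strand from `p` to `q`. -/
def Step (p q : F.Point) : Prop :=
  ∃ s, F.ini s = p ∧ F.ter s = q

/-- There is no directed cycle. -/
def Acyclic : Prop :=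
  ∀ p, ¬ Relation.TransGen F.Step p p

def IsUnivalentSource (p : F.Point) : Prop :=
  F.ins p = [] ∧ (F.outs p).length = 1

def IsUnivalentSink (p : F.Point) : Prop :=
  F.outs p = [] ∧ (F.ins p).length = 1

/-- A split: a split-source if it has no incoming strand, an internal split if it has one. -/
def IsSplit (p : F.Point) : Prop :=
  (F.ins p).length ≤ 1 ∧ 2 ≤ (F.outs p).length

/-- A merge: a merge-sink if it has no outgoing strand, an internal merge if it has one. -/
def IsMerge (p : F.Point) : Prop :=
  (F.outs p).length ≤ 1 ∧ 2 ≤ (F.ins p).length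

def IsDegenerate (p : F.Point) : Prop :=
  (F.ins p).length = 1 ∧ (F.outs p).length = 1

/-- The upside-down graph. -/
def flip : StrandGraph C where
  Point := F.Point
  Strand := F.Strand
  finite_point := F.finite_point
  finite_strand := F.finite_strand
  ini := F.ter
  ter := F.ini
  pcol := F.pcol
  scol := F.scol
  outs := F.ins
  outs_nodup := F.ins_nodup
  mem_outs := F.mem_ins
  ins := F.outs
  ins_nodup := F.outs_nodup
  mem_ins := F.mem_outs
  sources := F.sinks
  sources_nodup := F.sinks_nodup
  mem_sources := F.mem_sinks
  sinks := F.sources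
  sinks_nodup := F.sources_nodup
  mem_sinks := F.mem_sources

theorem flip_acyclic (h : F.Acyclic) : F.flip.Acyclic := by
  intro p hp
  have hstep : F.flip.Step = Function.swap F.Step := by
    funext a b
    exact propext ⟨fun ⟨s, h₁, h₂⟩ => ⟨s, h₂, h₁⟩, fun ⟨s, h₁, h₂⟩ => ⟨s, h₂, h₁⟩⟩
  rw [hstep] at hp
  exact h p (Relation.transGen_swap.1 hp)

end StrandGraph

/-- A `Γ`-strand diagram. -/
structure StrandDiagram {V E : Type*} (Γ : OrderedGraph V E) extends StrandGraph V where
  acyclic : toStrandGraph.Acyclic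
  types : ∀ p, toStrandGraph.IsUnivalentSource p ∨ toStrandGraph.IsUnivalentSink p ∨
    toStrandGraph.IsSplit p ∨ toStrandGraph.IsMerge p ∨ toStrandGraph.IsDegenerate p
  univalentSource_col : ∀ p, toStrandGraph.IsUnivalentSource p → ∀ s ∈ outs p, scol s = pcol p
  univalentSink_col : ∀ p, toStrandGraph.IsUnivalentSink p → ∀ s ∈ ins p, scol s = pcol p
  split_col : ∀ p, toStrandGraph.IsSplit p →
    (outs p).map scol = Γ.children (pcol p) ∧ ∀ s ∈ ins p, scol s = pcol p
  merge_col : ∀ p, toStrandGraph.IsMerge p →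
    (ins p).map scol = Γ.children (pcol p) ∧ ∀ s ∈ outs p, scol s = pcol p
  degenerate_col : ∀ p, toStrandGraph.IsDegenerate p →
    (∀ s ∈ ins p, scol s = pcol p) ∧ (∀ s ∈ outs p, scol s = pcol p) ∧
      ∃ e, Γ.out (pcol p) = [e] ∧ Γ.ter e = pcol p

namespace StrandDiagram

variable {V E : Type*} {Γ : OrderedGraph V E}

/-- The tuple of the colors of the sources. -/
def domain (F : StrandDiagram Γ) : List V := F.sources.map F.pcol

/-- The tuple of the colors of the sinks. -/
def range (F : StrandDiagram Γ) : List V := F.sinks.map F.pcol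

/-- The upside-down diagram. -/
def flip (F : StrandDiagram Γ) : StrandDiagram Γ where
  toStrandGraph := F.toStrandGraph.flip
  acyclic := F.toStrandGraph.flip_acyclic F.acyclic
  types := by
    intro p
    rcases F.types p with h | h | h | h | h
    · exact Or.inr (Or.inl h)
    · exact Or.inl h
    · exact Or.inr (Or.inr (Or.inr (Or.inl h)))
    · exact Or.inr (Or.inr (Or.inl h))
    · exact Or.inr (Or.inr (Or.inr (Or.inr ⟨h.2, h.1⟩)))
  univalentSource_col := F.univalentSink_col
  univalentSink_col := F.univalentSource_col
  split_col := F.merge_col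
  merge_col := F.split_col
  degenerate_col := fun p h =>
    ⟨(F.degenerate_col p ⟨h.2, h.1⟩).2.1, (F.degenerate_col p ⟨h.2, h.1⟩).1,
      (F.degenerate_col p ⟨h.2, h.1⟩).2.2⟩

/-- The maps `φ` and `π` carry the points of `F` that lie in `K`, with their colors and with the
ordered and colored strands around them, injectively to points of `F'`. The values of `φ` outside
`K` and those of `π` on strands not touching `K` are irrelevant. The map `π` may identify strands:
two strands with the same image become parts of one strand of `F'`. -/
structure Carries (F F' : StrandDiagram Γ) (K : Set F.Point)
    (φ : F.Point → F'.Point) (π : F.Strand → F'.Strand) : Prop where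
  injOn : Set.InjOn φ K
  pcol : ∀ p ∈ K, F'.pcol (φ p) = F.pcol p
  outs : ∀ p ∈ K, F'.outs (φ p) = (F.outs p).map π
  ins : ∀ p ∈ K, F'.ins (φ p) = (F.ins p).map π
  scol_outs : ∀ p ∈ K, ∀ s ∈ F.outs p, F'.scol (π s) = F.scol s
  scol_ins : ∀ p ∈ K, ∀ s ∈ F.ins p, F'.scol (π s) = F.scol s

/-- `F'` is the result of a type 0 reduction of `F`: a degenerate point `v` is removed and the
strands terminating at it and originating from it become a single strand. -/
def Reduction0 (F F' : StrandDiagram Γ) : Prop :=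
  ∃ (v : F.Point) (φ : F.Point → F'.Point) (π : F.Strand → F'.Strand),
    F.IsDegenerate v ∧
    F.Carries F' {v}ᶜ φ π ∧
    (F.ins v).map π = (F.outs v).map π ∧
    φ '' {v}ᶜ = Set.univ ∧
    F'.sources = F.sources.map φ ∧ F'.sinks = F.sinks.map φ

/-- `F'` is the result of a type 1 reduction of `F`: a split `v` and a merge `w` of the same color
are such that the strands originating from `v` are those terminating at `w`, in the same order.
These strands are removed, together with `v` if it is internal and with `w` if it is internal;
the strand terminating at `v` (or `v` itself, if it is a split-source) and the strand originating
from `w` (or `w` itself, if it is a merge-sink) are attached into a single strand `t`. -/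
def Reduction1 (F F' : StrandDiagram Γ) : Prop :=
  ∃ (v w : F.Point) (φ : F.Point → F'.Point) (π : F.Strand → F'.Strand) (t : F'.Strand),
    F.IsSplit v ∧ F.IsMerge w ∧ F.pcol v = F.pcol w ∧ F.outs v = F.ins w ∧
    F.Carries F' {v, w}ᶜ φ π ∧
    F'.scol t = F.pcol v ∧
    (∀ s ∈ F.ins v, π s = t) ∧ (∀ s ∈ F.outs w, π s = t) ∧
    (F.ins v = [] → F'.pcol (φ v) = F.pcol v ∧ F'.ins (φ v) = [] ∧ F'.outs (φ v) = [t]) ∧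
    (F.outs w = [] → F'.pcol (φ w) = F.pcol w ∧ F'.ins (φ w) = [t] ∧ F'.outs (φ w) = []) ∧
    Set.BijOn φ {p | (p = v → F.ins v = []) ∧ (p = w → F.outs w = [])} Set.univ ∧
    F'.sources = F.sources.map φ ∧ F'.sinks = F.sinks.map φ

/-- `F'` is the result of a type 2 reduction of `F`: a merge `v` and a split `w` are joined by a
strand `s`. Then `v`, `w` and `s` are removed and the `i`-th strand terminating at `v` is attached
to the `i`-th strand originating from `w`. -/
def Reduction2 (F F' : StrandDiagram Γ) : Prop :=
  ∃ (v w : F.Point) (s : F.Strand) (φ : F.Point → F'.Point) (π : F.Strand → F'.Strand),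
    F.IsMerge v ∧ F.IsSplit w ∧ F.outs v = [s] ∧ F.ins w = [s] ∧
    F.Carries F' {v, w}ᶜ φ π ∧
    (F.ins v).map π = (F.outs w).map π ∧
    φ '' {v, w}ᶜ = Set.univ ∧
    F'.sources = F.sources.map φ ∧ F'.sinks = F.sinks.map φ

/-- `F'` is obtained from `F` by permuting the base line, i.e., by applying the same permutation
to the sources and to the sinks (the identity permutation is allowed). -/
def BaseLinePermutation (F F' : StrandDiagram Γ) : Prop :=
  ∃ (φ : F.Point → F'.Point) (π : F.Strand → F'.Strand),
    F.Carries F' Set.univ φ π ∧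
    Function.Bijective φ ∧
    (F'.sources.zip F'.sinks).Perm ((F.sources.map φ).zip (F.sinks.map φ))

/-- `F'` is obtained from `F` by moving a split `w` from below a source `a` to below the
corresponding sink `b`. Here `w` is either `a` itself (a split-source) or an internal split joined
to the univalent source `a` by a strand. The source `a` is replaced by one source for each strand
originating from `w`, and that strand originates from it. If `b` is a univalent sink, the strand
terminating at `b` is made to terminate at `w`; if `b` is a merge-sink, it becomes an internal
merge, joined to `w` by a new strand. The strands now originating from `w` terminate at new
univalent sinks, which replace `b`. -/
def ExpandingSplitShift (F F' : StrandDiagram Γ) : Prop :=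
  ∃ (A B A' B' : List F.Point) (a b w : F.Point) (X X' : List F'.Point)
    (φ : F.Point → F'.Point) (π : F.Strand → F'.Strand) (t : F'.Strand),
    F.sources = A ++ a :: B ∧ F.sinks = A' ++ b :: B' ∧ A.length = A'.length ∧
    F.IsSplit w ∧ (w = a ∨ ∃ s, F.outs a = [s] ∧ F.ins w = [s]) ∧
    F.Carries F' {a, b, w}ᶜ φ π ∧
    (∀ s ∈ F.outs w, F'.scol (π s) = F.scol s) ∧
    F'.pcol (φ w) = F.pcol w ∧ F'.ins (φ w) = [t] ∧
    List.Forall₂ (fun x s => F'.outs x = [π s]) X (F.outs w) ∧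
    List.Forall₂ (fun x s => F'.ins x = [s]) X' (F'.outs (φ w)) ∧
    (F.IsUnivalentSink b → ∀ s ∈ F.ins b, π s = t) ∧
    (F.IsMerge b → F'.pcol (φ b) = F.pcol b ∧ F'.ins (φ b) = (F.ins b).map π ∧
      F'.outs (φ b) = [t]) ∧
    Set.BijOn φ {p | p = w ∨ (p ≠ a ∧ (p = b → F.IsMerge b))} {x | x ∉ X ∧ x ∉ X'} ∧
    F'.sources = A.map φ ++ X ++ B.map φ ∧ F'.sinks = A'.map φ ++ X' ++ B'.map φ

/-- `F'` is obtained from `F` by moving a merge from above a sink to above the corresponding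
source: upside-down, this moves a split from below a source to below the corresponding sink. -/
def ExpandingMergeShift (F F' : StrandDiagram Γ) : Prop :=
  F.flip.ExpandingSplitShift F'.flip

/-- In the closed diagram, there is a strand from the base point with source `x` (and with sink
`x'`) to the base point with sink `y'`, and `x` and `y'` are univalent, so that neither of these
base points is a split or a merge along this strand. -/
def BaseStrand (F : StrandDiagram Γ) (x y' : F.Point) : Prop :=
  ∃ s, F.outs x = [s] ∧ F.ins y' = [s]

/-- The consecutive base points with sources `X = [x₀, …, x_{kd-1}]` and sinks `X'` form `d` loops,
each with `k` points: for each `j < d`, the loop through the base points of indices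
`j, j + d, …, j + (k - 1) d`, in this order. -/
def FormLoops (F : StrandDiagram Γ) (d k : ℕ) (X X' : List F.Point) : Prop :=
  X.length = k * d ∧ X'.length = k * d ∧
    (∀ x ∈ X, F.ins x = []) ∧ (∀ x' ∈ X', F.outs x' = []) ∧
    List.Forall₂ F.BaseStrand X (X'.rotate d)

/-- `F'` is obtained from `F` by a type 3 reduction of the closed diagrams: for some vertex `v` of
`Γ` with `d` outgoing edges and some `k ≥ 1`, consecutive base points form `d` loops with `k` points
each, the `j`-th loop having the color of the `j`-th child of `v`; these are replaced by a single
loop of color `v` with `k` points. -/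
def Reduction3 (F F' : StrandDiagram Γ) : Prop :=
  ∃ (v : V) (k : ℕ) (A X B A' X' B' : List F.Point) (Z Z' : List F'.Point)
    (φ : F.Point → F'.Point) (π : F.Strand → F'.Strand),
    1 ≤ k ∧
    F.sources = A ++ X ++ B ∧ F.sinks = A' ++ X' ++ B' ∧ A.length = A'.length ∧
    F.FormLoops (Γ.out v).length k X X' ∧
    X.map F.pcol = (List.replicate k (Γ.children v)).flatten ∧
    F.Carries F' {p | p ∉ X ∧ p ∉ X'} φ π ∧
    Set.BijOn φ {p | p ∉ X ∧ p ∉ X'} {x | x ∉ Z ∧ x ∉ Z'} ∧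
    F'.sources = A.map φ ++ Z ++ B.map φ ∧ F'.sinks = A'.map φ ++ Z' ++ B'.map φ ∧
    F'.FormLoops 1 k Z Z' ∧
    (∀ z ∈ Z, F'.pcol z = v)

end StrandDiagram

/-- A `Γ`-closed strand diagram: the diagram `𝒞(F)` obtained from a `Γ`-strand diagram `F` with
equal domain and range by identifying each source with the corresponding sink. As the base line is
part of a closed diagram and cutting along it gives back `F`, a closed diagram is recorded by `F`;
its `i`-th base point is the pair of the `i`-th source and the `i`-th sink of `F`. -/
structure ClosedStrandDiagram {V E : Type*} (Γ : OrderedGraph V E) where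
  cut : StrandDiagram Γ
  domain_eq_range : cut.domain = cut.range

namespace ClosedStrandDiagram

variable {V E : Type*} {Γ : OrderedGraph V E}

/-- An expanding base line shift. The reducing base line shifts are the converse moves. -/
def ExpandingShift (X Y : ClosedStrandDiagram Γ) : Prop :=
  X.cut.ExpandingSplitShift Y.cut ∨ X.cut.ExpandingMergeShift Y.cut

/-- A single base line shift or base line permutation. -/
def SimilarityStep (X Y : ClosedStrandDiagram Γ) : Prop :=
  X.ExpandingShift Y ∨ Y.ExpandingShift X ∨ X.cut.BaseLinePermutation Y.cut

/-- Two closed diagrams are similar if they are related by base line shifts and permutations. -/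
def Similar (X Y : ClosedStrandDiagram Γ) : Prop :=
  Relation.EqvGen SimilarityStep X Y

/-- A single reduction of type 0, 1 or 2. -/
def Reduction012 (X Y : ClosedStrandDiagram Γ) : Prop :=
  X.cut.Reduction0 Y.cut ∨ X.cut.Reduction1 Y.cut ∨ X.cut.Reduction2 Y.cut

/-- A single reduction of type 3. -/
def Reduction3 (X Y : ClosedStrandDiagram Γ) : Prop :=
  X.cut.Reduction3 Y.cut

/-- Related by similarities, reductions (of types 0, 1, 2 and 3) and inverses of reductions. -/
def Equivalent (X Y : ClosedStrandDiagram Γ) : Prop :=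
  Relation.EqvGen (fun A B => SimilarityStep A B ∨ Reduction012 A B ∨ Reduction3 A B) X Y

/-- Related by similarities, type 3 reductions and inverses of type 3 reductions. -/
def ThreeEquivalent (X Y : ClosedStrandDiagram Γ) : Prop :=
  Relation.EqvGen (fun A B => SimilarityStep A B ∨ Reduction3 A B) X Y

/-- No reduction of type 0, 1 or 2 can be performed on any diagram similar to `X`. -/
def SemiReduced (X : ClosedStrandDiagram Γ) : Prop :=
  ∀ Y Z, Similar X Y → ¬ Reduction012 Y Z

end ClosedStrandDiagram

open Relation
open List (Forall₂ Nodup append_inj cons_ne_nil exists_mem_of_ne_nil ext_getElem forall₂_same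
  getElem?_eq_getElem getElem?_map getElem_map getElem_mem getElem_zip get_mem length_eq_one_iff
  length_eq_zero_iff length_finRange length_map length_pos_iff length_zip map_append map_congr_left
  map_eq_nil_iff map_id mem_append mem_append_right mem_finRange mem_iff_getElem mem_map
  mem_map_of_mem mem_of_getElem? mem_range mem_rotate mem_singleton nodup_append nodup_finRange
  of_mem_zip zip_append zip_map zip_swap)

section

variable {V E : Type*} {Γ : OrderedGraph V E}

lemma Relation.EqvGen.total_of_unique {α : Type*} {r : α → α → Prop}
    (hr : ∀ x y z, r x y → r x z → y = z) (hl : ∀ x y z, r x z → r y z → x = y)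
    {x y : α} (h : EqvGen r x y) : ReflTransGen r x y ∨ ReflTransGen r y x := by
  have U : Relator.RightUnique r := fun a b c h₁ h₂ => hr a b c h₁ h₂
  have U' : Relator.RightUnique (Function.swap r) := fun a b c h₁ h₂ => hl b c a h₁ h₂
  induction h with
  | rel x y h => exact .inl (.single h)
  | refl x => exact Or.inl .refl
  | symm x y _ ih => exact ih.symm
  | trans x y z _ _ ih₁ ih₂ =>
    rcases ih₁ with h₁ | h₁ <;> rcases ih₂ with h₂ | h₂
    · exact .inl (h₁.trans h₂)
    · have := ReflTransGen.total_of_right_unique U' (reflTransGen_swap.2 h₁)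
        (reflTransGen_swap.2 h₂)
      rcases this with h | h
      · exact .inr (reflTransGen_swap.1 h)
      · exact .inl (reflTransGen_swap.1 h)
    · exact ReflTransGen.total_of_right_unique U h₁ h₂
    · exact .inr (h₂.trans h₁)

lemma Relation.EqvGen.eq_of_isolated {α : Type*} {r : α → α → Prop} {x y : α}
    (h : EqvGen r x y) : (∀ z, ¬ r x z ∧ ¬ r z x) ∨ (∀ z, ¬ r y z ∧ ¬ r z y) → x = y := by
  induction h with
  | rel x y h => rintro (h' | h'); exacts [absurd h (h' _).1, absurd h (h' _).2]
  | refl x => exact fun _ => rfl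
  | symm x y _ ih => exact fun h => (ih h.symm).symm
  | trans x y z _ _ ih₁ ih₂ =>
    rintro (h | h)
    · obtain rfl := ih₁ (.inl h); exact ih₂ (.inl h)
    · obtain rfl := ih₂ (.inr h); exact ih₁ (.inr h)

/-- Shifting an element of the infinite cyclic cover. -/
def sh {S : Type*} (n : ℤ) (x : S × ℤ) : S × ℤ := (x.1, x.2 + n)

section sh
variable {S : Type*}
@[simp] lemma sh_zero (x : S × ℤ) : sh 0 x = x := by simp [sh]
@[simp] lemma sh_sh (m n : ℤ) (x : S × ℤ) : sh m (sh n x) = sh (n + m) x := by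
  simp [sh, add_assoc]
@[simp] lemma sh_mk (n m : ℤ) (s : S) : sh n (s, m) = (s, m + n) := rfl
@[simp] lemma sh_fst (n : ℤ) (x : S × ℤ) : (sh n x).1 = x.1 := rfl
lemma sh_fst_eq {n m : ℤ} {x y : S × ℤ} (h : sh n x = sh m y) : x.1 = y.1 :=
  show (sh n x).1 = (sh m y).1 from h ▸ rfl
lemma sh_eq_self {n : ℤ} {x : S × ℤ} : sh n x = x ↔ n = 0 := by
  simp [sh, Prod.ext_iff]
end sh

/-- A net: a presentation of the infinite cyclic cover of a closed strand diagram. -/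
structure Net {V E : Type*} (Γ : OrderedGraph V E) where
  P : Type
  S : Type
  fP : Finite P
  fS : Finite S
  alive : P → Prop
  split : P → Prop
  col : P → V
  scol : S → V
  port : P → ℕ → S × ℤ
  gen : S × ℤ → S × ℤ → Prop

namespace Net

variable (N : Net Γ) {N' N'' : Net Γ}

instance : Finite N.P := N.fP
instance : Finite N.S := N.fS

/-- The number of ports at the wide side of a point. -/
def deg (p : N.P) : ℕ := (Γ.children (N.col p)).length

/-- Two lifts lie on the same lifted strand. -/
def Rel : N.S × ℤ → N.S × ℤ → Prop := EqvGen N.gen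

variable {N}
lemma Rel.refl (x) : N.Rel x x := EqvGen.refl x
lemma Rel.symm {x y} (h : N.Rel x y) : N.Rel y x := EqvGen.symm _ _ h
lemma Rel.trans {x y z} (h : N.Rel x y) (h' : N.Rel y z) : N.Rel x z := EqvGen.trans _ _ _ h h'
lemma rel_of_gen {x y} (h : N.gen x y) : N.Rel x y := EqvGen.rel _ _ h
lemma rel_comm {x y} : N.Rel x y ↔ N.Rel y x := ⟨Rel.symm, Rel.symm⟩
variable (N)

structure WF : Prop where
  gen_sh : ∀ n x y, N.gen x y → N.gen (sh n x) (sh n y)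
  gen_right : ∀ x y z, N.gen x y → N.gen x z → y = z
  gen_left : ∀ x y z, N.gen x z → N.gen y z → x = y
  gen_col : ∀ x y, N.gen x y → N.scol x.1 = N.scol y.1
  deg_ge : ∀ p, N.alive p → 2 ≤ N.deg p
  col_zero : ∀ p, N.alive p → N.scol (N.port p 0).1 = N.col p
  col_succ : ∀ p, N.alive p → ∀ k < N.deg p, (Γ.children (N.col p))[k]? = some (N.scol (N.port p (k + 1)).1)
  start_gen : ∀ p k x n, N.alive p → k ≤ N.deg p → (N.split p ↔ k ≠ 0) → ¬ N.gen x (sh n (N.port p k))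
  start_inj : ∀ p k q l, N.alive p → k ≤ N.deg p → (N.split p ↔ k ≠ 0) →
    N.alive q → l ≤ N.deg q → (N.split q ↔ l ≠ 0) → (N.port p k).1 = (N.port q l).1 → p = q ∧ k = l
  end_gen : ∀ p k x n, N.alive p → k ≤ N.deg p → (N.split p ↔ k = 0) → ¬ N.gen (sh n (N.port p k)) x
  end_inj : ∀ p k q l, N.alive p → k ≤ N.deg p → (N.split p ↔ k = 0) →
    N.alive q → l ≤ N.deg q → (N.split q ↔ l = 0) → (N.port p k).1 = (N.port q l).1 → p = q ∧ k = l

variable {N}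

lemma eq_of_reflTransGen {α : Type*} {r : α → α → Prop} {x y : α} (hx : ∀ z, ¬ r z y)
    (h : ReflTransGen r x y) : x = y := by
  rcases h.cases_tail with h | ⟨z, _, h⟩
  exacts [h.symm, absurd h (hx z)]

lemma eq_of_reflTransGen' {α : Type*} {r : α → α → Prop} {x y : α} (hx : ∀ z, ¬ r x z)
    (h : ReflTransGen r x y) : x = y := by
  rcases h.cases_head with h | ⟨z, h, _⟩
  exacts [h, absurd h (hx z)]

section WF
variable (h : N.WF)
include h

lemma WF.rel_sh' (n : ℤ) {x y} (hxy : N.Rel x y) : N.Rel (sh n x) (sh n y) := by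
  induction hxy with
  | rel x y hg => exact rel_of_gen (h.gen_sh _ _ _ hg)
  | refl x => exact .refl _
  | symm x y _ ih => exact ih.symm
  | trans x y z _ _ ih₁ ih₂ => exact ih₁.trans ih₂

lemma WF.rel_sh (n : ℤ) {x y} : N.Rel (sh n x) (sh n y) ↔ N.Rel x y :=
  ⟨fun hh => by simpa using h.rel_sh' (-n) hh, h.rel_sh' n⟩

/-- Shifts may be moved from one side to the other. -/
lemma WF.rel_sh_left (n m : ℤ) {x y} : N.Rel (sh n x) (sh m y) ↔ N.Rel x (sh (m - n) y) := by
  rw [← h.rel_sh n (x := x)]; simp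

lemma WF.rel_col {x y} (hxy : N.Rel x y) : N.scol x.1 = N.scol y.1 := by
  induction hxy with
  | rel x y hg => exact h.gen_col _ _ hg
  | refl x => rfl
  | symm x y _ ih => exact ih.symm
  | trans x y z _ _ ih₁ ih₂ => exact ih₁.trans ih₂

lemma WF.rel_sh_base (n : ℤ) {x y : N.S × ℤ} : N.Rel (x.1, 0) (y.1, n) ↔ N.Rel x (sh (n + x.2 - y.2) y) := by
  rw [← h.rel_sh x.2]; simp [sh]

lemma WF.total {x y} (hxy : N.Rel x y) : ReflTransGen N.gen x y ∨ ReflTransGen N.gen y x :=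
  EqvGen.total_of_unique h.gen_right h.gen_left hxy

lemma WF.start_rel {p k q l n} (hp : N.alive p) (hk : k ≤ N.deg p) (hpk : N.split p ↔ k ≠ 0)
    (hq : N.alive q) (hl : l ≤ N.deg q) (hql : N.split q ↔ l ≠ 0)
    (hr : N.Rel (N.port p k) (sh n (N.port q l))) : p = q ∧ k = l ∧ n = 0 := by
  have key : N.port p k = sh n (N.port q l) := by
    rcases h.total hr with hr | hr
    · exact eq_of_reflTransGen (fun z => h.start_gen q l z n hq hl hql) hr
    · exact (eq_of_reflTransGen (fun z => by simpa using h.start_gen p k z 0 hp hk hpk) hr).symm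
  obtain ⟨rfl, rfl⟩ := h.start_inj p k q l hp hk hpk hq hl hql (by rw [key]; rfl)
  exact ⟨rfl, rfl, sh_eq_self.1 key.symm⟩

lemma WF.end_rel {p k q l n} (hp : N.alive p) (hk : k ≤ N.deg p) (hpk : N.split p ↔ k = 0)
    (hq : N.alive q) (hl : l ≤ N.deg q) (hql : N.split q ↔ l = 0)
    (hr : N.Rel (N.port p k) (sh n (N.port q l))) : p = q ∧ k = l ∧ n = 0 := by
  have key : N.port p k = sh n (N.port q l) := by
    rcases h.total hr with hr | hr
    · exact eq_of_reflTransGen' (fun z => by simpa using h.end_gen p k z 0 hp hk hpk) hr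
    · exact (eq_of_reflTransGen' (fun z => h.end_gen q l z n hq hl hql) hr).symm
  obtain ⟨rfl, rfl⟩ := h.end_inj p k q l hp hk hpk hq hl hql (by rw [key]; rfl)
  exact ⟨rfl, rfl, sh_eq_self.1 key.symm⟩

/-- Two ports of the same side (both starts or both ends) on one lifted strand coincide. -/
lemma WF.side_rel {p k q l n} (hp : N.alive p) (hk : k ≤ N.deg p)
    (hq : N.alive q) (hl : l ≤ N.deg q) (hs : (N.split p ↔ k = 0) ↔ (N.split q ↔ l = 0))
    (hr : N.Rel (N.port p k) (sh n (N.port q l))) : p = q ∧ k = l ∧ n = 0 := by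
  by_cases hpk : N.split p ↔ k = 0
  · exact h.end_rel hp hk hpk hq hl (hs.1 hpk) hr
  · exact h.start_rel hp hk (by tauto) hq hl (by tauto) hr

lemma WF.port_self {p k n} (hp : N.alive p) (hk : k ≤ N.deg p)
    (hr : N.Rel (N.port p k) (sh n (N.port p k))) : n = 0 :=
  (h.side_rel hp hk hp hk Iff.rfl hr).2.2

end WF

/-- The lifted strand of `x` meets no point. -/
def Portless (N : Net Γ) (x : N.S × ℤ) : Prop :=
  ∀ p k n, N.alive p → k ≤ N.deg p → ¬ N.Rel x (sh n (N.port p k))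

lemma Portless.congr {x y} (hx : N.Portless x) (h : N.Rel x y) : N.Portless y :=
  fun p k n hp hk hr => hx p k n hp hk (h.trans hr)

lemma WF.portless_sh (hN : N.WF) {x} (m : ℤ) : N.Portless (sh m x) ↔ N.Portless x := by
  constructor
  · intro hx p k n hp hk hr
    exact hx p k (n + m) hp hk (by simpa using hN.rel_sh' m hr)
  · intro hx p k n hp hk hr
    exact hx p k (n - m) hp hk ((hN.rel_sh_left _ _).1 hr)

lemma WF.portless_base (hN : N.WF) (x : N.S × ℤ) : N.Portless (x.1, 0) ↔ N.Portless x := by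
  rw [← hN.portless_sh x.2]; simp [_root_.sh]

/-- A loop: a strand without endpoints whose lifts have nontrivial period. -/
def IsLoop (N : Net Γ) (s : N.S) : Prop := N.Portless (s, 0) ∧ ∃ m : ℕ, 0 < m ∧ N.Rel (s, 0) (s, (m : ℤ))

lemma WF.isLoop_iff (hN : N.WF) (x : N.S × ℤ) :
    N.IsLoop x.1 ↔ N.Portless x ∧ ∃ m : ℕ, 0 < m ∧ N.Rel x (_root_.sh m x) := by
  unfold IsLoop
  rw [hN.portless_base]
  simp only [hN.rel_sh_base (x := x) (y := x)]
  simp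

lemma Portless.sh (hN : N.WF) {x} (hx : N.Portless x) (m : ℤ) : N.Portless (sh m x) :=
  fun p k n hp hk hr => hx p k (n - m) hp hk ((hN.rel_sh_left _ _).1 hr)

/-- The period of the lifts of a loop. -/
noncomputable def winding (N : Net Γ) (s : N.S) : ℕ := sInf {m : ℕ | 0 < m ∧ N.Rel (s, 0) (s, (m : ℤ))}

/-- Same strand, after forgetting lifts. -/
def Same (N : Net Γ) (s t : N.S) : Prop := ∃ n, N.Rel (s, 0) (t, n)

lemma WF.same_equivalence (h : N.WF) : Equivalence N.Same where
  refl s := ⟨0, .refl _⟩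
  symm := by
    rintro s t ⟨n, hn⟩
    refine ⟨-n, ?_⟩
    have := (h.rel_sh' (-n) hn).symm
    simpa using this
  trans := by
    rintro s t u ⟨n, hn⟩ ⟨m, hm⟩
    refine ⟨m + n, hn.trans ?_⟩
    simpa using h.rel_sh' n hm

lemma WF.same_of_rel (h : N.WF) {x y} (hr : N.Rel x y) : N.Same x.1 y.1 := by
  refine ⟨y.2 - x.2, ?_⟩
  have := h.rel_sh' (-x.2) hr
  simpa [Net.Rel, sh, sub_eq_add_neg] using this

lemma WF.isLoop_congr (h : N.WF) {s t} (hst : N.Same s t) (hs : N.IsLoop s) : N.IsLoop t := by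
  obtain ⟨n, hn⟩ := hst
  obtain ⟨hp, m, hm, hr⟩ := hs
  have hp' := hp.congr hn
  refine ⟨by simpa using hp'.sh h (-n), m, hm, ?_⟩
  have h1 := h.rel_sh' m hn
  have h2 := h.rel_sh' (-n) ((hn.symm.trans hr).trans (by simpa using h1))
  simpa [add_comm, add_assoc, add_left_comm] using h2

open Classical in
/-- The multiset of colors and periods of the loops in `T`. -/
noncomputable def loopsIn (N : Net Γ) (T : N.S → Prop) : Multiset (V × ℕ) :=
  (Set.toFinite {q : Quot N.Same | ∃ s, Quot.mk _ s = q ∧ T s ∧ N.IsLoop s}).toFinset.val.map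
    fun q => (N.scol q.out, N.winding q.out)

noncomputable def loops (N : Net Γ) : Multiset (V × ℕ) := N.loopsIn fun _ => True

lemma WF.mk_eq (h : N.WF) {s t : N.S} : Quot.mk N.Same s = Quot.mk N.Same t ↔ N.Same s t := ⟨fun he => by
    have := Quot.eqvGen_exact he
    rwa [h.same_equivalence.eqvGen_iff] at this, fun hs => Quot.sound hs⟩

lemma WF.same_out (h : N.WF) (s : N.S) : N.Same s (Quot.mk N.Same s).out := by
  rw [← h.mk_eq, Quot.out_eq]

/-- Comparison of the loops of two nets through a relation between lifts. -/
lemma loopsIn_congr (h : N.WF) (h' : N'.WF) {T : N.S → Prop} {T' : N'.S → Prop}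
    (ρ : N.S × ℤ → N'.S × ℤ → Prop)
    (heq : ∀ x x' y y', ρ x x' → ρ y y' → (N.Rel x y ↔ N'.Rel x' y'))
    (hsh : ∀ n x x', ρ x x' → ρ (sh n x) (sh n x'))
    (hcol : ∀ x x', ρ x x' → N.scol x.1 = N'.scol x'.1)
    (h1 : ∀ s, T s → N.IsLoop s → ∃ x', ρ (s, 0) x' ∧ T' x'.1 ∧ N'.IsLoop x'.1)
    (h2 : ∀ s', T' s' → N'.IsLoop s' → ∃ x, ρ x (s', 0) ∧ T x.1 ∧ N.IsLoop x.1) :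
    N.loopsIn T = N'.loopsIn T' := by
  classical
  have hS : ∀ x x' y y', ρ x x' → ρ y y' → (N.Same x.1 y.1 ↔ N'.Same x'.1 y'.1) := by
    intro x x' y y' hx hy
    constructor
    · rintro ⟨n, hn⟩
      have := h.rel_sh' x.2 hn
      have e1 : sh x.2 (x.1, 0) = x := by simp
      have e2 : sh x.2 (y.1, n) = sh (n + x.2 - y.2) y := by simp [sh]
      rw [e1, e2] at this
      exact (h'.same_of_rel ((heq _ _ _ _ hx (hsh _ _ _ hy)).1 this) :)
    · rintro ⟨n, hn⟩
      have := h'.rel_sh' x'.2 hn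
      have e1 : sh x'.2 (x'.1, 0) = x' := by simp
      have e2 : sh x'.2 (y'.1, n) = sh (n + x'.2 - y'.2) y' := by simp [sh]
      rw [e1, e2] at this
      exact (h.same_of_rel ((heq _ _ _ _ hx (hsh _ _ _ hy)).2 this) :)
  have hW : ∀ (M : Net Γ) (hM : M.WF) (x : M.S × ℤ) m, M.Rel (x.1, 0) (x.1, m) ↔ M.Rel x (sh m x) := by
    intro M hM x m
    rw [← hM.rel_sh x.2]; simp [sh, add_comm]
  have hwind : ∀ x x', ρ x x' → N.winding x.1 = N'.winding x'.1 := by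
    intro x x' hx
    unfold winding
    congr 1
    ext m
    simp only [Set.mem_ofPred_eq]
    rw [hW N h, hW N' h', heq _ _ _ _ hx (hsh _ _ _ hx)]
  have hsame : ∀ (M : Net Γ) (hM : M.WF) (s t : M.S), M.Same s t →
      M.scol s = M.scol t ∧ M.winding s = M.winding t := by
    rintro M hM s t ⟨n, hn⟩
    refine ⟨hM.rel_col hn, ?_⟩
    unfold winding
    congr 1
    ext m
    simp only [Set.mem_ofPred_eq]
    have e := hM.rel_sh' m hn
    rw [hW M hM (s, 0), hW M hM (t, n)]
    constructor
    · exact fun ⟨h1, h2⟩ => ⟨h1, hn.symm.trans (h2.trans e)⟩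
    · exact fun ⟨h1, h2⟩ => ⟨h1, hn.trans (h2.trans e.symm)⟩
  have key : ∀ q ∈ (Set.toFinite {q : Quot N.Same | ∃ s, Quot.mk _ s = q ∧ T s ∧ N.IsLoop s}).toFinset.val,
      ∃ s x', Quot.mk _ s = q ∧ ρ (s, 0) x' ∧ T' x'.1 ∧ N'.IsLoop x'.1 := by
    intro q hq
    obtain ⟨s, rfl, hs, hl⟩ := by simpa using hq
    obtain ⟨x', hx', h3, h4⟩ := h1 s hs hl
    exact ⟨s, x', rfl, hx', h3, h4⟩
  choose f g hf hρ hT hL using key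
  unfold loopsIn
  refine Multiset.map_eq_map_of_bij_of_nodup _ _ (Finset.nodup _) (Finset.nodup _)
    (fun q hq => Quot.mk _ (g q hq).1) ?_ ?_ ?_ ?_
  · intro q hq
    simpa using ⟨(g q hq).1, rfl, hT q hq, hL q hq⟩
  · intro q hq q' hq' he
    rw [h'.mk_eq, ← hS _ _ _ _ (hρ q hq) (hρ q' hq')] at he
    rw [← hf q hq, ← hf q' hq']
    exact Quot.sound he
  · intro q' hq'
    obtain ⟨s', rfl, hs', hl'⟩ := by simpa using hq'
    obtain ⟨x, hx, h3, h4⟩ := h2 s' hs' hl'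
    have hq : Quot.mk N.Same x.1 ∈ (Set.toFinite {q : Quot N.Same | ∃ s, Quot.mk _ s = q ∧ T s ∧ N.IsLoop s}).toFinset.val := by
      simpa using ⟨x.1, rfl, h3, h4⟩
    refine ⟨_, hq, ?_⟩
    rw [h'.mk_eq]
    refine (hS _ _ _ _ (hρ _ hq) hx).1 ?_
    exact (h.mk_eq.1 (hf _ hq))
  · intro q hq
    have a1 := hsame N h _ _ (h.mk_eq.1 ((Quot.out_eq q).trans (hf q hq).symm))
    have a2 := hsame N' h' _ _ (h'.same_out (g q hq).1)
    rw [a1.1, a1.2, ← a2.1, ← a2.2, ← hwind _ _ (hρ q hq), ← hcol _ _ (hρ q hq)]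

lemma WF.loops_eq_add (h : N.WF) {T U : N.S → Prop} (hTU : ∀ s, N.IsLoop s → (T s ↔ ¬ U s))
    (hT : ∀ s t, N.IsLoop s → N.Same s t → T s → T t) :
    N.loops = N.loopsIn T + N.loopsIn U := by
  classical
  unfold loops loopsIn
  rw [← Multiset.map_add]
  congr 1
  rw [← Finset.disjUnion_val _ _ (by
    rw [Finset.disjoint_left]
    intro q hq hq'
    obtain ⟨s, rfl, hs, hl⟩ := by simpa using hq
    obtain ⟨t, ht, htU, hl'⟩ := by simpa using hq'
    exact (hTU t hl').1 (hT s t hl (h.mk_eq.1 ht.symm) hs) htU)]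
  congr 1
  ext q
  simp only [Set.Finite.mem_toFinset, Set.mem_ofPred_eq, Finset.mem_disjUnion, true_and]
  constructor
  · rintro ⟨s, hq, hl⟩
    by_cases hs : T s
    · exact .inl ⟨s, hq, hs, hl⟩
    · exact .inr ⟨s, hq, by have := hTU s hl; tauto, hl⟩
  · rintro (⟨s, hq, _, hl⟩ | ⟨s, hq, _, hl⟩) <;> exact ⟨s, hq, hl⟩

lemma loopsIn_eq_zero {T : N.S → Prop} (hT : ∀ s, T s → ¬ N.IsLoop s) : N.loopsIn T = 0 := by
  classical
  unfold loopsIn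
  convert Multiset.map_zero _
  rw [Finset.val_eq_zero, Finset.eq_empty_iff_forall_notMem]
  intro q hq
  obtain ⟨s, rfl, hs, hl⟩ := by simpa using hq
  exact hT s hs hl

/-- The loops in `T`, listed through a family of representatives. -/
lemma WF.loopsIn_eq_map (h : N.WF) {T : N.S → Prop} {d : ℕ} (s : ℕ → N.S)
    (hs : ∀ i < d, T (s i) ∧ N.IsLoop (s i)) (hinj : ∀ i < d, ∀ j < d, N.Same (s i) (s j) → i = j)
    (hsurj : ∀ t, T t → N.IsLoop t → ∃ i < d, N.Same t (s i)) :
    N.loopsIn T = (Multiset.range d).map fun i => (N.scol (s i), N.winding (s i)) := by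
  classical
  have hsame : ∀ (s t : N.S), N.Same s t →
      N.scol s = N.scol t ∧ N.winding s = N.winding t := by
    rintro s t ⟨n, hn⟩
    refine ⟨h.rel_col hn, ?_⟩
    unfold winding
    congr 1
    ext m
    simp only [Set.mem_ofPred_eq]
    have e := h.rel_sh' m hn
    simp only [sh_mk, zero_add] at e
    constructor
    · rintro ⟨h1, h2⟩
      refine ⟨h1, ?_⟩
      have := h.rel_sh' (-n) (hn.symm.trans (h2.trans e))
      simpa [add_assoc, add_comm, add_left_comm] using this
    · rintro ⟨h1, h2⟩
      have := h.rel_sh' n h2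
      simp only [sh_mk, zero_add] at this
      refine ⟨h1, hn.trans (this.trans ?_)⟩
      rw [add_comm]; exact e.symm
  unfold loopsIn
  symm
  refine Multiset.map_eq_map_of_bij_of_nodup _ _ (Multiset.nodup_range d) (Finset.nodup _)
    (fun i _ => Quot.mk _ (s i)) ?_ ?_ ?_ ?_
  · intro i hi
    simpa using ⟨s i, rfl, hs i (by simpa using hi)⟩
  · intro i hi j hj he
    exact hinj i (by simpa using hi) j (by simpa using hj) (h.mk_eq.1 he)
  · intro q hq
    obtain ⟨t, rfl, ht, hl⟩ := by simpa using hq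
    obtain ⟨i, hi, hti⟩ := hsurj t ht hl
    exact ⟨i, by simpa using hi, (Quot.sound hti).symm⟩
  · intro i hi
    have := hsame _ _ (h.same_out (s i))
    rw [this.1, this.2]

/-- The elementary type 3 moves on multisets of loops. -/
def LoopMove (Γ : OrderedGraph V E) (m m' : Multiset (V × ℕ)) : Prop :=
  ∃ v k r, m = r + {(v, k)} ∧ m' = r + ((Γ.children v).map fun c => (c, k) : List (V × ℕ))

def LoopEq (Γ : OrderedGraph V E) : Multiset (V × ℕ) → Multiset (V × ℕ) → Prop := EqvGen (LoopMove Γ)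

lemma LoopEq.add {m m' : Multiset (V × ℕ)} (h : LoopEq Γ m m') (r : Multiset (V × ℕ)) :
    LoopEq Γ (m + r) (m' + r) := by
  induction h with
  | rel _ _ h =>
    obtain ⟨v, k, r', rfl, rfl⟩ := h
    exact EqvGen.rel _ _ ⟨v, k, r' + r, by abel, by abel⟩
  | refl x => exact EqvGen.refl _
  | symm x y _ ih => exact EqvGen.symm _ _ ih
  | trans x y z _ _ ih₁ ih₂ => exact EqvGen.trans _ _ _ ih₁ ih₂

/-- An isomorphism of the parts of two nets that touch points, up to shifting the points. -/
structure PortIso (N N' : Net Γ) (e : N.P → N'.P) (f : N.P → ℤ) : Prop where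
  bij : Set.BijOn e {p | N.alive p} {p | N'.alive p}
  split : ∀ p, N.alive p → (N'.split (e p) ↔ N.split p)
  col : ∀ p, N.alive p → N'.col (e p) = N.col p
  rel : ∀ p q k l n, N.alive p → N.alive q → k ≤ N.deg p → l ≤ N.deg q →
    (N.Rel (N.port p k) (sh n (N.port q l)) ↔
      N'.Rel (sh (f p) (N'.port (e p) k)) (sh (n + f q) (N'.port (e q) l)))

lemma PortIso.deg {e f} (h : PortIso N N' e f) {p} (hp : N.alive p) : N'.deg (e p) = N.deg p := by
  unfold Net.deg; rw [h.col p hp]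

lemma PortIso.alive {e f} (h : PortIso N N' e f) {p} (hp : N.alive p) : N'.alive (e p) := h.bij.mapsTo hp

lemma PortIso.refl (N : Net Γ) (hN : N.WF) (c : ℤ) : PortIso N N id fun _ => c where
  bij := Set.bijOn_id _
  split := fun _ _ => Iff.rfl
  col := fun _ _ => rfl
  rel := fun p q k l n _ _ _ _ => by simp [hN.rel_sh_left]

lemma PortIso.trans (hN' : N'.WF) (hN'' : N''.WF) {e f e' f'} (h : PortIso N N' e f)
    (h' : PortIso N' N'' e' f') : PortIso N N'' (e' ∘ e) (fun p => f p + f' (e p)) where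
  bij := h'.bij.comp h.bij
  split := fun p hp => (h'.split _ (h.alive hp)).trans (h.split p hp)
  col := fun p hp => (h'.col _ (h.alive hp)).trans (h.col p hp)
  rel := fun p q k l n hp hq hk hl => by
    rw [h.rel p q k l n hp hq hk hl, hN'.rel_sh_left,
      h'.rel _ _ _ _ _ (h.alive hp) (h.alive hq) (by rwa [h.deg hp]) (by rwa [h.deg hq]),
      ← hN''.rel_sh (f p)]
    simp only [sh_sh, Function.comp]
    rw [show f' (e p) + f p = f p + f' (e p) by ring,
      show n + f q - f p + f' (e q) + f p = n + (f q + f' (e q)) by ring]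

lemma PortIso.symm (hN : N.WF) (hN' : N'.WF) [Nonempty N.P] {e f} (h : PortIso N N' e f) :
    ∃ e', (∀ p, N.alive p → e' (e p) = p) ∧ (∀ p, N'.alive p → e (e' p) = p) ∧
      PortIso N' N e' (fun p => - f (e' p)) := by
  obtain ⟨e', he'⟩ : ∃ e', Set.InvOn e' e {p | N.alive p} {p | N'.alive p} := ⟨_, h.bij.invOn_invFunOn⟩
  have hb := Set.BijOn.symm he'.symm h.bij
  have ha : ∀ p, N'.alive p → N.alive (e' p) := fun p hp => hb.mapsTo hp
  have hd : ∀ p, N'.alive p → N.deg (e' p) = N'.deg p := fun p hp => by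
    rw [← h.deg (ha p hp), he'.2 hp]
  refine ⟨e', fun p hp => he'.1 hp, fun p hp => he'.2 hp, hb, fun p hp => ?_, fun p hp => ?_,
    fun p q k l n hp hq hk hl => ?_⟩
  · rw [← h.split _ (ha p hp), he'.2 hp]
  · rw [← h.col _ (ha p hp), he'.2 hp]
  · have := h.rel (e' p) (e' q) k l (n - f (e' q) + f (e' p)) (ha p hp) (ha q hq)
      (by rwa [hd p hp]) (by rwa [hd q hq])
    rw [he'.2 hp, he'.2 hq] at this
    rw [← hN.rel_sh (f (e' p)), ← hN'.rel_sh (f (e' p))]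
    simp only [sh_sh]
    rw [show n - f (e' q) + f (e' p) + f (e' q) = n + f (e' p) by ring] at this
    rw [← this]
    simp [sub_eq_add_neg]

def Equiv3 (N N' : Net Γ) : Prop := ∃ e f, PortIso N N' e f ∧ LoopEq Γ N.loops N'.loops

lemma Equiv3.refl (hN : N.WF) : Equiv3 N N := ⟨_, _, PortIso.refl N hN 0, EqvGen.refl _⟩

lemma Equiv3.trans (hN' : N'.WF) (hN'' : N''.WF) (h : Equiv3 N N') (h' : Equiv3 N' N'') :
    Equiv3 N N'' := by
  obtain ⟨e, f, h1, h2⟩ := h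
  obtain ⟨e', f', h1', h2'⟩ := h'
  exact ⟨_, _, h1.trans hN' hN'' h1', EqvGen.trans _ _ _ h2 h2'⟩

lemma Equiv3.symm (hN : N.WF) (hN' : N'.WF) [Nonempty N.P] (h : Equiv3 N N') : Equiv3 N' N := by
  obtain ⟨e, f, h1, h2⟩ := h
  obtain ⟨e', _, _, h'⟩ := h1.symm hN hN'
  exact ⟨_, _, h', EqvGen.symm _ _ h2⟩

end Net

lemma Relation.EqvGen.iff_of_closed {α : Type*} {r : α → α → Prop} {T : α → Prop}
    (hT : ∀ x y, r x y → (T x ↔ T y)) {x y : α} (h : EqvGen r x y) : T x ↔ T y := by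
  induction h with
  | rel x y h => exact hT _ _ h
  | refl x => rfl
  | symm x y _ ih => exact ih.symm
  | trans x y z _ _ ih₁ ih₂ => exact ih₁.trans ih₂

lemma Relation.EqvGen.of_imp {α : Type*} {r r' : α → α → Prop} 
    (hT : ∀ x y, r x y → EqvGen r' x y) {x y : α} (h : EqvGen r x y) : EqvGen r' x y := by
  induction h with
  | rel x y h => exact hT _ _ h
  | refl x => exact .refl _
  | symm x y _ ih => exact ih.symm
  | trans x y z _ _ ih₁ ih₂ => exact ih₁.trans _ _ _ ih₂

namespace Net

variable {N N' N'' : Net Γ}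

/-- In a reduction with parallel wide sides (`many = true`) the narrow ports survive, in a
reduction with a common narrow strand the wide ports survive. -/
def Live (many : Bool) (k : ℕ) : Prop := many = true ↔ k = 0

/-- The new gluing of a reduction, directed along the strands. -/
def Glue (N : Net Γ) (v w : N.P) (m : ℤ) (many : Bool) (x y : N.S × ℤ) : Prop :=
  ∃ k n, k ≤ N.deg v ∧ Live many k ∧ (k = 0 ∧ x = sh n (N.port v k) ∧ y = sh (n + m) (N.port w k) ∨
     k ≠ 0 ∧ x = sh (n + m) (N.port w k) ∧ y = sh n (N.port v k))

/-- Removal of the points `v` and `w`, with their surviving ports glued. -/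
abbrev red (N : Net Γ) (v w : N.P) (m : ℤ) (many : Bool) : Net Γ := { N with
    alive := fun p => N.alive p ∧ p ≠ v ∧ p ≠ w
    gen := fun x y => N.gen x y ∨ N.Glue v w m many x y }

structure Redex (N : Net Γ) (v w : N.P) (m : ℤ) (many : Bool) : Prop where
  av : N.alive v
  aw : N.alive w
  sv : N.split v
  sw : ¬ N.split w
  col : N.col v = N.col w
  dead : ∀ k ≤ N.deg v, ¬ Live many k → N.Rel (N.port v k) (sh m (N.port w k))

lemma Redex.deg {v w m many} (h : N.Redex v w m many) : N.deg w = N.deg v := by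
  unfold Net.deg; rw [h.col]

lemma Redex.ne {v w m many} (h : N.Redex v w m many) : v ≠ w := fun e => h.sw (e ▸ h.sv)

lemma red_rel_mono {v w m many x y} (h : N.Rel x y) : (N.red v w m many).Rel x y :=
  EqvGen.of_imp (fun _ _ hg => EqvGen.rel _ _ (.inl hg)) h

lemma Redex.wf (hN : N.WF) {v w m many} (h : N.Redex v w m many) : (N.red v w m many).WF := by
  have hl : ∀ x y, N.Glue v w m many x y → ∃ p k n, x = sh n (N.port p k) ∧ N.alive p ∧
      k ≤ N.deg p ∧ (N.split p ↔ k = 0) := by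
    rintro x y ⟨k, n, hk, hl, ⟨rfl, rfl, rfl⟩ | ⟨h0, rfl, rfl⟩⟩
    · exact ⟨v, 0, n, rfl, h.av, hk, by simp [h.sv]⟩
    · exact ⟨w, k, _, rfl, h.aw, by rwa [h.deg], by simp [h.sw, h0]⟩
  have hr : ∀ x y, N.Glue v w m many x y → ∃ p k n, y = sh n (N.port p k) ∧ N.alive p ∧
      k ≤ N.deg p ∧ (N.split p ↔ k ≠ 0) := by
    rintro x y ⟨k, n, hk, hl, ⟨rfl, rfl, rfl⟩ | ⟨h0, rfl, rfl⟩⟩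
    · exact ⟨w, 0, _, rfl, h.aw, by simp, by simp [h.sw]⟩
    · exact ⟨v, k, n, rfl, h.av, hk, by simp [h.sv, h0]⟩
  have key : ∀ x y x' y', N.Glue v w m many x y → N.Glue v w m many x' y' → (x = x' ↔ y = y') := by
    have e1 : ∀ k l n n', k ≤ N.deg v → l ≤ N.deg v → k ≠ 0 → l ≠ 0 → 
        (sh n (N.port v k) = sh n' (N.port v l) ↔ k = l ∧ n = n') := by
      intro k l n n' hk hl hk0 hl0
      refine ⟨fun he => ?_, by rintro ⟨rfl, rfl⟩; rfl⟩
      have := (hN.start_inj v k v l h.av hk (by simp [h.sv, hk0]) h.av hl (by simp [h.sv, hl0])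
        (sh_fst_eq he)).2
      subst this
      exact ⟨rfl, by simpa [sh] using he⟩
    have e2 : ∀ k l n n', k ≤ N.deg v → l ≤ N.deg v → k ≠ 0 → l ≠ 0 → 
        (sh n (N.port w k) = sh n' (N.port w l) ↔ k = l ∧ n = n') := by
      intro k l n n' hk hl hk0 hl0
      rw [← h.deg] at hk hl
      refine ⟨fun he => ?_, by rintro ⟨rfl, rfl⟩; rfl⟩
      have := (hN.end_inj w k w l h.aw hk (by simp [h.sw, hk0]) h.aw hl (by simp [h.sw, hl0])
        (sh_fst_eq he)).2
      subst this
      exact ⟨rfl, by simpa [sh] using he⟩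
    rintro x y x' y' ⟨k, n, hk, hl, ⟨hk0, rfl, rfl⟩ | ⟨h0, rfl, rfl⟩⟩
      ⟨k', n', hk', hl', ⟨hk0', rfl, rfl⟩ | ⟨h0', rfl, rfl⟩⟩
    · subst hk0 hk0'
      simp [sh, Prod.ext_iff]
    · exact absurd (hl'.1 (hl.2 hk0)) h0'
    · exact absurd (hl.1 (hl'.2 hk0')) h0
    · rw [e1 _ _ _ _ hk hk' h0 h0', e2 _ _ _ _ hk hk' h0 h0']; simp
  refine ⟨?_, ?_, ?_, ?_, ?_, ?_, ?_, ?_, ?_, ?_, ?_⟩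
  · rintro n x y (hg | ⟨k, n', hk, hl, ⟨h0, rfl, rfl⟩ | ⟨h0, rfl, rfl⟩⟩)
    · exact .inl (hN.gen_sh _ _ _ hg)
    · refine .inr ⟨k, n' + n, hk, hl, .inl ⟨h0, by simp, by simp [add_right_comm]⟩⟩
    · refine .inr ⟨k, n' + n, hk, hl, .inr ⟨h0, by simp [add_right_comm], by simp⟩⟩
  · rintro x y z (hg | hg) (hg' | hg')
    · exact hN.gen_right _ _ _ hg hg'
    · obtain ⟨p, k, n, rfl, h1, h2, h3⟩ := hl _ _ hg'
      exact absurd hg (hN.end_gen p k _ n h1 h2 h3)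
    · obtain ⟨p, k, n, rfl, h1, h2, h3⟩ := hl _ _ hg
      exact absurd hg' (hN.end_gen p k _ n h1 h2 h3)
    · exact (key _ _ _ _ hg hg').1 rfl
  · rintro x y z (hg | hg) (hg' | hg')
    · exact hN.gen_left _ _ _ hg hg'
    · obtain ⟨p, k, n, rfl, h1, h2, h3⟩ := hr _ _ hg'
      exact absurd hg (hN.start_gen p k _ n h1 h2 h3)
    · obtain ⟨p, k, n, rfl, h1, h2, h3⟩ := hr _ _ hg
      exact absurd hg' (hN.start_gen p k _ n h1 h2 h3)
    · exact (key _ _ _ _ hg hg').2 rfl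
  · have hc : ∀ k ≤ N.deg v, N.scol (N.port v k).1 = N.scol (N.port w k).1 := by
      intro k hk
      rcases k with _ | k
      · rw [hN.col_zero v h.av, hN.col_zero w h.aw, h.col]
      · have h1 := hN.col_succ v h.av k hk
        have h2 := hN.col_succ w h.aw k (by rwa [h.deg])
        rw [h.col, h2] at h1
        exact (Option.some.inj h1).symm
    rintro x y (hg | ⟨k, n', hk, hl, ⟨h0, rfl, rfl⟩ | ⟨h0, rfl, rfl⟩⟩)
    · exact hN.gen_col _ _ hg
    · exact hc k hk
    · exact (hc k hk).symm
  · exact fun p hp => hN.deg_ge p hp.1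
  · exact fun p hp => hN.col_zero p hp.1
  · exact fun p hp => hN.col_succ p hp.1
  · rintro p k x n hp hk hs (hg | hg)
    · exact hN.start_gen p k x n hp.1 hk hs hg
    · obtain ⟨q, l, n', he, h1, h2, h3⟩ := hr _ _ hg
      obtain ⟨rfl, rfl⟩ := hN.start_inj p k q l hp.1 hk hs h1 h2 h3 (sh_fst_eq he)
      obtain ⟨k', n', hk', hl, ⟨h0, _, he⟩ | ⟨h0, _, he⟩⟩ := hg
      · exact hp.2.2 (hN.start_inj p k w k' hp.1 hk hs h.aw (by rwa [h.deg])
          (by simp [h0, h.sw]) (sh_fst_eq he)).1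
      · exact hp.2.1 (hN.start_inj p k v k' hp.1 hk hs h.av hk'
          (by simp [h0, h.sv]) (sh_fst_eq he)).1
  · exact fun p k q l hp hk hs hq => hN.start_inj p k q l hp.1 hk hs hq.1
  · rintro p k x n hp hk hs (hg | hg)
    · exact hN.end_gen p k x n hp.1 hk hs hg
    · obtain ⟨k', n', hk', hl, ⟨h0, he, _⟩ | ⟨h0, he, _⟩⟩ := hg
      · exact hp.2.1 (hN.end_inj p k v k' hp.1 hk hs h.av hk'
          (by simp [h0, h.sv]) (sh_fst_eq he)).1
      · exact hp.2.2 (hN.end_inj p k w k' hp.1 hk hs h.aw (by rwa [h.deg])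
          (by simp [h0, h.sw]) (sh_fst_eq he)).1
  · exact fun p k q l hp hk hs hq => hN.end_inj p k q l hp.1 hk hs hq.1

/-- After the reduction all ports of the removed points match. -/
lemma Redex.red_rel (hN : N.WF) {v w m many} (h : N.Redex v w m many) {k} (hk : k ≤ N.deg v)
    (n : ℤ) : (N.red v w m many).Rel (sh n (N.port v k)) (sh (n + m) (N.port w k)) := by
  by_cases hl : Live many k
  · by_cases h0 : k = 0
    · exact EqvGen.rel _ _ (.inr ⟨k, n, hk, hl, .inl ⟨h0, rfl, rfl⟩⟩)
    · exact EqvGen.symm _ _ (EqvGen.rel _ _ (.inr ⟨k, n, hk, hl, .inr ⟨h0, rfl, rfl⟩⟩))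
  · have := hN.rel_sh' n (h.dead k hk hl)
    rw [sh_sh, add_comm] at this
    exact red_rel_mono this

/-- A predicate is constant on strands after the reduction if it is so before and respects the
gluing. -/
lemma red_rel_closed {v w m many} {T : N.S × ℤ → Prop}
    (h1 : ∀ x y, N.Rel x y → (T x ↔ T y))
    (h2 : ∀ k n, k ≤ N.deg v → Live many k → (T (sh n (N.port v k)) ↔ T (sh (n + m) (N.port w k))))
    {x y} (h : (N.red v w m many).Rel x y) : T x ↔ T y := by
  refine EqvGen.iff_of_closed ?_ h
  rintro x y (hg | ⟨k, n, hk, hl, ⟨h0, rfl, rfl⟩ | ⟨h0, rfl, rfl⟩⟩)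
  · exact h1 _ _ (rel_of_gen hg)
  · exact h2 k n hk hl
  · exact (h2 k n hk hl).symm

lemma red_rel_of_avoid {v w m many x y}
    (hv : ∀ k n, k ≤ N.deg v → Live many k → ¬ N.Rel x (sh n (N.port v k)))
    (hw : ∀ k n, k ≤ N.deg v → Live many k → ¬ N.Rel x (sh n (N.port w k)))
    (h : (N.red v w m many).Rel x y) : N.Rel x y := by
  refine (red_rel_closed (T := fun z => N.Rel x z) ?_ ?_ h).1 (.refl _)
  · exact fun y z hyz => ⟨fun h => h.trans hyz, fun h => h.trans hyz.symm⟩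
  · exact fun k n hk hl => iff_of_false (hv k n hk hl) (hw k _ hk hl)

lemma Redex.rel_of_portless {v w m many} (hr : N.Redex v w m many) {x y} (hx : N.Portless x)
    (h : (N.red v w m many).Rel x y) : N.Rel x y :=
  red_rel_of_avoid (fun k n hk _ => hx v k n hr.av hk)
    (fun k n hk _ => hx w k n hr.aw (by rwa [hr.deg])) h

lemma Redex.loops_eq (hN : N.WF) {v w m many} (hr : N.Redex v w m many) :
    (N.red v w m many).loops =
      N.loops + (N.red v w m many).loopsIn fun s => ¬ N.Portless (s, 0) := by
  have hN' := hr.wf hN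
  rw [hN'.loops_eq_add (T := fun s => N.Portless (s, 0)) (U := fun s => ¬ N.Portless (s, 0))]
  · congr 1
    symm
    refine loopsIn_congr hN hN' (fun x x' => x = x' ∧ N.Portless x) ?_ ?_ ?_ ?_ ?_
    · rintro x _ y _ ⟨rfl, hx⟩ ⟨rfl, hy⟩
      exact ⟨red_rel_mono, hr.rel_of_portless hx⟩
    · rintro n x _ ⟨rfl, hx⟩
      exact ⟨rfl, hx.sh hN n⟩
    · rintro x _ ⟨rfl, hx⟩; rfl
    · rintro s _ ⟨hs, n, hn, hr'⟩
      refine ⟨(s, 0), ⟨rfl, hs⟩, hs, fun p k n hp hk hh => ?_, n, hn, red_rel_mono hr'⟩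
      exact hs p k n hp.1 hk (hr.rel_of_portless hs hh)
    · rintro s hs ⟨_, n, hn, hr'⟩
      exact ⟨(s, 0), ⟨rfl, hs⟩, trivial, hs, n, hn, hr.rel_of_portless hs hr'⟩
  · exact fun s _ => not_not.symm
  · rintro s t _ ⟨n, hn⟩ hs
    exact (hN.portless_base _).2 (hs.congr (hr.rel_of_portless hs hn))

/-- Transport of a reduction along an isomorphism. -/
lemma PortIso.redex (hN' : N'.WF) {e f} (h : PortIso N N' e f) {v w m many}
    (hr : N.Redex v w m many) : N'.Redex (e v) (e w) (m + f w - f v) many where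
  av := h.alive hr.av
  aw := h.alive hr.aw
  sv := (h.split _ hr.av).2 hr.sv
  sw := fun hs => hr.sw ((h.split _ hr.aw).1 hs)
  col := by rw [h.col _ hr.av, h.col _ hr.aw, hr.col]
  dead := fun k hk hl => by
    rw [h.deg hr.av] at hk
    have := (h.rel v w k k m hr.av hr.aw hk (by rwa [hr.deg])).1 (hr.dead k hk hl)
    rwa [hN'.rel_sh_left] at this

lemma PortIso.red_rel (hN : N.WF) (hN' : N'.WF) {e f} (h : PortIso N N' e f) {v w m m' many}
    (hr : N.Redex v w m many) (hm : m' = m + f w - f v) {p q k l n n'} (hp : N.alive p)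
    (hq : N.alive q) (hk : k ≤ N.deg p) (hl : l ≤ N.deg q)
    (hh : (N.red v w m many).Rel (sh n' (N.port p k)) (sh n (N.port q l))) :
    (N'.red (e v) (e w) m' many).Rel (sh (n' + f p) (N'.port (e p) k))
      (sh (n + f q) (N'.port (e q) l)) := by
  subst hm
  have hr' := h.redex hN' hr
  let T : N.S × ℤ → Prop := fun y => ∃ q l n, N.alive q ∧ l ≤ N.deg q ∧ N.Rel y (sh n (N.port q l)) ∧
    (N'.red (e v) (e w) (m + f w - f v) many).Rel (sh (n' + f p) (N'.port (e p) k))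
      (sh (n + f q) (N'.port (e q) l))
  have hiso : ∀ {p q k l n n'}, N.alive p → N.alive q → k ≤ N.deg p → l ≤ N.deg q →
      N.Rel (sh n (N.port p k)) (sh n' (N.port q l)) →
      (N'.red (e v) (e w) (m + f w - f v) many).Rel (sh (n + f p) (N'.port (e p) k))
        (sh (n' + f q) (N'.port (e q) l)) := by
    intro p q k l n n' hp hq hk hl hh
    rw [hN.rel_sh_left, h.rel p q k l _ hp hq hk hl] at hh
    have := hN'.rel_sh' n hh
    simp only [sh_sh] at this
    refine red_rel_mono ?_
    rwa [add_comm (f p) n, show n' - n + f q + n = n' + f q by ring] at this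
  have key : T (sh n (N.port q l)) := by
    refine (red_rel_closed (T := T) ?_ ?_ hh).1 ⟨p, k, n', hp, hk, .refl _, .refl _⟩
    · rintro x y hxy
      constructor
      · rintro ⟨q, l, n, h1, h2, h3, h4⟩
        exact ⟨q, l, n, h1, h2, hxy.symm.trans h3, h4⟩
      · rintro ⟨q, l, n, h1, h2, h3, h4⟩
        exact ⟨q, l, n, h1, h2, hxy.trans h3, h4⟩
    · intro k n hk hl
      have hk' : k ≤ N.deg w := by rwa [hr.deg]
      have hg := hr'.red_rel hN' (k := k) (by rwa [h.deg hr.av]) (n + f v)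
      rw [show n + f v + (m + f w - f v) = n + m + f w by ring] at hg
      constructor
      · rintro ⟨q, l, n₂, h1, h2, h3, h4⟩
        refine ⟨w, k, n + m, hr.aw, hk', .refl _, ?_⟩
        exact (h4.trans (hiso h1 hr.av h2 hk h3.symm)).trans hg
      · rintro ⟨q, l, n₂, h1, h2, h3, h4⟩
        refine ⟨v, k, n, hr.av, hk, .refl _, ?_⟩
        exact (h4.trans (hiso h1 hr.aw h2 hk' h3.symm)).trans hg.symm
  obtain ⟨q', l', n₂, h1, h2, h3, h4⟩ := key
  exact h4.trans (hiso h1 hq h2 hl h3.symm)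

lemma PortIso.red_rel_iff (hN : N.WF) (hN' : N'.WF) {e f} (h : PortIso N N' e f) {v w m m' many}
    (hr : N.Redex v w m many) (hm : m' = m + f w - f v) {p q k l n n'} (hp : N.alive p)
    (hq : N.alive q) (hk : k ≤ N.deg p) (hl : l ≤ N.deg q) :
    (N.red v w m many).Rel (sh n' (N.port p k)) (sh n (N.port q l)) ↔
    (N'.red (e v) (e w) m' many).Rel (sh (n' + f p) (N'.port (e p) k))
      (sh (n + f q) (N'.port (e q) l)) := by
  refine ⟨h.red_rel hN hN' hr hm hp hq hk hl, fun hh => ?_⟩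
  have : Nonempty N.P := ⟨p⟩
  obtain ⟨e', h1, h2, h'⟩ := h.symm hN hN'
  have hr' := h.redex hN' hr
  rw [← hm] at hr'
  have := h'.red_rel (m' := m) hN' hN hr' (by rw [h1 _ hr.av, h1 _ hr.aw, hm]; ring) (h.alive hp)
    (h.alive hq) (by rwa [h.deg hp]) (by rwa [h.deg hq]) hh
  rw [h1 _ hr.av, h1 _ hr.aw, h1 _ hp, h1 _ hq] at this
  simpa using this

def Red (N N' : Net Γ) : Prop := ∃ v w m many, N.Redex v w m many ∧ N' = N.red v w m many

lemma PortIso.equiv3_red (hN : N.WF) (hN' : N'.WF) {e f} (h : PortIso N N' e f)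
    (hloops : LoopEq Γ N.loops N'.loops) {v w m m' many}
    (hr : N.Redex v w m many) (hm : m' = m + f w - f v) :
    Equiv3 (N.red v w m many) (N'.red (e v) (e w) m' many) := by
  have hr' := h.redex hN' hr
  rw [← hm] at hr'
  have hiff := @PortIso.red_rel_iff _ _ _ _ _ hN hN' e f h v w m m' many hr hm
  have hb : ∀ p q, N.alive p → N.alive q → (e p = e q ↔ p = q) := fun p q hp hq =>
    ⟨fun hh => h.bij.injOn hp hq hh, fun hh => hh ▸ rfl⟩
  have halive : ∀ p, N.alive p → ((N'.red (e v) (e w) m' many).alive (e p) ↔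
      (N.red v w m many).alive p) := by
    intro p hp
    show (_ ∧ _ ∧ _) ↔ (_ ∧ _ ∧ _)
    simp only [ne_eq, hb _ _ hp hr.av, hb _ _ hp hr.aw, hp, h.alive hp]
  refine ⟨e, f, ⟨⟨fun p hp => (halive p hp.1).2 hp, fun p hp q hq he => h.bij.injOn hp.1 hq.1 he,
    fun p' hp' => ?_⟩, fun p hp => h.split p hp.1, fun p hp => h.col p hp.1,
    fun p q k l n hp hq hk hl => ?_⟩, ?_⟩
  · obtain ⟨p, hp, rfl⟩ := h.bij.surjOn hp'.1
    exact ⟨p, (halive p hp).1 hp', rfl⟩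
  · have := hiff (n' := 0) (n := n) hp.1 hq.1 hk hl
    rw [zero_add, sh_zero] at this
    exact this
  rw [hr.loops_eq hN, hr'.loops_eq hN']
  suffices hs : (N.red v w m many).loopsIn (fun s => ¬ N.Portless (s, 0)) =
      (N'.red (e v) (e w) m' many).loopsIn (fun s => ¬ N'.Portless (s, 0)) by
    rw [hs]; exact hloops.add _
  refine loopsIn_congr (hr.wf hN) (hr'.wf hN') (fun x x' => ∃ p k n, N.alive p ∧ k ≤ N.deg p ∧
    N.Rel x (sh n (N.port p k)) ∧ N'.Rel x' (sh (n + f p) (N'.port (e p) k))) ?_ ?_ ?_ ?_ ?_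
  · rintro x x' y y' ⟨p, k, n, hp, hk, h1, h2⟩ ⟨q, l, n', hq, hl, h3, h4⟩
    have := hiff (n' := n) (n := n') hp hq hk hl
    constructor
    · intro hh
      exact (red_rel_mono h2).trans
        ((this.1 (((red_rel_mono h1).symm.trans hh).trans (red_rel_mono h3))).trans
          (red_rel_mono h4).symm)
    · intro hh
      exact (red_rel_mono h1).trans
        ((this.2 (((red_rel_mono h2).symm.trans hh).trans (red_rel_mono h4))).trans
          (red_rel_mono h3).symm)
  · rintro n x x' ⟨p, k, n', hp, hk, h1, h2⟩
    refine ⟨p, k, n' + n, hp, hk, by have := hN.rel_sh' n h1; rwa [sh_sh] at this, ?_⟩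
    have := hN'.rel_sh' n h2
    rwa [sh_sh, add_right_comm] at this
  · rintro x x' ⟨p, k, n, hp, hk, h1, h2⟩
    show N.scol x.1 = N'.scol x'.1
    rw [hN.rel_col h1, hN'.rel_col h2, sh_fst, sh_fst]
    rcases k with _ | k
    · rw [hN.col_zero p hp, hN'.col_zero _ (h.alive hp), h.col p hp]
    · have h1 := hN.col_succ p hp k hk
      have h2 := hN'.col_succ _ (h.alive hp) k (by rwa [h.deg hp])
      rw [h.col p hp, h1] at h2
      exact Option.some.inj h2
  · intro s hs hl
    simp only [Portless, not_forall, not_not] at hs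
    obtain ⟨p, k, n, hp, hk, h1⟩ := hs
    have hx : N'.Rel (sh (n + f p) (N'.port (e p) k)) (sh (n + f p) (N'.port (e p) k)) := .refl _
    refine ⟨sh (n + f p) (N'.port (e p) k), ⟨p, k, n, hp, hk, h1, .refl _⟩, ?_, ?_⟩
    · intro hpl
      exact hpl (e p) k (-(N'.port (e p) k).2) (h.alive hp) (by rwa [h.deg hp]) 
        (by simp [sh]; exact .refl _)
    · have hred : ((N'.red (e v) (e w) m' many).Portless (sh (n + f p) (N'.port (e p) k))) := by
        intro q' l n' hq' hl' hrel
        obtain ⟨q, hq, rfl⟩ := h.bij.surjOn hq'.1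
        have hl'' : l ≤ N.deg q := by rw [← h.deg hq]; exact hl'
        rw [← sub_add_cancel n' (f q)] at hrel
        exact hl.1 q l _ ((halive q hq).1 hq') hl'' ((red_rel_mono h1).trans ((hiff hp hq hk hl'').2 hrel))
      obtain ⟨j, hj, hj'⟩ := (((hr.wf hN).isLoop_iff (s, 0)).1 hl).2
      refine ((hr'.wf hN').isLoop_iff _).2 ⟨hred, j, hj, ?_⟩
      have a1 := (red_rel_mono (v := v) (w := w) (m := m) (many := many) h1).symm.trans
        (hj'.trans (red_rel_mono (hN.rel_sh' j h1)))
      rw [sh_sh, hiff hp hp hk hk, add_right_comm] at a1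
      rwa [sh_sh]
  · intro s hs hl
    simp only [Portless, not_forall, not_not] at hs
    obtain ⟨p', k, n', hp', hk', h1⟩ := hs
    obtain ⟨p, hp, rfl⟩ := h.bij.surjOn hp'
    have hk : k ≤ N.deg p := by rwa [h.deg hp] at hk'
    obtain ⟨n, rfl⟩ : ∃ n, n' = n + f p := ⟨n' - f p, by ring⟩
    refine ⟨sh n (N.port p k), ⟨p, k, n, hp, hk, .refl _, h1⟩, ?_, ?_⟩
    · intro hpl
      exact hpl p k (-(N.port p k).2) hp hk (by simp [sh]; exact .refl _)
    · have hred : ((N.red v w m many).Portless (sh n (N.port p k))) := by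
        intro q l n' hq hl'' hrel
        exact hl.1 (e q) l _ ((halive q hq.1).2 hq) 
          (by show l ≤ N'.deg (e q); rw [h.deg hq.1]; exact hl'') 
          ((red_rel_mono h1).trans ((hiff hp hq.1 hk hl'').1 hrel))
      obtain ⟨j, hj, hj'⟩ := (((hr'.wf hN').isLoop_iff (s, 0)).1 hl).2
      refine ((hr.wf hN).isLoop_iff _).2 ⟨hred, j, hj, ?_⟩
      have a1 := (red_rel_mono (v := e v) (w := e w) (m := m') (many := many) h1).symm.trans
        (hj'.trans (red_rel_mono (hN'.rel_sh' j h1)))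
      rw [sh_sh, add_right_comm, ← hiff hp hp hk hk] at a1
      rwa [sh_sh]

lemma Equiv3.red (hN : N.WF) (hN' : N'.WF) (h : Equiv3 N N') {N₁} (hr : Red N N₁) :
    ∃ N₁', Red N' N₁' ∧ Equiv3 N₁ N₁' := by
  obtain ⟨e, f, h1, h2⟩ := h
  obtain ⟨v, w, m, many, hr, rfl⟩ := hr
  exact ⟨_, ⟨_, _, _, _, h1.redex hN' hr, rfl⟩, h1.equiv3_red hN hN' h2 hr rfl⟩

end Net

/-- Attaching pendant classes to the classes of an equivalence relation does not change it away
from the pendant classes. -/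
lemma rel_of_pendant {α ι : Type*} {R G : α → α → Prop} (hR : Equivalence R) (γ β : ι → α)
    (h1 : ∀ i j, R (γ i) (γ j) → i = j) (h2 : ∀ i j, ¬ R (β i) (γ j))
    (hG : ∀ T : α → Prop, (∀ x y, R x y → (T x ↔ T y)) → (∀ i, T (γ i) ↔ T (β i)) →
      ∀ x y, G x y → (T x ↔ T y))
    {x y : α} (hx : ∀ i, ¬ R x (γ i)) (hy : ∀ i, ¬ R y (γ i)) (h : G x y) : R x y := by
  have := (hG (fun y => R x y ∨ ∃ i, R y (γ i) ∧ R x (β i)) ?_ ?_ x y h).1 (.inl (hR.refl x))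
  · rcases this with h | ⟨i, h, _⟩
    exacts [h, absurd h (hy i)]
  · intro y z hyz
    constructor
    · rintro (h | ⟨i, h, h'⟩)
      exacts [Or.inl (hR.trans h hyz), .inr ⟨i, hR.trans (hR.symm hyz) h, h'⟩]
    · rintro (h | ⟨i, h, h'⟩)
      exacts [Or.inl (hR.trans h (hR.symm hyz)), .inr ⟨i, hR.trans hyz h, h'⟩]
  · intro i
    constructor
    · rintro (h | ⟨j, h, h'⟩)
      · exact absurd h (hx i)
      · rw [h1 i j h]; exact .inl h'
    · rintro (h | ⟨j, h, h'⟩)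
      · exact .inr ⟨i, hR.refl _, h⟩
      · exact absurd h (h2 i j)

namespace Net

variable {N N' N'' : Net Γ}

lemma rel_equivalence (N : Net Γ) : Equivalence N.Rel := ⟨Rel.refl, Rel.symm, Rel.trans⟩

/-- The only ports of a strand with two given ends. -/
lemma WF.class_ports (hN : N.WF) {c a q : N.P} {k l : ℕ} {μ n n' : ℤ} (hc : N.alive c)
    (ha : N.alive a) (hq : N.alive q) (hk : k ≤ N.deg c) (hk' : k ≤ N.deg a) (hl : l ≤ N.deg q)
    (hca : N.split c ↔ ¬ N.split a) (h : N.Rel (N.port c k) (sh μ (N.port a k)))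
    (hr : N.Rel (sh n' (N.port c k)) (sh n (N.port q l))) :
    (q = c ∧ l = k ∧ n = n') ∨ (q = a ∧ l = k ∧ n = n' + μ) := by
  rw [hN.rel_sh_left] at hr
  by_cases hs : (N.split c ↔ k = 0) ↔ (N.split q ↔ l = 0)
  · obtain ⟨rfl, rfl, h0⟩ := hN.side_rel hc hk hq hl hs hr
    exact .inl ⟨rfl, rfl, by omega⟩
  · have := h.symm.trans hr
    rw [hN.rel_sh_left] at this
    obtain ⟨rfl, rfl, h0⟩ := hN.side_rel ha hk' hq hl (by tauto) this
    exact .inr ⟨rfl, rfl, by omega⟩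

lemma equiv3_of_shared (hN : N.WF) {v₁ w₁ v₂ w₂ : N.P} {m₁ m₂ : ℤ} {c a b : N.P} {μ ν : ℤ}
    (hr₁ : N.Redex v₁ w₁ m₁ true) (hr₂ : N.Redex v₂ w₂ m₂ false)
    (hc : N.alive c) (ha : N.alive a) (hb : N.alive b) (hac : a ≠ c) (hbc : b ≠ c) (hab : a ≠ b)
    (hcola : N.col a = N.col c) (hcolb : N.col b = N.col c)
    (hsa : N.split c ↔ ¬ N.split a) (hsb : N.split c ↔ ¬ N.split b)
    (hA : ∀ k < N.deg c, N.Rel (N.port c (k + 1)) (sh μ (N.port a (k + 1))))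
    (hB : N.Rel (N.port c 0) (sh ν (N.port b 0)))
    (al₁ : ∀ p, (N.red v₁ w₁ m₁ true).alive p ↔ N.alive p ∧ p ≠ c ∧ p ≠ a)
    (al₂ : ∀ p, (N.red v₂ w₂ m₂ false).alive p ↔ N.alive p ∧ p ≠ c ∧ p ≠ b)
    (cl₁ : ∀ T : N.S × ℤ → Prop, (∀ x y, N.Rel x y → (T x ↔ T y)) →
      (∀ n, T (sh n (N.port c 0)) ↔ T (sh (n + μ) (N.port a 0))) →
      ∀ x y, (N.red v₁ w₁ m₁ true).Rel x y → (T x ↔ T y))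
    (cl₂ : ∀ T : N.S × ℤ → Prop, (∀ x y, N.Rel x y → (T x ↔ T y)) →
      (∀ n, ∀ k < N.deg c, T (sh n (N.port c (k + 1))) ↔ T (sh (n + ν) (N.port b (k + 1)))) →
      ∀ x y, (N.red v₂ w₂ m₂ false).Rel x y → (T x ↔ T y))
    (gl₁ : ∀ n, (N.red v₁ w₁ m₁ true).Rel (sh n (N.port c 0)) (sh (n + μ) (N.port a 0)))
    (gl₂ : ∀ n, ∀ k < N.deg c,
      (N.red v₂ w₂ m₂ false).Rel (sh n (N.port c (k + 1))) (sh (n + ν) (N.port b (k + 1)))) :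
    Equiv3 (N.red v₁ w₁ m₁ true) (N.red v₂ w₂ m₂ false) := by
  classical
  have hN₁ := hr₁.wf hN
  have hN₂ := hr₂.wf hN
  set N₁ := N.red v₁ w₁ m₁ true with hN₁def
  set N₂ := N.red v₂ w₂ m₂ false with hN₂def
  have hda : N.deg a = N.deg c := by unfold Net.deg; rw [hcola]
  have hdb : N.deg b = N.deg c := by unfold Net.deg; rw [hcolb]
  have m1 : ∀ {x y : N.S × ℤ}, N.Rel x y → N₁.Rel x y := red_rel_mono
  have m2 : ∀ {x y : N.S × ℤ}, N.Rel x y → N₂.Rel x y := red_rel_mono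
  have hRcl : ∀ (z x y : N.S × ℤ), N.Rel x y → (N.Rel z x ↔ N.Rel z y) :=
    fun z x y h => ⟨fun h' => h'.trans h, fun h' => h'.trans h.symm⟩
  have fcA : ∀ {k q l n n'}, k < N.deg c → N.alive q → l ≤ N.deg q →
      N.Rel (sh n' (N.port c (k + 1))) (sh n (N.port q l)) →
      (q = c ∧ l = k + 1 ∧ n = n') ∨ (q = a ∧ l = k + 1 ∧ n = n' + μ) :=
    fun hk hq hl h => hN.class_ports hc ha hq hk (by rw [hda]; exact hk) hl hsa (hA _ hk) h
  have fcB : ∀ {q l n n'}, N.alive q → l ≤ N.deg q → N.Rel (sh n' (N.port c 0)) (sh n (N.port q l)) →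
      (q = c ∧ l = 0 ∧ n = n') ∨ (q = b ∧ l = 0 ∧ n = n' + ν) :=
    fun hq hl h => hN.class_ports hc hb hq (Nat.zero_le _) (Nat.zero_le _) hl hsb hB h
  have r1 : ∀ {k n} {y : N.S × ℤ}, k < N.deg c → N₁.Rel (sh n (N.port c (k + 1))) y →
      N.Rel (sh n (N.port c (k + 1))) y := by
    intro k n y hk h
    refine (cl₁ (fun y => N.Rel (sh n (N.port c (k + 1))) y) (hRcl _) (fun n' => ?_) _ _ h).1
      (.refl _)
    refine iff_of_false (fun h => ?_) (fun h => ?_)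
    · rcases fcA hk hc (Nat.zero_le _) h with h | h <;> omega
    · rcases fcA hk ha (Nat.zero_le _) h with h | h <;> omega
  have r2 : ∀ {n} {y : N.S × ℤ}, N₂.Rel (sh n (N.port c 0)) y → N.Rel (sh n (N.port c 0)) y := by
    intro n y h
    refine (cl₂ (fun y => N.Rel (sh n (N.port c 0)) y) (hRcl _) (fun n' k hk => ?_) _ _ h).1
      (.refl _)
    refine iff_of_false (fun h => ?_) (fun h => ?_)
    · rcases fcB hc hk h with h | h <;> omega
    · rcases fcB hb (by rw [hdb]; exact hk) h with h | h
      exacts [hbc h.1, by omega]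
  let G : N.S × ℤ → N.S × ℤ → Prop := EqvGen fun x y => N₁.Rel x y ∨ N₂.Rel x y
  have g1 : ∀ {x y : N.S × ℤ}, N₁.Rel x y → G x y := fun h => EqvGen.rel _ _ (.inl h)
  have g2 : ∀ {x y : N.S × ℤ}, N₂.Rel x y → G x y := fun h => EqvGen.rel _ _ (.inr h)
  have gs : ∀ {x y : N.S × ℤ}, G x y → G y x := fun h => EqvGen.symm _ _ h
  have gt : ∀ {x y z : N.S × ℤ}, G x y → G y z → G x z := fun h h' => EqvGen.trans _ _ _ h h'
  have G1 : ∀ {x y : N.S × ℤ}, (∀ k n, k < N.deg c → ¬ N₁.Rel x (sh n (N.port c (k + 1)))) →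
      (∀ k n, k < N.deg c → ¬ N₁.Rel y (sh n (N.port c (k + 1)))) → (G x y ↔ N₁.Rel x y) := by
    intro x y hx hy
    refine ⟨fun h => ?_, g1⟩
    refine rel_of_pendant (ι := {i : ℕ × ℤ // i.1 < N.deg c}) N₁.rel_equivalence
      (fun i => sh i.1.2 (N.port c (i.1.1 + 1))) (fun i => sh (i.1.2 + ν) (N.port b (i.1.1 + 1)))
      ?_ ?_ ?_ (fun i => hx _ _ i.2) (fun i => hy _ _ i.2) h
    · rintro ⟨⟨k, n⟩, hk⟩ ⟨⟨l, n'⟩, hl⟩ h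
      rcases fcA hk hc hl (r1 hk h) with h | h
      · simp only [Subtype.mk.injEq, Prod.mk.injEq]
        exact ⟨by omega, h.2.2.symm⟩
      · exact absurd h.1.symm hac
    · rintro ⟨⟨k, n⟩, hk⟩ ⟨⟨l, n'⟩, hl⟩ h
      rcases fcA hl hb (by rw [hdb]; exact hk) (r1 hl h.symm) with h | h
      · exact hbc h.1
      · exact hab h.1.symm
    · intro T hT1 hT2 x y h
      refine EqvGen.iff_of_closed ?_ h
      rintro x y (h | h)
      · exact hT1 _ _ h
      · exact cl₂ T (fun x y h => hT1 _ _ (m1 h)) (fun n k hk => hT2 ⟨⟨k, n⟩, hk⟩) x y h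
  have G2 : ∀ {x y : N.S × ℤ}, (∀ n, ¬ N₂.Rel x (sh n (N.port c 0))) →
      (∀ n, ¬ N₂.Rel y (sh n (N.port c 0))) → (G x y ↔ N₂.Rel x y) := by
    intro x y hx hy
    refine ⟨fun h => ?_, g2⟩
    refine rel_of_pendant (ι := ℤ) N₂.rel_equivalence
      (fun n => sh n (N.port c 0)) (fun n => sh (n + μ) (N.port a 0))
      ?_ ?_ ?_ hx hy h
    · intro n n' h
      rcases fcB hc (Nat.zero_le _) (r2 h) with h | h
      · omega
      · exact absurd h.1.symm hbc
    · intro n n' h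
      rcases fcB ha (Nat.zero_le _) (r2 h.symm) with h | h
      · exact hac h.1
      · exact hab h.1
    · intro T hT1 hT2 x y h
      refine EqvGen.iff_of_closed ?_ h
      rintro x y (h | h)
      · exact cl₁ T (fun x y h => hT1 _ _ (m2 h)) hT2 x y h
      · exact hT1 _ _ h
  let e : N.P → N.P := fun p => if p = b then a else p
  let f : N.P → ℤ := fun p => if p = b then μ - ν else 0
  have eb : e b = a := if_pos rfl
  have en : ∀ p, p ≠ b → e p = p := fun p h => if_neg h
  have ea : ∀ p, N₁.alive p → N₂.alive (e p) := by
    intro p hp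
    rw [al₁] at hp
    rw [al₂]
    by_cases h : p = b
    · subst h; rw [eb]; exact ⟨ha, hac, hab⟩
    · rw [en p h]; exact ⟨hp.1, hp.2.1, h⟩
  have hGe : ∀ p k n, k ≤ N.deg p → G (sh n (N.port p k)) (sh (n + f p) (N.port (e p) k)) := by
    intro p k n hk
    by_cases h : p = b
    · subst h
      rw [eb, show f p = μ - ν from if_pos rfl]
      rcases k with _ | k
      · have h1 := gl₁ (n - ν)
        have h2 := hN.rel_sh' (n - ν) hB
        rw [sh_sh, show ν + (n - ν) = n by ring] at h2
        rw [show n - ν + μ = n + (μ - ν) by ring] at h1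
        exact gt (gs (g1 (m1 h2))) (g1 h1)
      · rw [hdb] at hk
        have h1 := gl₂ (n - ν) k hk
        have h2 := hN.rel_sh' (n - ν) (hA k hk)
        rw [sh_sh, show μ + (n - ν) = n + (μ - ν) by ring] at h2
        rw [show n - ν + ν = n by ring] at h1
        exact gt (gs (g2 h1)) (g1 (m1 h2))
    · rw [en p h, show f p = 0 from if_neg h, add_zero]
      exact EqvGen.refl _
  have nC1 : ∀ p k n, N₁.alive p → k ≤ N.deg p →
      ∀ l n', l < N.deg c → ¬ N₁.Rel (sh n (N.port p k)) (sh n' (N.port c (l + 1))) := by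
    intro p k n hp hk l n' hl h
    rw [al₁] at hp
    rcases fcA hl hp.1 hk (r1 hl h.symm) with h | h
    exacts [hp.2.1 h.1, hp.2.2 h.1]
  have nC2 : ∀ p k n, N₂.alive p → k ≤ N.deg p →
      ∀ n', ¬ N₂.Rel (sh n (N.port p k)) (sh n' (N.port c 0)) := by
    intro p k n hp hk n' h
    rw [al₂] at hp
    rcases fcB hp.1 hk (r2 h.symm) with h | h
    exacts [hp.2.1 h.1, hp.2.2 h.1]
  have hde : ∀ p, N.deg (e p) = N.deg p := by
    intro p
    by_cases h : p = b
    · subst h; rw [eb, hda, hdb]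
    · rw [en p h]
  refine ⟨e, f, ⟨⟨fun p hp => ea p hp, ?_, ?_⟩, ?_, ?_, ?_⟩, ?_⟩
  · intro p hp q hq h
    have hp' := ((al₁ p).1 hp).2.2
    have hq' := ((al₁ q).1 hq).2.2
    by_cases h1 : p = b <;> by_cases h2 : q = b
    · rw [h1, h2]
    · rw [h1, eb, en q h2] at h; exact absurd h.symm hq'
    · rw [h2, eb, en p h1] at h; exact absurd h hp'
    · rwa [en p h1, en q h2] at h
  · intro p hp
    have hp' := (al₂ p).1 hp
    by_cases h : p = a
    · exact ⟨b, (al₁ b).2 ⟨hb, hbc, hab.symm⟩, by rw [eb, h]⟩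
    · exact ⟨p, (al₁ p).2 ⟨hp'.1, hp'.2.1, h⟩, en p hp'.2.2⟩
  · intro p hp
    show N.split (e p) ↔ N.split p
    by_cases h : p = b
    · subst h; rw [eb]; tauto
    · rw [en p h]
  · intro p hp
    show N.col (e p) = N.col p
    by_cases h : p = b
    · subst h; rw [eb, hcola, hcolb]
    · rw [en p h]
  · intro p q k l n hp hq hk hl
    have h1 : N₁.Rel (N.port p k) (sh n (N.port q l)) ↔ G (N.port p k) (sh n (N.port q l)) := by
      refine (G1 ?_ (fun l' n' => nC1 q l n hq hl l' n')).symm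
      intro l' n'; simpa using nC1 p k 0 hp hk l' n'
    have h2 : G (N.port p k) (sh n (N.port q l)) ↔
        G (sh (f p) (N.port (e p) k)) (sh (n + f q) (N.port (e q) l)) := by
      have a1 := hGe p k 0 hk
      have a2 := hGe q l n hl
      rw [sh_zero, zero_add] at a1
      exact ⟨fun h => gt (gs a1) (gt h a2), fun h => gt a1 (gt h (gs a2))⟩
    exact (h1.trans h2).trans (G2 (nC2 _ _ _ (ea p hp) (by rw [hde]; exact hk))
      (nC2 _ _ _ (ea q hq) (by rw [hde]; exact hl)))
  · suffices hs : N₁.loops = N₂.loops from hs ▸ EqvGen.refl _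
    have nL1 : ∀ s, N₁.IsLoop s → (∀ k n, k < N.deg c → ¬ N₁.Rel (s, 0) (sh n (N.port c (k + 1)))) ∧
        ∀ n, ¬ N₂.Rel (s, 0) (sh n (N.port c 0)) := by
      rintro s ⟨hs, j, hj, hj'⟩
      refine ⟨fun k n hk h => ?_, fun n h => ?_⟩
      · have h1 := hN₁.rel_sh' j h
        rw [sh_mk, zero_add, sh_sh] at h1
        rcases fcA hk hc hk (r1 hk ((h.symm.trans hj').trans h1)) with h | h
        · omega
        · exact hac h.1.symm
      · have h1 := (r2 h.symm).symm
        exact hs b 0 (ν + n) ((al₁ b).2 ⟨hb, hbc, hab.symm⟩) (Nat.zero_le _)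
          (m1 (h1.trans (by simpa using hN.rel_sh' n hB)))
    have nL2 : ∀ s, N₂.IsLoop s → (∀ k n, k < N.deg c → ¬ N₁.Rel (s, 0) (sh n (N.port c (k + 1)))) ∧
        ∀ n, ¬ N₂.Rel (s, 0) (sh n (N.port c 0)) := by
      rintro s ⟨hs, j, hj, hj'⟩
      refine ⟨fun k n hk h => ?_, fun n h => ?_⟩
      · have h1 := (r1 hk h.symm).symm
        exact hs a (k + 1) (μ + n) ((al₂ a).2 ⟨ha, hac, hab⟩) (by rw [← hda] at hk; exact hk)
          (m2 (h1.trans (by simpa using hN.rel_sh' n (hA k hk))))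
      · have h1 := hN₂.rel_sh' j h
        rw [sh_mk, zero_add, sh_sh] at h1
        rcases fcB hc (Nat.zero_le _) (r2 ((h.symm.trans hj').trans h1)) with h | h
        · omega
        · exact hbc h.1.symm
    have nCs : ∀ (s : N.S) (j : ℤ), ((∀ k n, k < N.deg c → ¬ N₁.Rel (s, 0) (sh n (N.port c (k + 1)))) ∧
        ∀ n, ¬ N₂.Rel (s, 0) (sh n (N.port c 0))) → 
        ((∀ k n, k < N.deg c → ¬ N₁.Rel (s, j) (sh n (N.port c (k + 1)))) ∧
        ∀ n, ¬ N₂.Rel (s, j) (sh n (N.port c 0))) := by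
      rintro s j ⟨h1, h2⟩
      refine ⟨fun k n hk h => h1 k (n - j) hk ?_, fun n h => h2 (n - j) ?_⟩
      · have := hN₁.rel_sh' (-j) h
        simpa [sub_eq_add_neg] using this
      · have := hN₂.rel_sh' (-j) h
        simpa [sub_eq_add_neg] using this
    have hGl : ∀ (s : N.S), (∀ p k n, N₁.alive p → k ≤ N.deg p → ¬ G (s, 0) (sh n (N.port p k))) ↔
        (∀ p k n, N₂.alive p → k ≤ N.deg p → ¬ G (s, 0) (sh n (N.port p k))) := by
      intro s
      constructor
      · intro h p k n hp hk hg
        have hp' := (al₂ p).1 hp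
        by_cases hpa : p = a
        · subst hpa
          have hk' : k ≤ N.deg b := by rw [hdb, ← hda]; exact hk
          have := hGe b k (n - f b) hk'
          rw [eb, sub_add_cancel] at this
          exact h b k _ ((al₁ b).2 ⟨hb, hbc, hab.symm⟩) hk' (gt hg (gs this))
        · exact h p k n ((al₁ p).2 ⟨hp'.1, hp'.2.1, hpa⟩) hk hg
      · intro h p k n hp hk hg
        exact h (e p) k _ (ea p hp) (by rw [hde]; exact hk) (gt hg (hGe p k n hk))
    refine loopsIn_congr hN₁ hN₂ (fun x x' => x = x' ∧
      (∀ k n, k < N.deg c → ¬ N₁.Rel x (sh n (N.port c (k + 1)))) ∧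
        ∀ n, ¬ N₂.Rel x (sh n (N.port c 0))) ?_ ?_ ?_ ?_ ?_
    · rintro x _ y _ ⟨rfl, hx1, hx2⟩ ⟨rfl, hy1, hy2⟩
      exact (G1 hx1 hy1).symm.trans (G2 hx2 hy2)
    · rintro n ⟨x, j⟩ _ ⟨rfl, h1⟩
      refine ⟨rfl, ?_⟩
      refine nCs x _ ?_
      simpa using nCs x 0 (by
        refine ⟨fun k n hk h => h1.1 k (n + j) hk ?_, fun n h => h1.2 (n + j) ?_⟩
        · have := hN₁.rel_sh' j h
          simpa using this
        · have := hN₂.rel_sh' j h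
          simpa using this)
    · rintro x _ ⟨rfl, _⟩; rfl
    · rintro s _ hs
      have h1 := nL1 s hs
      refine ⟨(s, 0), ⟨rfl, h1⟩, trivial, fun p k n hp hk hr => ?_, ?_⟩
      · refine (hGl s).1 (fun p k n hp hk hr => ?_) p k n hp hk (g2 hr)
        exact hs.1 p k n hp hk ((G1 h1.1 (nC1 p k n hp hk)).1 hr)
      · obtain ⟨_, j, hj, hj'⟩ := hs
        have h3 := nCs s j h1
        exact ⟨j, hj, (G2 h1.2 h3.2).1 (g1 hj')⟩
    · rintro s _ hs
      have h1 := nL2 s hs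
      refine ⟨(s, 0), ⟨rfl, h1⟩, trivial, fun p k n hp hk hr => ?_, ?_⟩
      · refine (hGl s).2 (fun p k n hp hk hr => ?_) p k n hp hk (g1 hr)
        exact hs.1 p k n hp hk ((G2 h1.2 (nC2 p k n hp hk)).1 hr)
      · obtain ⟨_, j, hj, hj'⟩ := hs
        have h3 := nCs s j h1
        exact ⟨j, hj, (G1 h1.1 h3.1).1 (g2 hj')⟩

section selfloop
variable (hN : N.WF) {v w : N.P} {m ν : ℤ} {many : Bool} (h : N.Redex v w m many)
  (hν : ∀ k ≤ N.deg v, Live many k → N.Rel (N.port v k) (sh ν (N.port w k)))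
include hN h hν

lemma Redex.class_ports {q k l n n'} (hk : k ≤ N.deg v) (hq : N.alive q) (hl : l ≤ N.deg q)
    (hr : N.Rel (sh n (N.port v k)) (sh n' (N.port q l))) :
    l = k ∧ (q = v ∧ n' = n ∨ q = w) := by
  have hk' : k ≤ N.deg w := by rwa [h.deg]
  have hs : N.split v ↔ ¬ N.split w := by simp [h.sv, h.sw]
  by_cases hL : Live many k
  · rcases hN.class_ports h.av h.aw hq hk hk' hl hs (hν k hk hL) hr with hh | hh <;> tauto
  · rcases hN.class_ports h.av h.aw hq hk hk' hl hs (h.dead k hk hL) hr with hh | hh <;> tauto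

lemma Redex.rel_v_w {k} (hk : k ≤ N.deg v) : ∃ j, N.Rel (N.port v k) (sh j (N.port w k)) := by
  by_cases hL : Live many k
  exacts [⟨_, hν k hk hL⟩, ⟨_, h.dead k hk hL⟩]

lemma Redex.red_rel_port {p k n y} (hp : N.alive p) (hpv : p ≠ v) (hpw : p ≠ w) (hk : k ≤ N.deg p)
    (hr : (N.red v w m many).Rel (sh n (N.port p k)) y) : N.Rel (sh n (N.port p k)) y := by
  refine red_rel_of_avoid (fun l n' hl _ hh => ?_) (fun l n' hl _ hh => ?_) hr
  · have := (h.class_ports hN hν hl hp hk hh.symm).2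
    tauto
  · obtain ⟨j, hj⟩ := h.rel_v_w hN hν hl
    have h1 := (hN.rel_sh' (n' - j) hj).trans (by simpa using hh.symm)
    have := (h.class_ports hN hν hl hp hk h1).2
    tauto

lemma Redex.red_rel_live {k y} (hk : k ≤ N.deg v) (hL : Live many k)
    (hr : (N.red v w m many).Rel (N.port v k) y) :
    ∃ j : ℤ, N.Rel (sh (j * (m - ν)) (N.port v k)) y := by
  refine (red_rel_closed (T := fun y => ∃ j : ℤ, N.Rel (sh (j * (m - ν)) (N.port v k)) y)
    ?_ ?_ hr).1 ⟨0, by simpa using .refl _⟩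
  · exact fun x y hxy => exists_congr fun j => ⟨fun hh => hh.trans hxy, fun hh => hh.trans hxy.symm⟩
  · intro l n hl hL'
    have e := hN.rel_sh' (n + m - ν) (hν l hl hL')
    rw [sh_sh, show ν + (n + m - ν) = n + m by ring] at e
    constructor
    · rintro ⟨j, hj⟩
      obtain ⟨rfl, ⟨_, rfl⟩ | hvw⟩ := h.class_ports hN hν hk h.av hl hj
      · exact ⟨j + 1, by convert e using 2; ring⟩
      · exact absurd hvw h.ne
    · rintro ⟨j, hj⟩
      obtain ⟨rfl, ⟨_, hn⟩ | hvw⟩ := h.class_ports hN hν hk h.av hl (hj.trans e.symm)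
      · refine ⟨j - 1, ?_⟩
        rw [show (j - 1) * (m - ν) = n by linear_combination -hn]
        exact .refl _
      · exact absurd hvw h.ne

lemma Redex.red_rel_dead {k y} (hk : k ≤ N.deg v) (hL : ¬ Live many k)
    (hr : (N.red v w m many).Rel (N.port v k) y) : N.Rel (N.port v k) y := by
  refine red_rel_of_avoid (fun l n' hl hL' hh => ?_) (fun l n' hl hL' hh => ?_) hr
  · rw [← sh_zero (N.port v k)] at hh
    exact hL ((h.class_ports hN hν hk h.av hl hh).1 ▸ hL')
  · rw [← sh_zero (N.port v k)] at hh
    exact hL ((h.class_ports hN hν hk h.aw (by rwa [h.deg]) hh).1 ▸ hL')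

lemma Redex.red_period {k} (hk : k ≤ N.deg v) (hL : Live many k) (n : ℤ) :
    (N.red v w m many).Rel (N.port v k) (sh n (N.port v k)) ↔ m - ν ∣ n := by
  have hN' := h.wf hN
  constructor
  · intro hr
    obtain ⟨j, hj⟩ := h.red_rel_live hN hν hk hL hr
    obtain ⟨_, ⟨_, hn⟩ | hvw⟩ := h.class_ports hN hν hk h.av hk hj
    · exact ⟨j, by rw [hn]; ring⟩
    · exact absurd hvw h.ne
  · have step : ∀ n, (N.red v w m many).Rel (sh n (N.port v k)) (sh (n + (m - ν)) (N.port v k)) := by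
      intro n
      refine (h.red_rel hN hk n).trans (Rel.symm (red_rel_mono ?_))
      have := hN.rel_sh' (n + (m - ν)) (hν k hk hL)
      rwa [sh_sh, show ν + (n + (m - ν)) = n + m by ring] at this
    rintro ⟨j, rfl⟩
    induction j using Int.induction_on with
    | zero => simpa using .refl _
    | succ i ih =>
      refine ih.trans ?_
      convert step _ using 2
      ring
    | pred i ih =>
      refine ih.trans (Rel.symm ?_)
      convert step _ using 2
      ring

lemma Redex.newLoops {o D : ℕ} (hoD : ∀ k, k ≤ N.deg v ∧ Live many k ↔ o ≤ k ∧ k < o + D) :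
    (N.red v w m many).loopsIn (fun s => ¬ N.Portless (s, 0)) =
      if m = ν then 0 else (Multiset.range D).map fun i =>
        (N.scol (N.port v (o + i)).1, (m - ν).natAbs) := by
  have hN' := h.wf hN
  have hsurj : ∀ t, ¬ N.Portless (t, 0) → (N.red v w m many).IsLoop t →
      ∃ k j, k ≤ N.deg v ∧ Live many k ∧ N.Rel (t, 0) (sh j (N.port v k)) := by
    intro t ht hl
    simp only [Portless, not_forall, not_not] at ht
    obtain ⟨p, k, n, hp, hk, h1⟩ := ht
    have hcase : ∃ j, k ≤ N.deg v ∧ N.Rel (t, 0) (sh j (N.port v k)) := by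
      by_cases hpv : p = v
      · subst hpv; exact ⟨n, hk, h1⟩
      by_cases hpw : p = w
      · subst hpw
        rw [h.deg] at hk
        obtain ⟨j, hj⟩ := h.rel_v_w hN hν hk
        refine ⟨n - j, hk, h1.trans (Rel.symm ?_)⟩
        simpa using hN.rel_sh' (n - j) hj
      · exact absurd (red_rel_mono h1) (hl.1 p k n ⟨hp, hpv, hpw⟩ hk)
    obtain ⟨j, hk, h2⟩ := hcase
    refine ⟨k, j, hk, ?_, h2⟩
    by_contra hL
    obtain ⟨_, i, hi, hr⟩ := (hN'.isLoop_iff (t, 0)).1 hl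
    have h3 := (red_rel_mono (v := v) (w := w) (m := m) (many := many) h2).symm.trans
      (hr.trans (hN'.rel_sh' i (red_rel_mono h2)))
    rw [sh_sh, hN'.rel_sh_left] at h3
    have := hN.port_self h.av hk (h.red_rel_dead hN hν hk hL h3)
    omega
  split_ifs with hm
  · refine loopsIn_eq_zero fun t ht hl => ?_
    obtain ⟨k, j, hk, hL, h1⟩ := hsurj t ht hl
    obtain ⟨_, i, hi, hr⟩ := (hN'.isLoop_iff (t, 0)).1 hl
    have h3 := (red_rel_mono (v := v) (w := w) (m := m) (many := many) h1).symm.trans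
      (hr.trans (hN'.rel_sh' i (red_rel_mono h1)))
    rw [sh_sh, hN'.rel_sh_left, h.red_period hN hν hk hL, hm, sub_self, zero_dvd_iff] at h3
    omega
  have hi : ∀ i < D, o + i ≤ N.deg v ∧ Live many (o + i) := fun i hi => (hoD _).2 (by omega)
  rw [hN'.loopsIn_eq_map (d := D) (fun i => (N.port v (o + i)).1)]
  · refine Multiset.map_congr rfl fun i hi' => ?_
    obtain ⟨hk, hL⟩ := hi i (by simpa using hi')
    congr 1
    unfold winding
    have : ∀ j : ℕ, (N.red v w m many).Rel ((N.port v (o + i)).1, 0) ((N.port v (o + i)).1, (j : ℤ)) ↔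
        m - ν ∣ j := by
      intro j
      rw [hN'.rel_sh_base, ← h.red_period hN hν hk hL]
      simp
    simp only [this]
    have hpos : 0 < (m - ν).natAbs := by omega
    refine le_antisymm (Nat.sInf_le ⟨hpos, by simp⟩) (le_csInf ⟨_, hpos, by simp⟩ ?_)
    rintro j ⟨hj, hd⟩
    exact Nat.le_of_dvd hj (by simpa using Int.natAbs_dvd_natAbs.2 hd)
  · intro i hi'
    obtain ⟨hk, hL⟩ := hi i hi'
    refine ⟨fun hp => ?_, ?_⟩
    · rw [hN.portless_base] at hp
      exact hp v (o + i) 0 h.av hk (by simpa using .refl _)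
    · rw [hN'.isLoop_iff]
      refine ⟨fun q l n hq hl hr => ?_, (m - ν).natAbs, by omega, ?_⟩
      · have h1 := (h.red_rel_port hN hν hq.1 hq.2.1 hq.2.2 hl hr.symm).symm
        rw [← sh_zero (N.port v (o + i))] at h1
        have := (h.class_ports hN hν hk hq.1 hl h1).2
        have h2 := hq.2
        tauto
      · rw [h.red_period hN hν hk hL]; simp
  · rintro i hi' j hj' ⟨n, hn⟩
    rw [hN'.rel_sh_base] at hn
    obtain ⟨hk, hL⟩ := hi i hi'
    obtain ⟨hk', _⟩ := hi j hj'
    obtain ⟨c, hc⟩ := h.red_rel_live hN hν hk hL hn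
    have := (h.class_ports hN hν hk h.av hk' hc).1
    omega
  · intro t ht hl
    obtain ⟨k, j, hk, hL, h1⟩ := hsurj t ht hl
    obtain ⟨h2, h3⟩ := (hoD k).1 ⟨hk, hL⟩
    refine ⟨k - o, by omega, ?_⟩
    rw [show o + (k - o) = k by omega]
    exact hN'.same_of_rel (red_rel_mono h1)

end selfloop

lemma Redex.equiv3_of_both (hN : N.WF) {v w : N.P} {m₁ m₂ : ℤ}
    (h₁ : N.Redex v w m₁ true) (h₂ : N.Redex v w m₂ false) :
    Equiv3 (N.red v w m₁ true) (N.red v w m₂ false) := by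
  have hν₁ : ∀ k ≤ N.deg v, Live true k → N.Rel (N.port v k) (sh m₂ (N.port w k)) :=
    fun k hk hL => h₂.dead k hk (by simp_all [Live])
  have hν₂ : ∀ k ≤ N.deg v, Live false k → N.Rel (N.port v k) (sh m₁ (N.port w k)) :=
    fun k hk hL => h₁.dead k hk (by simp_all [Live])
  refine ⟨id, fun _ => 0, ⟨Set.bijOn_id _, fun _ _ => Iff.rfl, fun _ _ => rfl, ?_⟩, ?_⟩
  · intro p q k l n hp hq hk hl
    simp only [sh_zero, add_zero, id]
    have h1 := @Redex.red_rel_port _ _ _ _ hN v w m₁ m₂ true h₁ hν₁ p k 0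
    have h2 := @Redex.red_rel_port _ _ _ _ hN v w m₂ m₁ false h₂ hν₂ p k 0
    simp only [sh_zero] at h1 h2
    exact ⟨fun hr => red_rel_mono (h1 hp.1 hp.2.1 hp.2.2 hk hr),
      fun hr => red_rel_mono (h2 hp.1 hp.2.1 hp.2.2 hk hr)⟩
  rw [h₁.loops_eq hN, h₂.loops_eq hN, h₁.newLoops hN hν₁ (o := 0) (D := 1) (by simp [Live]),
    h₂.newLoops hN hν₂ (o := 1) (D := N.deg v) (by simp [Live]; omega)]
  by_cases hm : m₁ = m₂
  · rw [if_pos hm, if_pos hm.symm]; exact EqvGen.refl _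
  rw [if_neg hm, if_neg (Ne.symm hm)]
  refine EqvGen.rel _ _ ⟨N.col v, (m₁ - m₂).natAbs, N.loops, ?_, ?_⟩
  · simp [hN.col_zero v h₁.av]
  · congr 1
    rw [show (m₂ - m₁).natAbs = (m₁ - m₂).natAbs by omega, ← Multiset.coe_range, Multiset.map_coe]
    congr 1
    apply List.ext_getElem?
    intro i
    simp only [getElem?_map]
    by_cases hi : i < N.deg v
    · rw [hN.col_succ v h₁.av i hi, List.getElem?_range hi]
      simp [add_comm]
    · rw [List.getElem?_eq_none (by simpa using hi), List.getElem?_eq_none (by simpa [Net.deg] using hi)]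
      rfl

lemma Redex.eq_of_left (hN : N.WF) {v w₁ w₂ m₁ m₂ many} (h₁ : N.Redex v w₁ m₁ many)
    (h₂ : N.Redex v w₂ m₂ many) : w₁ = w₂ ∧ m₁ = m₂ := by
  have hd := hN.deg_ge v h₁.av
  obtain ⟨k, hk, hL⟩ : ∃ k ≤ N.deg v, ¬ Live many k := by
    cases many
    · exact ⟨0, by omega, by simp [Live]⟩
    · exact ⟨1, by omega, by simp [Live]⟩
  have := (h₁.dead k hk hL).symm.trans (h₂.dead k hk hL)
  rw [hN.rel_sh_left] at this
  have := hN.side_rel h₁.aw (by rwa [h₁.deg]) h₂.aw (by rwa [h₂.deg]) (by simp [h₁.sw, h₂.sw]) this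
  exact ⟨this.1, by omega⟩

lemma Redex.eq_of_right (hN : N.WF) {v₁ v₂ w m₁ m₂ many} (h₁ : N.Redex v₁ w m₁ many)
    (h₂ : N.Redex v₂ w m₂ many) : v₁ = v₂ ∧ m₁ = m₂ := by
  have hd := hN.deg_ge v₁ h₁.av
  have hd₂ : N.deg v₂ = N.deg v₁ := by rw [← h₁.deg, h₂.deg]
  obtain ⟨k, hk, hL⟩ : ∃ k ≤ N.deg v₁, ¬ Live many k := by
    cases many
    · exact ⟨0, by omega, by simp [Live]⟩
    · exact ⟨1, by omega, by simp [Live]⟩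
  have h1 := h₁.dead k hk hL
  have h2 := hN.rel_sh' (m₁ - m₂) (h₂.dead k (by rwa [hd₂]) hL)
  rw [sh_sh, add_sub_cancel] at h2
  have := hN.side_rel h₁.av hk h₂.av (by rwa [hd₂]) (by simp [h₁.sv, h₂.sv]) (h1.trans h2.symm)
  exact ⟨this.1, by omega⟩

lemma Redex.equiv3_of_right (hN : N.WF) {v u w m₁ m₂} (h₁ : N.Redex v w m₁ true)
    (h₂ : N.Redex u w m₂ false) (hvu : v ≠ u) :
    Equiv3 (N.red v w m₁ true) (N.red u w m₂ false) := by
  have hd : N.deg u = N.deg v := by rw [← h₁.deg, h₂.deg]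
  refine equiv3_of_shared hN (c := w) (a := v) (b := u) (μ := -m₁) (ν := -m₂) h₁ h₂ h₁.aw h₁.av
    h₂.av h₁.ne h₂.ne hvu h₁.col h₂.col (by simp [h₁.sv, h₁.sw]) (by simp [h₂.sv, h₂.sw])
    (fun k hk => ?_) ?_ (fun p => by simp only [ne_eq]; tauto) (fun p => by simp only [ne_eq]; tauto)
    (fun T h1 h2 x y h => ?_) (fun T h1 h2 x y h => ?_) (fun n => ?_) (fun n k hk => ?_)
  · rw [h₁.deg] at hk
    have := hN.rel_sh' (-m₁) (h₁.dead (k + 1) hk (by simp [Live]))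
    exact Rel.symm (by simpa using this)
  · have := hN.rel_sh' (-m₂) (h₂.dead 0 (by simp) (by simp [Live]))
    exact Rel.symm (by simpa using this)
  · refine red_rel_closed h1 (fun k n hk hL => ?_) h
    have hk0 : k = 0 := by simpa [Live] using hL
    subst hk0
    simpa using (h2 (n + m₁)).symm
  · refine red_rel_closed h1 (fun k n hk hL => ?_) h
    obtain ⟨k, rfl⟩ : ∃ j, k = j + 1 := Nat.exists_eq_succ_of_ne_zero (by simpa [Live] using hL)
    simpa using (h2 (n + m₂) k (by rw [h₂.deg]; exact hk)).symm
  · simpa using (h₁.red_rel hN (k := 0) (by simp) (n + -m₁)).symm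
  · simpa using (h₂.red_rel hN (k := k + 1) (by rw [h₂.deg] at hk; exact hk) (n + -m₂)).symm

lemma Redex.equiv3_of_left (hN : N.WF) {v u w m₁ m₂} (h₁ : N.Redex v w m₁ true)
    (h₂ : N.Redex v u m₂ false) (hwu : w ≠ u) :
    Equiv3 (N.red v w m₁ true) (N.red v u m₂ false) := by
  refine equiv3_of_shared hN (c := v) (a := w) (b := u) (μ := m₁) (ν := m₂) h₁ h₂ h₁.av h₁.aw
    h₂.aw h₁.ne.symm h₂.ne.symm hwu h₁.col.symm h₂.col.symm (by simp [h₁.sv, h₁.sw])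
    (by simp [h₂.sv, h₂.sw])
    (fun k hk => h₁.dead (k + 1) hk (by simp [Live])) (h₂.dead 0 (by simp) (by simp [Live]))
    (fun p => Iff.rfl) (fun p => Iff.rfl)
    (fun T h1 h2 x y h => ?_) (fun T h1 h2 x y h => ?_) (fun n => h₁.red_rel hN (by simp) n)
    (fun n k hk => h₂.red_rel hN hk n)
  · refine red_rel_closed h1 (fun k n hk hL => ?_) h
    have hk0 : k = 0 := by simpa [Live] using hL
    subst hk0
    exact h2 n
  · refine red_rel_closed h1 (fun k n hk hL => ?_) h
    obtain ⟨k, rfl⟩ : ∃ j, k = j + 1 := Nat.exists_eq_succ_of_ne_zero (by simpa [Live] using hL)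
    exact h2 n k hk

lemma Redex.red_redex {v w m many v' w' m' many'} (h : N.Redex v w m many)
    (h₁ : v ≠ v') (h₂ : w ≠ w') (h' : N.Redex v' w' m' many') :
    (N.red v' w' m' many').Redex v w m many where
  av := ⟨h.av, h₁, fun e => h'.sw (e ▸ h.sv)⟩
  aw := ⟨h.aw, fun e => h.sw (e ▸ h'.sv), h₂⟩
  sv := h.sv
  sw := h.sw
  col := h.col
  dead := fun k hk hL => red_rel_mono (h.dead k hk hL)

lemma red_red_comm (N : Net Γ) (v w m many v' w' m' many') :
    (N.red v w m many).red v' w' m' many' = (N.red v' w' m' many').red v w m many := by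
  refine congrArg₂ (fun a g => ({N with alive := a, gen := g} : Net Γ)) ?_ ?_
  · funext p
    exact propext (by tauto)
  · funext x y
    exact propext or_right_comm

lemma Red.local_confluence (hN : N.WF) [Nonempty N.P] {N₁ N₂ : Net Γ} (h₁ : Red N N₁)
    (h₂ : Red N N₂) : Equiv3 N₁ N₂ ∨ ∃ N₃, Red N₁ N₃ ∧ Red N₂ N₃ := by
  obtain ⟨v₁, w₁, m₁, b₁, h₁, rfl⟩ := h₁
  obtain ⟨v₂, w₂, m₂, b₂, h₂, rfl⟩ := h₂
  have hW₁ := h₁.wf hN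
  have hW₂ := h₂.wf hN
  by_cases hb : b₁ = b₂
  · subst hb
    by_cases hv : v₁ = v₂
    · subst hv
      obtain ⟨rfl, rfl⟩ := h₁.eq_of_left hN h₂
      exact .inl (Equiv3.refl hW₁)
    by_cases hw : w₁ = w₂
    · subst hw
      obtain ⟨rfl, rfl⟩ := h₁.eq_of_right hN h₂
      exact .inl (Equiv3.refl hW₁)
    exact .inr ⟨_, ⟨_, _, _, _, h₂.red_redex (Ne.symm hv) (Ne.symm hw) h₁, rfl⟩,
      ⟨_, _, _, _, h₁.red_redex hv hw h₂, red_red_comm ..⟩⟩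
  · by_cases hv : v₁ = v₂
    · subst hv
      left
      by_cases hw : w₁ = w₂
      · subst hw
        cases b₁ <;> cases b₂
        · exact absurd rfl hb
        · exact (h₂.equiv3_of_both hN h₁).symm hW₂ hW₁
        · exact h₁.equiv3_of_both hN h₂
        · exact absurd rfl hb
      · cases b₁ <;> cases b₂
        · exact absurd rfl hb
        · exact (h₂.equiv3_of_left hN h₁ (Ne.symm hw)).symm hW₂ hW₁
        · exact h₁.equiv3_of_left hN h₂ hw
        · exact absurd rfl hb
    · by_cases hw : w₁ = w₂
      · subst hw
        left
        cases b₁ <;> cases b₂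
        · exact absurd rfl hb
        · exact (h₂.equiv3_of_right hN h₁ (Ne.symm hv)).symm hW₂ hW₁
        · exact h₁.equiv3_of_right hN h₂ hv
        · exact absurd rfl hb
      · exact .inr ⟨_, ⟨_, _, _, _, h₂.red_redex (Ne.symm hv) (Ne.symm hw) h₁, rfl⟩,
          ⟨_, _, _, _, h₁.red_redex hv hw h₂, red_red_comm ..⟩⟩

/-- No reduction is possible. -/
def Irred (N : Net Γ) : Prop := ∀ N', ¬ Red N N'

noncomputable def size (N : Net Γ) : ℕ := {p | N.alive p}.ncard

lemma Red.wf (hN : N.WF) (h : Red N N') : N'.WF := by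
  obtain ⟨v, w, m, b, h, rfl⟩ := h
  exact h.wf hN

lemma Red.nonempty (hN : Nonempty N.P) (h : Red N N') : Nonempty N'.P := by
  obtain ⟨v, w, m, b, h, rfl⟩ := h
  exact hN

lemma Red.size_lt (h : Red N N') : N'.size < N.size := by
  obtain ⟨v, w, m, b, h, rfl⟩ := h
  refine Set.ncard_lt_ncard ⟨fun p hp => hp.1, fun hs => ?_⟩ (Set.toFinite _)
  exact (hs h.av).2.1 rfl

lemma exists_irred (N : Net Γ) : ∃ A, ReflTransGen Red N A ∧ A.Irred := by
  induction hn : N.size using Nat.strong_induction_on generalizing N with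
  | _ n ih =>
    by_cases hN : N.Irred
    · exact ⟨N, .refl, hN⟩
    · simp only [Irred, not_forall, not_not] at hN
      obtain ⟨N', hN'⟩ := hN
      obtain ⟨A, h1, h2⟩ := ih _ (hn ▸ hN'.size_lt) N' rfl
      exact ⟨A, .head hN' h1, h2⟩

lemma wf_of_red (hN : N.WF) (h : ReflTransGen Red N N') : N'.WF := by
  induction h with
  | refl => exact hN
  | tail _ h ih => exact h.wf ih

lemma nonempty_of_red (hN : Nonempty N.P) (h : ReflTransGen Red N N') : Nonempty N'.P := by
  induction h with
  | refl => exact hN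
  | tail _ h ih => exact h.nonempty ih

lemma Irred.congr (hN : N.WF) (hN' : N'.WF) [Nonempty N.P] (h : Equiv3 N N') (hi : N.Irred) :
    N'.Irred := fun _ hr =>
  let ⟨_, h1, _⟩ := (h.symm hN hN').red hN' hN hr
  hi _ h1

/-- Reducing equivalent nets completely gives equivalent nets. -/
lemma irred_unique {n : ℕ} : ∀ {N N' A B : Net Γ}, N.size ≤ n → N.WF → N'.WF → Nonempty N.P →
    Nonempty N'.P → Equiv3 N N' → ReflTransGen Red N A → A.Irred → ReflTransGen Red N' B →
    B.Irred → Equiv3 A B := by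
  induction n with
  | zero =>
    intro N N' A B hn hN hN' hP hP' he hA _ hB _
    have hi : N.Irred := fun M hM => by have := hM.size_lt; omega
    have hi' := hi.congr hN hN' he
    rcases hA.cases_head with rfl | ⟨M, hM, _⟩
    · rcases hB.cases_head with rfl | ⟨M, hM, _⟩
      · exact he
      · exact absurd hM (hi' _)
    · exact absurd hM (hi _)
  | succ n ih =>
    intro N N' A B hn hN hN' hP hP' he hA hAi hB hBi
    rcases hA.cases_head with rfl | ⟨N₁, h₁, hA⟩
    · have hi' := hAi.congr hN hN' he
      rcases hB.cases_head with rfl | ⟨M, hM, _⟩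
      · exact he
      · exact absurd hM (hi' _)
    · rcases hB.cases_head with rfl | ⟨N₁', h₁', hB⟩
      · exact absurd h₁ ((hBi.congr hN' hN (he.symm hN hN')) _)
      have hlt := h₁.size_lt
      have W₁ := h₁.wf hN
      have P₁ := h₁.nonempty hP
      have W₁' := h₁'.wf hN'
      have P₁' := h₁'.nonempty hP'
      obtain ⟨M, hM, hNM⟩ := he.red hN hN' h₁
      have WM := hM.wf hN'
      have PM := hM.nonempty hP'
      have hs : ∀ {K K' : Net Γ}, K.WF → Nonempty K.P → Equiv3 K K' → K'.size = K.size := by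
        rintro K K' hK hP ⟨e, f, hp, _⟩
        exact (Set.ncard_congr (fun p _ => e p) (fun p hp' => hp.alive hp')
          (fun p q hp' hq' h => hp.bij.injOn hp' hq' h)
          (fun p hp' => by obtain ⟨q, hq, rfl⟩ := hp.bij.surjOn hp'; exact ⟨q, hq, rfl⟩)).symm
      have sM : M.size ≤ n := by rw [hs W₁ P₁ hNM]; omega
      have sN' : N'.size = N.size := hs hN hP he
      have sN₁' : N₁'.size ≤ n := by have := h₁'.size_lt; omega
      rcases hM.local_confluence hN' h₁' with h | ⟨K, hK, hK'⟩
      · exact ih (by omega) W₁ W₁' P₁ P₁' (hNM.trans WM W₁' h) hA hAi hB hBi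
      · obtain ⟨C, hC, hCi⟩ := exists_irred K
        have WC := wf_of_red (hK.wf WM) hC
        have PC := nonempty_of_red (hK.nonempty PM) hC
        have c1 := ih (by omega) W₁ WM P₁ PM hNM hA hAi (.head hK hC) hCi
        have c2 := ih sN₁' W₁' W₁' P₁' P₁' (Equiv3.refl W₁') (.head hK' hC) hCi hB hBi
        exact c1.trans WC (wf_of_red W₁' hB) c2

lemma not_isLoop_of_isolated {s : N.S}
    (h : ∀ y, ¬ N.gen (s, 0) y ∧ ¬ N.gen y (s, 0)) : ¬ N.IsLoop s := by
  rintro ⟨_, m, hm, hr⟩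
  have := EqvGen.eq_of_isolated hr (.inl h)
  simp only [Prod.mk.injEq, true_and] at this
  omega

/-- A correspondence between the lifts of two nets that respects strands. -/
structure Corr (N N' : Net Γ) (ρ : N.S × ℤ → N'.S × ℤ → Prop) : Prop where
  sh : ∀ n x x', ρ x x' → ρ (sh n x) (sh n x')
  coh : ∀ x x' y', ρ x x' → ρ x y' → N'.Rel x' y'
  coh' : ∀ x y x', ρ x x' → ρ y x' → N.Rel x y
  fwd : ∀ x y, N.gen x y → ∃ x' y', ρ x x' ∧ ρ y y' ∧ N'.Rel x' y'
  bwd : ∀ x' y', N'.gen x' y' → ∃ x y, ρ x x' ∧ ρ y y' ∧ N.Rel x y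
  col : ∀ x x', ρ x x' → N.scol x.1 = N'.scol x'.1

lemma rel_of_simulation {ρ : N.S × ℤ → N'.S × ℤ → Prop}
    (hc : ∀ x x' y', ρ x x' → ρ x y' → N'.Rel x' y')
    (hf : ∀ x y, N.gen x y → ∃ x' y', ρ x x' ∧ ρ y y' ∧ N'.Rel x' y')
    {x y x' y'} (hx : ρ x x') (hy : ρ y y') (h : N.Rel x y) : N'.Rel x' y' := by
  have : (∀ x', ρ x x' → ∃ y', ρ y y' ∧ N'.Rel x' y') ∧
      (∀ y', ρ y y' → ∃ x', ρ x x' ∧ N'.Rel x' y') := by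
    clear hx hy x' y'
    induction h with
    | rel x y h =>
      obtain ⟨x', y', h1, h2, h3⟩ := hf x y h
      exact ⟨fun z hz => ⟨y', h2, (hc _ _ _ hz h1).trans h3⟩, fun z hz => ⟨x', h1, h3.trans (hc _ _ _ h2 hz)⟩⟩
    | refl x => exact ⟨fun z hz => ⟨z, hz, .refl _⟩, fun z hz => ⟨z, hz, .refl _⟩⟩
    | symm x y _ ih =>
      exact ⟨fun z hz => let ⟨w, h1, h2⟩ := ih.2 z hz; ⟨w, h1, h2.symm⟩,
        fun z hz => let ⟨w, h1, h2⟩ := ih.1 z hz; ⟨w, h1, h2.symm⟩⟩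
    | trans x y z _ _ ih₁ ih₂ =>
      constructor
      · intro x' hx'
        obtain ⟨y', h1, h2⟩ := ih₁.1 x' hx'
        obtain ⟨z', h3, h4⟩ := ih₂.1 y' h1
        exact ⟨z', h3, h2.trans h4⟩
      · intro z' hz'
        obtain ⟨y', h1, h2⟩ := ih₂.2 z' hz'
        obtain ⟨x', h3, h4⟩ := ih₁.2 y' h1
        exact ⟨x', h3, h4.trans h2⟩
  obtain ⟨z, h1, h2⟩ := this.1 x' hx
  exact h2.trans (hc _ _ _ h1 hy)

lemma Corr.rel_iff {ρ} (h : Corr N N' ρ) {x y x' y'} (hx : ρ x x') (hy : ρ y y') :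
    N.Rel x y ↔ N'.Rel x' y' := by
  refine ⟨rel_of_simulation h.coh h.fwd hx hy, ?_⟩
  refine rel_of_simulation (N := N') (N' := N) (ρ := fun x' x => ρ x x')
    (fun x' x y h1 h2 => h.coh' _ _ _ h1 h2) (fun x' y' hg => ?_) hx hy
  obtain ⟨x, y, h1, h2, h3⟩ := h.bwd x' y' hg
  exact ⟨x, y, h1, h2, h3⟩

/-- An isomorphism of nets: on points, up to shifts, and on loops. -/
structure Iso (N N' : Net Γ) (e : N.P → N'.P) (f : N.P → ℤ) : Prop where
  port : PortIso N N' e f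
  loops : N.loops = N'.loops

lemma Iso.equiv3 {e f} (h : Iso N N' e f) : Equiv3 N N' := ⟨e, f, h.port, h.loops ▸ EqvGen.refl _⟩

lemma Corr.portIso {ρ} (h : Corr N N' ρ) {e f}
    (bij : Set.BijOn e {p | N.alive p} {p | N'.alive p})
    (split : ∀ p, N.alive p → (N'.split (e p) ↔ N.split p))
    (col : ∀ p, N.alive p → N'.col (e p) = N.col p)
    (port : ∀ p k, N.alive p → k ≤ N.deg p → ρ (N.port p k) (_root_.sh (f p) (N'.port (e p) k))) :
    PortIso N N' e f where
  bij := bij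
  split := split
  col := col
  rel := fun p q k l n hp hq hk hl => by
    refine h.rel_iff (port p k hp hk) ?_
    have := h.sh n _ _ (port q l hq hl)
    rwa [sh_sh, add_comm] at this

lemma Corr.iso (hN : N.WF) (hN' : N'.WF) {ρ} (h : Corr N N' ρ) {e f}
    (bij : Set.BijOn e {p | N.alive p} {p | N'.alive p})
    (split : ∀ p, N.alive p → (N'.split (e p) ↔ N.split p))
    (col : ∀ p, N.alive p → N'.col (e p) = N.col p)
    (port : ∀ p k, N.alive p → k ≤ N.deg p → ρ (N.port p k) (_root_.sh (f p) (N'.port (e p) k)))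
    (tot : ∀ s, (∃ x', ρ (s, 0) x') ∨ ∀ y, ¬ N.gen (s, 0) y ∧ ¬ N.gen y (s, 0))
    (tot' : ∀ s', (∃ x, ρ x (s', 0)) ∨ ∀ y, ¬ N'.gen (s', 0) y ∧ ¬ N'.gen y (s', 0)) :
    Iso N N' e f := by
  refine ⟨h.portIso bij split col port, ?_⟩
  have hdeg : ∀ p, N.alive p → N'.deg (e p) = N.deg p := fun p hp => by
    unfold Net.deg; rw [col p hp]
  have hpl : ∀ x x', ρ x x' → (N.Portless x ↔ N'.Portless x') := by
    intro x x' hx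
    constructor
    · intro hp p' k n hp' hk hr
      obtain ⟨p, hpa, rfl⟩ := bij.surjOn hp'
      rw [hdeg p hpa] at hk
      have h1 := h.sh (n - f p) _ _ (port p k hpa hk)
      rw [sh_sh, add_sub_cancel] at h1
      exact hp p k _ hpa hk ((h.rel_iff hx h1).2 hr)
    · intro hp p k n hpa hk hr
      have h1 := h.sh n _ _ (port p k hpa hk)
      rw [sh_sh] at h1
      exact hp (e p) k _ (bij.mapsTo hpa) (by rwa [hdeg p hpa]) ((h.rel_iff hx h1).1 hr)
  have hL : ∀ x x', ρ x x' → (N.IsLoop x.1 ↔ N'.IsLoop x'.1) := by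
    intro x x' hx
    rw [hN.isLoop_iff, hN'.isLoop_iff, hpl x x' hx]
    simp only [h.rel_iff hx (h.sh _ _ _ hx)]
  refine loopsIn_congr hN hN' ρ (fun x x' y y' hx hy => h.rel_iff hx hy) h.sh h.col ?_ ?_
  · intro s _ hs
    rcases tot s with ⟨x', hx'⟩ | hi
    · exact ⟨x', hx', trivial, (hL _ _ hx').1 hs⟩
    · exact absurd hs (not_isLoop_of_isolated hi)
  · intro s _ hs
    rcases tot' s with ⟨x, hx⟩ | hi
    · exact ⟨x, hx, trivial, (hL _ _ hx).2 hs⟩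
    · exact absurd hs (not_isLoop_of_isolated hi)

end Net

namespace StrandDiagram

variable (F : StrandDiagram Γ)

instance : Finite F.Point := F.finite_point
instance : Finite F.Strand := F.finite_strand

/-- `a` and `b` are corresponding source and sink. -/
def Base (a b : F.Point) : Prop := (a, b) ∈ F.sources.zip F.sinks

variable {F}

lemma ini_of_mem {p s} (h : s ∈ F.outs p) : F.ini s = p := (F.mem_outs p s).1 h
lemma ter_of_mem {p s} (h : s ∈ F.ins p) : F.ter s = p := (F.mem_ins p s).1 h
lemma ini_of_eq {p s} (h : F.outs p = [s]) : F.ini s = p := ini_of_mem (by simp [h])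
lemma ter_of_eq {p s} (h : F.ins p = [s]) : F.ter s = p := ter_of_mem (by simp [h])
lemma mem_outs_ini (s) : s ∈ F.outs (F.ini s) := (F.mem_outs _ s).2 rfl
lemma mem_ins_ter (s) : s ∈ F.ins (F.ter s) := (F.mem_ins _ s).2 rfl

lemma eq_of_ini {p s t} (h : F.outs p = [t]) (hs : F.ini s = p) : s = t := by
  simpa [h] using (F.mem_outs p s).2 hs
lemma eq_of_ter {p s t} (h : F.ins p = [t]) (hs : F.ter s = p) : s = t := by
  simpa [h] using (F.mem_ins p s).2 hs
lemma ini_ne {p s} (h : F.outs p = []) : F.ini s ≠ p := fun hs => by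
  simpa [h] using (F.mem_outs p s).2 hs
lemma ter_ne {p s} (h : F.ins p = []) : F.ter s ≠ p := fun hs => by
  simpa [h] using (F.mem_ins p s).2 hs

lemma Base.ins {a b} (h : F.Base a b) : F.ins a = [] := (F.mem_sources a).1 (of_mem_zip h).1

lemma Base.outs {a b} (h : F.Base a b) : F.outs b = [] := (F.mem_sinks b).1 (of_mem_zip h).2

lemma Base.right {a b b'} (h : F.Base a b) (h' : F.Base a b') : b = b' := by
  obtain ⟨i, hi, he⟩ := mem_iff_getElem.1 h
  obtain ⟨j, hj, he'⟩ := mem_iff_getElem.1 h'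
  simp only [getElem_zip, Prod.mk.injEq] at he he'
  have := (F.sources_nodup.getElem_inj_iff).1 (he.1.trans he'.1.symm)
  subst this
  exact he.2.symm.trans he'.2

lemma Base.left {a a' b} (h : F.Base a b) (h' : F.Base a' b) : a = a' := by
  obtain ⟨i, hi, he⟩ := mem_iff_getElem.1 h
  obtain ⟨j, hj, he'⟩ := mem_iff_getElem.1 h'
  simp only [getElem_zip, Prod.mk.injEq] at he he'
  have := (F.sinks_nodup.getElem_inj_iff).1 (he.2.trans he'.2.symm)
  subst this
  exact he.1.symm.trans he'.1

/-- The diagram can be closed. -/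
def Closed (F : StrandDiagram Γ) : Prop := F.domain = F.range

lemma Closed.length_eq (h : F.Closed) : F.sources.length = F.sinks.length := by
  simpa [domain, range] using congrArg List.length h

lemma Closed.exists_sink (h : F.Closed) {a} (ha : F.ins a = []) : ∃ b, F.Base a b := by
  obtain ⟨i, hi, he⟩ := mem_iff_getElem.1 ((F.mem_sources a).2 ha)
  refine ⟨F.sinks[i]'(h.length_eq ▸ hi), mem_iff_getElem.2 ⟨i, ?_, ?_⟩⟩
  · simp [hi, ← h.length_eq]
  · simp [he]

lemma Closed.exists_source (h : F.Closed) {b} (hb : F.outs b = []) : ∃ a, F.Base a b := by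
  obtain ⟨i, hi, he⟩ := mem_iff_getElem.1 ((F.mem_sinks b).2 hb)
  refine ⟨F.sources[i]'(h.length_eq ▸ hi), mem_iff_getElem.2 ⟨i, ?_, ?_⟩⟩
  · simp [hi, h.length_eq]
  · simp [he]

lemma Closed.base_col (h : F.Closed) {a b} (hb : F.Base a b) : F.pcol a = F.pcol b := by
  obtain ⟨i, hi, he⟩ := mem_iff_getElem.1 hb
  simp only [getElem_zip, Prod.mk.injEq] at he
  have := congrArg (fun l => l[i]?) h
  simp only [domain, range, getElem?_map] at this
  simp only [length_zip, lt_min_iff] at hi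
  rw [getElem?_eq_getElem hi.1, getElem?_eq_getElem hi.2, he.1, he.2] at this
  simpa using this

variable (F)

open Classical in
/-- The source corresponding to a sink. -/
noncomputable def sourceOf (b : F.Point) : F.Point := if h : ∃ a, F.Base a b then h.choose else b

variable {F}

lemma Base.sourceOf {a b} (h : F.Base a b) : F.sourceOf b = a := by
  have hh : ∃ a, F.Base a b := ⟨a, h⟩
  unfold StrandDiagram.sourceOf
  rw [dif_pos hh]
  exact hh.choose_spec.left h

variable (F)

/-- The strands of the lifted closed diagram: the strand `inr a` leads to the source `a`. -/
inductive Gen : (F.Strand ⊕ F.Point) × ℤ → (F.Strand ⊕ F.Point) × ℤ → Prop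
  | src (a s n) : F.ins a = [] → F.outs a = [s] → Gen (.inr a, n) (.inl s, n)
  | snk (a b s n) : F.Base a b → F.ins b = [s] → Gen (.inl s, n) (.inr a, n + 1)
  | deg (p s t n) : F.ins p = [s] → F.outs p = [t] → Gen (.inl s, n) (.inl t, n)

open Classical in
noncomputable def port (p : F.Point) : ℕ → (F.Strand ⊕ F.Point) × ℤ
  | 0 => if F.IsSplit p then (match F.ins p with | [] => (.inr p, 0) | s :: _ => (.inl s, 0))
      else (match F.outs p with | [] => (.inr (F.sourceOf p), 1) | s :: _ => (.inl s, 0))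
  | k + 1 => match (if F.IsSplit p then F.outs p else F.ins p)[k]? with
      | none => (.inr p, 0) | some s => (.inl s, 0)

/-- The net of the closed diagram of `F`. -/
noncomputable abbrev net : Net Γ where
  P := F.Point
  S := F.Strand ⊕ F.Point
  fP := F.finite_point
  fS := inferInstance
  alive := fun p => F.IsSplit p ∨ F.IsMerge p
  split := F.IsSplit
  col := F.pcol
  scol := Sum.elim F.scol F.pcol
  port := F.port
  gen := F.Gen

variable {F}

lemma _root_.StrandGraph.IsSplit.not_merge {p} (h : F.IsSplit p) : ¬ F.IsMerge p := fun h' => by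
  have := h.2; have := h'.1; omega

lemma _root_.StrandGraph.IsSplit.deg {p} (h : F.IsSplit p) : F.net.deg p = (F.outs p).length := by
  have := congrArg List.length (F.split_col p h).1
  simpa [Net.deg] using this.symm

lemma _root_.StrandGraph.IsMerge.deg {p} (h : F.IsMerge p) : F.net.deg p = (F.ins p).length := by
  have := congrArg List.length (F.merge_col p h).1
  simpa [Net.deg] using this.symm

lemma _root_.StrandGraph.IsSplit.port_zero {p} (h : F.IsSplit p) :
    F.port p 0 = match F.ins p with | [] => (.inr p, 0) | s :: _ => (.inl s, 0) := by
  simp [port, h]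

lemma _root_.StrandGraph.IsMerge.port_zero {p} (h : F.IsMerge p) :
    F.port p 0 = match F.outs p with | [] => (.inr (F.sourceOf p), 1) | s :: _ => (.inl s, 0) := by
  have : ¬ F.IsSplit p := fun h' => h'.not_merge h
  simp [port, this]

lemma _root_.StrandGraph.IsSplit.port_succ {p} (h : F.IsSplit p) {k s} (hs : (F.outs p)[k]? = some s) :
    F.port p (k + 1) = (.inl s, 0) := by
  simp [port, h, hs]

lemma _root_.StrandGraph.IsMerge.port_succ {p} (h : F.IsMerge p) {k s} (hs : (F.ins p)[k]? = some s) :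
    F.port p (k + 1) = (.inl s, 0) := by
  have : ¬ F.IsSplit p := fun h' => h'.not_merge h
  simp [port, this, hs]

lemma _root_.StrandGraph.IsSplit.ins_cases {p} (h : F.IsSplit p) : F.ins p = [] ∨ ∃ s, F.ins p = [s] := by
  have := h.1
  rcases hi : F.ins p with _ | ⟨s, _ | ⟨t, l⟩⟩
  · simp
  · simp
  · simp [hi] at this

lemma _root_.StrandGraph.IsMerge.outs_cases {p} (h : F.IsMerge p) : F.outs p = [] ∨ ∃ s, F.outs p = [s] := by
  have := h.1
  rcases hi : F.outs p with _ | ⟨s, _ | ⟨t, l⟩⟩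
  · simp
  · simp
  · simp [hi] at this

/-- The ports at which strands start. -/
lemma Closed.port_start (hF : F.Closed) {p k} (hp : F.net.alive p) (hk : k ≤ F.net.deg p)
    (hs : F.IsSplit p ↔ k ≠ 0) :
    (∃ s, F.port p k = (.inl s, 0) ∧ F.ini s = p ∧ (F.outs p)[k - 1]? = some s) ∨
    (∃ a, F.port p k = (.inr a, 1) ∧ F.Base a p ∧ k = 0) := by
  rcases hp with hp | hp
  · obtain ⟨k, rfl⟩ := Nat.exists_eq_succ_of_ne_zero (hs.1 hp)
    rw [hp.deg] at hk
    have hs := getElem?_eq_getElem hk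
    exact .inl ⟨_, hp.port_succ hs, ini_of_mem (getElem_mem _), hs⟩
  · have h0 : k = 0 := by
      by_contra h0
      exact (hs.2 h0).not_merge hp
    subst h0
    rcases hp.outs_cases with h0 | ⟨s, h0⟩
    · obtain ⟨a, ha⟩ := hF.exists_source h0
      exact .inr ⟨a, by rw [hp.port_zero, h0, ha.sourceOf], ha, rfl⟩
    · exact .inl ⟨s, by rw [hp.port_zero, h0], ini_of_eq h0, by simp [h0]⟩

lemma port_end {p k} (hp : F.net.alive p) (hk : k ≤ F.net.deg p) (hs : F.IsSplit p ↔ k = 0) :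
    (∃ s, F.port p k = (.inl s, 0) ∧ F.ter s = p ∧ (F.ins p)[k - 1]? = some s) ∨
    (F.port p k = (.inr p, 0) ∧ F.ins p = [] ∧ k = 0) := by
  rcases hp with hp | hp
  · have h0 := hs.1 hp
    subst h0
    rcases hp.ins_cases with h0 | ⟨s, h0⟩
    · exact .inr ⟨by rw [hp.port_zero, h0], h0, rfl⟩
    · exact .inl ⟨s, by rw [hp.port_zero, h0], ter_of_eq h0, by simp [h0]⟩
  · have h0 : k ≠ 0 := fun h0 => (hs.2 h0).not_merge hp
    obtain ⟨k, rfl⟩ := Nat.exists_eq_succ_of_ne_zero h0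
    rw [hp.deg] at hk
    have hs := getElem?_eq_getElem hk
    exact .inl ⟨_, hp.port_succ hs, ter_of_mem (getElem_mem _), hs⟩

lemma alive_iff {p} : F.net.alive p ↔ 2 ≤ (F.ins p).length ∨ 2 ≤ (F.outs p).length := by
  show (_ ∨ _) ↔ _
  constructor
  · rintro (h | h)
    exacts [Or.inr h.2, .inl h.2]
  · have := F.types p
    unfold StrandGraph.IsUnivalentSource StrandGraph.IsUnivalentSink StrandGraph.IsDegenerate at this
    rintro (h | h)
    · rcases this with h' | h' | h' | h' | h'
      · simp [h'.1] at h
      · omega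
      exacts [.inl h', .inr h', by omega]
    · rcases this with h' | h' | h' | h' | h'
      · omega
      · simp [h'.1] at h
      exacts [.inl h', .inr h', by omega]

lemma getElem?_inj {α : Type*} {l : List α} (hl : l.Nodup) {i j : ℕ} {x : α} (hi : l[i]? = some x)
    (hj : l[j]? = some x) : i = j := by
  obtain ⟨h1, h2⟩ := List.getElem?_eq_some_iff.1 hi
  obtain ⟨h3, h4⟩ := List.getElem?_eq_some_iff.1 hj
  exact (hl.getElem_inj_iff).1 (h2.trans h4.symm)

lemma mem_of_eq_singleton {α : Type*} {l : List α} {x : α} (h : l = [x]) : x ∈ l := by simp [h]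

lemma Gen.start_not {p s n x} (hp : F.net.alive p) (hs : F.ini s = p) : ¬ F.Gen x (.inl s, n) := by
  rintro (⟨a, s, n, h1, h2⟩ | _ | ⟨q, t, s, n, h1, h2⟩)
  · obtain rfl := (ini_of_eq h2).symm.trans hs
    rw [alive_iff, h1, h2] at hp; simp at hp
  · obtain rfl := (ini_of_eq h2).symm.trans hs
    rw [alive_iff, h1, h2] at hp; simp at hp

lemma Gen.end_not {p s n x} (hp : F.net.alive p) (hs : F.ter s = p) : ¬ F.Gen (.inl s, n) x := by
  rintro (_ | ⟨a, b, s, n, h1, h2⟩ | ⟨q, s, t, n, h1, h2⟩)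
  · obtain rfl := (ter_of_eq h2).symm.trans hs
    rw [alive_iff, h1.outs, h2] at hp; simp at hp
  · obtain rfl := (ter_of_eq h1).symm.trans hs
    rw [alive_iff, h1, h2] at hp; simp at hp

lemma Closed.wf (hF : F.Closed) : F.net.WF where
  gen_sh := by
    rintro n _ _ (⟨a, s, m, h1, h2⟩ | ⟨a, b, s, m, h1, h2⟩ | ⟨p, s, t, m, h1, h2⟩)
    · exact .src a s _ h1 h2
    · rw [sh_mk, sh_mk, add_right_comm]; exact .snk a b s _ h1 h2
    · exact .deg p s t _ h1 h2
  gen_right := by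
    rintro _ _ _ (⟨a, s, m, h1, h2⟩ | ⟨a, b, s, m, h1, h2⟩ | ⟨p, s, t, m, h1, h2⟩) h
    · rcases h with ⟨_, s', _, h1', h2'⟩ | _ | _
      rw [h2] at h2'; simp_all
    · rcases h with _ | ⟨a', b', _, _, h1', h2'⟩ | ⟨p', _, t', _, h1', h2'⟩
      · obtain rfl := (ter_of_eq h2).symm.trans
          (ter_of_eq h2')
        rw [h1.left h1']
      · obtain rfl := (ter_of_eq h2).symm.trans
          (ter_of_eq h1')
        simp [h1.outs] at h2'
    · rcases h with _ | ⟨a', b', _, _, h1', h2'⟩ | ⟨p', _, t', _, h1', h2'⟩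
      · obtain rfl := (ter_of_eq h1).symm.trans
          (ter_of_eq h2')
        simp [h1'.outs] at h2
      · obtain rfl := (ter_of_eq h1).symm.trans
          (ter_of_eq h1')
        rw [h2] at h2'; simp_all
  gen_left := by
    rintro _ _ _ (⟨a, s, m, h1, h2⟩ | ⟨a, b, s, m, h1, h2⟩ | ⟨p, s, t, m, h1, h2⟩) h
    · rcases h with ⟨a', _, _, h1', h2'⟩ | _ | ⟨p', s', _, _, h1', h2'⟩
      · obtain rfl := (ini_of_eq h2).symm.trans
          (ini_of_eq h2')
        rfl
      · obtain rfl := (ini_of_eq h2).symm.trans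
          (ini_of_eq h2')
        simp [h1] at h1'
    · generalize hz : m + 1 = z at h
      rcases h with _ | ⟨_, b', s', m', h1', h2'⟩ | _
      obtain rfl := h1.right h1'
      rw [h2] at h2'
      simp_all
    · rcases h with ⟨a', _, _, h1', h2'⟩ | _ | ⟨p', s', _, _, h1', h2'⟩
      · obtain rfl := (ini_of_eq h2).symm.trans
          (ini_of_eq h2')
        simp [h1] at h1'
      · obtain rfl := (ini_of_eq h2).symm.trans
          (ini_of_eq h2')
        rw [h1] at h1'; simp_all
  gen_col := by
    rintro _ _ (⟨a, s, m, h1, h2⟩ | ⟨a, b, s, m, h1, h2⟩ | ⟨p, s, t, m, h1, h2⟩)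
    · exact (F.univalentSource_col a ⟨h1, by simp [h2]⟩ s (by simp [h2])).symm
    · exact (F.univalentSink_col b ⟨h1.outs, by simp [h2]⟩ s (by simp [h2])).trans
        (hF.base_col h1).symm
    · have := F.degenerate_col p ⟨by simp [h1], by simp [h2]⟩
      exact (this.1 s (by simp [h1])).trans (this.2.1 t (by simp [h2])).symm
  deg_ge := by
    rintro p (hp | hp)
    · rw [hp.deg]; exact hp.2
    · rw [hp.deg]; exact hp.2
  col_zero := by
    rintro p (hp | hp)
    · show Sum.elim _ _ (F.port p 0).1 = _
      rw [hp.port_zero]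
      rcases hp.ins_cases with h0 | ⟨s, h0⟩ <;> rw [h0]
      · rfl
      · exact (F.split_col p hp).2 s (by simp [h0])
    · show Sum.elim _ _ (F.port p 0).1 = _
      rw [hp.port_zero]
      rcases hp.outs_cases with h0 | ⟨s, h0⟩ <;> rw [h0]
      · obtain ⟨a, ha⟩ := hF.exists_source h0
        rw [ha.sourceOf]
        exact hF.base_col ha
      · exact (F.merge_col p hp).2 s (by simp [h0])
  col_succ := by
    rintro p (hp | hp) k hk
    · rw [hp.deg] at hk
      show _ = some (Sum.elim _ _ (F.port p (k + 1)).1)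
      rw [hp.port_succ (getElem?_eq_getElem hk), ← (F.split_col p hp).1]
      simp [hk]
    · rw [hp.deg] at hk
      show _ = some (Sum.elim _ _ (F.port p (k + 1)).1)
      rw [hp.port_succ (getElem?_eq_getElem hk), ← (F.merge_col p hp).1]
      simp [hk]
  start_gen := by
    intro p k x n hp hk hs
    rcases hF.port_start hp hk hs with ⟨s, h1, h2, _⟩ | ⟨a, h1, h2, h3⟩
    · show ¬ F.Gen x (sh n (F.port p k))
      rw [h1]; exact Gen.start_not hp h2
    · show ¬ F.Gen x (sh n (F.port p k))
      rw [h1]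
      rw [sh_mk]
      generalize 1 + n = z
      rintro (_ | ⟨_, b, s, m, h1', h2'⟩ | _)
      obtain rfl := h1'.right h2
      rw [alive_iff, h2.outs, h2'] at hp
      simp at hp
  start_inj := by
    intro p k q l hp hk hs hq hl hs' he
    have he' : (F.port p k).1 = (F.port q l).1 := he
    rcases hF.port_start hp hk hs with ⟨s, h1, h2, h3⟩ | ⟨a, h1, h2, h3⟩ <;>
    rcases hF.port_start hq hl hs' with ⟨s', h1', h2', h3'⟩ | ⟨a', h1', h2', h3'⟩ <;> rw [h1, h1'] at he'
    · obtain rfl := Sum.inl.inj he'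
      obtain rfl := h2.symm.trans h2'
      refine ⟨rfl, ?_⟩
      have := getElem?_inj (F.outs_nodup p) h3 h3'
      by_cases hh : F.IsSplit p
      · have := hs.1 hh; have := hs'.1 hh; omega
      · have : k = 0 := by_contra fun h => hh (hs.2 h)
        have : l = 0 := by_contra fun h => hh (hs'.2 h)
        omega
    · simp at he'
    · simp at he'
    · obtain rfl := Sum.inr.inj he'
      exact ⟨h2.right h2', h3.trans h3'.symm⟩
  end_gen := by
    intro p k x n hp hk hs
    rcases port_end hp hk hs with ⟨s, h1, h2, _⟩ | ⟨h1, h2, h3⟩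
    · show ¬ F.Gen (sh n (F.port p k)) x
      rw [h1]; exact Gen.end_not hp h2
    · show ¬ F.Gen (sh n (F.port p k)) x
      rw [h1]
      rintro (⟨_, s, m, h1', h2'⟩ | _ | _)
      rw [alive_iff, h2, h2'] at hp
      simp at hp
  end_inj := by
    intro p k q l hp hk hs hq hl hs' he
    have he' : (F.port p k).1 = (F.port q l).1 := he
    rcases port_end hp hk hs with ⟨s, h1, h2, h3⟩ | ⟨h1, h2, h3⟩ <;>
    rcases port_end hq hl hs' with ⟨s', h1', h2', h3'⟩ | ⟨h1', h2', h3'⟩ <;> rw [h1, h1'] at he'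
    · obtain rfl := Sum.inl.inj he'
      obtain rfl := h2.symm.trans h2'
      refine ⟨rfl, ?_⟩
      have := getElem?_inj (F.ins_nodup p) h3 h3'
      by_cases hh : F.IsSplit p
      · have := hs.1 hh; have := hs'.1 hh; omega
      · have : k ≠ 0 := fun h => hh (hs.2 h)
        have : l ≠ 0 := fun h => hh (hs'.2 h)
        omega
    · simp at he'
    · simp at he'
    · exact ⟨Sum.inr.inj he', h3.trans h3'.symm⟩

variable {F F' : StrandDiagram Γ}

lemma exists_height (F : StrandDiagram Γ) : ∃ h : F.Point → ℕ, ∀ s, h (F.ini s) < h (F.ter s) := by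
  refine ⟨fun p => {q | TransGen F.Step q p}.ncard, fun s => ?_⟩
  have hs : F.Step (F.ini s) (F.ter s) := ⟨s, rfl, rfl⟩
  refine Set.ncard_lt_ncard ⟨fun q hq => TransGen.tail hq hs, fun hh => ?_⟩ (Set.toFinite _)
  exact F.acyclic _ (hh (TransGen.single hs))

lemma ini_ne_ter (s : F.Strand) : F.ini s ≠ F.ter s := by
  obtain ⟨h, hh⟩ := F.exists_height
  exact fun e => (hh s).ne (congrArg h e)

lemma no_two_cycle {s t : F.Strand} (h₁ : F.ter s = F.ini t) : F.ter t ≠ F.ini s := by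
  obtain ⟨h, hh⟩ := F.exists_height
  intro e
  have a := hh s; have b := hh t
  rw [h₁] at a; rw [e] at b
  omega

lemma Base.ne {a b} (h : F.Base a b) : a ≠ b := by
  rintro rfl
  have h1 := h.ins; have h2 := h.outs
  have := F.types a
  simp [StrandGraph.IsUnivalentSource, StrandGraph.IsUnivalentSink, StrandGraph.IsSplit,
    StrandGraph.IsMerge, StrandGraph.IsDegenerate, h1, h2] at this

lemma outs_ne_nil_of_ins {a} (h : F.ins a = []) : F.outs a ≠ [] := by
  intro h2
  have := F.types a
  simp [StrandGraph.IsUnivalentSource, StrandGraph.IsUnivalentSink, StrandGraph.IsSplit,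
    StrandGraph.IsMerge, StrandGraph.IsDegenerate, h, h2] at this

lemma _root_.StrandGraph.IsSplit.outs_ne {p} (h : F.IsSplit p) : F.outs p ≠ [] := fun h' => by
  have := h.2; simp [h'] at this

lemma _root_.StrandGraph.IsMerge.ins_ne {p} (h : F.IsMerge p) : F.ins p ≠ [] := fun h' => by
  have := h.2; simp [h'] at this

lemma not_alive_of {p s} (h : F.ins p = [] ∧ F.outs p = [s] ∨ F.ins p = [s] ∧ F.outs p = []) :
    ¬ F.net.alive p := by
  rw [alive_iff]
  rcases h with h | h <;> simp [h.1, h.2]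

section Carries
variable {K : Set F.Point} {φ : F.Point → F'.Point} {π : F.Strand → F'.Strand}
  (h : F.Carries F' K φ π)
include h

lemma Carries.isSplit {p} (hp : p ∈ K) : F'.IsSplit (φ p) ↔ F.IsSplit p := by
  unfold StrandGraph.IsSplit; rw [h.outs p hp, h.ins p hp]; simp

lemma Carries.isMerge {p} (hp : p ∈ K) : F'.IsMerge (φ p) ↔ F.IsMerge p := by
  unfold StrandGraph.IsMerge; rw [h.outs p hp, h.ins p hp]; simp

lemma Carries.alive {p} (hp : p ∈ K) : F'.net.alive (φ p) ↔ F.net.alive p :=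
  or_congr (h.isSplit hp) (h.isMerge hp)

lemma Carries.ini {s} (hs : F.ini s ∈ K) : F'.ini (π s) = φ (F.ini s) := by
  apply ini_of_mem
  rw [h.outs _ hs]
  exact mem_map_of_mem (mem_outs_ini s)

lemma Carries.ter {s} (hs : F.ter s ∈ K) : F'.ter (π s) = φ (F.ter s) := by
  apply ter_of_mem
  rw [h.ins _ hs]
  exact mem_map_of_mem (mem_ins_ter s)

lemma Carries.inj {s t} (hs : F.ini s ∈ K) (ht : F.ini t ∈ K) (he : π s = π t) : s = t := by
  have h1 := h.ini hs
  rw [he, h.ini ht] at h1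
  have h2 := h.injOn ht hs h1
  have h3 := F'.outs_nodup (φ (F.ini s))
  rw [h.outs _ hs] at h3
  exact List.inj_on_of_nodup_map h3 (mem_outs_ini s) (h2 ▸ mem_outs_ini t) he

lemma Carries.scol {s} (hs : F.ini s ∈ K ∨ F.ter s ∈ K) : F'.scol (π s) = F.scol s := by
  rcases hs with hs | hs
  · exact h.scol_outs _ hs s (mem_outs_ini s)
  · exact h.scol_ins _ hs s (mem_ins_ter s)

lemma Carries.outs_singleton {p s'} (hp : p ∈ K) (hs : F'.outs (φ p) = [s']) :
    ∃ s, F.outs p = [s] ∧ π s = s' := by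
  rw [h.outs p hp] at hs
  rcases hl : F.outs p with _ | ⟨s, _ | ⟨u, l⟩⟩ <;> simp [hl] at hs
  exact ⟨s, rfl, hs⟩

lemma Carries.ins_singleton {p s'} (hp : p ∈ K) (hs : F'.ins (φ p) = [s']) :
    ∃ s, F.ins p = [s] ∧ π s = s' := by
  rw [h.ins p hp] at hs
  rcases hl : F.ins p with _ | ⟨s, _ | ⟨u, l⟩⟩ <;> simp [hl] at hs
  exact ⟨s, rfl, hs⟩

lemma Carries.ins_eq_nil {p} (hp : p ∈ K) : F'.ins (φ p) = [] ↔ F.ins p = [] := by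
  rw [h.ins p hp]; simp

lemma Carries.outs_eq {p s} (hp : p ∈ K) (hs : F.outs p = [s]) : F'.outs (φ p) = [π s] := by
  rw [h.outs p hp, hs]; rfl

lemma Carries.ins_eq {p s} (hp : p ∈ K) (hs : F.ins p = [s]) : F'.ins (φ p) = [π s] := by
  rw [h.ins p hp, hs]; rfl

lemma Carries.port {p} (hp : p ∈ K) (hF : F.Closed) (ha : F.net.alive p) {k}
    (hk : k ≤ F.net.deg p) {ρ : (F.Strand ⊕ F.Point) × ℤ → (F'.Strand ⊕ F'.Point) × ℤ → Prop}
    (h1 : ∀ s, F.ini s = p ∨ F.ter s = p → ρ (.inl s, 0) (.inl (π s), 0))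
    (h2 : F.ins p = [] → ρ (.inr p, 0) (.inr (φ p), 0))
    (h3 : ∀ a, F.Base a p → ∃ a', F'.Base a' (φ p) ∧ ρ (.inr a, 1) (.inr a', 1)) :
    ρ (F.port p k) (F'.port (φ p) k) := by
  rcases ha with ha | ha
  · have ha' := (h.isSplit hp).2 ha
    rcases k with _ | k
    · rw [ha.port_zero, ha'.port_zero, h.ins p hp]
      rcases ha.ins_cases with h0 | ⟨s, h0⟩ <;> rw [h0]
      · exact h2 h0
      · exact h1 s (.inr (ter_of_eq h0))
    · rw [ha.deg] at hk
      rw [ha.port_succ (getElem?_eq_getElem hk), ha'.port_succ (s := π (F.outs p)[k])]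
      · exact h1 _ (.inl (ini_of_mem (getElem_mem _)))
      · rw [h.outs p hp, getElem?_map, getElem?_eq_getElem hk]; rfl
  · have ha' := (h.isMerge hp).2 ha
    rcases k with _ | k
    · rw [ha.port_zero, ha'.port_zero, h.outs p hp]
      rcases ha.outs_cases with h0 | ⟨s, h0⟩ <;> rw [h0]
      · obtain ⟨a, hb⟩ := hF.exists_source h0
        obtain ⟨a', hb', hr⟩ := h3 a hb
        simpa [hb.sourceOf, hb'.sourceOf] using hr
      · exact h1 s (.inl (ini_of_eq h0))
    · rw [ha.deg] at hk
      rw [ha.port_succ (getElem?_eq_getElem hk), ha'.port_succ (s := π (F.ins p)[k])]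
      · exact h1 _ (.inr (ter_of_mem (getElem_mem _)))
      · rw [h.ins p hp, getElem?_map, getElem?_eq_getElem hk]; rfl

end Carries

lemma Gen.src' {a s} (n) (h1 : F.ins a = []) (h2 : F.outs a = [s]) :
    F.net.Rel (.inr a, n) (.inl s, n) := EqvGen.rel _ _ (.src a s n h1 h2)
lemma Gen.snk' {a b s} (n) (h1 : F.Base a b) (h2 : F.ins b = [s]) :
    F.net.Rel (.inl s, n) (.inr a, n + 1) := EqvGen.rel _ _ (.snk a b s n h1 h2)
lemma Gen.deg' {p s t} (n) (h1 : F.ins p = [s]) (h2 : F.outs p = [t]) :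
    F.net.Rel (.inl s, n) (.inl t, n) := EqvGen.rel _ _ (.deg p s t n h1 h2)

/-- The virtual strand leading to a point that is not a source is isolated. -/
lemma Closed.isolated {a : F.Point} (ha : F.ins a ≠ []) (y) :
    ¬ F.Gen (.inr a, 0) y ∧ ¬ F.Gen y (.inr a, 0) := by
  refine ⟨?_, ?_⟩
  · rintro (⟨_, _, _, h, _⟩ | _ | _); exact ha h
  · generalize (0 : ℤ) = z
    rintro (_ | ⟨_, _, _, _, h, _⟩ | _); exact ha h.ins

/-- Base points of a diagram whose base line is the image of the base line of another. -/
lemma base_map {φ : F.Point → F'.Point} (h1 : F'.sources = F.sources.map φ)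
    (h2 : F'.sinks = F.sinks.map φ) (x y) :
    F'.Base x y ↔ ∃ a b, F.Base a b ∧ φ a = x ∧ φ b = y := by
  unfold Base
  rw [h1, h2, zip_map, mem_map]
  simp [Prod.ext_iff]

/-- The correspondence given by maps of strands and of points. -/
inductive MapRel (φ : F.Point → F'.Point) (π : F.Strand → F'.Strand) (S : F.Strand → Prop) :
    (F.Strand ⊕ F.Point) × ℤ → (F'.Strand ⊕ F'.Point) × ℤ → Prop
  | strand (s n) : S s → MapRel φ π S (.inl s, n) (.inl (π s), n)
  | source (a n) : F.ins a = [] → MapRel φ π S (.inr a, n) (.inr (φ a), n)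

lemma MapRel.sh {φ : F.Point → F'.Point} {π : F.Strand → F'.Strand} {S} (n x x')
    (h : MapRel φ π S x x') : MapRel φ π S (sh n x) (sh n x') := by
  rcases h with ⟨s, m, h⟩ | ⟨a, m, h⟩
  exacts [.strand _ _ h, .source _ _ h]

lemma MapRel.eq_strand {φ : F.Point → F'.Point} {π : F.Strand → F'.Strand} {S x t n}
    (h : MapRel φ π S x (.inl t, n)) : ∃ s, x = (.inl s, n) ∧ S s ∧ π s = t := by
  generalize hz : (Sum.inl t, n) = z at h
  rcases h with ⟨s, m, hs⟩ | _ <;> simp only [Prod.mk.injEq, Sum.inl.injEq, reduceCtorEq, false_and] at hz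
  obtain ⟨rfl, rfl⟩ := hz
  exact ⟨s, rfl, hs, rfl⟩

lemma MapRel.eq_source {φ : F.Point → F'.Point} {π : F.Strand → F'.Strand} {S x c n}
    (h : MapRel φ π S x (.inr c, n)) : ∃ a, x = (.inr a, n) ∧ F.ins a = [] ∧ φ a = c := by
  generalize hz : (Sum.inr c, n) = z at h
  rcases h with _ | ⟨a, m, ha⟩ <;> simp only [Prod.mk.injEq, Sum.inr.injEq, reduceCtorEq, false_and] at hz
  obtain ⟨rfl, rfl⟩ := hz
  exact ⟨a, rfl, ha, rfl⟩

/-- The net of a diagram with other living points and another gluing. -/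
noncomputable abbrev netWith (F : StrandDiagram Γ) (al : F.Point → Prop)
    (g : (F.Strand ⊕ F.Point) × ℤ → (F.Strand ⊕ F.Point) × ℤ → Prop) : Net Γ :=
  { F.net with alive := al, gen := g }

/-- A diagram all of whose points are carried over from `K` has the net of the original diagram with
the other points removed and with strands of equal image glued. -/
lemma Carries.iso {K : Set F.Point} {φ : F.Point → F'.Point} {π : F.Strand → F'.Strand}
    (hC : F.Carries F' K φ π) (hF : F.Closed) (hF' : F'.Closed) {S : F.Strand → Prop}
    {al : F.Point → Prop} {g : (F.Strand ⊕ F.Point) × ℤ → (F.Strand ⊕ F.Point) × ℤ → Prop}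
    (hN : (F.netWith al g).WF)
    (hB : ∀ x y, F'.Base x y ↔ ∃ a b, F.Base a b ∧ φ a = x ∧ φ b = y) (hφ : φ '' K = Set.univ)
    (hal : ∀ p, al p ↔ F.net.alive p ∧ p ∈ K) (hS : ∀ p ∈ K, ∀ s, F.ini s = p ∨ F.ter s = p → S s)
    (hsrc : ∀ {a}, F.ins a = [] → a ∈ K) (hsnk : ∀ {b}, F.outs b = [] → b ∈ K)
    (hcol : ∀ s, S s → F.ini s ∈ K ∨ F.ter s ∈ K)
    (hrep : ∀ s n, S s → ∃ r, EqvGen g (.inl s, n) (.inl r, n) ∧ π r = π s ∧ F.ini r ∈ K)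
    (hg : ∀ x y, F.Gen x y → g x y) (hg' : ∀ x y, g x y → F.Gen x y ∨
      ∃ s t n, x = (.inl s, n) ∧ y = (.inl t, n) ∧ S s ∧ S t ∧ π s = π t)
    (hdeg : ∀ p s t, F.ins p = [s] → F.outs p = [t] → p ∈ K ∨ S s ∧ S t ∧ π s = π t)
    (hnS : ∀ s, ¬ S s → ∀ y, ¬ F.Gen (.inl s, 0) y ∧ ¬ F.Gen y (.inl s, 0)) :
    (F.netWith al g).Iso F'.net φ fun _ => 0 := by
  have hsurj : ∀ p', ∃ p ∈ K, φ p = p' := fun p' => (hφ ▸ trivial : p' ∈ φ '' K)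
  have hρ : (F.netWith al g).Corr F'.net (MapRel φ π S) := by
    refine ⟨MapRel.sh, ?_, ?_, ?_, ?_, ?_⟩
    · rintro _ _ _ (⟨s, n⟩ | ⟨a, n⟩) (_ | _) <;> exact .refl _
    · rintro x y ⟨s | c, n⟩ h1 h2
      · obtain ⟨s, rfl, hs, h3⟩ := h1.eq_strand
        obtain ⟨t, rfl, ht, h4⟩ := h2.eq_strand
        obtain ⟨r, h5, h6, h7⟩ := hrep s n hs
        obtain ⟨r', h8, h9, h10⟩ := hrep t n ht
        obtain rfl := hC.inj h7 h10 (by rw [h6, h9, h3, h4])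
        exact Net.Rel.trans h5 (Net.Rel.symm h8)
      · obtain ⟨a, rfl, ha, h3⟩ := h1.eq_source
        obtain ⟨b, rfl, hb, h4⟩ := h2.eq_source
        rw [hC.injOn (hsrc ha) (hsrc hb) (h3.trans h4.symm)]
        exact .refl _
    · intro x y h
      rcases hg' x y h with (⟨a, s, m, h1, h2⟩ | ⟨a, b, s, m, h1, h2⟩ | ⟨p, s, t, m, h1, h2⟩) |
        ⟨s, t, m, rfl, rfl, h1, h2, h3⟩
      · have ha := hsrc h1
        exact ⟨_, _, .source _ _ h1, .strand _ _ (hS a ha _ (.inl (ini_of_eq h2))),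
          Gen.src' _ ((hC.ins_eq_nil ha).2 h1) (hC.outs_eq ha h2)⟩
      · have hb := hsnk h1.outs
        exact ⟨_, _, .strand _ _ (hS b hb _ (.inr (ter_of_eq h2))), .source _ _ h1.ins,
          Gen.snk' _ ((hB _ _).2 ⟨a, b, h1, rfl, rfl⟩) (hC.ins_eq hb h2)⟩
      · rcases hdeg p s t h1 h2 with hp | ⟨h3, h4, h5⟩
        · exact ⟨_, _, .strand _ _ (hS p hp _ (.inr (ter_of_eq h1))),
            .strand _ _ (hS p hp _ (.inl (ini_of_eq h2))),
            Gen.deg' _ (hC.ins_eq hp h1) (hC.outs_eq hp h2)⟩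
        · exact ⟨_, _, .strand _ _ h3, .strand _ _ h4, h5 ▸ .refl _⟩
      · exact ⟨_, _, .strand _ _ h1, .strand _ _ h2, h3 ▸ .refl _⟩
    · rintro _ _ (⟨a, s, m, h1, h2⟩ | ⟨a, b, s, m, h1, h2⟩ | ⟨p, s, t, m, h1, h2⟩)
      · obtain ⟨a, ha, rfl⟩ := hsurj a
        obtain ⟨s, g2, rfl⟩ := hC.outs_singleton ha h2
        have g1 := (hC.ins_eq_nil ha).1 h1
        exact ⟨(.inr a, m), (.inl s, m), .source _ _ g1, .strand _ _ (hS a ha _ (.inl (ini_of_eq g2))),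
          EqvGen.rel _ _ (hg _ _ (.src a s m g1 g2))⟩
      · obtain ⟨a, b, g1, rfl, rfl⟩ := (hB _ _).1 h1
        obtain ⟨s, g2, rfl⟩ := hC.ins_singleton (hsnk g1.outs) h2
        exact ⟨(.inl s, m), (.inr a, m + 1), .strand _ _ (hS b (hsnk g1.outs) _ (.inr (ter_of_eq g2))),
          .source _ _ g1.ins, EqvGen.rel _ _ (hg _ _ (.snk a b s m g1 g2))⟩
      · obtain ⟨p, hp, rfl⟩ := hsurj p
        obtain ⟨s, g1, rfl⟩ := hC.ins_singleton hp h1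
        obtain ⟨t, g2, rfl⟩ := hC.outs_singleton hp h2
        exact ⟨(.inl s, m), (.inl t, m), .strand _ _ (hS p hp _ (.inr (ter_of_eq g1))),
          .strand _ _ (hS p hp _ (.inl (ini_of_eq g2))), EqvGen.rel _ _ (hg _ _ (.deg p s t m g1 g2))⟩
    · rintro _ _ (⟨s, n, hs⟩ | ⟨a, n, ha⟩)
      · exact (hC.scol (hcol s hs)).symm
      · exact (hC.pcol a (hsrc ha)).symm
  have hK : ∀ {p}, al p → F.net.alive p ∧ p ∈ K := (hal _).1
  refine hρ.iso hN hF'.wf ⟨fun p hp => (hC.alive (hK hp).2).2 (hK hp).1,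
    fun p hp q hq => hC.injOn (hK hp).2 (hK hq).2, fun p' hp' => ?_⟩ (fun p hp => hC.isSplit (hK hp).2)
    (fun p hp => hC.pcol p (hK hp).2) (fun p k hp hk => ?_) ?_ ?_
  · obtain ⟨p, hp, rfl⟩ := hsurj p'
    exact ⟨p, (hal p).2 ⟨(hC.alive hp).1 hp', hp⟩, rfl⟩
  · rw [sh_zero]
    exact hC.port (hK hp).2 hF (hK hp).1 hk (fun s hs => .strand _ _ (hS p (hK hp).2 s hs))
      (fun h => .source _ _ h) (fun a ha => ⟨φ a, (hB _ _).2 ⟨a, p, ha, rfl, rfl⟩, .source _ _ ha.ins⟩)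
  · rintro (s | a)
    · by_cases hs : S s
      · exact .inl ⟨_, .strand _ _ hs⟩
      · refine .inr fun y => ⟨fun h => ?_, fun h => ?_⟩ <;>
          rcases hg' _ _ h with h | ⟨u, v, m, h1, h2, h3, h4, -⟩
        · exact (hnS s hs y).1 h
        · cases h1; exact hs h3
        · exact (hnS s hs y).2 h
        · cases h2; exact hs h4
    · by_cases ha : F.ins a = []
      · exact .inl ⟨_, .source _ _ ha⟩
      · refine .inr fun y => ⟨fun h => ?_, fun h => ?_⟩ <;> rcases hg' _ _ h with h | ⟨u, v, m, h1, h2, -⟩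
        · exact (Closed.isolated ha y).1 h
        · cases h1
        · exact (Closed.isolated ha y).2 h
        · cases h2
  · rintro (s' | a')
    · obtain ⟨p, hp, he⟩ := hsurj (F'.ini s')
      have := mem_outs_ini s'
      rw [← he, hC.outs p hp, mem_map] at this
      obtain ⟨s, hs, rfl⟩ := this
      exact .inl ⟨_, .strand s 0 (hS p hp s (.inl (ini_of_mem hs)))⟩
    · by_cases ha : F'.ins a' = []
      · obtain ⟨a, hp, rfl⟩ := hsurj a'
        exact .inl ⟨_, .source _ _ ((hC.ins_eq_nil hp).1 ha)⟩
      · exact .inr (Closed.isolated ha)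

lemma BaseLinePermutation.iso (hF : F.Closed) (hF' : F'.Closed) {φ : F.Point → F'.Point}
    {π : F.Strand → F'.Strand} (hC : F.Carries F' Set.univ φ π) (hφ : Function.Bijective φ)
    (hp : (F'.sources.zip F'.sinks).Perm ((F.sources.map φ).zip (F.sinks.map φ))) :
    F.net.Iso F'.net φ (fun _ => 0) := by
  have hB : ∀ x y, F'.Base x y ↔ ∃ a b, F.Base a b ∧ φ a = x ∧ φ b = y := by
    intro x y
    unfold Base
    rw [hp.mem_iff, zip_map, mem_map]
    simp [Prod.ext_iff]
  exact hC.iso (S := fun _ => True) (al := F.net.alive) (g := F.Gen) hF hF' hF.wf hB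
    (Set.image_univ_of_surjective hφ.2) (by simp) (by simp) (by simp) (by simp) (by simp)
    (fun s n _ => ⟨s, .refl _, rfl, trivial⟩) (fun _ _ h => h) (fun _ _ => .inl) (by simp) (by simp)

lemma Reduction0.iso (hF : F.Closed) (hF' : F'.Closed) (h : F.Reduction0 F') :
    ∃ e f, F.net.Iso F'.net e f := by
  obtain ⟨v, φ, π, hv, hC, hvπ, hφ, hso, hsi⟩ := h
  obtain ⟨s₀, hs₀⟩ := length_eq_one_iff.1 hv.1
  obtain ⟨t₀, ht₀⟩ := length_eq_one_iff.1 hv.2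
  have hπ₀ : π s₀ = π t₀ := by simpa [hs₀, ht₀] using hvπ
  refine ⟨φ, fun _ => 0, hC.iso (S := fun _ => True) (al := F.net.alive) (g := F.Gen) hF hF' hF.wf
    (base_map hso hsi) hφ ?_ (by simp) ?_ ?_ ?_ ?_ (fun _ _ h => h) (fun _ _ => .inl) ?_ (by simp)⟩
  · refine fun p => ⟨fun hp => ⟨hp, ?_⟩, And.left⟩
    rintro rfl
    rw [alive_iff, hs₀, ht₀] at hp; simp at hp
  · rintro a ha rfl; simp [hs₀] at ha
  · rintro a ha rfl; simp [ht₀] at ha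
  · intro s _
    by_contra hh
    simp only [Set.mem_compl_iff, Set.mem_singleton_iff, not_or, not_not] at hh
    exact ini_ne_ter s (hh.1.trans hh.2.symm)
  · intro s n _
    by_cases hs : F.ini s = v
    · obtain rfl : s = t₀ := eq_of_ini ht₀ hs
      refine ⟨s₀, (Gen.deg' n hs₀ ht₀).symm, hπ₀, fun h => ini_ne_ter s₀ ?_⟩
      rw [show F.ini s₀ = v from h, ter_of_eq hs₀]
    · exact ⟨s, .refl _, rfl, hs⟩
  · intro p s t h1 h2
    by_cases hp : p = v
    · subst hp
      rw [hs₀] at h1; rw [ht₀] at h2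
      simp only [List.cons.injEq, and_true] at h1 h2
      exact .inr ⟨trivial, trivial, h1 ▸ h2 ▸ hπ₀⟩
    · exact .inl hp

lemma Reduction2.iso (hF : F.Closed) (hF' : F'.Closed) (h : F.Reduction2 F') :
    ∃ N, Net.Red F.net N ∧ ∃ e f, N.Iso F'.net e f := by
  obtain ⟨v, w, s₀, φ, π, hv, hw, hvs, hws, hC, hπ, hφ, hso, hsi⟩ := h
  generalize hKe : ({v, w}ᶜ : Set F.Point) = K at hC hφ
  have hini : F.ini s₀ = v := ini_of_eq hvs
  have hter : F.ter s₀ = w := ter_of_eq hws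
  have hcol : F.pcol w = F.pcol v := by
    rw [← (F.split_col w hw).2 s₀ (by simp [hws]), (F.merge_col v hv).2 s₀ (by simp [hvs])]
  have pw : F.port w 0 = (.inl s₀, 0) := by rw [hw.port_zero, hws]
  have pv : F.port v 0 = (.inl s₀, 0) := by rw [hv.port_zero, hvs]
  have hredex : F.net.Redex w v 0 false :=
    ⟨.inl hw, .inr hv, hw, fun h => h.not_merge hv, hcol, fun k hk hL => by
      have : k = 0 := by simpa [Net.Live] using hL
      subst this
      show F.net.Rel (F.port w 0) (sh 0 (F.port v 0))
      rw [pw, pv, sh_zero]; exact .refl _⟩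
  have hK : ∀ {p}, p ∈ K ↔ p ≠ v ∧ p ≠ w := by simp [← hKe]
  have hv' : ∀ s, F.ini s = v → s = s₀ := fun _ => eq_of_ini hvs
  have hw' : ∀ s, F.ter s = w → s = s₀ := fun _ => eq_of_ter hws
  have hlen : (F.ins v).length = (F.outs w).length := by simpa using congrArg List.length hπ
  have hglue : ∀ k (hk : k < (F.outs w).length) n, (F.net.red w v 0 false).Rel
      (.inl (F.outs w)[k], n) (.inl ((F.ins v)[k]'(hlen ▸ hk)), n) := by
    intro k hk n
    have := hredex.red_rel hF.wf (k := k + 1) (by rw [hw.deg]; exact hk) n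
    simpa only [show F.net.port = F.port from rfl, hw.port_succ (getElem?_eq_getElem hk),
      hv.port_succ (getElem?_eq_getElem (hlen ▸ hk)), sh_mk, zero_add, add_zero] using this
  have hπk : ∀ k (hk : k < (F.outs w).length), π ((F.ins v)[k]'(hlen ▸ hk)) = π (F.outs w)[k] := by
    intro k hk
    have := congrArg (fun l => l[k]?) hπ
    simpa [hk, hlen] using this
  have hrep : ∀ s n, s ≠ s₀ → ∃ r, (F.net.red w v 0 false).Rel (.inl s, n) (.inl r, n) ∧ π r = π s ∧
      F.ini r ∈ K := by
    intro s n hs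
    by_cases hsw : F.ini s = w
    · have := mem_outs_ini s
      rw [hsw] at this
      obtain ⟨k, hk, rfl⟩ := mem_iff_getElem.1 this
      refine ⟨_, hglue k hk n, hπk k hk, hK.2 ⟨fun hh => ?_, fun hh => ?_⟩⟩
      · refine ini_ne_ter ((F.ins v)[k]'(hlen ▸ hk)) ?_
        rw [hh, ter_of_mem (p := v) (getElem_mem _)]
      · refine no_two_cycle (s := s₀) (t := ((F.ins v)[k]'(hlen ▸ hk))) ?_ ?_
        · rw [hh, hter]
        · rw [hini, ter_of_mem (p := v) (getElem_mem _)]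
    · exact ⟨s, .refl _, rfl, hK.2 ⟨fun h => hs (hv' s h), hsw⟩⟩
  refine ⟨_, ⟨w, v, 0, false, hredex, rfl⟩, φ, fun _ => 0, hC.iso (S := fun s => s ≠ s₀) hF hF'
    (hredex.wf hF.wf) (base_map hso hsi) hφ (fun p => ?_) ?_ ?_ ?_ ?_ hrep (fun _ _ => .inl) ?_ ?_ ?_⟩
  · rw [hK]; tauto
  · rintro p hp s hs rfl
    rw [hini, hter] at hs
    rw [hK] at hp
    rcases hs with hs | hs
    exacts [hp.1 hs.symm, hp.2 hs.symm]
  · rintro a ha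
    refine hK.2 ⟨?_, ?_⟩ <;> rintro rfl
    · exact hv.ins_ne ha
    · simp [hws] at ha
  · rintro a ha
    refine hK.2 ⟨?_, ?_⟩ <;> rintro rfl
    · simp [hvs] at ha
    · exact hw.outs_ne ha
  · intro s hs
    by_contra hh
    simp only [hK, not_or, not_and_or, not_not] at hh
    rcases hh.1 with h1 | h1
    · exact hs (hv' s h1)
    · rcases hh.2 with h2 | h2
      · exact no_two_cycle (s := s₀) (t := s) (by rw [hter, h1]) (by rw [h2, hini])
      · exact hs (hw' s h2)
  · rintro x y (hg | ⟨k, n, hk, hL, ⟨rfl, _⟩ | ⟨h0, rfl, rfl⟩⟩)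
    · exact .inl hg
    · simp [Net.Live] at hL
    obtain ⟨k, rfl⟩ := Nat.exists_eq_succ_of_ne_zero h0
    rw [hw.deg] at hk
    have hk : k < (F.outs w).length := hk
    simp only [hw.port_succ (getElem?_eq_getElem hk),
      hv.port_succ (getElem?_eq_getElem (hlen ▸ hk)), sh_mk, zero_add, add_zero]
    refine .inr ⟨_, _, _, rfl, rfl, fun e => ?_, fun e => ?_, hπk k hk⟩
    · have := ter_of_mem (p := v) (getElem_mem (hlen ▸ hk : k < (F.ins v).length))
      rw [e, hter] at this
      exact hredex.ne this
    · have := ini_of_mem (p := w) (getElem_mem hk)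
      rw [e, hini] at this
      exact hredex.ne this.symm
  · refine fun p s t h1 h2 => .inl (hK.2 ⟨?_, ?_⟩) <;> rintro rfl
    · have := hv.2; simp [h1] at this
    · have := hw.2; simp [h2] at this
  · intro s hs y
    obtain rfl := not_not.1 hs
    exact ⟨Gen.end_not (.inl hw) hter, Gen.start_not (.inr hv) hini⟩

lemma MapRel.unique {φ : F.Point → F'.Point} {π : F.Strand → F'.Strand} {S x x' y'}
    (h : MapRel φ π S x x') (h' : MapRel φ π S x y') : x' = y' := by
  rcases h with ⟨s, n, h⟩ | ⟨a, n, h⟩ <;> rcases h' with ⟨_, _, h'⟩ | ⟨_, _, h'⟩ <;> rfl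

lemma _root_.StrandGraph.IsSplit.end_port {p} (h : F.IsSplit p) :
    (∃ s, F.ins p = [s] ∧ F.port p 0 = (.inl s, 0)) ∨ F.ins p = [] ∧ F.port p 0 = (.inr p, 0) := by
  rcases h.ins_cases with h0 | ⟨s, h0⟩
  · exact .inr ⟨h0, by rw [h.port_zero, h0]⟩
  · exact .inl ⟨s, h0, by rw [h.port_zero, h0]⟩

lemma _root_.StrandGraph.IsMerge.start_port (hF : F.Closed) {p} (h : F.IsMerge p) :
    (∃ s, F.outs p = [s] ∧ F.port p 0 = (.inl s, 0)) ∨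
      F.outs p = [] ∧ ∃ a, F.Base a p ∧ F.port p 0 = (.inr a, 1) := by
  rcases h.outs_cases with h0 | ⟨s, h0⟩
  · obtain ⟨a, ha⟩ := hF.exists_source h0
    exact .inr ⟨h0, a, ha, by rw [h.port_zero, h0, ha.sourceOf]⟩
  · exact .inl ⟨s, h0, by rw [h.port_zero, h0]⟩

lemma Reduction1.iso (hF : F.Closed) (hF' : F'.Closed) (h : F.Reduction1 F') :
    ∃ N, Net.Red F.net N ∧ ∃ e f, N.Iso F'.net e f := by
  obtain ⟨v, w, φ, π, t, hv, hw, hcol, hvw, hC, htcol, hπv, hπw, hφv, hφw, hbij, hso, hsi⟩ := h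
  generalize hKe : ({v, w}ᶜ : Set F.Point) = K at hC
  have hB := base_map hso hsi
  have hne : v ≠ w := fun e => hv.not_merge (e ▸ hw)
  have hK : ∀ {p}, p ∈ K ↔ p ≠ v ∧ p ≠ w := by simp [← hKe]
  have hredex : F.net.Redex v w 0 true := by
    refine ⟨.inl hv, .inr hw, hv, fun h => h.not_merge hw, hcol, fun k hk hL => ?_⟩
    obtain ⟨k, rfl⟩ := Nat.exists_eq_succ_of_ne_zero (show k ≠ 0 by simpa [Net.Live] using hL)
    rw [hv.deg] at hk
    obtain ⟨u, h1⟩ : ∃ u, (F.outs v)[k]? = some u := ⟨_, getElem?_eq_getElem hk⟩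
    have h2 := h1
    rw [hvw] at h2
    show F.net.Rel (F.port v (k + 1)) (sh 0 (F.port w (k + 1)))
    rw [hv.port_succ h1, hw.port_succ h2, sh_zero]; exact .refl _
  have hvs : ∀ s, F.ini s = v → F.ter s = w := fun s hs => by
    have := mem_outs_ini s
    rw [hs, hvw] at this
    exact ter_of_mem this
  have hnw : ∀ s, F.ter s = v → F.ini s ≠ w := fun s h1 h2 => by
    obtain ⟨u, hu⟩ := exists_mem_of_ne_nil _ hv.outs_ne
    exact no_two_cycle (s := s) (t := u) (h1.trans (ini_of_mem hu).symm)
      ((hvs u (ini_of_mem hu)).trans h2.symm)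
  have glue : ∀ n, (F.net.red v w 0 true).Rel (sh n (F.port v 0)) (sh n (F.port w 0)) := fun n => by
    have := hredex.red_rel hF.wf (k := 0) (by simp) n
    simpa using this
  set S : F.Strand → Prop := fun s => F.ini s ≠ v with hS
  have hKS : ∀ p, p ∈ K → ∀ s, F.ini s = p ∨ F.ter s = p → S s := by
    rintro p hp s (hs | hs) h0
    · exact (hK.1 hp).1 (hs.symm.trans h0)
    · exact (hK.1 hp).2 (hs.symm.trans (hvs s h0))
  have hin : ∀ {p}, p ∈ K → p ∈ {p | (p = v → F.ins v = []) ∧ (p = w → F.outs w = [])} :=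
    fun hp => ⟨fun e => absurd e (hK.1 hp).1, fun e => absurd e (hK.1 hp).2⟩
  have hsurj : ∀ p', (∃ p ∈ K, φ p = p') ∨ (φ v = p' ∧ F.ins v = []) ∨
      (φ w = p' ∧ F.outs w = []) := fun p' => by
    obtain ⟨p, hp, rfl⟩ := hbij.surjOn (Set.mem_univ p')
    by_cases h1 : p = v
    · subst h1; exact .inr (.inl ⟨rfl, hp.1 rfl⟩)
    by_cases h2 : p = w
    · subst h2; exact .inr (.inr ⟨rfl, hp.2 rfl⟩)
    · exact .inl ⟨p, hK.2 ⟨h1, h2⟩, rfl⟩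
  have hsrcK : ∀ {a}, F.ins a = [] → a ≠ v → a ∈ K := fun ha h0 =>
    hK.2 ⟨h0, by rintro rfl; exact hw.ins_ne ha⟩
  have hsrc : ∀ {a}, F.ins a = [] → a ∈ {p | (p = v → F.ins v = []) ∧ (p = w → F.outs w = [])} :=
    fun {a} ha => by
      by_cases h0 : a = v
      · subst h0; exact ⟨fun _ => ha, fun e => absurd e hne⟩
      · exact hin (hsrcK ha h0)
  have hins' : ∀ {a}, F.ins a = [] → F'.ins (φ a) = [] := fun {a} ha => by
    by_cases h0 : a = v
    · subst h0; exact (hφv ha).2.1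
    · exact (hC.ins_eq_nil (hsrcK ha h0)).2 ha
  have HV : ∃ x0, MapRel φ π S (F.port v 0) x0 ∧ F'.net.Rel x0 (.inl t, 0) := by
    rcases hv.end_port with ⟨s, h1, h2⟩ | ⟨h1, h2⟩ <;> rw [h2]
    · refine ⟨_, .strand s 0 fun h0 => ini_ne_ter s ?_, ?_⟩
      · rw [h0, ter_of_eq h1]
      · rw [hπv s (by simp [h1])]; exact .refl _
    · exact ⟨_, .source v 0 h1, Gen.src' _ (hφv h1).2.1 (hφv h1).2.2⟩
  have HW : ∃ x0, MapRel φ π S (F.port w 0) x0 ∧ F'.net.Rel x0 (.inl t, 0) := by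
    rcases hw.start_port hF with ⟨s, h1, h2⟩ | ⟨h1, a, ha, h2⟩ <;> rw [h2]
    · refine ⟨_, .strand s 0 fun h0 => hne ?_, ?_⟩
      · rw [← h0, ini_of_eq h1]
      · rw [hπw s (by simp [h1])]; exact .refl _
    · exact ⟨_, .source a 1 ha.ins, (Gen.snk' 0 ((hB _ _).2 ⟨a, w, ha, rfl, rfl⟩) (hφw h1).2.1).symm⟩
  let ρ : (F.Strand ⊕ F.Point) × ℤ → (F'.Strand ⊕ F'.Point) × ℤ → Prop := fun x x' =>
    MapRel φ π S x x' ∨ ∃ n, x' = (.inl t, n) ∧ (x = sh n (F.port v 0) ∨ x = sh n (F.port w 0))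
  have hρ0 : ∀ x x', ρ x x' → ∃ x0, MapRel φ π S x x0 ∧ F'.net.Rel x0 x' := by
    rintro x x' (h | ⟨n, rfl, rfl | rfl⟩)
    · exact ⟨x', h, .refl _⟩
    · obtain ⟨x0, h1, h2⟩ := HV
      exact ⟨sh n x0, h1.sh n, by simpa using hF'.wf.rel_sh' n h2⟩
    · obtain ⟨x0, h1, h2⟩ := HW
      exact ⟨sh n x0, h1.sh n, by simpa using hF'.wf.rel_sh' n h2⟩
  have key : ∀ s n, S s → π s = t → (F.net.red v w 0 true).Rel (.inl s, n) (sh n (F.port v 0)) := by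
    intro s n hs hst
    by_cases hsw : F.ini s = w
    · have : F.port w 0 = (.inl s, 0) := by
        have hm := mem_outs_ini s
        rw [hsw] at hm
        rw [hw.port_zero]
        rcases hw.outs_cases with h0 | ⟨u, h0⟩ <;> rw [h0] at hm ⊢ <;> simp at hm
        rw [hm]
      have h2 := glue n
      rw [this] at h2
      simpa using h2.symm
    · have hsK : F.ini s ∈ K := hK.2 ⟨hs, hsw⟩
      rcases hv.end_port with ⟨u, h1, h2⟩ | ⟨h1, h2⟩
      · have hu : F.ter u = v := ter_of_eq h1
        have : s = u := by
          refine hC.inj hsK (hK.2 ⟨fun e => ini_ne_ter u (e.trans hu.symm), hnw u hu⟩) ?_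
          rw [hst, hπv u (by simp [h1])]
        rw [h2, this]; simpa using .refl _
      · exfalso
        have h3 := hC.ini hsK
        rw [hst, ini_of_mem (p := φ v) (by simp [(hφv h1).2.2])] at h3
        exact hs (hbij.injOn (hsrc h1) (hin hsK) h3).symm
  have keyt : ∀ x n, ρ x (.inl t, n) → (F.net.red v w 0 true).Rel x (sh n (F.port v 0)) := by
    rintro x n (h | ⟨m, h, rfl | rfl⟩)
    · obtain ⟨s, rfl, hs, h⟩ := h.eq_strand
      exact key s n hs h
    · obtain rfl := (Prod.mk.inj h).2; exact .refl _
    · obtain rfl := (Prod.mk.inj h).2; exact (glue _).symm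
  have hρ : (F.net.red v w 0 true).Corr F'.net ρ := by
    refine ⟨?_, ?_, ?_, ?_, ?_, ?_⟩
    · rintro m x x' (h | ⟨n, rfl, rfl | rfl⟩)
      · exact .inl (h.sh m)
      · exact .inr ⟨n + m, rfl, .inl (by simp)⟩
      · exact .inr ⟨n + m, rfl, .inr (by simp)⟩
    · intro x x' y' h1 h2
      obtain ⟨x0, h3, h4⟩ := hρ0 _ _ h1
      obtain ⟨y0, h5, h6⟩ := hρ0 _ _ h2
      obtain rfl := h3.unique h5
      exact h4.symm.trans h6
    · intro x y z h1 h2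
      by_cases hz : ∃ n, z = (.inl t, n)
      · obtain ⟨n, rfl⟩ := hz
        exact (keyt _ _ h1).trans (keyt _ _ h2).symm
      rcases h1 with h1 | ⟨n, rfl, -⟩
      swap; · exact absurd ⟨n, rfl⟩ hz
      rcases h2 with h2 | ⟨n, rfl, -⟩
      swap; · exact absurd ⟨n, rfl⟩ hz
      rcases z with ⟨c | c, n⟩
      · obtain ⟨s, rfl, hs, rfl⟩ := h1.eq_strand
        obtain ⟨u, rfl, hu, hus⟩ := h2.eq_strand
        have hw' : ∀ s, S s → π s ≠ t → F.ini s ∈ K := fun s h1 h2 =>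
          hK.2 ⟨h1, fun e => h2 (hπw s (e ▸ mem_outs_ini s))⟩
        have hst : π s ≠ t := fun e => hz ⟨n, by rw [e]⟩
        rw [hC.inj (hw' s hs hst) (hw' u hu (hus ▸ hst)) hus.symm]
        exact .refl _
      · obtain ⟨a, rfl, ha, rfl⟩ := h1.eq_source
        obtain ⟨b, rfl, hb, h⟩ := h2.eq_source
        rw [hbij.injOn (hsrc ha) (hsrc hb) h.symm]
        exact .refl _
    · rintro _ _ ((⟨a, s, m, h1, h2⟩ | ⟨a, b, s, m, h1, h2⟩ | ⟨p, s, u, m, h1, h2⟩) | hg)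
      · have ha : a ∈ K := hsrcK h1 (by
          rintro rfl; have := hv.2; simp [h2] at this)
        exact ⟨_, _, .inl (.source _ _ h1), .inl (.strand _ _ (hKS a ha _ (.inl (ini_of_eq h2)))),
          Gen.src' _ ((hC.ins_eq_nil ha).2 h1) (hC.outs_eq ha h2)⟩
      · have hb : b ∈ K := hK.2 ⟨by rintro rfl; exact hv.outs_ne h1.outs,
          by rintro rfl; have := hw.2; simp [h2] at this⟩
        exact ⟨_, _, .inl (.strand _ _ (hKS b hb _ (.inr (ter_of_eq h2)))), .inl (.source _ _ h1.ins),
          Gen.snk' _ ((hB _ _).2 ⟨a, b, h1, rfl, rfl⟩) (hC.ins_eq hb h2)⟩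
      · have hp : p ∈ K := by
          refine hK.2 ⟨?_, ?_⟩ <;> rintro rfl
          · have := hv.2; simp [h2] at this
          · have := hw.2; simp [h1] at this
        exact ⟨_, _, .inl (.strand _ _ (hKS p hp _ (.inr (ter_of_eq h1)))),
          .inl (.strand _ _ (hKS p hp _ (.inl (ini_of_eq h2)))),
          Gen.deg' _ (hC.ins_eq hp h1) (hC.outs_eq hp h2)⟩
      · obtain ⟨k, n, hk, hL, ⟨rfl, rfl, rfl⟩ | ⟨h0, _⟩⟩ := hg
        · exact ⟨_, _, .inr ⟨n, rfl, .inl rfl⟩, .inr ⟨n, rfl, .inr (by simp)⟩, .refl _⟩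
        · exact absurd (show k = 0 by simpa [Net.Live] using hL) h0
    · rintro _ _ (⟨a, s, m, h1, h2⟩ | ⟨a, b, s, m, h1, h2⟩ | ⟨p, s, u, m, h1, h2⟩)
      · rcases hsurj a with ⟨a, ha, rfl⟩ | ⟨rfl, hv0⟩ | ⟨rfl, hw0⟩
        · obtain ⟨s, g2, rfl⟩ := hC.outs_singleton ha h2
          have g1 := (hC.ins_eq_nil ha).1 h1
          exact ⟨(.inr a, m), (.inl s, m), .inl (.source _ _ g1),
            .inl (.strand _ _ (hKS a ha _ (.inl (ini_of_eq g2)))),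
            Net.red_rel_mono (Gen.src' _ g1 g2)⟩
        · rw [(hφv hv0).2.2] at h2
          obtain rfl : t = s := by simpa using h2
          refine ⟨(.inr v, m), (.inr v, m), .inl (.source _ _ hv0), .inr ⟨m, rfl, .inl ?_⟩, .refl _⟩
          rw [hv.port_zero, hv0]; simp
        · simp [(hφw hw0).2.1] at h1
      · obtain ⟨a, b, g1, rfl, rfl⟩ := (hB _ _).1 h1
        by_cases hbw : b = w
        · subst hbw
          rw [(hφw g1.outs).2.1] at h2
          obtain rfl : t = s := by simpa using h2
          refine ⟨(.inr a, m + 1), (.inr a, m + 1), .inr ⟨m, rfl, .inr ?_⟩,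
            .inl (.source _ _ g1.ins), .refl _⟩
          rw [hw.port_zero, g1.outs, g1.sourceOf]; simp [add_comm]
        · have hb : b ∈ K := hK.2 ⟨by rintro rfl; exact hv.outs_ne g1.outs, hbw⟩
          obtain ⟨s, g2, rfl⟩ := hC.ins_singleton hb h2
          exact ⟨(.inl s, m), (.inr a, m + 1), .inl (.strand _ _ (hKS b hb _ (.inr (ter_of_eq g2)))),
            .inl (.source _ _ g1.ins), Net.red_rel_mono (Gen.snk' _ g1 g2)⟩
      · rcases hsurj p with ⟨p, hp, rfl⟩ | ⟨rfl, hv0⟩ | ⟨rfl, hw0⟩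
        · obtain ⟨s, g1, rfl⟩ := hC.ins_singleton hp h1
          obtain ⟨u, g2, rfl⟩ := hC.outs_singleton hp h2
          exact ⟨(.inl s, m), (.inl u, m), .inl (.strand _ _ (hKS p hp _ (.inr (ter_of_eq g1)))),
            .inl (.strand _ _ (hKS p hp _ (.inl (ini_of_eq g2)))),
            Net.red_rel_mono (Gen.deg' _ g1 g2)⟩
        · simp [(hφv hv0).2.1] at h1
        · simp [(hφw hw0).2.2] at h2
    · intro x x' h
      obtain ⟨x0, h1, h2⟩ := hρ0 _ _ h
      refine Eq.trans ?_ (hF'.wf.rel_col h2)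
      rcases h1 with ⟨s, n, hs⟩ | ⟨a, n, ha⟩
      · show F.scol s = F'.scol (π s)
        by_cases hsw : F.ini s = w
        · have hm : s ∈ F.outs w := hsw ▸ mem_outs_ini s
          rw [hπw s hm, htcol, hcol]
          exact (F.merge_col w hw).2 s hm
        · exact (hC.scol (.inl (hK.2 ⟨hs, hsw⟩))).symm
      · show F.pcol a = F'.pcol (φ a)
        by_cases h0 : a = v
        · subst h0; exact (hφv ha).1.symm
        · exact (hC.pcol a (hsrcK ha h0)).symm
  have hal : ∀ {p}, (F.net.red v w 0 true).alive p → p ∈ K := fun hp => hK.2 ⟨hp.2.1, hp.2.2⟩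
  refine ⟨_, ⟨v, w, 0, true, hredex, rfl⟩, φ, fun _ => 0,
    hρ.iso (hredex.wf hF.wf) hF'.wf ⟨fun p hp => (hC.alive (hal hp)).2 hp.1,
    fun p hp q hq => hC.injOn (hal hp) (hal hq), fun p' hp' => ?_⟩
    (fun p hp => hC.isSplit (hal hp)) (fun p hp => hC.pcol p (hal hp)) (fun p k hp hk => ?_)
    ?_ ?_⟩
  · rcases hsurj p' with ⟨p, hp, rfl⟩ | ⟨rfl, hv0⟩ | ⟨rfl, hw0⟩
    · exact ⟨p, ⟨(hC.alive hp).1 hp', (hK.1 hp).1, (hK.1 hp).2⟩, rfl⟩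
    · exact absurd hp' (not_alive_of (.inl (hφv hv0).2))
    · exact absurd hp' (not_alive_of (.inr (hφw hw0).2))
  · rw [sh_zero]
    exact hC.port (hal hp) hF hp.1 hk (fun s hs => .inl (.strand _ _ (hKS p (hal hp) s hs)))
      (fun h => .inl (.source _ _ h))
      (fun a ha => ⟨φ a, (hB _ _).2 ⟨a, p, ha, rfl, rfl⟩, .inl (.source _ _ ha.ins)⟩)
  · have hports : ∀ {n x}, (x = sh n (F.port v 0) ∨ x = sh n (F.port w 0)) →
        (∃ s n, x = (.inl s, n) ∧ F.ini s ≠ v) ∨ (∃ a n, x = (.inr a, n) ∧ F.ins a = []) := by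
      rintro n x (rfl | rfl)
      · rcases hv.end_port with ⟨s, h1, h2⟩ | ⟨h1, h2⟩ <;> rw [h2]
        · refine .inl ⟨s, _, rfl, fun e => ini_ne_ter s ?_⟩
          rw [e, ter_of_eq h1]
        · exact .inr ⟨v, _, rfl, h1⟩
      · rcases hw.start_port hF with ⟨s, h1, h2⟩ | ⟨h1, a, ha, h2⟩ <;> rw [h2]
        · refine .inl ⟨s, _, rfl, fun e => hne ?_⟩
          rw [← e, ini_of_eq h1]
        · exact .inr ⟨a, _, rfl, ha.ins⟩
    have hglue : ∀ {x y}, F.net.Glue v w 0 true x y → ∃ n, (x = sh n (F.port v 0) ∨ x = sh n (F.port w 0)) ∧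
        ∃ n, (y = sh n (F.port v 0) ∨ y = sh n (F.port w 0)) := by
      rintro x y ⟨k, n, hk, hL, ⟨rfl, rfl, rfl⟩ | ⟨h0, _⟩⟩
      · exact ⟨n, .inl rfl, n + 0, .inr rfl⟩
      · exact absurd (show k = 0 by simpa [Net.Live] using hL) h0
    have hno : ∀ s : F.Strand ⊕ F.Point, (∀ y, ¬ F.Gen (s, 0) y ∧ ¬ F.Gen y (s, 0)) →
        (∀ u, s = .inl u → F.ini u = v) → (∀ a, s = .inr a → F.ins a ≠ []) →
        ∀ y, ¬ (F.net.red v w 0 true).gen (s, 0) y ∧ ¬ (F.net.red v w 0 true).gen y (s, 0) := by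
      intro s h1 h2 h3 y
      have h4 : ∀ n, ¬ ((s, (0 : ℤ)) = sh n (F.port v 0) ∨ (s, (0 : ℤ)) = sh n (F.port w 0)) := by
        intro n hn
        rcases hports hn with ⟨u, n, he, hu⟩ | ⟨a, n, he, ha⟩
        · exact hu (h2 u (Prod.mk.inj he).1)
        · exact h3 a (Prod.mk.inj he).1 ha
      refine ⟨?_, ?_⟩
      · rintro (hg | hg)
        · exact (h1 y).1 hg
        · obtain ⟨n, h5, _⟩ := hglue hg; exact h4 n h5
      · rintro (hg | hg)
        · exact (h1 y).2 hg
        · obtain ⟨_, _, n, h5⟩ := hglue hg; exact h4 n h5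
    rintro (s | a)
    · by_cases hs : F.ini s = v
      · refine .inr (hno _ (fun y => ⟨Gen.end_not (.inr hw) (hvs s hs), Gen.start_not (.inl hv) hs⟩) ?_ ?_)
        · rintro u h; rwa [← Sum.inl.inj h]
        · simp
      · exact .inl ⟨_, .inl (.strand s 0 hs)⟩
    · by_cases ha : F.ins a = []
      · exact .inl ⟨_, .inl (.source _ _ ha)⟩
      · refine .inr (hno _ (Closed.isolated ha) ?_ ?_)
        · simp
        · rintro u h; rwa [← Sum.inr.inj h]
  · rintro (s' | a')
    · refine .inl ?_
      have hm := mem_outs_ini s'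
      rcases hsurj (F'.ini s') with ⟨p, hp, he⟩ | ⟨he, hv0⟩ | ⟨he, hw0⟩ <;> rw [← he] at hm
      · rw [hC.outs p hp, mem_map] at hm
        obtain ⟨s, hs, rfl⟩ := hm
        exact ⟨_, .inl (.strand s 0 (hKS p hp s (.inl (ini_of_mem hs))))⟩
      · rw [(hφv hv0).2.2] at hm
        obtain rfl : s' = t := by simpa using hm
        exact ⟨_, .inr ⟨0, rfl, .inl rfl⟩⟩
      · simp [(hφw hw0).2.2] at hm
    · by_cases ha : F'.ins a' = []
      · refine .inl ?_
        rcases hsurj a' with ⟨p, hp, rfl⟩ | ⟨rfl, hv0⟩ | ⟨rfl, hw0⟩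
        · exact ⟨_, .inl (.source _ _ ((hC.ins_eq_nil hp).1 ha))⟩
        · exact ⟨_, .inl (.source _ _ hv0)⟩
        · simp [(hφw hw0).2.1] at ha
      · exact .inr (Closed.isolated ha)

/-- The data of an expanding split shift. -/
structure SplitShift (F F' : StrandDiagram Γ) (A B A' B' : List F.Point) (a b w : F.Point)
    (X X' : List F'.Point) (φ : F.Point → F'.Point) (π : F.Strand → F'.Strand) (t : F'.Strand) :
    Prop where
  sources : F.sources = A ++ a :: B
  sinks : F.sinks = A' ++ b :: B'
  length : A.length = A'.length
  split : F.IsSplit w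
  top : w = a ∨ ∃ s, F.outs a = [s] ∧ F.ins w = [s]
  carries : F.Carries F' {a, b, w}ᶜ φ π
  scol : ∀ s ∈ F.outs w, F'.scol (π s) = F.scol s
  pcol : F'.pcol (φ w) = F.pcol w
  ins : F'.ins (φ w) = [t]
  new : Forall₂ (fun x s => F'.outs x = [π s]) X (F.outs w)
  new' : Forall₂ (fun x s => F'.ins x = [s]) X' (F'.outs (φ w))
  univalent : F.IsUnivalentSink b → ∀ s ∈ F.ins b, π s = t
  merge : F.IsMerge b → F'.pcol (φ b) = F.pcol b ∧ F'.ins (φ b) = (F.ins b).map π ∧ F'.outs (φ b) = [t]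
  bij : Set.BijOn φ {p | p = w ∨ (p ≠ a ∧ (p = b → F.IsMerge b))} {x | x ∉ X ∧ x ∉ X'}
  sources' : F'.sources = A.map φ ++ X ++ B.map φ
  sinks' : F'.sinks = A'.map φ ++ X' ++ B'.map φ

lemma expandingSplitShift_iff : F.ExpandingSplitShift F' ↔
    ∃ A B A' B' a b w X X' φ π t, F.SplitShift F' A B A' B' a b w X X' φ π t := by
  constructor <;> rintro ⟨A, B, A', B', a, b, w, X, X', φ, π, t, h1, h2, h3, h4, h5, h6, h7, h8, h9, h10, h11,
    h12, h13, h14, h15, h16⟩ <;> exact ⟨A, B, A', B', a, b, w, X, X', φ, π, t, h1, h2, h3, h4, h5, h6, h7, h8,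
    h9, h10, h11, h12, h13, h14, h15, h16⟩

open Classical in
set_option maxHeartbeats 1600000 in
/-- A split shift moves the split one sheet down. -/
lemma SplitShift.iso (hF : F.Closed) (hF' : F'.Closed) {A B A' B' a b w X X' φ π t}
    (h : F.SplitShift F' A B A' B' a b w X X' φ π t) :
    F.net.Iso F'.net φ (fun p => if p = w then -1 else 0) := by
  obtain ⟨hso, hsi, hAA, hw, hwa, hC, hcolw, hφw, hinsw, hX, hX', hbu, hbm, hbij, hso', hsi'⟩ := h
  generalize hKe : ({a, b, w}ᶜ : Set F.Point) = K at hC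
  have hXl : X.length = (F.outs w).length := hX.length_eq
  have hXl' : X'.length = (F'.outs (φ w)).length := hX'.length_eq
  have hXX : X.length = X'.length := by
    have h1 := hF.length_eq; have h2 := hF'.length_eq
    rw [hso, hsi] at h1; rw [hso', hsi'] at h2
    simp at h1 h2; omega
  have hnA : a ∉ A ∧ a ∉ B := by
    have := F.sources_nodup
    rw [hso, List.nodup_middle, List.nodup_cons, mem_append, not_or] at this
    exact this.1
  have hBab : F.Base a b := by
    unfold Base; rw [hso, hsi, zip_append hAA]; simp
  have hB : ∀ x y, F'.Base x y ↔ (∃ c d, F.Base c d ∧ c ≠ a ∧ φ c = x ∧ φ d = y) ∨ (x, y) ∈ X.zip X' := by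
    intro x y
    unfold Base
    rw [hso, hsi, hso', hsi', zip_append (by simp [hAA, hXX]), zip_append (by simp [hAA]),
      zip_append hAA, zip_map, zip_map]
    simp only [mem_append, mem_map, List.zip_cons_cons, List.mem_cons, Prod.map, Prod.exists, Prod.mk.injEq]
    constructor
    · rintro ((⟨c, d, h1, h2, h3⟩ | h) | ⟨c, d, h1, h2, h3⟩)
      · exact .inl ⟨c, d, .inl h1, by rintro rfl; exact hnA.1 (of_mem_zip h1).1, h2, h3⟩
      · exact .inr h
      · exact .inl ⟨c, d, .inr (.inr h1), by rintro rfl; exact hnA.2 (of_mem_zip h1).1, h2, h3⟩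
    · rintro (⟨c, d, h1 | h1 | h1, h4, h2, h3⟩ | h)
      · exact .inl (.inl ⟨c, d, h1, h2, h3⟩)
      · exact absurd h1.1 h4
      · exact .inr ⟨c, d, h1, h2, h3⟩
      · exact .inl (.inr h)
  have hK : ∀ {p}, p ∈ K ↔ p ≠ a ∧ p ≠ b ∧ p ≠ w := by simp [← hKe]
  have hai := hBab.ins
  have hbo := hBab.outs
  have hab := hBab.ne
  have hbw : b ≠ w := fun e => hw.outs_ne (e ▸ hbo)
  set D : Set F.Point := {p | p = w ∨ (p ≠ a ∧ (p = b → F.IsMerge b))} with hD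
  have hKD : ∀ {p}, p ∈ K → p ∈ D := fun hp => .inr ⟨(hK.1 hp).1, fun e => absurd e (hK.1 hp).2.1⟩
  have hwD : w ∈ D := .inl rfl
  have hsrcK : ∀ {c}, F.ins c = [] → c ≠ a → c ∈ K := fun {c} hc h0 => by
    refine hK.2 ⟨h0, ?_, ?_⟩ <;> rintro rfl
    · exact outs_ne_nil_of_ins hc hbo
    · rcases hwa with e | ⟨s, _, e⟩
      · exact h0 e
      · rw [hc] at e; cases e
  have hsnkK : ∀ {c d}, F.Base c d → c ≠ a → d ∈ K := fun {c d} hc h0 => by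
    refine hK.2 ⟨?_, ?_, ?_⟩ <;> rintro rfl
    · exact outs_ne_nil_of_ins hai hc.outs
    · exact h0 (hc.left hBab)
    · exact hw.outs_ne hc.outs
  have hsurj : ∀ p', (∃ p ∈ K, φ p = p') ∨ φ w = p' ∨
      (φ b = p' ∧ F.IsMerge b) ∨ p' ∈ X ∨ p' ∈ X' := fun p' => by
    by_cases h1 : p' ∈ X
    · tauto
    by_cases h2 : p' ∈ X'
    · tauto
    obtain ⟨p, hp, rfl⟩ := hbij.surjOn ⟨h1, h2⟩
    by_cases hpw : p = w
    · subst hpw; tauto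
    by_cases hpb : p = b
    · subst hpb
      rcases hp with hp | hp
      · exact absurd hp hpw
      · exact .inr (.inr (.inl ⟨rfl, hp.2 rfl⟩))
    · rcases hp with hp | hp
      · exact absurd hp hpw
      · exact .inl ⟨p, hK.2 ⟨hp.1, hpb, hpw⟩, rfl⟩
  have hXk : ∀ x ∈ X, ∃ (i : ℕ) (s : F.Strand), X[i]? = some x ∧ (F.outs w)[i]? = some s ∧ F'.outs x = [π s] := by
    intro x hx
    obtain ⟨i, hi, rfl⟩ := mem_iff_getElem.1 hx
    exact ⟨i, (F.outs w)[i], getElem?_eq_getElem hi, getElem?_eq_getElem _, hX.get hi (hXl ▸ hi)⟩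
  have hXo : ∀ s ∈ F.outs w, ∃ x ∈ X, F'.outs x = [π s] := by
    intro s hs
    obtain ⟨i, hi, rfl⟩ := mem_iff_getElem.1 hs
    exact ⟨X[i], getElem_mem _, hX.get (hXl.symm ▸ hi) hi⟩
  have hXs : ∀ x ∈ X, F'.ins x = [] := fun x hx => (F'.mem_sources x).1 (by rw [hso']; simp [hx])
  have hXs' : ∀ x ∈ X', F'.outs x = [] := fun x hx => (F'.mem_sinks x).1 (by rw [hsi']; simp [hx])
  have hXi' : ∀ x ∈ X', ∃ s, F'.ins x = [s] := by
    intro x hx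
    obtain ⟨i, hi, rfl⟩ := mem_iff_getElem.1 hx
    exact ⟨_, hX'.get hi (hXl' ▸ hi)⟩
  have hXnd : X.Nodup := by
    have := F'.sources_nodup
    rw [hso'] at this
    exact (nodup_append.1 (nodup_append.1 this).1).2.1
  have hterw : ∀ s, F.ter s = w → F.ini s = a ∧ F.ins w = [s] ∧ F.outs a = [s] ∧ w ≠ a := by
    intro s hs
    rcases hwa with e | ⟨u, h1, h2⟩
    · exact absurd (hs.trans e) (ter_ne hai)
    · obtain rfl := eq_of_ter h2 hs
      exact ⟨ini_of_eq h1, h2, h1, by rintro rfl; rw [hai] at h2; cases h2⟩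
  have hia : ∀ s, F.ini s = a → w = a ∨ F.ter s = w := by
    intro s hs
    rcases hwa with e | ⟨u, h1, h2⟩
    · exact .inl e
    · obtain rfl := eq_of_ini h1 hs
      exact .inr (ter_of_eq h2)
  have how : ∀ s ∈ F.outs w, F.ter s ≠ w := fun s hs e => ini_ne_ter s ((ini_of_mem hs).trans e.symm)
  have hKt : ∀ p, p ∈ K → ∀ s, F.ini s = p ∨ F.ter s = p → F.ter s ≠ w := by
    rintro p hp s (hs | hs) h0
    · exact (hK.1 hp).1 (hs ▸ (hterw s h0).1)
    · exact (hK.1 hp).2.2 (hs.symm.trans h0)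
  have ht : F'.ter t = φ w := ter_of_eq hinsw
  have hsplit' : F'.IsSplit (φ w) := ⟨by simp [hinsw], by rw [← hXl', ← hXX, hXl]; exact hw.2⟩
  have hpa : F.pcol w = F.pcol a := by
    rcases hwa with e | ⟨u, h1, h2⟩
    · rw [e]
    · rw [← (F.split_col w hw).2 u (by simp [h2])]
      exact F.univalentSource_col a ⟨hai, by simp [h1]⟩ u (by simp [h1])
  have hlow : ∀ (i : ℕ) s x s', (F.outs w)[i]? = some s → X[i]? = some x → (F'.outs (φ w))[i]? = some s' →
      F'.outs x = [π s] ∧ ∃ x', (x, x') ∈ X.zip X' ∧ F'.ins x' = [s'] := by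
    intro i s x s' h1 h2 h3
    obtain ⟨i1, rfl⟩ := List.getElem?_eq_some_iff.1 h1
    obtain ⟨i2, rfl⟩ := List.getElem?_eq_some_iff.1 h2
    obtain ⟨i3, rfl⟩ := List.getElem?_eq_some_iff.1 h3
    refine ⟨hX.get i2 i1, X'[i]'(hXX ▸ i2), ?_, hX'.get (hXX ▸ i2) i3⟩
    exact mem_iff_getElem.2 ⟨i, by simp [i2, hXX ▸ i2], by simp⟩
  -- the elementary correspondence
  let ρ₀ : (F.Strand ⊕ F.Point) × ℤ → (F'.Strand ⊕ F'.Point) × ℤ → Prop := fun x x' => x' = ((match x.1 with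
      | .inl s => if F.ter s = w then .inl t else .inl (π s)
      | .inr c => if c = a then .inl t else .inr (φ c)),
      (match x.1 with
      | .inl s => if F.ter s = w then x.2 - 1 else x.2
      | .inr c => if c = a then x.2 - 1 else x.2)) ∧ ∀ c, x.1 = .inr c → F.ins c = []
  have r1 : ∀ s n, F.ter s ≠ w → ρ₀ (.inl s, n) (.inl (π s), n) := fun s n h => by simp [ρ₀, h]
  have r2 : ∀ s n, F.ter s = w → ρ₀ (.inl s, n) (.inl t, n - 1) := fun s n h => by simp [ρ₀, h]
  have r3 : ∀ c n, F.ins c = [] → c ≠ a → ρ₀ (.inr c, n) (.inr (φ c), n) := fun c n h h' => by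
    simp [ρ₀, h, h']
  have r4 : ∀ n, ρ₀ (.inr a, n) (.inl t, n - 1) := fun n => by simp [ρ₀, hai]
  have rc : ∀ x x', ρ₀ x x' → (∃ s n, F.ter s ≠ w ∧ x = (.inl s, n) ∧ x' = (.inl (π s), n)) ∨
      (∃ s n, F.ter s = w ∧ x = (.inl s, n) ∧ x' = (.inl t, n - 1)) ∨
      (∃ c n, F.ins c = [] ∧ c ≠ a ∧ x = (.inr c, n) ∧ x' = (.inr (φ c), n)) ∨
      (∃ n, x = (.inr a, n) ∧ x' = (.inl t, n - 1)) := by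
    rintro ⟨s | c, n⟩ x' ⟨rfl, h2⟩
    · by_cases h : F.ter s = w <;> simp [h]
    · by_cases h : c = a
      · simp [h]
      · simp [h]; exact h2 c rfl
  let ρ : (F.Strand ⊕ F.Point) × ℤ → (F'.Strand ⊕ F'.Point) × ℤ → Prop := fun x x' =>
    ρ₀ x x' ∨ ∃ (i : ℕ) (s : F.Strand) (n : ℤ), (F.outs w)[i]? = some s ∧ x = (.inl s, n) ∧
      ((∃ x₁, X[i]? = some x₁ ∧ x' = (.inr x₁, n)) ∨
        ∃ s', (F'.outs (φ w))[i]? = some s' ∧ x' = (.inl s', n - 1))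
  have ρsh : ∀ n x x', ρ x x' → ρ (sh n x) (sh n x') := by
    rintro n x x' (h | ⟨i, s, m, h1, rfl, ⟨x₁, h2, rfl⟩ | ⟨s', h2, rfl⟩⟩)
    · left
      rcases rc _ _ h with ⟨s, m, h1, rfl, rfl⟩ | ⟨s, m, h1, rfl, rfl⟩ | ⟨c, m, h1, h2, rfl, rfl⟩ |
        ⟨m, rfl, rfl⟩
      · exact r1 _ _ h1
      · rw [sh_mk, sh_mk, sub_add_eq_add_sub]; exact r2 _ _ h1
      · exact r3 _ _ h1 h2
      · rw [sh_mk, sh_mk, sub_add_eq_add_sub]; exact r4 _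
    · exact .inr ⟨i, s, m + n, h1, rfl, .inl ⟨x₁, h2, rfl⟩⟩
    · exact .inr ⟨i, s, m + n, h1, rfl, .inr ⟨s', h2, by rw [sh_mk, sub_add_eq_add_sub]⟩⟩
  have hρ0 : ∀ x x', ρ x x' → ∃ x0, ρ₀ x x0 ∧ F'.net.Rel x0 x' := by
    rintro x x' (h | ⟨i, s, n, h1, rfl, ⟨x₁, h2, rfl⟩ | ⟨s', h2, rfl⟩⟩)
    · exact ⟨x', h, .refl _⟩
    · obtain ⟨i3, h3⟩ : ∃ s', (F'.outs (φ w))[i]? = some s' := by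
        obtain ⟨i2, rfl⟩ := List.getElem?_eq_some_iff.1 h2
        exact ⟨_, getElem?_eq_getElem (by rwa [← hXl', ← hXX])⟩
      have h4 := hlow i s x₁ _ h1 h2 h3
      exact ⟨_, r1 s n (how s (mem_of_getElem? h1)), (Gen.src' n (hXs x₁ (mem_of_getElem? h2)) h4.1).symm⟩
    · obtain ⟨x₁, h3⟩ : ∃ x₁, X[i]? = some x₁ := by
        obtain ⟨i2, rfl⟩ := List.getElem?_eq_some_iff.1 h2
        exact ⟨_, getElem?_eq_getElem (by rwa [hXX, hXl'])⟩
      obtain ⟨h4, x', h5, h6⟩ := hlow i s x₁ _ h1 h3 h2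
      refine ⟨_, r1 s n (how s (mem_of_getElem? h1)),
        (Gen.src' n (hXs x₁ (mem_of_getElem? h3)) h4).symm.trans ?_⟩
      have := Gen.snk' (n - 1) ((hB _ _).2 (.inr h5)) h6
      rw [sub_add_cancel] at this
      exact this.symm
  have keyt : ∀ x n, ρ x (.inl t, n) → F.net.Rel x (.inr a, n + 1) := by
    rintro x n (h | ⟨i, s, m, h1, rfl, ⟨x₁, h2, h3⟩ | ⟨s', h2, h3⟩⟩)
    · rcases rc _ _ h with ⟨s, m, h1, rfl, h2⟩ | ⟨s, m, h1, rfl, h2⟩ | ⟨c, m, h1, h2, rfl, h3⟩ | ⟨m, rfl, h2⟩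
      · simp only [Prod.mk.injEq, Sum.inl.injEq] at h2
        obtain ⟨h2, rfl⟩ := h2
        by_cases hsK : F.ter s ∈ K
        · have := hC.ter hsK
          rw [← h2, ht] at this
          exact absurd (hbij.injOn hwD (hKD hsK) this).symm h1
        · have hsb : F.ter s = b := by
            by_contra hsb
            refine hsK (hK.2 ⟨fun e => ?_, hsb, h1⟩)
            exact ter_ne hai e
          have hm := mem_ins_ter s
          rw [hsb] at hm
          by_cases hbm' : F.IsMerge b
          · exfalso
            have h4 : F'.ter (π s) = φ b := ter_of_mem (by
              rw [(hbm hbm').2.1]; exact mem_map_of_mem hm)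
            rw [← h2, ht] at h4
            exact hbw (hbij.injOn hwD (.inr ⟨hab.symm, fun _ => hbm'⟩) h4).symm
          · have hl : (F.ins b).length = 1 := by
              have := F.types b
              simp only [StrandGraph.IsUnivalentSource, StrandGraph.IsUnivalentSink, hbo,
                StrandGraph.IsSplit, hbm', StrandGraph.IsDegenerate] at this
              simpa using this
            obtain ⟨u, hu⟩ := length_eq_one_iff.1 hl
            obtain rfl : s = u := by simpa [hu] using hm
            exact Gen.snk' n hBab hu
      · obtain rfl := (Prod.mk.inj h2).2
        rw [sub_add_cancel]
        exact (Gen.src' m hai (hterw s h1).2.2.1).symm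
      · simp at h3
      · obtain rfl := (Prod.mk.inj h2).2
        rw [sub_add_cancel]
        exact .refl _
    · simp at h3
    · simp only [Prod.mk.injEq, Sum.inl.injEq] at h3
      have := ini_of_mem (mem_of_getElem? h2)
      rw [← h3.1] at this
      exact absurd (this.trans ht.symm) (ini_ne_ter t)
  have keyr : ∀ x n c', ρ x (.inr c', n) → (∃ c, x = (.inr c, n) ∧ F.ins c = [] ∧ c ≠ a ∧ φ c = c') ∨
      (∃ (i : ℕ) (s : F.Strand), (F.outs w)[i]? = some s ∧ X[i]? = some c' ∧ x = (.inl s, n)) := by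
    rintro x n c' (h | ⟨i, s, m, h1, rfl, ⟨x₁, h2, h3⟩ | ⟨s', h2, h3⟩⟩)
    · rcases rc _ _ h with ⟨s, m, h1, rfl, h2⟩ | ⟨s, m, h1, rfl, h2⟩ | ⟨c, m, h1, h2, rfl, h3⟩ | ⟨m, rfl, h2⟩
      · simp at h2
      · simp at h2
      · simp only [Prod.mk.injEq, Sum.inr.injEq] at h3
        obtain ⟨rfl, rfl⟩ := h3
        exact .inl ⟨c, rfl, h1, h2, rfl⟩
      · simp at h2
    · simp only [Prod.mk.injEq, Sum.inr.injEq] at h3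
      obtain ⟨rfl, rfl⟩ := h3
      exact .inr ⟨i, s, h1, h2, rfl⟩
    · simp at h3
  have keyl : ∀ x n s', s' ≠ t → ρ x (.inl s', n) → (∃ s, x = (.inl s, n) ∧ F.ini s ∈ K ∧ π s = s') ∨
      (∃ (i : ℕ) (s : F.Strand), x = (.inl s, n) ∧ (F.outs w)[i]? = some s ∧ π s = s') ∨
      (∃ (i : ℕ) (s : F.Strand), x = (.inl s, n + 1) ∧ (F.outs w)[i]? = some s ∧ (F'.outs (φ w))[i]? = some s') := by
    rintro x n s' hs' (h | ⟨i, s, m, h1, rfl, ⟨x₁, h2, h3⟩ | ⟨s'', h2, h3⟩⟩)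
    · rcases rc _ _ h with ⟨s, m, h1, rfl, h2⟩ | ⟨s, m, h1, rfl, h2⟩ | ⟨c, m, h1, h2, rfl, h3⟩ | ⟨m, rfl, h2⟩
      · simp only [Prod.mk.injEq, Sum.inl.injEq] at h2
        obtain ⟨rfl, rfl⟩ := h2
        by_cases hsw : F.ini s = w
        · obtain ⟨i, hi, he⟩ := mem_iff_getElem.1 (hsw ▸ mem_outs_ini s)
          exact .inr (.inl ⟨i, s, rfl, by rw [getElem?_eq_getElem hi, he], rfl⟩)
        · refine .inl ⟨s, rfl, hK.2 ⟨fun e => ?_, fun e => ?_, hsw⟩, rfl⟩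
          · rcases hia s e with e' | e'
            · exact hsw (e.trans e'.symm)
            · exact h1 e'
          · exact ini_ne hbo e
      · exact absurd (Sum.inl.inj (Prod.mk.inj h2).1) hs'
      · simp at h3
      · exact absurd (Sum.inl.inj (Prod.mk.inj h2).1) hs'
    · simp at h3
    · simp only [Prod.mk.injEq, Sum.inl.injEq] at h3
      obtain ⟨rfl, rfl⟩ := h3
      exact .inr (.inr ⟨i, s, by rw [sub_add_cancel], h1, h2⟩)
  have hφX : ∀ {p}, p ∈ D → φ p ∉ X := fun hp => (hbij.mapsTo hp).1
  have hXπ : ∀ {i : ℕ} {s}, (F.outs w)[i]? = some s → ∃ x, X[i]? = some x ∧ F'.ini (π s) = x := by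
    intro i s h
    obtain ⟨i1, rfl⟩ := List.getElem?_eq_some_iff.1 h
    have i2 : i < X.length := hXl ▸ i1
    refine ⟨X[i], getElem?_eq_getElem i2, ini_of_mem ?_⟩
    have := hX.get i2 i1
    rw [show F'.outs X[i] = _ from this]; simp
  have hρ : F.net.Corr F'.net ρ := by
    refine ⟨ρsh, ?_, ?_, ?_, ?_, ?_⟩
    · intro x x' y' h1 h2
      obtain ⟨x0, h3, h4⟩ := hρ0 _ _ h1
      obtain ⟨y0, h5, h6⟩ := hρ0 _ _ h2
      obtain rfl := h3.1.trans h5.1.symm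
      exact h4.symm.trans h6
    · rintro x y ⟨s' | c', n⟩ h1 h2
      · by_cases hs' : s' = t
        · subst hs'
          exact (keyt _ _ h1).trans (keyt _ _ h2).symm
        · rcases keyl _ _ _ hs' h1 with ⟨s, rfl, h3, h4⟩ | ⟨i, s, rfl, h3, h4⟩ | ⟨i, s, rfl, h3, h4⟩ <;>
          rcases keyl _ _ _ hs' h2 with ⟨u, rfl, h3', h4'⟩ | ⟨j, u, rfl, h3', h4'⟩ | ⟨j, u, rfl, h3', h4'⟩
          · rw [hC.inj h3 h3' (h4.trans h4'.symm)]; exact .refl _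
          · exfalso
            obtain ⟨x, h5, h6⟩ := hXπ h3'
            have := hC.ini h3
            rw [h4, ← h4', h6] at this
            exact hφX (hKD h3) (this ▸ mem_of_getElem? h5)
          · exfalso
            have := hC.ini h3
            rw [h4, ini_of_mem (mem_of_getElem? h4')] at this
            exact (hK.1 h3).2.2 (hbij.injOn hwD (hKD h3) this).symm
          · exfalso
            obtain ⟨x, h5, h6⟩ := hXπ h3
            have := hC.ini h3'
            rw [h4', ← h4, h6] at this
            exact hφX (hKD h3') (this ▸ mem_of_getElem? h5)
          · obtain ⟨x, h5, h6⟩ := hXπ h3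
            obtain ⟨x', h5', h6'⟩ := hXπ h3'
            rw [h4] at h6; rw [h4'] at h6'
            obtain rfl := h6.symm.trans h6'
            obtain rfl := getElem?_inj hXnd h5 h5'
            obtain rfl := Option.some.inj (h3.symm.trans h3')
            exact .refl _
          · exfalso
            obtain ⟨x, h5, h6⟩ := hXπ h3
            rw [h4, ini_of_mem (mem_of_getElem? h4')] at h6
            exact hφX hwD (h6 ▸ mem_of_getElem? h5)
          · exfalso
            have := hC.ini h3'
            rw [h4', ini_of_mem (mem_of_getElem? h4)] at this
            exact (hK.1 h3').2.2 (hbij.injOn hwD (hKD h3') this).symm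
          · exfalso
            obtain ⟨x, h5, h6⟩ := hXπ h3'
            rw [h4', ini_of_mem (mem_of_getElem? h4)] at h6
            exact hφX hwD (h6 ▸ mem_of_getElem? h5)
          · obtain rfl := getElem?_inj (F'.outs_nodup _) h4 h4'
            obtain rfl := Option.some.inj (h3.symm.trans h3')
            exact .refl _
      · rcases keyr _ _ _ h1 with ⟨c, rfl, h3, h4, h5⟩ | ⟨i, s, h3, h4, rfl⟩ <;>
        rcases keyr _ _ _ h2 with ⟨d, rfl, h3', h4', h5'⟩ | ⟨j, u, h3', h4', rfl⟩
        · rw [hbij.injOn (hKD (hsrcK h3 h4)) (hKD (hsrcK h3' h4')) (h5.trans h5'.symm)]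
          exact .refl _
        · exact absurd (h5 ▸ mem_of_getElem? h4') (hφX (hKD (hsrcK h3 h4)))
        · exact absurd (h5' ▸ mem_of_getElem? h4) (hφX (hKD (hsrcK h3' h4')))
        · obtain rfl := getElem?_inj hXnd h4 h4'
          obtain rfl := Option.some.inj (h3.symm.trans h3')
          exact .refl _
    · rintro _ _ (⟨c, s, m, h1, h2⟩ | ⟨c, d, s, m, h1, h2⟩ | ⟨p, s, u, m, h1, h2⟩)
      · by_cases hca : c = a
        · subst hca
          refine ⟨_, _, .inl (r4 m), .inl (r2 s m ?_), .refl _⟩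
          rcases hia s (ini_of_eq h2) with e | e
          · subst e; have := hw.2; simp [h2] at this
          · exact e
        · have hc := hsrcK h1 hca
          exact ⟨_, _, .inl (r3 _ m h1 hca), .inl (r1 s m (hKt c hc _ (.inl (ini_of_eq h2)))),
            Gen.src' _ ((hC.ins_eq_nil hc).2 h1) (hC.outs_eq hc h2)⟩
      · by_cases hca : c = a
        · subst hca
          obtain rfl := h1.right hBab
          refine ⟨_, _, .inl (r1 s m fun e => hbw ?_), .inl (r4 (m + 1)), ?_⟩
          · rw [← e, ter_of_eq h2]
          · rw [add_sub_cancel_right, hbu ⟨hbo, by simp [h2]⟩ s (by simp [h2])]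
            exact .refl _
        · have hd := hsnkK h1 hca
          exact ⟨_, _, .inl (r1 s m (hKt d hd _ (.inr (ter_of_eq h2)))), .inl (r3 _ (m + 1) h1.ins hca),
            Gen.snk' _ ((hB _ _).2 (.inl ⟨c, d, h1, hca, rfl, rfl⟩)) (hC.ins_eq hd h2)⟩
      · have hp : p ∈ K := by
          refine hK.2 ⟨?_, ?_, ?_⟩ <;> rintro rfl
          · rw [hai] at h1; cases h1
          · rw [hbo] at h2; cases h2
          · have := hw.2; simp [h2] at this
        exact ⟨_, _, .inl (r1 s m (hKt p hp _ (.inr (ter_of_eq h1)))),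
          .inl (r1 u m (hKt p hp _ (.inl (ini_of_eq h2)))),
          Gen.deg' _ (hC.ins_eq hp h1) (hC.outs_eq hp h2)⟩
    · rintro _ _ (⟨c, s, m, h1, h2⟩ | ⟨c, d, s, m, h1, h2⟩ | ⟨p, s, u, m, h1, h2⟩)
      · rcases hsurj c with ⟨c, hc, rfl⟩ | rfl | ⟨rfl, hb⟩ | hc | hc
        · obtain ⟨s, g2, rfl⟩ := hC.outs_singleton hc h2
          have g1 := (hC.ins_eq_nil hc).1 h1
          exact ⟨(.inr c, m), (.inl s, m), .inl (r3 _ m g1 (hK.1 hc).1),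
            .inl (r1 s m (hKt c hc _ (.inl (ini_of_eq g2)))), Gen.src' _ g1 g2⟩
        · rw [hinsw] at h1; cases h1
        · have := (hbm hb).2.1; rw [h1] at this; exact absurd (map_eq_nil_iff.1 this.symm) hb.ins_ne
        · obtain ⟨i, o, h3, h4, h5⟩ := hXk c hc
          rw [h5] at h2
          obtain rfl : π o = s := by simpa using h2
          exact ⟨(.inl o, m), (.inl o, m), .inr ⟨i, o, m, h4, rfl, .inl ⟨c, h3, rfl⟩⟩,
            .inl (r1 o m (how o (mem_of_getElem? h4))), .refl _⟩
        · obtain ⟨u, hu⟩ := hXi' c hc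
          rw [h1] at hu; cases hu
      · rcases (hB _ _).1 h1 with ⟨c, d, h3, h4, rfl, rfl⟩ | h3
        · have hd := hsnkK h3 h4
          obtain ⟨s, g2, rfl⟩ := hC.ins_singleton hd h2
          exact ⟨(.inl s, m), (.inr c, m + 1), .inl (r1 s m (hKt d hd _ (.inr (ter_of_eq g2)))),
            .inl (r3 _ _ h3.ins h4), Gen.snk' _ h3 g2⟩
        · obtain ⟨i, hi, he⟩ := mem_iff_getElem.1 h3
          simp only [getElem_zip, Prod.mk.injEq] at he
          obtain ⟨rfl, rfl⟩ := he
          have i2 : i < X'.length := by simp at hi; omega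
          have i1 : i < X.length := by omega
          have h4 : F'.ins X'[i] = [(F'.outs (φ w))[i]'(by omega)] := hX'.get i2 (hXl' ▸ i2)
          rw [h4] at h2
          have h5 : (F.outs w)[i]? = some ((F.outs w)[i]'(by omega)) := getElem?_eq_getElem _
          refine ⟨(.inl ((F.outs w)[i]'(by omega)), m + 1), _, .inr ⟨i, _, m + 1, h5, rfl, Or.inr
              ⟨s, ?_, by rw [add_sub_cancel_right]⟩⟩,
            .inr ⟨i, _, m + 1, h5, rfl, .inl ⟨_, getElem?_eq_getElem i1, rfl⟩⟩, .refl _⟩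
          rw [getElem?_eq_getElem]
          simpa using h2
      · rcases hsurj p with ⟨p, hp, rfl⟩ | rfl | ⟨rfl, hb⟩ | hc | hc
        · obtain ⟨s, g1, rfl⟩ := hC.ins_singleton hp h1
          obtain ⟨u, g2, rfl⟩ := hC.outs_singleton hp h2
          exact ⟨(.inl s, m), (.inl u, m), .inl (r1 s m (hKt p hp _ (.inr (ter_of_eq g1)))),
            .inl (r1 u m (hKt p hp _ (.inl (ini_of_eq g2)))), Gen.deg' _ g1 g2⟩
        · have := hsplit'.2; simp [h2] at this
        · have := congrArg List.length (hbm hb).2.1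
          rw [h1, length_map] at this
          exact absurd hb.2 (by rw [← this]; simp)
        · rw [hXs _ hc] at h1; cases h1
        · rw [hXs' _ hc] at h2; cases h2
    · intro x x' h
      obtain ⟨x0, h1, h2⟩ := hρ0 _ _ h
      refine Eq.trans ?_ (hF'.wf.rel_col h2)
      have htc : F'.scol t = F.pcol w := ((F'.split_col _ hsplit').2 t (by simp [hinsw])).trans hφw
      rcases rc _ _ h1 with ⟨s, m, h3, rfl, rfl⟩ | ⟨s, m, h3, rfl, rfl⟩ | ⟨c, m, h3, h4, rfl, rfl⟩ |
        ⟨m, rfl, rfl⟩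
      · show F.scol s = F'.scol (π s)
        by_cases hsw : F.ini s = w
        · exact (hcolw s (hsw ▸ mem_outs_ini s)).symm
        · refine (hC.scol (.inl (hK.2 ⟨fun e => ?_, fun e => ?_, hsw⟩))).symm
          · rcases hia s e with e' | e'
            · exact hsw (e.trans e'.symm)
            · exact h3 e'
          · exact ini_ne hbo e
      · show F.scol s = F'.scol t
        rw [htc, (F.split_col w hw).2 s (by simp [(hterw s h3).2.1])]
      · exact (hC.pcol c (hsrcK h3 h4)).symm
      · show F.pcol a = F'.scol t
        rw [htc, hpa]
  have hal : ∀ {p}, F.net.alive p → p ∈ K ∨ p = w ∨ p = b ∧ F.IsMerge b := by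
    intro p hp
    by_cases hpw : p = w
    · exact .inr (.inl hpw)
    by_cases hpb : p = b
    · subst hpb
      rcases hp with hp | hp
      · exact absurd hbo hp.outs_ne
      · exact .inr (.inr ⟨rfl, hp⟩)
    refine .inl (hK.2 ⟨?_, hpb, hpw⟩)
    rintro rfl
    rcases hwa with e | ⟨s, h1, h2⟩
    · exact hpw e.symm
    · exact not_alive_of (.inl ⟨hai, h1⟩) hp
  have halD : ∀ {p}, F.net.alive p → p ∈ D := fun hp => by
    rcases hal hp with h | rfl | ⟨rfl, h⟩
    exacts [hKD h, hwD, .inr ⟨hab.symm, fun _ => h⟩]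
  have hmb : F.IsMerge b → F'.IsMerge (φ b) := fun h => by
    obtain ⟨_, h1, h2⟩ := hbm h
    exact ⟨by simp [h2], by rw [h1]; simpa using h.2⟩
  refine hρ.iso hF.wf hF'.wf ⟨fun p hp => ?_,
    fun p hp q hq => hbij.injOn (halD hp) (halD hq), fun p' hp' => ?_⟩
    (fun p hp => ?_) (fun p hp => ?_) (fun p k hp hk => ?_) ?_ ?_
  · rcases hal hp with h | rfl | ⟨rfl, h⟩
    · exact (hC.alive h).2 hp
    · exact .inl hsplit'
    · exact .inr (hmb h)
  · rcases hsurj p' with ⟨p, hp, rfl⟩ | rfl | ⟨rfl, hb⟩ | hc | hc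
    · exact ⟨p, (hC.alive hp).1 hp', rfl⟩
    · exact ⟨w, .inl hw, rfl⟩
    · exact ⟨b, .inr hb, rfl⟩
    · obtain ⟨i, o, _, _, h5⟩ := hXk p' hc
      exact absurd hp' (not_alive_of (.inl ⟨hXs _ hc, h5⟩))
    · obtain ⟨u, hu⟩ := hXi' p' hc
      exact absurd hp' (not_alive_of (.inr ⟨hu, hXs' _ hc⟩))
  · rcases hal hp with h | rfl | ⟨rfl, h⟩
    · exact hC.isSplit h
    · exact ⟨fun _ => hw, fun _ => hsplit'⟩
    · exact ⟨fun h' => absurd (hmb h) h'.not_merge, fun h' => absurd h h'.not_merge⟩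
  · rcases hal hp with h | rfl | ⟨rfl, h⟩
    · exact hC.pcol p h
    · exact hφw
    · exact (hbm h).1
  · show ρ (F.port p k) (sh (if p = w then -1 else 0) (F'.port (φ p) k))
    rcases hal hp with h | rfl | ⟨rfl, h⟩
    · rw [if_neg (hK.1 h).2.2, sh_zero]
      refine hC.port h hF hp hk (fun s hs => .inl (r1 s 0 (hKt p h s hs)))
        (fun h0 => .inl (r3 p 0 h0 (hK.1 h).1)) fun c hc => ?_
      have hca : c ≠ a := by rintro rfl; exact (hK.1 h).2.1 (hc.right hBab)
      exact ⟨φ c, (hB _ _).2 (.inl ⟨c, p, hc, hca, rfl, rfl⟩), .inl (r3 c 1 hc.ins hca)⟩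
    · rw [if_pos rfl]
      rcases k with _ | k
      · rw [hsplit'.port_zero, hinsw]
        refine .inl ?_
        rcases hw.end_port with ⟨s, h1, h2⟩ | ⟨h1, h2⟩ <;> rw [h2]
        · exact r2 s 0 (ter_of_eq h1)
        · have : p = a := by
            rcases hwa with e | ⟨s, _, e⟩
            · exact e
            · rw [h1] at e; cases e
          subst this; exact r4 0
      · have hk' : k < (F.outs p).length := by rw [hw.deg] at hk; exact hk
        have h1 := getElem?_eq_getElem hk'
        have h2 := getElem?_eq_getElem (show k < (F'.outs (φ p)).length by omega)
        rw [hw.port_succ h1, hsplit'.port_succ h2]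
        exact .inr ⟨k, _, 0, h1, rfl, .inr ⟨_, h2, rfl⟩⟩
    · rw [if_neg hbw, sh_zero]
      obtain ⟨_, h1, h2⟩ := hbm h
      rcases k with _ | k
      · rw [(hmb h).port_zero, h2, h.port_zero, hbo, hBab.sourceOf]
        exact .inl (r4 1)
      · have hk' : k < (F.ins p).length := by rw [h.deg] at hk; exact hk
        have h3 := getElem?_eq_getElem hk'
        rw [h.port_succ h3, (hmb h).port_succ (s := π (F.ins p)[k]) (by rw [h1]; simp [hk'])]
        exact .inl (r1 _ 0 (by rw [ter_of_mem (getElem_mem hk')]; exact hbw))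
  · rintro (s | c)
    · by_cases hs : F.ter s = w
      · exact .inl ⟨_, .inl (r2 s 0 hs)⟩
      · exact .inl ⟨_, .inl (r1 s 0 hs)⟩
    · by_cases hc : F.ins c = []
      · by_cases hca : c = a
        · subst hca; exact .inl ⟨_, .inl (r4 0)⟩
        · exact .inl ⟨_, .inl (r3 c 0 hc hca)⟩
      · exact .inr (Closed.isolated hc)
  · rintro (s' | c')
    · refine .inl ?_
      have hm := mem_outs_ini s'
      rcases hsurj (F'.ini s') with ⟨p, hp, he⟩ | he | ⟨he, hb⟩ | hc | hc
      · rw [← he, hC.outs p hp, mem_map] at hm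
        obtain ⟨s, hs, rfl⟩ := hm
        exact ⟨(.inl s, 0), .inl (r1 s 0 (hKt p hp s (.inl (ini_of_mem hs))))⟩
      · rw [← he] at hm
        obtain ⟨i, hi, rfl⟩ := mem_iff_getElem.1 hm
        exact ⟨(.inl ((F.outs w)[i]'(by omega)), 1), .inr ⟨i, _, 1, getElem?_eq_getElem _, rfl,
          .inr ⟨_, getElem?_eq_getElem hi, by simp⟩⟩⟩
      · rw [← he, (hbm hb).2.2] at hm
        obtain rfl : s' = t := by simpa using hm
        exact ⟨(.inr a, 1), .inl (r4 1)⟩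
      · obtain ⟨i, o, _, h4, h5⟩ := hXk _ hc
        rw [h5] at hm
        obtain rfl : s' = π o := by simpa using hm
        exact ⟨(.inl o, 0), .inl (r1 o 0 (how o (mem_of_getElem? h4)))⟩
      · rw [hXs' _ hc] at hm; cases hm
    · by_cases hc' : F'.ins c' = []
      · refine .inl ?_
        rcases hsurj c' with ⟨p, hp, rfl⟩ | rfl | ⟨rfl, hb⟩ | hc | hc
        · exact ⟨(.inr p, 0), .inl (r3 p 0 ((hC.ins_eq_nil hp).1 hc') (hK.1 hp).1)⟩
        · rw [hinsw] at hc'; cases hc'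
        · have := (hbm hb).2.1; rw [hc'] at this; exact absurd (map_eq_nil_iff.1 this.symm) hb.ins_ne
        · obtain ⟨i, o, h3, h4, h5⟩ := hXk c' hc
          exact ⟨_, .inr ⟨i, o, 0, h4, rfl, .inl ⟨c', h3, rfl⟩⟩⟩
        · obtain ⟨u, hu⟩ := hXi' c' hc
          rw [hc'] at hu; cases hu
      · exact .inr (Closed.isolated hc')

end StrandDiagram

namespace Net

variable {N N' : Net Γ}

/-- The net seen upside-down. -/
abbrev neg (N : Net Γ) : Net Γ := { N with
    split := fun p => ¬ N.split p
    port := fun p k => ((N.port p k).1, -(N.port p k).2)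
    gen := fun x y => N.gen (y.1, -y.2) (x.1, -x.2) }

lemma neg_rel {x y} : N.neg.Rel x y ↔ N.Rel (x.1, -x.2) (y.1, -y.2) := by
  constructor
  · intro h
    induction h with
    | rel x y h => exact (rel_of_gen (N := N) (x := (y.1, -y.2)) (y := (x.1, -x.2)) h).symm
    | refl x => exact .refl _
    | symm x y _ ih => exact ih.symm
    | trans x y z _ _ ih₁ ih₂ => exact ih₁.trans ih₂
  · have : ∀ x y, N.Rel x y → N.neg.Rel (x.1, -x.2) (y.1, -y.2) := by
      intro x y h
      induction h with
      | rel x y h =>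
        refine Rel.symm (rel_of_gen ?_)
        show N.gen _ _
        simpa using h
      | refl x => exact .refl _
      | symm x y _ ih => exact ih.symm
      | trans x y z _ _ ih₁ ih₂ => exact ih₁.trans ih₂
    intro h
    simpa using this _ _ h

lemma WF.neg (h : N.WF) : N.neg.WF where
  gen_sh n x y hg := by
    have := h.gen_sh (-n) _ _ hg
    simpa [Net.neg, sh, add_comm] using this
  gen_right x y z h1 h2 := by
    have := h.gen_left _ _ _ h1 h2
    simpa [Prod.ext_iff] using this
  gen_left x y z h1 h2 := by
    have := h.gen_right _ _ _ h1 h2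
    simpa [Prod.ext_iff] using this
  gen_col x y hg := (h.gen_col _ _ hg).symm
  deg_ge := h.deg_ge
  col_zero := h.col_zero
  col_succ := h.col_succ
  start_gen p k x n hp hk hs hg := by
    refine h.end_gen p k (x.1, -x.2) (-n) hp hk (by tauto) ?_
    simpa [Net.neg, sh, add_comm] using hg
  start_inj p k q l hp hk hs hq hl hs' he := h.end_inj p k q l hp hk (by tauto) hq hl (by tauto) he
  end_gen p k x n hp hk hs hg := by
    refine h.start_gen p k (x.1, -x.2) (-n) hp hk (by tauto) ?_
    simpa [Net.neg, sh, add_comm] using hg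
  end_inj p k q l hp hk hs hq hl hs' he := h.start_inj p k q l hp hk (by tauto) hq hl (by tauto) he

lemma neg_portIso {e f} (h : PortIso N N' e f) : PortIso N.neg N'.neg e fun p => - f p where
  bij := h.bij
  split p hp := not_congr (h.split p hp)
  col := h.col
  rel p q k l n hp hq hk hl := by
    have := h.rel p q k l (-n) hp hq hk hl
    rw [neg_rel, neg_rel]
    simpa [Net.neg, sh, add_comm, add_left_comm, add_assoc] using this

lemma WF.neg_loops (h : N.WF) : N.neg.loops = N.loops := by
  have hs : N.neg.Same = N.Same := by
    funext s t
    exact propext ⟨fun ⟨n, hn⟩ => ⟨-n, by simpa using neg_rel.1 hn⟩,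
      fun ⟨n, hn⟩ => ⟨-n, neg_rel.2 (by simpa using hn)⟩⟩
  have hr : ∀ (s : N.S) (m : ℤ), N.neg.Rel (s, 0) (s, m) ↔ N.Rel (s, 0) (s, m) := by
    intro s m
    rw [neg_rel, ← h.rel_sh m, rel_comm]
    simp
  have hp : ∀ s : N.S, N.neg.Portless (s, 0) ↔ N.Portless (s, 0) := by
    intro s
    constructor
    · intro hs p k n hpa hk hrel
      exact hs p k (-n) hpa hk (neg_rel.2 (by simpa [sh, add_comm] using hrel))
    · intro hs p k n hpa hk hrel
      exact hs p k (-n) hpa hk (by simpa [sh, add_comm] using neg_rel.1 hrel)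
  have hl : N.neg.IsLoop = N.IsLoop := funext fun s => propext
    (and_congr (hp s) (exists_congr fun m => and_congr_right fun _ => hr s m))
  have hw : N.neg.winding = N.winding := funext fun s => by
    unfold winding
    exact congrArg _ (Set.ext fun m => and_congr_right fun _ => hr s m)
  have key : ∀ (r r' : N.S → N.S → Prop) (P P' : N.S → Prop) (g g' : N.S → ℕ), r = r' → P = P' →
      g = g' → (Set.toFinite {q : Quot r | ∃ s, Quot.mk _ s = q ∧ True ∧ P s}).toFinset.val.map
        (fun q => (N.scol q.out, g q.out)) =
      (Set.toFinite {q : Quot r' | ∃ s, Quot.mk _ s = q ∧ True ∧ P' s}).toFinset.val.map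
        (fun q => (N.scol q.out, g' q.out)) := by
    rintro r _ P _ g _ rfl rfl rfl; rfl
  exact key _ _ _ _ _ _ hs hl hw

/-- The part of a net consisting of some of its strands. -/
abbrev sub (N : Net Γ) (T : N.S → Prop) : Net Γ :=
  { N with gen := fun x y => N.gen x y ∧ T x.1 }

lemma WF.sub (h : N.WF) (T : N.S → Prop) : (N.sub T).WF where
  gen_sh n x y hg := ⟨h.gen_sh n x y hg.1, hg.2⟩
  gen_right x y z h1 h2 := h.gen_right x y z h1.1 h2.1
  gen_left x y z h1 h2 := h.gen_left x y z h1.1 h2.1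
  gen_col x y hg := h.gen_col x y hg.1
  deg_ge := h.deg_ge
  col_zero := h.col_zero
  col_succ := h.col_succ
  start_gen p k x n hp hk hs hg := h.start_gen p k x n hp hk hs hg.1
  start_inj := h.start_inj
  end_gen p k x n hp hk hs hg := h.end_gen p k x n hp hk hs hg.1
  end_inj := h.end_inj

section sub
variable {T : N.S → Prop} (hT : ∀ x y, N.gen x y → (T x.1 ↔ T y.1))
include hT

lemma sub_closed {x y} (h : N.Rel x y) : T x.1 ↔ T y.1 :=
  EqvGen.iff_of_closed (T := fun x => T x.1) hT h

lemma sub_rel {x y} (hx : T x.1) : (N.sub T).Rel x y ↔ N.Rel x y := by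
  refine ⟨EqvGen.of_imp fun _ _ h => EqvGen.rel _ _ h.1, fun h => ?_⟩
  induction h with
  | rel x y h => exact rel_of_gen ⟨h, hx⟩
  | refl x => exact .refl _
  | symm x y h ih => exact (ih ((sub_closed hT h).2 hx)).symm
  | trans x y z h1 _ ih₁ ih₂ => exact (ih₁ hx).trans (ih₂ ((sub_closed hT h1).1 hx))

lemma WF.sub_loops (h : N.WF) :
    (N.sub T).loops = N.loopsIn T := by
  have hpl : ∀ s n, T s → ((N.sub T).Portless (s, n) ↔ N.Portless (s, n)) := fun s n hs =>
    forall_congr' fun p => forall_congr' fun k => forall_congr' fun n =>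
      forall_congr' fun _ => forall_congr' fun _ => not_congr (sub_rel hT (x := (s, _)) hs)
  have hl : ∀ s, T s → ((N.sub T).IsLoop s ↔ N.IsLoop s) := fun s hs =>
    and_congr (hpl s 0 hs) (exists_congr fun m => and_congr_right fun _ =>
      sub_rel hT (x := (s, 0)) hs)
  have hn : ∀ s, (N.sub T).IsLoop s → T s := by
    intro s hs
    by_contra hTs
    refine not_isLoop_of_isolated (N := N.sub T) (fun y => ⟨fun hg => hTs hg.2, fun hg => ?_⟩) hs
    exact hTs ((hT _ _ hg.1).1 hg.2)
  refine loopsIn_congr (h.sub T) h (fun x x' => x = x' ∧ T x.1) ?_ ?_ ?_ ?_ ?_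
  · rintro x _ y _ ⟨rfl, hx⟩ ⟨rfl, _⟩
    exact sub_rel hT hx
  · rintro n x _ ⟨rfl, hx⟩
    exact ⟨rfl, hx⟩
  · rintro x _ ⟨rfl, hx⟩; rfl
  · intro s _ hs
    exact ⟨_, ⟨rfl, hn s hs⟩, hn s hs, (hl s (hn s hs)).1 hs⟩
  · intro s hs hs'
    exact ⟨_, ⟨rfl, hs⟩, trivial, (hl s hs).2 hs'⟩

end sub

lemma PortIso.of_sub {T : N.S → Prop} {T' : N'.S → Prop} (hT : ∀ x y, N.gen x y → (T x.1 ↔ T y.1))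
    (hT' : ∀ x y, N'.gen x y → (T' x.1 ↔ T' y.1))
    (hp : ∀ p k, N.alive p → k ≤ N.deg p → T (N.port p k).1)
    (hp' : ∀ p k, N'.alive p → k ≤ N'.deg p → T' (N'.port p k).1) {e f}
    (h : PortIso (N.sub T) (N'.sub T') e f) : PortIso N N' e f where
  bij := h.bij
  split := h.split
  col := h.col
  rel p q k l n ha hb hk hl := by
    have hd : N'.deg (e p) = N.deg p := h.deg ha
    rw [← sub_rel hT (hp p k ha hk), ← sub_rel hT' (x := sh _ _) (hp' (e p) k (h.alive ha) (hd.symm ▸ hk))]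
    exact h.rel p q k l n ha hb hk hl

end Net

namespace StrandDiagram

variable {F F' : StrandDiagram Γ}

lemma flip_base {a b : F.Point} : F.flip.Base b a ↔ F.Base a b := by
  have : ∀ l l' : List F.Point, (b, a) ∈ l'.zip l ↔ (a, b) ∈ l.zip l' := fun l l' => by
    rw [← zip_swap, mem_map]
    simp
  exact this _ _

lemma Closed.flip (h : F.Closed) : F.flip.Closed := Eq.symm h

/-- The net of the upside-down diagram. -/
lemma flip_iso (hF : F.Closed) : F.net.neg.Iso F.flip.net id fun _ => 0 := by
  let ρ : (F.Strand ⊕ F.Point) × ℤ → (F.Strand ⊕ F.Point) × ℤ → Prop := fun x x' =>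
    (∃ s n, x = (.inl s, n) ∧ x' = (.inl s, n)) ∨ ∃ a b n, F.Base a b ∧ x = (.inr a, n) ∧ x' = (.inr b, 1 + n)
  have hρ : F.net.neg.Corr F.flip.net ρ := by
    refine ⟨?_, ?_, ?_, ?_, ?_, ?_⟩
    · rintro n _ _ (⟨s, m, rfl, rfl⟩ | ⟨a, b, m, h, rfl, rfl⟩)
      · exact .inl ⟨s, m + n, rfl, rfl⟩
      · exact .inr ⟨a, b, m + n, h, rfl, Prod.ext rfl (add_assoc _ _ _)⟩
    · rintro _ _ _ (⟨s, m, rfl, rfl⟩ | ⟨a, b, m, h, rfl, rfl⟩) (⟨s', m', h1, rfl⟩ | ⟨a', b', m', h', h1, rfl⟩)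
      · cases h1; exact .refl _
      · cases h1
      · cases h1
      · cases h1
        rw [h.right h']; exact .refl _
    · rintro _ _ _ (⟨s, m, rfl, rfl⟩ | ⟨a, b, m, h, rfl, rfl⟩) (⟨s', m', rfl, h1⟩ | ⟨a', b', m', h', rfl, h1⟩)
      · cases h1; exact .refl _
      · cases h1
      · cases h1
      · simp only [Prod.mk.injEq, Sum.inr.injEq, add_right_inj] at h1
        obtain ⟨rfl, rfl⟩ := h1
        rw [h.left h']; exact .refl _
    · rintro ⟨x, n⟩ ⟨y, m⟩ hg
      change F.Gen (y, -m) (x, -n) at hg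
      generalize hn : -n = n' at hg
      generalize hm : -m = m' at hg
      obtain rfl : n = -n' := by omega
      obtain rfl : m = -m' := by omega
      rcases hg with ⟨a, s, m, h1, h2⟩ | ⟨a, b, s, m, h1, h2⟩ | ⟨p, s, t, m, h1, h2⟩
      · obtain ⟨b, hb⟩ := hF.exists_sink h1
        refine ⟨_, _, .inl ⟨s, _, rfl, rfl⟩, .inr ⟨a, b, _, hb, rfl, rfl⟩, ?_⟩
        rw [add_comm]
        exact Gen.snk' (F := F.flip) _ (flip_base.2 hb) h2
      · refine ⟨_, _, .inr ⟨a, b, _, h1, rfl, rfl⟩, .inl ⟨s, _, rfl, rfl⟩, ?_⟩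
        rw [show ∀ z : ℤ, 1 + -(z + 1) = -z from fun z => by ring]
        exact Gen.src' (F := F.flip) _ h1.outs h2
      · exact ⟨_, _, .inl ⟨t, _, rfl, rfl⟩, .inl ⟨s, _, rfl, rfl⟩, Gen.deg' (F := F.flip) (p := p) _ h2 h1⟩
    · rintro x y (⟨b, s, m, h1, h2⟩ | ⟨b, a, s, m, h1, h2⟩ | ⟨p, s, t, m, h1, h2⟩)
      · change F.outs b = [] at h1
        change F.ins b = [s] at h2
        obtain ⟨a, ha⟩ := hF.exists_source h1
        refine ⟨_, _, .inr ⟨a, b, m - 1, ha, rfl, Prod.ext rfl (add_sub_cancel 1 m).symm⟩, .inl ⟨s, m, rfl, rfl⟩, ?_⟩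
        refine Net.neg_rel.2 (Net.Rel.symm ?_)
        have := Gen.snk' (-m) ha h2
        simpa [sub_eq_add_neg, add_comm] using this
      · have ha := flip_base.1 h1
        refine ⟨_, _, .inl ⟨s, m, rfl, rfl⟩, .inr ⟨a, b, m, ha, rfl, Prod.ext rfl (add_comm m 1)⟩, ?_⟩
        exact Net.neg_rel.2 (Gen.src' (-m) ha.ins h2).symm
      · exact ⟨_, _, .inl ⟨s, m, rfl, rfl⟩, .inl ⟨t, m, rfl, rfl⟩,
          Net.neg_rel.2 (Gen.deg' (F := F) (p := p) (-m) h2 h1).symm⟩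
    · rintro _ _ (⟨s, m, rfl, rfl⟩ | ⟨a, b, m, h, rfl, rfl⟩)
      · rfl
      · exact hF.base_col h
  refine hρ.iso hF.wf.neg hF.flip.wf ⟨fun p hp => Or.symm hp, Set.injOn_id _, fun p hp => ⟨p, Or.symm hp, rfl⟩⟩
    (fun p hp => ?_) (fun _ _ => rfl) (fun p k hp hk => ?_) ?_ ?_
  · show F.IsMerge p ↔ ¬ F.IsSplit p
    rcases hp with hp | hp
    · exact ⟨fun h => absurd h hp.not_merge, fun h => absurd hp h⟩
    · exact ⟨fun _ h => h.not_merge hp, fun _ => hp⟩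
  · rw [sh_zero]
    show ρ ((F.port p k).1, -(F.port p k).2) (F.flip.port p k)
    have hone : ∀ s, ρ ((.inl s : F.Strand ⊕ F.Point), -0) (.inl s, 0) := fun s => .inl ⟨s, 0, rfl, rfl⟩
    rcases hp with hp | hp
    · have hp' : F.flip.IsMerge p := hp
      rcases k with _ | k
      · rcases hp.end_port with ⟨s, h1, h2⟩ | ⟨h1, h2⟩ <;> rw [h2, hp'.port_zero]
        · rw [show F.flip.outs p = [s] from h1]; exact hone s
        · rw [show F.flip.outs p = [] from h1]
          obtain ⟨b, hb⟩ := hF.exists_sink h1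
          rw [(flip_base.2 hb).sourceOf]
          exact .inr ⟨p, b, 0, hb, rfl, rfl⟩
      · have hk : k + 1 ≤ F.net.deg p := hk
        rw [hp.deg] at hk
        have h3 := getElem?_eq_getElem (show k < (F.outs p).length from hk)
        rw [hp.port_succ h3, hp'.port_succ (s := (F.outs p)[k]) h3]
        exact hone _
    · have hp' : F.flip.IsSplit p := hp
      rcases k with _ | k
      · rcases hp.start_port hF with ⟨s, h1, h2⟩ | ⟨h1, a, ha, h2⟩ <;> rw [h2, hp'.port_zero]
        · rw [show F.flip.ins p = [s] from h1]; exact hone s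
        · rw [show F.flip.ins p = [] from h1]
          exact .inr ⟨a, p, -1, ha, rfl, rfl⟩
      · have hk : k + 1 ≤ F.net.deg p := hk
        rw [hp.deg] at hk
        have h3 := getElem?_eq_getElem (show k < (F.ins p).length from hk)
        rw [hp.port_succ h3, hp'.port_succ (s := (F.ins p)[k]) h3]
        exact hone _
  · rintro (s | a)
    · exact .inl ⟨_, .inl ⟨s, 0, rfl, rfl⟩⟩
    · by_cases ha : F.ins a = []
      · obtain ⟨b, hb⟩ := hF.exists_sink ha
        exact .inl ⟨_, .inr ⟨a, b, 0, hb, rfl, rfl⟩⟩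
      · refine .inr fun y => ⟨fun h => ?_, fun h => ?_⟩
        · exact (Closed.isolated ha _).2 h
        · exact (Closed.isolated ha _).1 h
  · rintro (s | b)
    · exact .inl ⟨_, .inl ⟨s, 0, rfl, rfl⟩⟩
    · by_cases hb : F.outs b = []
      · obtain ⟨a, ha⟩ := hF.exists_source hb
        exact .inl ⟨_, .inr ⟨a, b, -1, ha, rfl, rfl⟩⟩
      · exact .inr (Closed.isolated (F := F.flip) hb)

/-- Isomorphisms of upside-down diagrams give isomorphisms. -/
lemma portIso_of_flip (hF : F.Closed) (hF' : F'.Closed) {e f}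
    (h : Net.PortIso F.flip.net F'.flip.net e f) : Net.PortIso F.net F'.net e fun p => -f p := by
  have h1 := Net.neg_portIso h
  have h2 : Net.PortIso F'.flip.net.neg F'.net id fun _ => 0 := (flip_iso hF'.flip).port
  have h3 : Net.PortIso F.flip.net.neg F.net id fun _ => 0 := (flip_iso hF.flip).port
  have h4 : Net.PortIso F.net F.flip.net.neg id fun _ => 0 := by
    refine ⟨?_, fun p hp => ?_, fun _ _ => rfl, fun p q k l n hp hq hk hl => ?_⟩
    · exact ⟨fun p hp => Or.symm hp, Set.injOn_id _, fun p hp => ⟨p, Or.symm hp, rfl⟩⟩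
    · exact (h3.split p (Or.symm hp)).symm
    · have := h3.rel p q k l n (Or.symm hp) (Or.symm hq) hk hl
      simp only [sh_zero, add_zero] at this ⊢
      exact this.symm
  have h5 := (h4.trans hF.flip.wf.neg hF'.flip.wf.neg h1).trans hF'.flip.wf.neg hF'.wf h2
  refine Eq.mp (congrArg (fun g => Net.PortIso F.net F'.net e g) ?_) h5
  funext p
  simp

lemma loops_flip (hF : F.Closed) : F.flip.net.loops = F.net.loops := by
  rw [← (flip_iso hF).loops, hF.wf.neg_loops]

/-- The strands of the base points in `X`. -/
def Block (F : StrandDiagram Γ) (X : List F.Point) (t : F.Strand ⊕ F.Point) : Prop :=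
  (∃ a ∈ X, t = .inr a) ∨ ∃ s, F.ini s ∈ X ∧ t = .inl s

/-- A block of loops between the base points with sources `X` and sinks `X'`. -/
structure LoopBlock (F : StrandDiagram Γ) (d k : ℕ) (X X' : List F.Point) : Prop where
  loops : F.FormLoops d k X X'
  base : ∃ A B A' B', F.sources = A ++ X ++ B ∧ F.sinks = A' ++ X' ++ B' ∧ A.length = A'.length

namespace LoopBlock

variable {d k : ℕ} {X X' : List F.Point} (h : F.LoopBlock d k X X')
include h

lemma len : X.length = X'.length := h.loops.1.trans h.loops.2.1.symm

lemma base_zip {a b} (hab : (a, b) ∈ X.zip X') : F.Base a b := by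
  obtain ⟨A, B, A', B', h1, h2, h3⟩ := h.base
  unfold Base
  rw [h1, h2, zip_append (by simp [h3, h.loops.1, h.loops.2.1]), zip_append h3]
  simp [hab]

lemma exists_snk {a} (ha : a ∈ X) : ∃ b, (a, b) ∈ X.zip X' := by
  obtain ⟨i, hi, rfl⟩ := mem_iff_getElem.1 ha
  have := h.len
  exact ⟨X'[i]'(by omega), mem_iff_getElem.2 ⟨i, by simp only [length_zip]; omega, by simp⟩⟩

lemma exists_src {b} (hb : b ∈ X') : ∃ a, (a, b) ∈ X.zip X' := by
  obtain ⟨i, hi, rfl⟩ := mem_iff_getElem.1 hb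
  have := h.len
  exact ⟨X[i]'(by omega), mem_iff_getElem.2 ⟨i, by simp only [length_zip]; omega, by simp⟩⟩

lemma mem_iff {a b} (hab : F.Base a b) : a ∈ X ↔ b ∈ X' := by
  constructor
  · intro ha
    obtain ⟨c, hc⟩ := h.exists_snk ha
    rw [hab.right (h.base_zip hc)]
    exact (of_mem_zip hc).2
  · intro hb
    obtain ⟨c, hc⟩ := h.exists_src hb
    rw [hab.left (h.base_zip hc)]
    exact (of_mem_zip hc).1

lemma out {a} (ha : a ∈ X) : F.ins a = [] ∧ ∃ s, F.outs a = [s] ∧ F.ter s ∈ X' := by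
  refine ⟨h.loops.2.2.1 a ha, ?_⟩
  have h5 := h.loops.2.2.2.2
  obtain ⟨i, hi, rfl⟩ := mem_iff_getElem.1 ha
  obtain ⟨s, h1, h2⟩ := h5.get hi (h5.length_eq ▸ hi)
  refine ⟨s, h1, ?_⟩
  rw [ter_of_eq h2]
  exact mem_rotate.1 (get_mem _ _)

lemma inn {b} (hb : b ∈ X') : F.outs b = [] ∧ ∃ s, F.ins b = [s] ∧ F.ini s ∈ X := by
  refine ⟨h.loops.2.2.2.1 b hb, ?_⟩
  have h5 := h.loops.2.2.2.2
  obtain ⟨i, hi, rfl⟩ := mem_iff_getElem.1 (mem_rotate.2 hb : b ∈ X'.rotate d)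
  obtain ⟨s, h1, h2⟩ := h5.get (h5.length_eq ▸ hi) hi
  refine ⟨s, h2, ?_⟩
  rw [ini_of_eq h1]
  exact get_mem _ _

lemma ini_iff {s} : F.ini s ∈ X ↔ F.ter s ∈ X' := by
  constructor
  · intro hs
    obtain ⟨_, u, h1, h2⟩ := h.out hs
    have := mem_outs_ini s
    obtain rfl : s = u := by simpa [h1] using this
    exact h2
  · intro hs
    obtain ⟨_, u, h1, h2⟩ := h.inn hs
    have := mem_ins_ter s
    obtain rfl : s = u := by simpa [h1] using this
    exact h2

lemma ini_not {s} : F.ini s ∉ X' := fun hs => by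
  exact ini_ne (h.inn hs).1 rfl

lemma ter_not {s} : F.ter s ∉ X := fun hs => by
  exact ter_ne (h.out hs).1 rfl

lemma not_alive {p} (hp : F.net.alive p) : p ∉ X ∧ p ∉ X' := by
  refine ⟨fun hX => ?_, fun hX => ?_⟩
  · obtain ⟨h1, s, h2, _⟩ := h.out hX
    exact not_alive_of (.inl ⟨h1, h2⟩) hp
  · obtain ⟨h1, s, h2, _⟩ := h.inn hX
    exact not_alive_of (.inr ⟨h2, h1⟩) hp

lemma closed (x y) (hg : F.Gen x y) : F.Block X x.1 ↔ F.Block X y.1 := by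
  rcases hg with ⟨a, s, n, h1, h2⟩ | ⟨a, b, s, n, h1, h2⟩ | ⟨p, s, t, n, h1, h2⟩
  · have := ini_of_eq h2
    simp [Block, this]
  · have := ter_of_eq h2
    simp [Block, h.ini_iff, this, h.mem_iff h1]
  · have e1 := ter_of_eq h1
    have e2 := ini_of_eq h2
    simp only [Block, reduceCtorEq, and_false, exists_false, Sum.inl.injEq, exists_eq_right', false_or]
    rw [h.ini_iff, e1, e2]
    constructor
    · intro hX; rw [(h.inn hX).1] at h2; cases h2
    · intro hX; rw [(h.out hX).1] at h1; cases h1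

lemma port_not (hF : F.Closed) (p k) (hp : F.net.alive p) (hk : k ≤ F.net.deg p) :
    ¬ F.Block X (F.port p k).1 := by
  have hp' := h.not_alive hp
  by_cases hs : F.IsSplit p ↔ k = 0
  · rcases port_end hp hk hs with ⟨s, h1, h2, _⟩ | ⟨h1, _⟩ <;> rw [h1]
    · simp [Block, h.ini_iff, h2, hp'.2]
    · simp [Block, hp'.1]
  · rcases hF.port_start hp hk (by tauto) with ⟨s, h1, h2, _⟩ | ⟨a, h1, h2, _⟩ <;> rw [h1]
    · simp [Block, h2, hp'.1]
    · simp [Block, h.mem_iff h2, hp'.2]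

end LoopBlock

lemma block_mod {d k j : ℕ} (hk : 1 ≤ k) (hj : j < k * d) :
    (j + d) % (k * d) < k * d ∧ (j + d) % (k * d) % d = j % d ∧
      (k : ℤ) ∣ (((j + d) % (k * d) / d : ℕ) : ℤ) - ((j / d : ℕ) : ℤ) - 1 := by
  have hd : 0 < d := Nat.pos_of_ne_zero (by rintro rfl; simp at hj)
  refine ⟨Nat.mod_lt _ (by positivity), by rw [Nat.mod_mul_left_mod, Nat.add_mod_right], ?_⟩
  rw [Nat.mod_mul_left_div_self, Nat.add_div_right _ hd]
  have := Int.emod_emod_of_dvd ((j / d + 1 : ℕ) : ℤ) (dvd_refl (k : ℤ))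
  push_cast at *
  rw [sub_sub]
  exact Int.ModEq.dvd (Int.ModEq.symm this)

lemma LoopBlock.loops_eq (hF : F.Closed) {d k : ℕ} {X X' : List F.Point} (hk : 1 ≤ k)
    (h : F.LoopBlock d k X X') :
    F.net.loopsIn (F.Block X) = ((X.take d).map fun a => (F.pcol a, k) : List (V × ℕ)) := by
  rcases Nat.eq_zero_or_pos d with rfl | hd
  · have hX : X = [] := List.eq_nil_of_length_eq_zero (by simpa using h.loops.1)
    subst hX
    rw [Net.loopsIn_eq_zero]
    · simp
    · rintro s (⟨_, h, _⟩ | ⟨_, h, _⟩) <;> cases h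
  have hlen := h.loops.1
  have hlen' := h.loops.2.1
  have h0 : 0 < k * d := by positivity
  have : Nonempty F.Point := ⟨X[0]'(by omega)⟩
  have hinh : Inhabited F.Point := Classical.inhabited_of_nonempty this
  obtain ⟨x, hx⟩ : ∃ x : ℕ → F.Point, ∀ j (hj : j < k * d), x j = X[j] :=
    ⟨fun j => X.getD j default, fun j hj => by simp [List.getD, hlen, hj]⟩
  obtain ⟨y, hy⟩ : ∃ y : ℕ → F.Point, ∀ j (hj : j < k * d), y j = X'[j] :=
    ⟨fun j => X'.getD j default, fun j hj => by simp [List.getD, hlen', hj]⟩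
  have hσ' : ∀ j, ∃ s, j < k * d → F.outs (x j) = [s] ∧ F.ins (y ((j + d) % (k * d))) = [s] := by
    intro j
    by_cases hj : j < k * d
    · have h5 := h.loops.2.2.2.2
      obtain ⟨s, h1, h2⟩ := h5.get (hlen ▸ hj) (by simpa [hlen'] using hj)
      refine ⟨s, fun _ => ⟨by rw [hx j hj]; exact h1, ?_⟩⟩
      rw [hy _ (Nat.mod_lt _ h0)]
      simpa [List.getElem_rotate, hlen'] using h2
    · obtain ⟨_, s, _⟩ := h.out (getElem_mem (show 0 < X.length by omega))
      exact ⟨s, fun h => absurd h hj⟩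
  choose σ hσ using hσ'
  have hxX : ∀ j < k * d, x j ∈ X := fun j hj => hx j hj ▸ getElem_mem _
  have hXx : ∀ a ∈ X, ∃ j < k * d, a = x j := fun a ha => by
    obtain ⟨j, hj, rfl⟩ := mem_iff_getElem.1 ha
    exact ⟨j, hlen ▸ hj, (hx j (hlen ▸ hj)).symm⟩
  have hxi : ∀ i < k * d, ∀ j < k * d, x i = x j → i = j := fun i hi j hj he => by
    rw [hx i hi, hx j hj] at he
    obtain ⟨A, B, _, _, h1, _⟩ := h.base
    have := F.sources_nodup
    rw [h1] at this
    exact ((nodup_append.1 (nodup_append.1 this).1).2.1.getElem_inj_iff).1 he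
  have hb : ∀ j < k * d, F.Base (x j) (y j) := fun j hj => by
    apply h.base_zip
    rw [hx j hj, hy j hj]
    exact mem_iff_getElem.2 ⟨j, by simp [hlen, hlen', hj], by simp⟩
  have hins : ∀ j < k * d, F.ins (x j) = [] := fun j hj => (hb j hj).ins
  have step : ∀ j < k * d, ∀ n, F.net.Rel (.inr (x j), n) (.inr (x ((j + d) % (k * d))), n + 1) :=
    fun j hj n => (Gen.src' n (hins j hj) (hσ j hj).1).trans
      (Gen.snk' n (hb _ (Nat.mod_lt _ h0)) (hσ j hj).2)
  have path : ∀ i < d, ∀ l < k, F.net.Rel (.inr (x i), 0) (.inr (x (i + l * d)), (l : ℤ)) := by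
    intro i hi l
    induction l with
    | zero => intro _; simpa using .refl _
    | succ l ih =>
      intro hl
      have h1 : i + l * d + d < k * d := by
        have : (l + 1 + 1) * d ≤ k * d := Nat.mul_le_mul_right _ hl
        have e : (l + 1 + 1) * d = l * d + d + d := by ring
        omega
      have h2 := step (i + l * d) (by omega) l
      rw [Nat.mod_eq_of_lt h1] at h2
      have e : i + (l + 1) * d = i + l * d + d := by ring
      rw [e]; push_cast
      exact (ih (by omega)).trans h2
  have full : ∀ i < d, F.net.Rel (.inr (x i), 0) (.inr (x i), (k : ℤ)) := by
    intro i hi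
    have h1 := path i hi (k - 1) (by omega)
    have e : (k - 1) * d + d = k * d := by
      rw [← Nat.succ_mul]; congr 1; omega
    have h2 := step (i + (k - 1) * d) (by omega) ((k - 1 : ℕ) : ℤ)
    rw [add_assoc, e, Nat.add_mod_right, Nat.mod_eq_of_lt (by nlinarith)] at h2
    have := h1.trans h2
    rwa [show (((k - 1 : ℕ) : ℤ) + 1) = (k : ℤ) by omega] at this
  let T : ℕ → (F.Strand ⊕ F.Point) × ℤ → Prop := fun i z =>
    ∃ j < k * d, (z.1 = .inr (x j) ∨ z.1 = .inl (σ j)) ∧ j % d = i ∧ (k : ℤ) ∣ z.2 - ((j / d : ℕ) : ℤ)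
  have hT : ∀ i z z', F.Gen z z' → (T i z ↔ T i z') := by
    have hini : ∀ j < k * d, F.ini (σ j) = x j := fun j hj => ini_of_eq (hσ j hj).1
    have hter : ∀ j < k * d, F.ter (σ j) = y ((j + d) % (k * d)) := fun j hj => ter_of_eq (hσ j hj).2
    have hdvd : ∀ j < k * d, ∀ n : ℤ, (k : ℤ) ∣ n - ((j / d : ℕ) : ℤ) ↔
        (k : ℤ) ∣ n + 1 - (((j + d) % (k * d) / d : ℕ) : ℤ) := by
      intro j hj n
      have h1 := (block_mod hk hj).2.2
      constructor
      · intro h2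
        have := dvd_sub h2 h1
        ring_nf at this ⊢
        exact this
      · intro h2
        have := dvd_add h2 h1
        ring_nf at this ⊢
        exact this
    rintro i _ _ (⟨a, s, n, h1, h2⟩ | ⟨a, b, s, n, h1, h2⟩ | ⟨p, s, t, n, h1, h2⟩)
    · refine exists_congr fun j => and_congr_right fun hj => and_congr_left fun _ => ?_
      simp only [Sum.inr.injEq, reduceCtorEq, or_false, Sum.inl.injEq, false_or]
      constructor
      · rintro rfl
        rw [(hσ j hj).1] at h2
        simpa using h2.symm
      · rintro rfl
        rw [← hini j hj, ini_of_eq h2]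
    · have e1 := ter_of_eq h2
      constructor
      · rintro ⟨j, hj, hs, h3, h4⟩
        simp only [reduceCtorEq, Sum.inl.injEq, false_or] at hs
        subst hs
        rw [hter j hj] at e1
        refine ⟨(j + d) % (k * d), Nat.mod_lt _ h0, .inl ?_, ?_, (hdvd j hj n).1 h4⟩
        · rw [h1.left (e1 ▸ hb _ (Nat.mod_lt _ h0))]
        · rw [(block_mod hk hj).2.1, h3]
      · rintro ⟨j', hj', hs, h3, h4⟩
        simp only [reduceCtorEq, Sum.inr.injEq, or_false] at hs
        subst hs
        have hdk : d ≤ k * d := Nat.le_mul_of_pos_left d hk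
        set j := (j' + (k * d - d)) % (k * d) with hjd
        have hj : j < k * d := Nat.mod_lt _ h0
        have hjj : (j + d) % (k * d) = j' := by
          rw [hjd, Nat.mod_add_mod, add_assoc, Nat.sub_add_cancel hdk, Nat.add_mod_right,
            Nat.mod_eq_of_lt hj']
        have hby : b = y j' := h1.right (hb j' hj')
        have hs : σ j = s := by
          have := (hσ j hj).2
          rw [hjj, ← hby, h2] at this
          simpa using this.symm
        refine ⟨j, hj, .inr (congrArg _ hs.symm), ?_, ?_⟩
        · rw [← (block_mod hk hj).2.1, hjj, h3]
        · rw [hdvd j hj n, hjj]; exact h4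
    · have e1 := ter_of_eq h1
      have e2 := ini_of_eq h2
      constructor
      · rintro ⟨j, hj, hs, _⟩
        simp only [reduceCtorEq, Sum.inl.injEq, false_or] at hs
        rw [hs, hter j hj] at e1
        rw [← e1, (hb _ (Nat.mod_lt _ h0)).outs] at h2; cases h2
      · rintro ⟨j, hj, hs, _⟩
        simp only [reduceCtorEq, Sum.inl.injEq, false_or] at hs
        rw [hs, hini j hj] at e2
        rw [← e2, hins j hj] at h1; cases h1
  have hT' : ∀ i z z', F.net.Rel z z' → (T i z ↔ T i z') := fun i z z' hr => EqvGen.iff_of_closed (hT i) hr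
  have hstart : ∀ i < d, T i (.inr (x i), 0) := fun i hi =>
    ⟨i, by nlinarith, .inl rfl, Nat.mod_eq_of_lt hi, by simp [Nat.div_eq_of_lt hi]⟩
  have hTx : ∀ i < d, ∀ i' < d, ∀ n, T i' (.inr (x i), n) → i = i' ∧ (k : ℤ) ∣ n := by
    rintro i hi i' hi' n ⟨j, hj, hs, h1, h2⟩
    simp only [reduceCtorEq, Sum.inr.injEq, or_false] at hs
    obtain rfl := hxi i (by nlinarith) j hj hs
    rw [Nat.mod_eq_of_lt hi] at h1
    rw [Nat.div_eq_of_lt hi] at h2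
    exact ⟨h1, by simpa using h2⟩
  have hblk : ∀ z i, T i z → F.Block X z.1 := by
    rintro z i ⟨j, hj, hs | hs, _⟩
    · exact .inl ⟨_, hxX j hj, hs⟩
    · exact .inr ⟨σ j, by rw [ini_of_eq (hσ j hj).1]; exact hxX j hj, hs⟩
  have hwind : ∀ i < d, F.net.winding (.inr (x i)) = k := by
    intro i hi
    unfold Net.winding
    refine le_antisymm (Nat.sInf_le ⟨hk, full i hi⟩) (le_csInf ⟨k, hk, full i hi⟩ ?_)
    rintro m ⟨hm, hr⟩
    have := (hTx i hi i hi m ((hT' i _ _ hr).1 (hstart i hi))).2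
    exact Nat.le_of_dvd hm (by exact_mod_cast this)
  rw [hF.wf.loopsIn_eq_map (d := d) (fun i => .inr (x i))]
  · have e : (X.take d).map (fun a => (F.pcol a, k)) =
        (List.range d).map fun i => (F.pcol (x i), k) := by
      apply ext_getElem
      · simp [hlen]; nlinarith
      · intro i h1 h2
        simp only [length_map, List.length_range] at h2
        simp [hx i (by nlinarith)]
    rw [e]
    refine Multiset.map_congr rfl fun i hi => ?_
    rw [hwind i (by simpa using hi)]
    rfl
  · intro i hi
    refine ⟨.inl ⟨_, hxX i (by nlinarith), rfl⟩, fun p q n hp hq hr => ?_, k, hk, full i hi⟩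
    exact h.port_not hF p q hp hq (hblk (sh n (F.port p q)) _ ((hT' i _ _ hr).1 (hstart i hi)))
  · rintro i hi j hj ⟨n, hr⟩
    exact (hTx j hj i hi n ((hT' i _ _ hr).1 (hstart i hi))).1.symm
  · have hrep : ∀ j < k * d, F.net.Same (.inr (x j)) (.inr (x (j % d))) := by
      intro j hj
      refine hF.wf.same_equivalence.symm ⟨((j / d : ℕ) : ℤ), ?_⟩
      have := path (j % d) (Nat.mod_lt _ hd) (j / d) (Nat.div_lt_of_lt_mul (by linarith [mul_comm k d]))
      rwa [mul_comm (j / d) d, Nat.mod_add_div] at this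
    rintro t (⟨a, ha, rfl⟩ | ⟨s, hs, rfl⟩) -
    · obtain ⟨j, hj, rfl⟩ := hXx a ha
      exact ⟨j % d, Nat.mod_lt _ hd, hrep j hj⟩
    · obtain ⟨j, hj, hj'⟩ := hXx _ hs
      refine ⟨j % d, Nat.mod_lt _ hd, hF.wf.same_equivalence.trans ?_ (hrep j hj)⟩
      obtain rfl := eq_of_ini (hσ j hj).1 hj'
      exact ⟨0, (Gen.src' 0 (hins j hj) (hσ j hj).1).symm⟩

/-- A type 3 reduction at a given vertex with given winding number. -/
def Reduction3At (F F' : StrandDiagram Γ) (v : V) (k : ℕ) : Prop :=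
  ∃ (A X B A' X' B' : List F.Point) (Z Z' : List F'.Point)
    (φ : F.Point → F'.Point) (π : F.Strand → F'.Strand),
    1 ≤ k ∧
    F.sources = A ++ X ++ B ∧ F.sinks = A' ++ X' ++ B' ∧ A.length = A'.length ∧
    F.FormLoops (Γ.out v).length k X X' ∧
    X.map F.pcol = (List.replicate k (Γ.children v)).flatten ∧
    F.Carries F' {p | p ∉ X ∧ p ∉ X'} φ π ∧
    Set.BijOn φ {p | p ∉ X ∧ p ∉ X'} {x | x ∉ Z ∧ x ∉ Z'} ∧
    F'.sources = A.map φ ++ Z ++ B.map φ ∧ F'.sinks = A'.map φ ++ Z' ++ B'.map φ ∧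
    F'.FormLoops 1 k Z Z' ∧
    (∀ z ∈ Z, F'.pcol z = v)

lemma Reduction3At.portIso (hF : F.Closed) (hF' : F'.Closed) {v k} (h : F.Reduction3At F' v k) :
    ∃ e f L, Net.PortIso F.net F'.net e f ∧
      F.net.loops = L + ((Γ.children v).map fun c => (c, k) : List (V × ℕ)) ∧
      F'.net.loops = L + {(v, k)} := by
  obtain ⟨A, X, B, A', X', B', Z, Z', φ, π, hk, hso, hsi, hAA, hX, hXc, hC, hbij, hso', hsi', hZ, hZc⟩ := h
  have hXb : F.LoopBlock _ k X X' := ⟨hX, A, B, A', B', hso, hsi, hAA⟩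
  have hZb : F'.LoopBlock 1 k Z Z' := ⟨hZ, A.map φ, B.map φ, A'.map φ, B'.map φ, hso', hsi', by simp [hAA]⟩
  set K : Set F.Point := {p | p ∉ X ∧ p ∉ X'} with hK
  have hB : ∀ x y, F'.Base x y ↔ (∃ c d, F.Base c d ∧ c ∈ K ∧ φ c = x ∧ φ d = y) ∨ (x, y) ∈ Z.zip Z' := by
    have hnA : ∀ c, (c ∈ A ∨ c ∈ B) → c ∉ X := by
      have := F.sources_nodup
      rw [hso, nodup_append, nodup_append] at this
      rintro c (h | h) hc
      · exact this.1.2.2 c h c hc rfl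
      · exact this.2.2 c (by simp [hc]) c h rfl
    have hcX' : ∀ {c d}, F.Base c d → c ∉ X' := fun h1 h2 => outs_ne_nil_of_ins h1.ins (hXb.inn h2).1
    have hXl : X.length = X'.length := hX.1.trans hX.2.1.symm
    have hZl : Z.length = Z'.length := hZ.1.trans hZ.2.1.symm
    have e : ∀ c d, F.Base c d ↔ ((c, d) ∈ A.zip A' ∨ (c, d) ∈ X.zip X') ∨ (c, d) ∈ B.zip B' := by
      intro c d
      unfold Base
      rw [hso, hsi, zip_append (by simp [hAA, hXl]), zip_append hAA]
      simp [or_assoc]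
    intro x y
    unfold Base
    rw [hso', hsi', zip_append (by simp [hAA, hZl]), zip_append (by simp [hAA]), zip_map, zip_map]
    simp only [mem_append, mem_map, Prod.map, Prod.exists, Prod.mk.injEq]
    constructor
    · rintro ((⟨c, d, h1, h2, h3⟩ | h) | ⟨c, d, h1, h2, h3⟩)
      · have hb : F.Base c d := (e _ _).2 (.inl (.inl h1))
        exact .inl ⟨c, d, hb, ⟨hnA c (.inl (of_mem_zip h1).1), hcX' hb⟩, h2, h3⟩
      · exact .inr h
      · have hb : F.Base c d := (e _ _).2 (.inr h1)
        exact .inl ⟨c, d, hb, ⟨hnA c (.inr (of_mem_zip h1).1), hcX' hb⟩, h2, h3⟩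
    · rintro (⟨c, d, h1, h4, h2, h3⟩ | h)
      · rcases (e _ _).1 h1 with (h1 | h1) | h1
        · exact .inl (.inl ⟨c, d, h1, h2, h3⟩)
        · exact absurd (of_mem_zip h1).1 h4.1
        · exact .inr ⟨c, d, h1, h2, h3⟩
      · exact .inl (.inr h)
  have hsK : ∀ {s}, F.ini s ∈ K ↔ F.ini s ∉ X := fun {s} => ⟨And.left, fun h => ⟨h, hXb.ini_not⟩⟩
  have htK : ∀ {s}, F.ter s ∈ K ↔ F.ini s ∈ K := fun {s} =>
    ⟨fun h => hsK.2 fun h' => h.2 (hXb.ini_iff.1 h'), fun h => ⟨hXb.ter_not, fun h' => h.1 (hXb.ini_iff.2 h')⟩⟩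
  have hsnk : ∀ {c d}, F.Base c d → c ∈ K → d ∈ K := fun {c d} h1 h2 =>
    ⟨fun h' => outs_ne_nil_of_ins (hXb.out h').1 h1.outs, fun h' => h2.1 ((hXb.mem_iff h1).2 h')⟩
  have hsurj : ∀ p', p' ∉ Z → p' ∉ Z' → ∃ p ∈ K, φ p = p' := fun p' h1 h2 => hbij.surjOn ⟨h1, h2⟩
  have hφZ : ∀ {p}, p ∈ K → φ p ∉ Z := fun h => (hbij.mapsTo h).1
  have hblkX : ∀ s, ¬ F.Block X (.inl s) ↔ F.ini s ∈ K := fun s => by simp [Block, hsK]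
  have hblkZ : ∀ s, ¬ F'.Block Z (.inl s) ↔ F'.ini s ∉ Z := fun s => by simp [Block]
  have hins : ∀ {p}, p ∈ K → (F'.ins (φ p) = [] ↔ F.ins p = []) := fun hp => by
    rw [hC.ins _ hp]; simp
  let T := fun t => ¬ F.Block X t
  let T' := fun t => ¬ F'.Block Z t
  have hT : ∀ x y, F.net.gen x y → (T x.1 ↔ T y.1) := fun x y hg => not_congr (hXb.closed x y hg)
  have hT' : ∀ x y, F'.net.gen x y → (T' x.1 ↔ T' y.1) := fun x y hg => not_congr (hZb.closed x y hg)
  let ρ : (F.Strand ⊕ F.Point) × ℤ → (F'.Strand ⊕ F'.Point) × ℤ → Prop := fun x x' =>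
    (∃ s n, F.ini s ∈ K ∧ x = (.inl s, n) ∧ x' = (.inl (π s), n)) ∨
      ∃ a n, F.ins a = [] ∧ a ∈ K ∧ x = (.inr a, n) ∧ x' = (.inr (φ a), n)
  have r1 : ∀ {s} n, F.ini s ∈ K → ρ (.inl s, n) (.inl (π s), n) := fun n h => .inl ⟨_, n, h, rfl, rfl⟩
  have r2 : ∀ {a} n, F.ins a = [] → a ∈ K → ρ (.inr a, n) (.inr (φ a), n) := fun n h h' =>
    .inr ⟨_, n, h, h', rfl, rfl⟩
  have hN := hF.wf.sub T
  have hN' := hF'.wf.sub T'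
  have hiniK : ∀ {p s}, p ∈ K → (F.ini s = p ∨ F.ter s = p) → F.ini s ∈ K := by
    rintro p s hp (rfl | rfl)
    exacts [hp, htK.1 hp]
  have hal : ∀ {p}, F.net.alive p → p ∈ K := fun hp => hXb.not_alive hp
  have hρ : (F.net.sub T).Corr (F'.net.sub T') ρ := by
    refine ⟨?_, ?_, ?_, ?_, ?_, ?_⟩
    · rintro m _ _ (⟨s, n, h, rfl, rfl⟩ | ⟨a, n, h, h', rfl, rfl⟩)
      exacts [r1 _ h, r2 _ h h']
    · rintro _ _ _ (⟨s, n, h, rfl, rfl⟩ | ⟨a, n, h, h', rfl, rfl⟩) (⟨s', n', h1, h2, rfl⟩ | ⟨a', n', h1, h1', h2, rfl⟩) <;>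
      cases h2 <;> exact .refl _
    · rintro _ _ _ (⟨s, n, h, rfl, rfl⟩ | ⟨a, n, h, h', rfl, rfl⟩) (⟨s', n', h1, rfl, h2⟩ | ⟨a', n', h1, h1', rfl, h2⟩) <;>
      simp only [Prod.mk.injEq, Sum.inl.injEq, Sum.inr.injEq, reduceCtorEq, false_and] at h2 <;>
      obtain ⟨h2, rfl⟩ := h2
      · rw [hC.inj h h1 h2]; exact .refl _
      · rw [hC.injOn h' h1' h2]; exact .refl _
    · rintro _ _ ⟨⟨a, s, m, h1, h2⟩ | ⟨a, b, s, m, h1, h2⟩ | ⟨p, s, t, m, h1, h2⟩, hTx⟩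
      · have hi := ini_of_eq h2
        have ha : a ∈ K := by
          rw [← hi, hsK, hi]
          exact fun h => hTx (.inl ⟨a, h, rfl⟩)
        refine ⟨_, _, r2 _ h1 ha, r1 _ (hi ▸ ha), Net.rel_of_gen ⟨.src _ _ _ ((hins ha).2 h1)
          (hC.outs_eq ha h2), ?_⟩⟩
        exact fun h => hφZ ha (by simpa [Block] using h)
      · have hs := (hblkX s).1 hTx
        have hi := ter_of_eq h2
        have hb : b ∈ K := hi ▸ htK.2 hs
        have ha : a ∈ K := ⟨fun h => hb.2 ((hXb.mem_iff h1).1 h),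
          fun h => outs_ne_nil_of_ins h1.ins (hXb.inn h).1⟩
        refine ⟨_, _, r1 _ hs, r2 _ h1.ins ha, Net.rel_of_gen ⟨.snk _ (φ b) _ _ ((hB _ _).2
          (.inl ⟨a, b, h1, ha, rfl, rfl⟩)) (hC.ins_eq hb h2), (hblkZ _).2 ?_⟩⟩
        rw [hC.ini hs]; exact hφZ hs
      · have hs := (hblkX s).1 hTx
        have hp : p ∈ K := ter_of_eq h1 ▸ htK.2 hs
        refine ⟨_, _, r1 _ hs, r1 _ (hiniK hp (.inl (ini_of_eq h2))),
          Net.rel_of_gen ⟨.deg (φ p) _ _ _ (hC.ins_eq hp h1) (hC.outs_eq hp h2), (hblkZ _).2 ?_⟩⟩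
        rw [hC.ini hs]; exact hφZ hs
    · rintro _ _ ⟨⟨a, s, m, h1, h2⟩ | ⟨a, b, s, m, h1, h2⟩ | ⟨p, s, t, m, h1, h2⟩, hTx⟩
      · obtain ⟨a, ha, rfl⟩ := hsurj a (fun h => hTx (.inl ⟨a, h, rfl⟩))
          (fun h => by rw [(hZb.inn h).1] at h2; cases h2)
        obtain ⟨s, g2, rfl⟩ := hC.outs_singleton ha h2
        have g1 := (hins ha).1 h1
        exact ⟨_, _, r2 _ g1 ha, r1 _ (hiniK ha (.inl (ini_of_eq g2))),
          Net.rel_of_gen ⟨.src _ _ _ g1 g2, fun h => ha.1 (by simpa [Block] using h)⟩⟩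
      · have hs := (hblkZ s).1 hTx
        rcases (hB _ _).1 h1 with ⟨a, b, g1, ha, rfl, rfl⟩ | h3
        · have hb := hsnk g1 ha
          obtain ⟨s, g2, rfl⟩ := hC.ins_singleton hb h2
          have hi := hiniK hb (.inr (ter_of_eq g2))
          exact ⟨_, _, r1 _ hi, r2 _ g1.ins ha, Net.rel_of_gen ⟨.snk _ _ _ _ g1 g2, (hblkX _).2 hi⟩⟩
        · exfalso
          apply hs
          rw [hZb.ini_iff, ter_of_eq h2]
          exact (of_mem_zip h3).2
      · obtain ⟨p, hp, rfl⟩ := hsurj p (fun h => by rw [(hZb.out h).1] at h1; cases h1)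
          (fun h => by rw [(hZb.inn h).1] at h2; cases h2)
        obtain ⟨s, g1, rfl⟩ := hC.ins_singleton hp h1
        obtain ⟨u, g2, rfl⟩ := hC.outs_singleton hp h2
        have hi := hiniK hp (.inr (ter_of_eq g1))
        exact ⟨_, _, r1 _ hi, r1 _ (hiniK hp (.inl (ini_of_eq g2))),
          Net.rel_of_gen ⟨.deg _ _ _ _ g1 g2, (hblkX _).2 hi⟩⟩
    · rintro _ _ (⟨s, n, h, rfl, rfl⟩ | ⟨a, n, h, h', rfl, rfl⟩)
      exacts [(hC.scol (.inl h)).symm, (hC.pcol a h').symm]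
  have hiso : (F.net.sub T).Iso (F'.net.sub T') φ fun _ => 0 := by
    refine hρ.iso hN hN' ⟨fun p hp => (hC.alive (hal hp)).2 hp,
      fun p hp q hq => hC.injOn (hal hp) (hal hq), fun p' hp' => ?_⟩
      (fun p hp => hC.isSplit (hal hp)) (fun p hp => hC.pcol p (hal hp)) (fun p k hp hk => ?_)
      ?_ ?_
    · obtain ⟨p, hp, rfl⟩ := hsurj p' (hZb.not_alive hp').1 (hZb.not_alive hp').2
      exact ⟨p, (hC.alive hp).1 hp', rfl⟩
    · rw [sh_zero]
      refine hC.port (hal hp) hF hp hk (fun s hs => r1 _ (hiniK (hal hp) hs)) (fun h => r2 _ h (hal hp))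
        fun a ha => ?_
      have haK : a ∈ K := ⟨fun h => (hal hp).2 ((hXb.mem_iff ha).1 h),
          fun h => outs_ne_nil_of_ins ha.ins (hXb.inn h).1⟩
      exact ⟨φ a, (hB _ _).2 (.inl ⟨a, p, ha, haK, rfl, rfl⟩), r2 _ ha.ins haK⟩
    · have hno : ∀ t, ¬ T t → ∀ y, ¬ (F.net.sub T).gen (t, 0) y ∧ ¬ (F.net.sub T).gen y (t, 0) :=
        fun t ht y => ⟨fun hg => ht hg.2, fun hg => ht ((hT _ _ hg.1).1 hg.2)⟩
      rintro (s | a)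
      · by_cases hs : F.ini s ∈ K
        · exact .inl ⟨_, r1 _ hs⟩
        · exact .inr (hno _ (mt (hblkX s).1 hs))
      · by_cases ha : F.ins a = []
        · by_cases haX : a ∈ X
          · exact .inr (hno _ (not_not.2 (.inl ⟨a, haX, rfl⟩)))
          · exact .inl ⟨_, r2 _ ha ⟨haX, fun h => outs_ne_nil_of_ins ha (hXb.inn h).1⟩⟩
        · exact .inr fun y => ⟨fun hg => (Closed.isolated ha y).1 hg.1, fun hg => (Closed.isolated ha y).2 hg.1⟩
    · have hno : ∀ t, ¬ T' t → ∀ y, ¬ (F'.net.sub T').gen (t, 0) y ∧ ¬ (F'.net.sub T').gen y (t, 0) :=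
        fun t ht y => ⟨fun hg => ht hg.2, fun hg => ht ((hT' _ _ hg.1).1 hg.2)⟩
      rintro (s | a)
      · by_cases hs : F'.ini s ∈ Z
        · exact .inr (hno _ (mt (hblkZ s).1 (not_not.2 hs)))
        · obtain ⟨p, hp, he⟩ := hsurj _ hs hZb.ini_not
          have hm := mem_outs_ini s
          rw [← he, hC.outs p hp, mem_map] at hm
          obtain ⟨s, hs', rfl⟩ := hm
          exact .inl ⟨(.inl s, 0), r1 _ (hiniK hp (.inl (ini_of_mem hs')))⟩
      · by_cases ha : F'.ins a = []
        · by_cases haX : a ∈ Z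
          · exact .inr (hno _ (not_not.2 (.inl ⟨a, haX, rfl⟩)))
          · obtain ⟨p, hp, rfl⟩ := hsurj a haX fun h => outs_ne_nil_of_ins ha (hZb.inn h).1
            exact .inl ⟨(.inr p, 0), r2 _ ((hins hp).1 ha) hp⟩
        · exact .inr fun y => ⟨fun hg => (Closed.isolated ha y).1 hg.1, fun hg => (Closed.isolated ha y).2 hg.1⟩
  have e1 : F.net.loops = F.net.loopsIn T + F.net.loopsIn (F.Block X) :=
    hF.wf.loops_eq_add (fun _ _ => Iff.rfl) fun s t _ ⟨n, hst⟩ => (Net.sub_closed hT hst).1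
  have e2 : F'.net.loops = F'.net.loopsIn T' + F'.net.loopsIn (F'.Block Z) :=
    hF'.wf.loops_eq_add (fun _ _ => Iff.rfl) fun s t _ ⟨n, hst⟩ => (Net.sub_closed hT' hst).1
  have e3 : F.net.loopsIn T = F'.net.loopsIn T' := by
    rw [← Net.WF.sub_loops hT hF.wf, ← Net.WF.sub_loops hT' hF'.wf]
    exact hiso.loops
  refine ⟨φ, fun _ => 0, F'.net.loopsIn T', Net.PortIso.of_sub hT hT' (hXb.port_not hF)
    (hZb.port_not hF') hiso.port, ?_, ?_⟩
  · rw [e1, e3, hXb.loops_eq hF hk]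
    congr 2
    obtain ⟨k, rfl⟩ := Nat.exists_eq_succ_of_ne_zero (show k ≠ 0 by omega)
    have h1 := congrArg (fun l => (l.take (Γ.out v).length).map fun c => (c, k + 1)) hXc
    have hlen : (Γ.children v).length = (Γ.out v).length := by simp [OrderedGraph.children]
    simp only [← List.map_take, List.map_map, List.replicate_succ, List.flatten_cons] at h1
    rw [← hlen, List.take_left, hlen] at h1
    exact h1
  · rw [e2, hZb.loops_eq hF' hk]
    congr 1
    have hl := hZ.1
    obtain ⟨z, Z0, rfl⟩ := List.exists_cons_of_ne_nil (l := Z) (by rintro rfl; simp at hl; omega)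
    simp [hZc z (by simp)]

lemma Reduction3.equiv3 (hF : F.Closed) (hF' : F'.Closed) (h : F.Reduction3 F') :
    Net.Equiv3 F.net F'.net := by
  obtain ⟨v, k, h⟩ := h
  obtain ⟨e, f, L, h1, h2, h3⟩ := Reduction3At.portIso hF hF' (v := v) (k := k) h
  rw [Net.Equiv3, h2, h3]
  exact ⟨e, f, h1, EqvGen.symm _ _ (EqvGen.rel _ _ ⟨v, k, L, rfl, rfl⟩)⟩

end StrandDiagram

/-- The complete reductions of two nets are equivalent. -/
def Net.SameReduct {V E : Type*} {Γ : OrderedGraph V E} (N N' : Net Γ) : Prop :=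
  ∀ A B, ReflTransGen Net.Red N A → A.Irred → ReflTransGen Net.Red N' B → B.Irred → Net.Equiv3 A B

namespace Net

variable {N N' N'' : Net Γ}

lemma Equiv3.sameReduct (hN : N.WF) (hN' : N'.WF) (hP : Nonempty N.P) (hP' : Nonempty N'.P)
    (h : Equiv3 N N') : N.SameReduct N' := fun _ _ h1 h2 h3 h4 =>
  irred_unique le_rfl hN hN' hP hP' h h1 h2 h3 h4

lemma SameReduct.symm (hN : N.WF) (hN' : N'.WF) (hP : Nonempty N.P)
    (h : N.SameReduct N') : N'.SameReduct N := fun _ _ h1 h2 h3 h4 => by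
  have := nonempty_of_red hP h3
  exact (h _ _ h3 h4 h1 h2).symm (wf_of_red hN h3) (wf_of_red hN' h1)

lemma SameReduct.trans (hN' : N'.WF) (hN'' : N''.WF) (h : N.SameReduct N')
    (h' : N'.SameReduct N'') : N.SameReduct N'' := fun A B h1 h2 h3 h4 => by
  obtain ⟨C, h5, h6⟩ := N'.exists_irred
  exact (h A C h1 h2 h5 h6).trans (wf_of_red hN' h5) (wf_of_red hN'' h3) (h' C B h5 h6 h3 h4)

lemma Red.sameReduct (hN : N.WF) (hP : Nonempty N.P) (h : Red N N') : N.SameReduct N' :=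
  fun _ _ h1 h2 h3 h4 => irred_unique le_rfl hN hN hP hP (Equiv3.refl hN) h1 h2 (ReflTransGen.head h h3) h4

end Net

namespace ClosedStrandDiagram

variable {X Y : ClosedStrandDiagram Γ}

lemma closed (X : ClosedStrandDiagram Γ) : X.cut.Closed := X.domain_eq_range

abbrev Pt (X : ClosedStrandDiagram Γ) : Type := X.cut.Point

lemma wf (X : ClosedStrandDiagram Γ) : X.cut.net.WF := X.closed.wf

/-- Both diagrams are empty, or their complete reductions are equivalent. -/
def Linked (X Y : ClosedStrandDiagram Γ) : Prop :=
  (Nonempty X.Pt ↔ Nonempty Y.Pt) ∧ (Nonempty X.Pt → X.cut.net.SameReduct Y.cut.net)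

lemma Linked.symm (h : Linked X Y) : Linked Y X :=
  ⟨h.1.symm, fun hY => (h.2 (h.1.2 hY)).symm X.wf Y.wf (h.1.2 hY)⟩

lemma Linked.of_equiv3 (h : Nonempty X.Pt ↔ Nonempty Y.Pt)
    (h' : Nonempty X.Pt → Net.Equiv3 X.cut.net Y.cut.net) : Linked X Y :=
  ⟨h, fun hX => (h' hX).sameReduct X.wf Y.wf hX (h.1 hX)⟩

lemma Linked.of_red (h : Nonempty X.Pt) (h' : Nonempty Y.Pt)
    (hr : ∃ N, Net.Red X.cut.net N ∧ ∃ e f, N.Iso Y.cut.net e f) : Linked X Y := by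
  refine ⟨iff_of_true h h', fun _ => ?_⟩
  obtain ⟨N, h1, e, f, h2⟩ := hr
  exact (h1.sameReduct X.wf h).trans (h1.wf X.wf) Y.wf
    (h2.equiv3.sameReduct (h1.wf X.wf) Y.wf (h1.nonempty h) h')

lemma _root_.StrandDiagram.ExpandingSplitShift.iso {F F' : StrandDiagram Γ} (hF : F.Closed)
    (hF' : F'.Closed) (h : F.ExpandingSplitShift F') : Nonempty F.Point ∧ Nonempty F'.Point ∧
      ∃ e f, F.net.Iso F'.net e f := by
  obtain ⟨A, B, A', B', a, b, w, X, X', φ, π, t, h⟩ := StrandDiagram.expandingSplitShift_iff.1 h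
  exact ⟨⟨a⟩, ⟨φ a⟩, φ, _, h.iso hF hF'⟩

lemma ExpandingShift.linked (h : X.ExpandingShift Y) : Linked X Y := by
  rcases h with h | h
  · obtain ⟨h1, h2, e, f, h3⟩ := h.iso X.closed Y.closed
    exact Linked.of_equiv3 (iff_of_true h1 h2) fun _ => h3.equiv3
  · obtain ⟨h1, h2, e, f, h3⟩ := StrandDiagram.ExpandingSplitShift.iso X.closed.flip Y.closed.flip h
    refine Linked.of_equiv3 (iff_of_true h1 h2) fun _ => ⟨e, _, StrandDiagram.portIso_of_flip X.closed Y.closed h3.port, ?_⟩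
    rw [← StrandDiagram.loops_flip X.closed, ← StrandDiagram.loops_flip Y.closed, h3.loops]
    exact EqvGen.refl _

lemma Equivalent.linked (hdead : Γ.NoDeadEnds) (h : X.Equivalent Y) : Linked X Y := by
  induction h with
  | rel X Y h =>
    rcases h with (h | h | h) | (h | h | h) | h
    · exact h.linked
    · exact h.linked.symm
    · obtain ⟨φ, π, h1, h2, h3⟩ := h
      exact Linked.of_equiv3 ⟨fun ⟨p⟩ => ⟨φ p⟩, fun ⟨p⟩ => ⟨(h2.2 p).choose⟩⟩ fun _ =>
        (StrandDiagram.BaseLinePermutation.iso X.closed Y.closed h1 h2 h3).equiv3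
    · have := StrandDiagram.Reduction0.iso X.closed Y.closed h
      obtain ⟨v, φ, h⟩ := h
      obtain ⟨e, f, h⟩ := this
      exact Linked.of_equiv3 (iff_of_true ⟨v⟩ ⟨φ v⟩) fun _ => h.equiv3
    · have := StrandDiagram.Reduction1.iso X.closed Y.closed h
      obtain ⟨v, w, φ, h⟩ := h
      exact Linked.of_red ⟨v⟩ ⟨φ v⟩ this
    · have := StrandDiagram.Reduction2.iso X.closed Y.closed h
      obtain ⟨v, w, s, φ, h⟩ := h
      exact Linked.of_red ⟨v⟩ ⟨φ v⟩ this
    · have := StrandDiagram.Reduction3.equiv3 X.closed Y.closed h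
      refine Linked.of_equiv3 ?_ fun _ => this
      obtain ⟨v, k, A, P, B, A', P', B', Z, Z', φ, π, hk, hso, hsi, hAA, hX, hXc, hC, hbij, hso', hsi', hZ, hZc⟩ := h
      refine ⟨fun ⟨p⟩ => ⟨φ p⟩, fun _ => ?_⟩
      have hlen := hX.1
      obtain ⟨e, he⟩ := hdead v
      have h0 : (Γ.out v).length ≠ 0 := fun h => by
        have := (Γ.mem_out v e).2 he
        rw [length_eq_zero_iff.1 h] at this; cases this
      have h1 : 0 < P.length := by rw [hlen]; positivity
      exact ⟨P[0]⟩
  | refl X => exact Linked.of_equiv3 Iff.rfl fun _ => Net.Equiv3.refl X.wf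
  | symm X Y _ ih => exact ih.symm
  | trans X Y Z _ _ ih₁ ih₂ =>
    exact ⟨ih₁.1.trans ih₂.1, fun h => (ih₁.2 h).trans Y.wf Z.wf (ih₂.2 (ih₁.1.1 h))⟩

lemma ThreeEquivalent.of_similar (h : X.Similar Y) : X.ThreeEquivalent Y :=
  EqvGen.of_imp (fun _ _ h => EqvGen.rel _ _ (.inl h)) h

/-- The main theorem, for nets whose irreducibility is known. -/
lemma Equivalent.equiv3 (hdead : Γ.NoDeadEnds) (h : X.Equivalent Y) (hX : X.cut.net.Irred)
    (hY : Y.cut.net.Irred) (hP : Nonempty X.Pt) : Net.Equiv3 X.cut.net Y.cut.net :=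
  (h.linked hdead).2 hP _ _ .refl hX .refl hY

lemma similar_of_isEmpty (hX : IsEmpty X.Pt) (hY : IsEmpty Y.Pt) : X.Similar Y := by
  have h : ∀ {Z : ClosedStrandDiagram Γ}, IsEmpty Z.Pt → Z.cut.sources = [] := fun {Z} h =>
    List.eq_nil_iff_forall_not_mem.2 fun p => (h.false p).elim
  refine EqvGen.rel _ _ (.inr (.inr ⟨isEmptyElim, fun s => (hX.false (X.cut.ini s)).elim,
    ⟨fun p => (hX.false p).elim, fun p => (hX.false p).elim, fun p => (hX.false p).elim,
      fun p => (hX.false p).elim, fun p => (hX.false p).elim, fun p => (hX.false p).elim⟩,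
    ⟨fun p => (hX.false p).elim, fun p => (hY.false p).elim⟩, ?_⟩))
  rw [h hX, h hY]
  simp

end ClosedStrandDiagram

namespace OrderedGraph

/-- The possible colors of a point and of the strands entering and leaving it. -/
def Local (Γ : OrderedGraph V E) (c : V) (is os : List V) : Prop :=
  (is = [] ∧ os = [c]) ∨ (os = [] ∧ is = [c]) ∨
  ((is = [] ∨ is = [c]) ∧ 2 ≤ os.length ∧ os = Γ.children c) ∨
  ((os = [] ∨ os = [c]) ∧ 2 ≤ is.length ∧ is = Γ.children c) ∨
  (is = [c] ∧ os = [c] ∧ ∃ e, Γ.out c = [e] ∧ Γ.ter e = c)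

end OrderedGraph

namespace StrandDiagram

variable {F F' : StrandDiagram Γ}

lemma map_eq_singleton_of {α β : Type*} {l : List α} {f : α → β} {c : β} (h : l.length = 1)
    (hc : ∀ s ∈ l, f s = c) : l.map f = [c] := by
  obtain ⟨s, rfl⟩ := length_eq_one_iff.1 h
  simpa using hc

lemma map_le_one {α β : Type*} {l : List α} {f : α → β} {c : β} (h : l.length ≤ 1)
    (hc : ∀ s ∈ l, f s = c) : l.map f = [] ∨ l.map f = [c] := by
  rcases Nat.le_one_iff_eq_zero_or_eq_one.1 h with h | h
  · exact .inl (by simpa using h)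
  · exact .inr (map_eq_singleton_of h hc)

lemma isLocal (p : F.Point) : Γ.Local (F.pcol p) ((F.ins p).map F.scol) ((F.outs p).map F.scol) := by
  rcases F.types p with h | h | h | h | h
  · exact .inl ⟨by simp [h.1], map_eq_singleton_of h.2 (F.univalentSource_col p h)⟩
  · exact .inr (.inl ⟨by simp [h.1], map_eq_singleton_of h.2 (F.univalentSink_col p h)⟩)
  · exact .inr (.inr (.inl ⟨map_le_one h.1 (F.split_col p h).2, by simpa using h.2, (F.split_col p h).1⟩))
  · exact .inr (.inr (.inr (.inl ⟨map_le_one h.1 (F.merge_col p h).2, by simpa using h.2,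
      (F.merge_col p h).1⟩)))
  · obtain ⟨h1, h2, h3⟩ := F.degenerate_col p h
    exact .inr (.inr (.inr (.inr ⟨map_eq_singleton_of h.1 h1, map_eq_singleton_of h.2 h2, h3⟩)))

/-- A strand diagram from the lists of strands at each point. -/
noncomputable def build (Γ : OrderedGraph V E) (P S : Type) [Finite P] [Finite S]
    (pc : P → V) (sc : S → V) (o i : P → List S)
    (ho : ∀ p, (o p).Nodup) (ho' : ∀ s, ∃ p, s ∈ o p) (ho'' : ∀ s p q, s ∈ o p → s ∈ o q → p = q)
    (hi : ∀ p, (i p).Nodup) (hi' : ∀ s, ∃ p, s ∈ i p) (hi'' : ∀ s p q, s ∈ i p → s ∈ i q → p = q)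
    (ht : ∃ h : P → ℕ, ∀ s p q, s ∈ o p → s ∈ i q → h p < h q)
    (hl : ∀ p, Γ.Local (pc p) ((i p).map sc) ((o p).map sc))
    (so si : List P) (hso : so.Nodup) (hso' : ∀ p, p ∈ so ↔ i p = [])
    (hsi : si.Nodup) (hsi' : ∀ p, p ∈ si ↔ o p = []) : StrandDiagram Γ :=
  have H : ∀ p, ((i p = [] ∧ (o p).length = 1) ∧ ∀ s ∈ o p, sc s = pc p) ∨
      ((o p = [] ∧ (i p).length = 1) ∧ ∀ s ∈ i p, sc s = pc p) ∨
      (((i p).length ≤ 1 ∧ 2 ≤ (o p).length) ∧ ((o p).map sc = Γ.children (pc p) ∧ ∀ s ∈ i p, sc s = pc p)) ∨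
      (((o p).length ≤ 1 ∧ 2 ≤ (i p).length) ∧ ((i p).map sc = Γ.children (pc p) ∧ ∀ s ∈ o p, sc s = pc p)) ∨
      (((i p).length = 1 ∧ (o p).length = 1) ∧ ((∀ s ∈ i p, sc s = pc p) ∧ (∀ s ∈ o p, sc s = pc p) ∧
        ∃ e, Γ.out (pc p) = [e] ∧ Γ.ter e = pc p)) := fun p => by
    have h1 : ∀ {l : List S}, l.map sc = [pc p] → l.length = 1 ∧ ∀ s ∈ l, sc s = pc p := fun {l} h => by
      obtain ⟨s, rfl, h'⟩ := List.map_eq_singleton_iff.1 h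
      simp [h']
    have h2 : ∀ {l : List S}, l.map sc = [] ∨ l.map sc = [pc p] → l.length ≤ 1 ∧ ∀ s ∈ l, sc s = pc p :=
      fun {l} h => by
        rcases h with h | h
        · rw [map_eq_nil_iff.1 h]; simp
        · exact ⟨(h1 h).1.le, (h1 h).2⟩
    rcases hl p with ⟨a, b⟩ | ⟨a, b⟩ | ⟨a, b, c⟩ | ⟨a, b, c⟩ | ⟨a, b, c⟩
    · exact .inl ⟨⟨by simpa using a, (h1 b).1⟩, (h1 b).2⟩
    · exact .inr (.inl ⟨⟨by simpa using a, (h1 b).1⟩, (h1 b).2⟩)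
    · exact .inr (.inr (.inl ⟨⟨(h2 a).1, by simpa using b⟩, c, (h2 a).2⟩))
    · exact .inr (.inr (.inr (.inl ⟨⟨(h2 a).1, by simpa using b⟩, c, (h2 a).2⟩)))
    · exact .inr (.inr (.inr (.inr ⟨⟨(h1 a).1, (h1 b).1⟩, (h1 a).2, (h1 b).2, c⟩)))
  have hmo : ∀ p s, s ∈ o p ↔ (ho' s).choose = p := fun p s =>
    ⟨fun h => ho'' s _ _ (ho' s).choose_spec h, fun h => h ▸ (ho' s).choose_spec⟩
  have hmi : ∀ p s, s ∈ i p ↔ (hi' s).choose = p := fun p s =>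
    ⟨fun h => hi'' s _ _ (hi' s).choose_spec h, fun h => h ▸ (hi' s).choose_spec⟩
  { Point := P
    Strand := S
    finite_point := inferInstance
    finite_strand := inferInstance
    ini := fun s => (ho' s).choose
    ter := fun s => (hi' s).choose
    pcol := pc
    scol := sc
    outs := o
    outs_nodup := ho
    mem_outs := hmo
    ins := i
    ins_nodup := hi
    mem_ins := hmi
    sources := so
    sources_nodup := hso
    mem_sources := hso'
    sinks := si
    sinks_nodup := hsi
    mem_sinks := hsi'
    acyclic := by
      obtain ⟨h, hh⟩ := ht
      have : ∀ p q, TransGen (fun p q => ∃ s, (ho' s).choose = p ∧ (hi' s).choose = q) p q → h p < h q := by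
        intro p q hpq
        induction hpq with
        | single hs => obtain ⟨s, rfl, rfl⟩ := hs; exact hh s _ _ (ho' s).choose_spec (hi' s).choose_spec
        | tail _ hs ih =>
          obtain ⟨s, rfl, rfl⟩ := hs
          exact ih.trans (hh s _ _ (ho' s).choose_spec (hi' s).choose_spec)
      exact fun p hp => (this p p hp).false
    types := fun p => (H p).imp And.left (Or.imp And.left (Or.imp And.left (Or.imp And.left And.left)))
    univalentSource_col := fun p hp => by
      obtain ⟨hp1, hp2⟩ : i p = [] ∧ (o p).length = 1 := hp
      show ∀ s ∈ o p, sc s = pc p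
      rcases H p with h | h | h | h | h
      · exact h.2
      · have := h.1.1; simp [this] at hp2
      · have := h.1.2; omega
      · have := h.1.2; simp [hp1] at this
      · have := h.1.1; simp [hp1] at this
    univalentSink_col := fun p hp => by
      obtain ⟨hp1, hp2⟩ : o p = [] ∧ (i p).length = 1 := hp
      show ∀ s ∈ i p, sc s = pc p
      rcases H p with h | h | h | h | h
      · have := h.1.1; simp [this] at hp2
      · exact h.2
      · have := h.1.2; simp [hp1] at this
      · have := h.1.2; omega
      · have := h.1.2; simp [hp1] at this
    split_col := fun p hp => by
      obtain ⟨hp1, hp2⟩ : (i p).length ≤ 1 ∧ 2 ≤ (o p).length := hp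
      rcases H p with h | h | h | h | h
      · have := h.1.2; omega
      · have := h.1.1; simp [this] at hp2
      · exact h.2
      · have := h.1.2; omega
      · have := h.1.2; omega
    merge_col := fun p hp => by
      obtain ⟨hp1, hp2⟩ : (o p).length ≤ 1 ∧ 2 ≤ (i p).length := hp
      rcases H p with h | h | h | h | h
      · have := h.1.1; simp [this] at hp2
      · have := h.1.2; omega
      · have := h.1.2; omega
      · exact h.2
      · have := h.1.1; omega
    degenerate_col := fun p hp => by
      obtain ⟨hp1, hp2⟩ : (i p).length = 1 ∧ (o p).length = 1 := hp
      rcases H p with h | h | h | h | h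
      · have := h.1.1; simp [this] at hp1
      · have := h.1.1; simp [this] at hp2
      · have := h.1.2; omega
      · have := h.1.2; omega
      · exact h.2 }

/-- Data to modify a strand diagram: the points in `K` are kept, with the strands around them
renamed by `π`, the other points are replaced by those of `N`, with strands `no` and `ni`. -/
structure Surgery (F : StrandDiagram Γ) where
  K : Set F.Point
  N : Type
  S : Type
  fN : Finite N
  fS : Finite S
  π : F.Strand → S
  pc : N → V
  sc : S → V
  no : N → List S
  ni : N → List S

namespace Surgery

variable (T : F.Surgery)

def o : T.K ⊕ T.N → List T.S := Sum.elim (fun p => (F.outs p).map T.π) T.no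
def i : T.K ⊕ T.N → List T.S := Sum.elim (fun p => (F.ins p).map T.π) T.ni
def pcol : T.K ⊕ T.N → V := Sum.elim (fun p => F.pcol p) T.pc

/-- The surgery yields a strand diagram. -/
structure Valid : Prop where
  scol : ∀ s, F.ini s ∈ T.K ∨ F.ter s ∈ T.K → T.sc (T.π s) = F.scol s
  oinj : Set.InjOn T.π {s | F.ini s ∈ T.K}
  onodup : ∀ n, (T.no n).Nodup
  odisj : ∀ n s, F.ini s ∈ T.K → T.π s ∉ T.no n
  ouniq : ∀ s n n', s ∈ T.no n → s ∈ T.no n' → n = n'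
  oex : ∀ s, (∃ u, F.ini u ∈ T.K ∧ T.π u = s) ∨ ∃ n, s ∈ T.no n
  iinj : Set.InjOn T.π {s | F.ter s ∈ T.K}
  inodup : ∀ n, (T.ni n).Nodup
  idisj : ∀ n s, F.ter s ∈ T.K → T.π s ∉ T.ni n
  iuniq : ∀ s n n', s ∈ T.ni n → s ∈ T.ni n' → n = n'
  iex : ∀ s, (∃ u, F.ter u ∈ T.K ∧ T.π u = s) ∨ ∃ n, s ∈ T.ni n
  height : ∃ h : T.K ⊕ T.N → ℕ, ∀ s p q, s ∈ T.o p → s ∈ T.i q → h p < h q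
  types : ∀ n, Γ.Local (T.pc n) ((T.ni n).map T.sc) ((T.no n).map T.sc)

variable {T}

lemma mem_o_inl {p : T.K} {s} : s ∈ T.o (.inl p) ↔ ∃ u, F.ini u = p ∧ T.π u = s := by
  show s ∈ (F.outs p).map T.π ↔ _
  simp [F.mem_outs]

lemma mem_i_inl {p : T.K} {s} : s ∈ T.i (.inl p) ↔ ∃ u, F.ter u = p ∧ T.π u = s := by
  show s ∈ (F.ins p).map T.π ↔ _
  simp [F.mem_ins]

/-- The result of a surgery. -/
noncomputable def Valid.diagram (h : T.Valid) (so si : List (T.K ⊕ T.N))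
    (hso : so.Nodup ∧ ∀ p, p ∈ so ↔ T.i p = []) (hsi : si.Nodup ∧ ∀ p, p ∈ si ↔ T.o p = []) :
    StrandDiagram Γ :=
  have := T.fN
  have := T.fS
  build Γ (T.K ⊕ T.N) T.S T.pcol T.sc T.o T.i
    (by
      rintro (p | n)
      · refine (F.outs_nodup p).map_on fun s hs t ht he => h.oinj ?_ ?_ he
        · rw [Set.mem_ofPred_eq, ini_of_mem hs]; exact p.2
        · rw [Set.mem_ofPred_eq, ini_of_mem ht]; exact p.2
      · exact h.onodup n)
    (by
      intro s
      rcases h.oex s with ⟨u, hu, rfl⟩ | ⟨n, hn⟩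
      · exact ⟨.inl ⟨_, hu⟩, mem_o_inl.2 ⟨u, rfl, rfl⟩⟩
      · exact ⟨.inr n, hn⟩)
    (by
      rintro s (p | n) (q | m) hp hq
      · obtain ⟨u, h1, rfl⟩ := mem_o_inl.1 hp
        obtain ⟨v, h2, h3⟩ := mem_o_inl.1 hq
        have := h.oinj (show F.ini v ∈ T.K from h2 ▸ q.2) (show F.ini u ∈ T.K from h1 ▸ p.2) h3
        subst this
        exact congrArg Sum.inl (Subtype.ext (h1.symm.trans h2))
      · obtain ⟨u, h1, rfl⟩ := mem_o_inl.1 hp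
        exact absurd hq (h.odisj m u (h1 ▸ p.2))
      · obtain ⟨u, h1, rfl⟩ := mem_o_inl.1 hq
        exact absurd hp (h.odisj n u (h1 ▸ q.2))
      · exact congrArg Sum.inr (h.ouniq s n m hp hq))
    (by
      rintro (p | n)
      · refine (F.ins_nodup p).map_on fun s hs t ht he => h.iinj ?_ ?_ he
        · rw [Set.mem_ofPred_eq, ter_of_mem hs]; exact p.2
        · rw [Set.mem_ofPred_eq, ter_of_mem ht]; exact p.2
      · exact h.inodup n)
    (by
      intro s
      rcases h.iex s with ⟨u, hu, rfl⟩ | ⟨n, hn⟩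
      · exact ⟨.inl ⟨_, hu⟩, mem_i_inl.2 ⟨u, rfl, rfl⟩⟩
      · exact ⟨.inr n, hn⟩)
    (by
      rintro s (p | n) (q | m) hp hq
      · obtain ⟨u, h1, rfl⟩ := mem_i_inl.1 hp
        obtain ⟨v, h2, h3⟩ := mem_i_inl.1 hq
        have := h.iinj (show F.ter v ∈ T.K from h2 ▸ q.2) (show F.ter u ∈ T.K from h1 ▸ p.2) h3
        subst this
        exact congrArg Sum.inl (Subtype.ext (h1.symm.trans h2))
      · obtain ⟨u, h1, rfl⟩ := mem_i_inl.1 hp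
        exact absurd hq (h.idisj m u (h1 ▸ p.2))
      · obtain ⟨u, h1, rfl⟩ := mem_i_inl.1 hq
        exact absurd hp (h.idisj n u (h1 ▸ q.2))
      · exact congrArg Sum.inr (h.iuniq s n m hp hq))
    h.height
    (by
      rintro (p | n)
      · have := F.isLocal p.1
        rw [← map_congr_left (f := T.sc ∘ T.π) (g := F.scol)
            fun s hs => h.scol s (.inr (ter_of_mem hs ▸ p.2)), ← List.map_map,
          ← map_congr_left (f := T.sc ∘ T.π) (g := F.scol)
            fun s hs => h.scol s (.inl (ini_of_mem hs ▸ p.2)), ← List.map_map] at this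
        exact this
      · exact h.types n)
    so si hso.1 hso.2 hsi.1 hsi.2

variable (T) in
open Classical in
/-- The image of a point that is kept; the other points are mapped by `x`. -/
noncomputable def keep (x : F.Point → T.K ⊕ T.N) (p : F.Point) :
    T.K ⊕ T.N := if h : p ∈ T.K then .inl ⟨p, h⟩ else x p

lemma keep_mem {x} (p : F.Point) (h : p ∈ T.K) : T.keep x p = .inl ⟨p, h⟩ := dif_pos h
lemma keep_not_mem {x} (p : F.Point) (h : p ∉ T.K) : T.keep x p = x p := dif_neg h

lemma keep_injOn {x} : Set.InjOn (T.keep x) T.K := fun p hp q hq he => by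
  rw [keep_mem p hp, keep_mem q hq] at he
  exact congrArg Subtype.val (Sum.inl.inj he)

lemma keep_nodup {x} {l : List F.Point} (hl : ∀ p ∈ l, p ∈ T.K) (hn : l.Nodup) :
    (l.map (T.keep x)).Nodup := hn.map_on fun p hp q hq he => keep_injOn (hl p hp) (hl q hq) he

lemma inl_mem_keep {x} {l : List F.Point} (hl : ∀ p ∈ l, p ∈ T.K) (p : T.K) :
    .inl p ∈ l.map (T.keep x) ↔ p.1 ∈ l := by
  refine ⟨fun h => ?_, fun h => mem_map.2 ⟨p, h, keep_mem p.1 p.2⟩⟩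
  obtain ⟨q, hq, h⟩ := mem_map.1 h
  rw [keep_mem q (hl q hq)] at h
  rwa [← congrArg Subtype.val (Sum.inl.inj h)]

lemma inr_not_mem_keep {x} {l : List F.Point} (hl : ∀ p ∈ l, p ∈ T.K) (n) :
    .inr n ∉ l.map (T.keep x) := fun h => by
  obtain ⟨q, hq, h⟩ := mem_map.1 h
  rw [keep_mem q (hl q hq)] at h
  cases h

/-- The sources of the result of a surgery (`g = T.i`) and its sinks (`g = T.o`). -/
lemma keep_append {x} {A : List F.Point} {Z : List (T.K ⊕ T.N)} {g : T.K ⊕ T.N → List T.S}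
    (hA : ∀ p ∈ A, p ∈ T.K) (hAn : A.Nodup) (hZn : Z.Nodup) (hZ : ∀ p, .inl p ∉ Z)
    (h1 : ∀ p : T.K, p.1 ∈ A ↔ g (.inl p) = []) (h2 : ∀ n, .inr n ∈ Z ↔ g (.inr n) = []) :
    (A.map (T.keep x) ++ Z).Nodup ∧ ∀ p, p ∈ A.map (T.keep x) ++ Z ↔ g p = [] := by
  refine ⟨(keep_nodup hA hAn).append hZn ?_, ?_⟩
  · rintro (p | n) h h'
    exacts [hZ p h', inr_not_mem_keep hA n h]
  · rintro (p | n) <;> rw [mem_append]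
    · rw [inl_mem_keep hA, h1]; simp [hZ]
    · rw [h2]; simp only [inr_not_mem_keep hA, false_or]

lemma map_pcol_keep {x} {l : List F.Point} (hl : ∀ p ∈ l, p ∈ T.K) :
    (l.map (T.keep x)).map T.pcol = l.map F.pcol := by
  rw [List.map_map]
  refine map_congr_left fun p hp => ?_
  rw [Function.comp_apply, keep_mem p (hl p hp)]; rfl

lemma Valid.carries (h : T.Valid) {so si} (hso hsi) (x : F.Point → T.K ⊕ T.N) :
    F.Carries (h.diagram so si hso hsi) T.K (T.keep x) T.π where
  injOn := keep_injOn
  pcol := fun p hp => by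
    show T.pcol (T.keep x p) = _
    rw [keep_mem p hp]; rfl
  outs := fun p hp => by
    show T.o (T.keep x p) = _
    rw [keep_mem p hp]; rfl
  ins := fun p hp => by
    show T.i (T.keep x p) = _
    rw [keep_mem p hp]; rfl
  scol_outs := fun p hp s hs => h.scol s (.inl (ini_of_mem hs ▸ hp))
  scol_ins := fun p hp s hs => h.scol s (.inr (ter_of_mem hs ▸ hp))

end Surgery

variable {F F' : StrandDiagram Γ}

open Classical in
/-- Removing inner points of a diagram, and attaching the strands around them. -/
lemma exists_excision (hF : F.Closed) (K : Set F.Point) (r : F.Strand → F.Strand) (s₀ : F.Strand)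
    (h₀ : F.ini s₀ ∈ K) (hK : ∀ p ∉ K, F.ins p ≠ [] ∧ F.outs p ≠ [])
    (hid : ∀ s, F.ini s ∈ K → r s = s) (hmem : ∀ s, F.ter s ∈ K → F.ini (r s) ∈ K)
    (hinj : Set.InjOn r {s | F.ter s ∈ K}) (hsurj : ∀ u, F.ini u ∈ K → ∃ s, F.ter s ∈ K ∧ r s = u)
    (hcol : ∀ s, F.ter s ∈ K → F.scol (r s) = F.scol s)
    (hh : ∀ h : F.Point → ℕ, (∀ s, h (F.ini s) < h (F.ter s)) →
      ∀ s, F.ter s ∈ K → h (F.ini (r s)) < h (F.ter s)) :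
    ∃ (F' : StrandDiagram Γ) (φ : F.Point → F'.Point) (π : F.Strand → F'.Strand), F'.Closed ∧
      F.Carries F' K φ π ∧ φ '' K = Set.univ ∧ F'.sources = F.sources.map φ ∧
      F'.sinks = F.sinks.map φ ∧ (∀ s t, r s = r t → π s = π t) ∧
      ∀ s, F.ini (r s) ∈ K → F'.scol (π s) = F.scol (r s) := by
  let T : F.Surgery :=
    { K := K
      N := Empty
      S := {s // F.ini s ∈ K}
      fN := inferInstance
      fS := inferInstance
      π := fun s => if h : F.ini (r s) ∈ K then ⟨r s, h⟩ else ⟨s₀, h₀⟩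
      pc := Empty.elim
      sc := fun s => F.scol s.1
      no := Empty.elim
      ni := Empty.elim }
  have hπ : ∀ s (h : F.ini (r s) ∈ K), T.π s = ⟨r s, h⟩ := fun s h => dif_pos h
  have hπ1 : ∀ s (h : F.ini s ∈ K), T.π s = ⟨s, h⟩ := fun s h => by
    rw [hπ s (by rwa [hid s h])]; exact Subtype.ext (hid s h)
  have hπ2 : ∀ s (h : F.ter s ∈ K), T.π s = ⟨r s, hmem s h⟩ := fun s h => hπ s _
  have hT : T.Valid :=
    { scol := by
        rintro s (h | h)
        · rw [hπ1 s h]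
        · rw [hπ2 s h]; exact hcol s h
      oinj := fun s hs t ht he => by
        rw [hπ1 s hs, hπ1 t ht] at he; exact congrArg Subtype.val he
      onodup := fun n => n.elim
      odisj := fun n => n.elim
      ouniq := fun _ n => n.elim
      oex := fun s => .inl ⟨s.1, s.2, hπ1 _ _⟩
      iinj := fun s hs t ht he => by
        rw [hπ2 s hs, hπ2 t ht] at he; exact hinj hs ht (congrArg Subtype.val he)
      inodup := fun n => n.elim
      idisj := fun n => n.elim
      iuniq := fun _ n => n.elim
      iex := fun s => by
        obtain ⟨u, h1, h2⟩ := hsurj s.1 s.2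
        exact .inl ⟨u, h1, (hπ2 u h1).trans (Subtype.ext h2)⟩
      height := by
        obtain ⟨h, h1⟩ := F.exists_height
        refine ⟨Sum.elim (fun p => h p) Empty.elim, ?_⟩
        rintro s (p | n) (q | n)
        · intro hp hq
          obtain ⟨u, h2, rfl⟩ := Surgery.mem_o_inl.1 hp
          obtain ⟨v, h3, h4⟩ := Surgery.mem_i_inl.1 hq
          have h2' : F.ini u ∈ K := h2 ▸ p.2
          have h3' : F.ter v ∈ K := h3 ▸ q.2
          have := hh h h1 v h3'
          rw [hπ1 u h2', hπ2 v h3'] at h4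
          rw [show r v = u from congrArg Subtype.val h4, h2, h3] at this
          exact this
        all_goals exact n.elim
      types := fun n => n.elim }
  let φ := T.keep fun _ => .inl ⟨_, h₀⟩
  have hso : ∀ p ∈ F.sources, p ∈ K := fun p hp => by
    by_contra h; exact (hK p h).1 ((F.mem_sources p).1 hp)
  have hsi : ∀ p ∈ F.sinks, p ∈ K := fun p hp => by
    by_contra h; exact (hK p h).2 ((F.mem_sinks p).1 hp)
  have hS : (F.sources.map φ).Nodup ∧ ∀ p, p ∈ F.sources.map φ ↔ T.i p = [] := by
    refine ⟨Surgery.keep_nodup hso F.sources_nodup, ?_⟩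
    rintro (p | n)
    · rw [Surgery.inl_mem_keep hso, F.mem_sources]
      exact (map_eq_nil_iff (f := T.π)).symm
    · exact n.elim
  have hS' : (F.sinks.map φ).Nodup ∧ ∀ p, p ∈ F.sinks.map φ ↔ T.o p = [] := by
    refine ⟨Surgery.keep_nodup hsi F.sinks_nodup, ?_⟩
    rintro (p | n)
    · rw [Surgery.inl_mem_keep hsi, F.mem_sinks]
      exact (map_eq_nil_iff (f := T.π)).symm
    · exact n.elim
  have hC := hT.carries hS hS' fun _ => .inl ⟨_, h₀⟩
  refine ⟨hT.diagram _ _ hS hS', φ, T.π, ?_, hC, ?_, rfl, rfl, fun s t h => ?_, fun s h => ?_⟩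
  · show (F.sources.map φ).map T.pcol = (F.sinks.map φ).map T.pcol
    rw [Surgery.map_pcol_keep hso, Surgery.map_pcol_keep hsi]
    exact hF
  · refine Set.eq_univ_of_forall ?_
    rintro (p | n)
    · exact ⟨p, p.2, Surgery.keep_mem p.1 p.2⟩
    · exact n.elim
  · by_cases hs : F.ini (r s) ∈ K
    · rw [hπ s hs, hπ t (h ▸ hs)]; exact Subtype.ext h
    · have e : ∀ s, F.ini (r s) ∉ K → T.π s = ⟨s₀, h₀⟩ := fun s h => dif_neg h
      rw [e s hs, e t (h ▸ hs)]
  · show F.scol (T.π s).1 = _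
    rw [hπ s h]

open Classical in
lemma exists_reduction0 (hF : F.Closed) {v : F.Point} (hv : F.IsDegenerate v) :
    ∃ F' : StrandDiagram Γ, F'.Closed ∧ F.Reduction0 F' := by
  obtain ⟨s, hs⟩ := length_eq_one_iff.1 hv.1
  obtain ⟨t, ht⟩ := length_eq_one_iff.1 hv.2
  have es := ter_of_eq hs
  have et := ini_of_eq ht
  have hini : ∀ u, F.ini u = v → u = t := fun _ => eq_of_ini ht
  have hter : ∀ u, F.ter u = v → u = s := fun _ => eq_of_ter hs
  have hsv : F.ini s ≠ v := fun h => ini_ne_ter s (h.trans es.symm)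
  have htv : F.ter t ≠ v := fun h => ini_ne_ter t (et.trans h.symm)
  obtain ⟨F', φ, π, h1, h2, h3, h4, h5, h6, h7⟩ := exists_excision hF {v}ᶜ
    (fun u => if u = t then s else u) s hsv (fun p hp => by
      obtain rfl : p = v := by simpa using hp
      simp [hs, ht])
    (fun u hu => if_neg (by rintro rfl; exact hu et))
    (fun u hu => by
      show (_ : F.Point) ≠ v
      split_ifs with h
      · exact hsv
      · exact fun h' => h (hini u h'))
    (fun u hu u' hu' he => by
      have a : u ≠ s := fun h => hu (h ▸ es)
      have b : u' ≠ s := fun h => hu' (h ▸ es)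
      simp only at he
      split_ifs at he <;> simp_all)
    (fun u hu => by
      by_cases h : u = s
      · exact ⟨t, htv, by simp [h]⟩
      · exact ⟨u, fun h' => h (hter u h'), if_neg (by rintro rfl; exact hu et)⟩)
    (fun u hu => by
      have := F.degenerate_col v hv
      split_ifs with h
      · rw [h, this.1 s (by simp [hs]), this.2.1 t (by simp [ht])]
      · rfl)
    (fun h hh u hu => by
      try dsimp only
      split_ifs with h'
      · rw [h']; have a := hh s; have b := hh t; rw [es] at a; rw [et] at b; omega
      · exact hh u)
  refine ⟨F', h1, v, φ, π, hv, h2, ?_, h3, h4, h5⟩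
  rw [hs, ht]
  simp only [List.map_cons, List.map_nil, List.cons.injEq, and_true]
  exact h6 _ _ (by simp)

open Classical in
lemma exists_reduction1 (hF : F.Closed) {v w : F.Point} (hv : F.IsSplit v) (hw : F.IsMerge w)
    (hc : F.pcol v = F.pcol w) (he : F.outs v = F.ins w) (hv' : F.ins v ≠ []) (hw' : F.outs w ≠ []) :
    ∃ F' : StrandDiagram Γ, F'.Closed ∧ F.Reduction1 F' := by
  obtain ⟨s, hs⟩ := hv.ins_cases.resolve_left hv'
  obtain ⟨t, ht⟩ := hw.outs_cases.resolve_left hw'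
  have es := ter_of_eq hs
  have et := ini_of_eq ht
  have hini : ∀ u, F.ini u = w → u = t := fun _ => eq_of_ini ht
  have hter : ∀ u, F.ter u = v → u = s := fun _ => eq_of_ter hs
  have hvw : ∀ u, F.ini u = v ↔ F.ter u = w := fun u => by
    rw [← F.mem_outs, he, F.mem_ins]
  obtain ⟨o, ho⟩ := exists_mem_of_ne_nil _ hv.outs_ne
  have ho1 := ini_of_mem ho
  have ho2 := (hvw o).1 ho1
  have hsv : F.ini s ∈ ({v, w}ᶜ : Set F.Point) := by
    simp only [Set.mem_compl_iff, Set.mem_insert_iff, Set.mem_singleton_iff, not_or]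
    exact ⟨fun h => ini_ne_ter s (h.trans es.symm),
      fun h => no_two_cycle (es.trans ho1.symm) (ho2.trans h.symm)⟩
  have htv : F.ter t ∈ ({v, w}ᶜ : Set F.Point) := by
    simp only [Set.mem_compl_iff, Set.mem_insert_iff, Set.mem_singleton_iff, not_or]
    exact ⟨fun h => no_two_cycle (ho2.trans et.symm) (h.trans ho1.symm),
      fun h => ini_ne_ter t (et.trans h.symm)⟩
  have hK : ∀ {p : F.Point}, p ∈ ({v, w}ᶜ : Set F.Point) ↔ p ≠ v ∧ p ≠ w := by simp
  obtain ⟨F', φ, π, h1, h2, h3, h4, h5, h6, h7⟩ := exists_excision hF {v, w}ᶜ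
    (fun u => if u = t then s else u) s hsv (fun p hp => by
      have : p = v ∨ p = w := by_contra fun h => hp (hK.2 (not_or.1 h))
      rcases this with rfl | rfl
      · exact ⟨hv', hv.outs_ne⟩
      · exact ⟨hw.ins_ne, hw'⟩)
    (fun u hu => if_neg (by rintro rfl; exact (hK.1 hu).2 et))
    (fun u hu => by
      try dsimp only
      split_ifs with h
      · exact hsv
      · exact hK.2 ⟨fun h' => (hK.1 hu).2 ((hvw u).1 h'), fun h' => h (hini u h')⟩)
    (fun u hu u' hu' he => by
      have a : u ≠ s := fun h => (hK.1 hu).1 (h ▸ es)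
      have b : u' ≠ s := fun h => (hK.1 hu').1 (h ▸ es)
      simp only at he
      split_ifs at he <;> simp_all)
    (fun u hu => by
      by_cases h : u = s
      · exact ⟨t, htv, by simp [h]⟩
      · exact ⟨u, hK.2 ⟨fun h' => h (hter u h'), fun h' => (hK.1 hu).1 ((hvw u).2 h')⟩,
          if_neg (by rintro rfl; exact (hK.1 hu).2 et)⟩)
    (fun u hu => by
      split_ifs with h
      · rw [h, (F.split_col v hv).2 s (by simp [hs]), (F.merge_col w hw).2 t (by simp [ht]), hc]
      · rfl)
    (fun h hh u hu => by
      try dsimp only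
      split_ifs with h'
      · rw [h']; have a := hh s; have b := hh t; have c := hh o
        rw [es] at a; rw [et] at b; rw [ho1, ho2] at c; omega
      · exact hh u)
  refine ⟨F', h1, v, w, φ, π, π s, hv, hw, hc, he, h2, ?_, ?_, ?_, fun h => absurd h hv',
    fun h => absurd h hw', ?_, h4, h5⟩
  · rw [h7 s (by split_ifs <;> exact hsv)]
    split_ifs <;> exact (F.split_col v hv).2 s (by simp [hs])
  · simp [hs]
  · simp only [ht, mem_singleton, forall_eq]
    exact h6 _ _ (by simp)
  · have : {p | (p = v → F.ins v = []) ∧ (p = w → F.outs w = [])} = ({v, w}ᶜ : Set F.Point) := by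
      ext p; simp [hv', hw']
    rw [this]
    exact ⟨fun _ _ => trivial, h2.injOn, h3.ge⟩

open Classical in
lemma exists_reduction2 (hF : F.Closed) {v w : F.Point} {s} (hv : F.IsMerge v) (hw : F.IsSplit w)
    (hs : F.outs v = [s]) (hs' : F.ins w = [s]) :
    ∃ F' : StrandDiagram Γ, F'.Closed ∧ F.Reduction2 F' := by
  have es := ini_of_eq hs
  have es' := ter_of_eq hs'
  have hini : ∀ u, F.ini u = v → u = s := fun _ => eq_of_ini hs
  have hter : ∀ u, F.ter u = w → u = s := fun _ => eq_of_ter hs'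
  have hcv : F.pcol v = F.pcol w := by
    rw [← (F.merge_col v hv).2 s (by simp [hs]), (F.split_col w hw).2 s (by simp [hs'])]
  have hmap : (F.ins v).map F.scol = (F.outs w).map F.scol := by
    rw [(F.merge_col v hv).1, (F.split_col w hw).1, hcv]
  have hlen : (F.ins v).length = (F.outs w).length := by simpa using congrArg List.length hmap
  have hK : ∀ {p : F.Point}, p ∈ ({v, w}ᶜ : Set F.Point) ↔ p ≠ v ∧ p ≠ w := by simp
  have hin : ∀ u ∈ F.ins v, F.ini u ∈ ({v, w}ᶜ : Set F.Point) := fun u hu => by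
    have := ter_of_mem hu
    exact hK.2 ⟨fun h => ini_ne_ter u (h.trans this.symm),
      fun h => no_two_cycle (this.trans es.symm) (es'.trans h.symm)⟩
  have hout : ∀ u ∈ F.outs w, F.ter u ∈ ({v, w}ᶜ : Set F.Point) := fun u hu => by
    have := ini_of_mem hu
    exact hK.2 ⟨fun h => no_two_cycle (es'.trans this.symm) (h.trans es.symm),
      fun h => ini_ne_ter u (this.trans h.symm)⟩
  obtain ⟨i₀, hi₀⟩ := exists_mem_of_ne_nil _ hv.ins_ne
  let r : F.Strand → F.Strand := fun u => ((F.ins v)[(F.outs w).idxOf u]?).getD u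
  have hr : ∀ u ∉ F.outs w, r u = u := fun u hu => by
    simp [r, List.idxOf_eq_length hu, ← hlen]
  have hr' : ∀ j (hj : j < (F.outs w).length), r (F.outs w)[j] = (F.ins v)[j] := fun j hj => by
    simp [r, (F.outs_nodup w).idxOf_getElem, hlen, hj]
  have hri : ∀ u ∈ F.outs w, r u ∈ F.ins v := fun u hu => by
    obtain ⟨j, hj, rfl⟩ := mem_iff_getElem.1 hu
    rw [hr' j hj]; exact getElem_mem _
  obtain ⟨F', φ, π, h1, h2, h3, h4, h5, h6, h7⟩ := exists_excision hF {v, w}ᶜ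
    r i₀ (hin _ hi₀) (fun p hp => by
      have : p = v ∨ p = w := by_contra fun h => hp (hK.2 (not_or.1 h))
      rcases this with rfl | rfl
      · exact ⟨hv.ins_ne, by simp [hs]⟩
      · exact ⟨by simp [hs'], hw.outs_ne⟩)
    (fun u hu => hr u fun h => (hK.1 hu).2 (ini_of_mem h))
    (fun u hu => by
      by_cases h : u ∈ F.outs w
      · exact hin _ (hri u h)
      · rw [hr u h]
        exact hK.2 ⟨fun h' => (hK.1 hu).2 (by rw [hini u h', es']), fun h' => h ((F.mem_outs _ _).2 h')⟩)
    (fun u hu u' hu' he => by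
      have key : ∀ u u', F.ter u ∈ ({v, w}ᶜ : Set F.Point) → F.ter u' ∈ ({v, w}ᶜ : Set F.Point) →
          r u = r u' → u ∈ F.outs w → u' ∈ F.outs w := fun u u' hu hu' he h => by
        by_contra h'
        rw [hr u' h'] at he
        exact (hK.1 hu').1 (ter_of_mem (he ▸ hri u h))
      by_cases h : u ∈ F.outs w
      · have h' := key u u' hu hu' he h
        obtain ⟨j, hj, rfl⟩ := mem_iff_getElem.1 h
        obtain ⟨j', hj', rfl⟩ := mem_iff_getElem.1 h'
        rw [hr' j hj, hr' j' hj', (F.ins_nodup v).getElem_inj_iff] at he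
        simp only [he]
      · have h' : u' ∉ F.outs w := fun h' => h (key u' u hu' hu he.symm h')
        rwa [hr u h, hr u' h'] at he)
    (fun u hu => by
      by_cases h : u ∈ F.ins v
      · obtain ⟨j, hj, rfl⟩ := mem_iff_getElem.1 h
        exact ⟨(F.outs w)[j]'(hlen ▸ hj), hout _ (getElem_mem _), hr' j _⟩
      · exact ⟨u, hK.2 ⟨fun h' => h ((F.mem_ins _ _).2 h'), fun h' => (hK.1 hu).1 (by rw [hter u h', es])⟩,
          hr u fun h' => (hK.1 hu).2 (ini_of_mem h')⟩)
    (fun u hu => by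
      by_cases h : u ∈ F.outs w
      · obtain ⟨j, hj, rfl⟩ := mem_iff_getElem.1 h
        rw [hr' j hj]
        have := congrArg (fun l => l[j]?) hmap
        simpa [hj, hlen] using this
      · rw [hr u h])
    (fun h hh u hu => by
      by_cases h' : u ∈ F.outs w
      · have a := hh u; have b := hh s; have c := hh (r u)
        rw [ini_of_mem h'] at a; rw [es, es'] at b; rw [ter_of_mem (hri u h')] at c; omega
      · rw [hr u h']; exact hh u)
  refine ⟨F', h1, v, w, s, φ, π, hv, hw, hs, hs', h2, ?_, h3, h4, h5⟩
  refine ext_getElem (by simpa using hlen) fun j hj hj' => ?_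
  simp only [length_map] at hj hj'
  rw [getElem_map, getElem_map]
  refine h6 _ _ ?_
  rw [hr' j hj', hr]
  exact fun h => (hK.1 (hin _ (getElem_mem hj))).2 (ini_of_mem h)

lemma Carries.flip {K φ π} (h : F.Carries F' K φ π) : F.flip.Carries F'.flip K φ π :=
  ⟨h.injOn, h.pcol, h.ins, h.outs, h.scol_ins, h.scol_outs⟩

lemma Carries.symm {K J φ π Q} [Nonempty F.Point] [Nonempty F.Strand] (h : F.Carries F' K φ π)
    (hJ : K ⊆ J) (hφ : Set.InjOn φ J) (hQ : ∀ s, F.ini s ∈ K ∨ F.ter s ∈ K → s ∈ Q)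
    (hπ : Set.InjOn π Q) : ∃ ψ π', F'.Carries F (φ '' K) ψ π' ∧ (∀ p ∈ J, ψ (φ p) = p) ∧
      ∀ s ∈ Q, π' (π s) = s := by
  have h1 : ∀ p ∈ J, Function.invFunOn φ J (φ p) = p := fun p hp => hφ.leftInvOn_invFunOn hp
  have h2 : ∀ s ∈ Q, Function.invFunOn π Q (π s) = s := fun s hs => hπ.leftInvOn_invFunOn hs
  have ho : ∀ p ∈ K, ∀ s ∈ F.outs p, s ∈ Q := fun p hp s hs => hQ s (.inl (ini_of_mem hs ▸ hp))
  have hi : ∀ p ∈ K, ∀ s ∈ F.ins p, s ∈ Q := fun p hp s hs => hQ s (.inr (ter_of_mem hs ▸ hp))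
  have h3 : ∀ l : List F.Strand, (∀ s ∈ l, s ∈ Q) → (l.map π).map (Function.invFunOn π Q) = l := fun l hl => by
    rw [List.map_map]
    exact (map_congr_left fun s hs => h2 s (hl s hs)).trans (map_id l)
  refine ⟨_, _, ⟨?_, ?_, ?_, ?_, ?_, ?_⟩, h1, h2⟩
  · rintro _ ⟨p, hp, rfl⟩ _ ⟨q, hq, rfl⟩ he
    rw [h1 p (hJ hp), h1 q (hJ hq)] at he; rw [he]
  · rintro _ ⟨p, hp, rfl⟩; rw [h1 p (hJ hp), h.pcol p hp]
  · rintro _ ⟨p, hp, rfl⟩; rw [h1 p (hJ hp), h.outs p hp, h3 _ (ho p hp)]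
  · rintro _ ⟨p, hp, rfl⟩; rw [h1 p (hJ hp), h.ins p hp, h3 _ (hi p hp)]
  · rintro _ ⟨p, hp, rfl⟩ s hs
    rw [h.outs p hp] at hs
    obtain ⟨u, hu, rfl⟩ := mem_map.1 hs
    rw [h2 u (ho p hp u hu), h.scol_outs p hp u hu]
  · rintro _ ⟨p, hp, rfl⟩ s hs
    rw [h.ins p hp] at hs
    obtain ⟨u, hu, rfl⟩ := mem_map.1 hs
    rw [h2 u (hi p hp u hu), h.scol_ins p hp u hu]

lemma rotate_flatten_replicate {α : Type*} (cs : List α) (k : ℕ) :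
    (List.replicate k cs).flatten.rotate cs.length = (List.replicate k cs).flatten := by
  cases k with
  | zero => simp
  | succ k =>
    conv_lhs => rw [List.replicate_succ, List.flatten_cons, List.rotate_append_length_eq]
    rw [List.replicate_succ', List.flatten_append]; simp

open Classical in
/-- Replacing a block of loops by another one. -/
lemma exists_replaceBlock (hF : F.Closed) {d l k : ℕ} {A A' X X' : List F.Point}
    (hB : F.LoopBlock d l X X') (hso : F.sources = A ++ X) (hsi : F.sinks = A' ++ X')
    {cs : List V} (hcs : cs ≠ []) (hk : 1 ≤ k) :
    ∃ (F' : StrandDiagram Γ) (Z Z' : List F'.Point) (φ : F.Point → F'.Point)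
      (π : F.Strand → F'.Strand), F'.Closed ∧ F.Carries F' {p | p ∉ X ∧ p ∉ X'} φ π ∧
      Set.InjOn π {s | F.ini s ∉ X} ∧
      Set.BijOn φ {p | p ∉ X ∧ p ∉ X'} {x | x ∉ Z ∧ x ∉ Z'} ∧
      F'.sources = A.map φ ++ Z ∧ F'.sinks = A'.map φ ++ Z' ∧
      F'.FormLoops cs.length k Z Z' ∧ Z.map F'.pcol = (List.replicate k cs).flatten ∧
      ∀ z, (z ∈ Z → ∃ s, F'.outs z = [s]) ∧ (z ∈ Z' → ∃ s, F'.ins z = [s]) := by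
  obtain ⟨L, hL⟩ : ∃ L, L = (List.replicate k cs).flatten := ⟨_, rfl⟩
  have hn : L.length = k * cs.length := by simp [hL]
  have h0 : 0 < L.length := by
    have := length_pos_iff.2 hcs
    rw [hn]; positivity
  have hdn : cs.length ≤ L.length := by rw [hn]; exact Nat.le_mul_of_pos_left _ hk
  let T : F.Surgery :=
    { K := {p | p ∉ X ∧ p ∉ X'}
      N := Fin L.length ⊕ Fin L.length
      S := {s // F.ini s ∉ X} ⊕ Fin L.length
      fN := inferInstance
      fS := inferInstance
      π := fun s => if h : F.ini s ∉ X then .inl ⟨s, h⟩ else .inr ⟨0, h0⟩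
      pc := Sum.elim L.get L.get
      sc := Sum.elim (fun s => F.scol s) L.get
      no := Sum.elim (fun j => [.inr j]) fun _ => []
      ni := Sum.elim (fun _ => []) fun j => [.inr j] }
  have hK : ∀ s, F.ini s ∈ T.K ↔ F.ini s ∉ X := fun s => ⟨fun h => h.1, fun h => ⟨h, hB.ini_not⟩⟩
  have hK' : ∀ s, F.ter s ∈ T.K ↔ F.ini s ∉ X := fun s =>
    ⟨fun h h' => h.2 (hB.ini_iff.1 h'), fun h => ⟨hB.ter_not, fun h' => h (hB.ini_iff.2 h')⟩⟩
  have hπ : ∀ s (h : F.ini s ∉ X), T.π s = .inl ⟨s, h⟩ := fun s h => dif_pos h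
  have hinj : Set.InjOn T.π {s | F.ini s ∉ X} := fun s hs t ht he => by
    rw [hπ s hs, hπ t ht] at he
    exact congrArg Subtype.val (Sum.inl.inj he)
  have hT : T.Valid :=
    { scol := fun s hs => by
        rw [hK, hK', or_self] at hs
        rw [hπ s hs]; rfl
      oinj := hinj.mono fun s => (hK s).1
      onodup := by rintro (n | n) <;> simp [T]
      odisj := by
        rintro (n | n) s hs <;> rw [hπ s ((hK s).1 hs)] <;> simp [T]
      ouniq := by rintro s (n | n) (m | m) hs hs' <;> simp_all [T]
      oex := by
        rintro (s | j)
        · exact .inl ⟨s.1, (hK _).2 s.2, hπ _ _⟩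
        · exact .inr ⟨.inl j, by simp [T]⟩
      iinj := hinj.mono fun s => (hK' s).1
      inodup := by rintro (n | n) <;> simp [T]
      idisj := by
        rintro (n | n) s hs <;> rw [hπ s ((hK' s).1 hs)] <;> simp [T]
      iuniq := by rintro s (n | n) (m | m) hs hs' <;> simp_all [T]
      iex := by
        rintro (s | j)
        · exact .inl ⟨s.1, (hK' _).2 s.2, hπ _ _⟩
        · exact .inr ⟨.inr j, by simp [T]⟩
      height := by
        obtain ⟨h, h1⟩ := F.exists_height
        refine ⟨Sum.elim (fun p => h p) (Sum.elim (fun _ => 0) fun _ => 1), ?_⟩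
        rintro s (p | n | n) (q | m | m) hp hq
        · obtain ⟨u, h2, rfl⟩ := Surgery.mem_o_inl.1 hp
          obtain ⟨v, h3, h4⟩ := Surgery.mem_i_inl.1 hq
          have := hinj ((hK' v).1 (h3 ▸ q.2)) ((hK u).1 (h2 ▸ p.2)) h4
          subst this
          have := h1 v; rwa [h2, h3] at this
        · simp [T, Surgery.i] at hq
        · obtain ⟨u, h2, rfl⟩ := Surgery.mem_o_inl.1 hp
          rw [hπ u ((hK u).1 (h2 ▸ p.2))] at hq
          simp [T, Surgery.i] at hq
        · obtain ⟨v, h3, rfl⟩ := Surgery.mem_i_inl.1 hq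
          rw [hπ v ((hK' v).1 (h3 ▸ q.2))] at hp
          simp [T, Surgery.o] at hp
        · simp [T, Surgery.i] at hq
        · exact Nat.one_pos
        all_goals simp [T, Surgery.o] at hp
      types := by
        rintro (n | n)
        · exact .inl ⟨rfl, rfl⟩
        · exact .inr (.inl ⟨rfl, rfl⟩) }
  let x₀ : F.Point → T.K ⊕ T.N := fun _ => .inr (.inl ⟨0, h0⟩)
  let Z : List (T.K ⊕ T.N) := (List.finRange L.length).map fun j => .inr (.inl j)
  let Y : List (T.K ⊕ T.N) := (List.finRange L.length).map fun j => .inr (.inr j)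
  have hY : (Y.rotate (L.length - cs.length)).rotate cs.length = Y := by
    rw [List.rotate_rotate, Nat.sub_add_cancel hdn]
    have : Y.length = L.length := by simp [Y]
    rw [← this, List.rotate_length]
  have hAX : ∀ p ∈ A, p ∈ T.K := fun p hp => by
    have h1 := F.sources_nodup
    rw [hso] at h1
    refine ⟨fun h => List.disjoint_of_nodup_append h1 hp h, fun h => outs_ne_nil_of_ins ((F.mem_sources p).1 (by simp [hso, hp])) (hB.inn h).1⟩
  have hAX' : ∀ p ∈ A', p ∈ T.K := fun p hp => by
    have h1 := F.sinks_nodup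
    rw [hsi] at h1
    refine ⟨fun h => outs_ne_nil_of_ins (hB.out h).1 ((F.mem_sinks p).1 (by simp [hsi, hp])), fun h => List.disjoint_of_nodup_append h1 hp h⟩
  have hA : ∀ p : T.K, p.1 ∈ A ↔ T.i (.inl p) = [] := fun p => by
    show _ ↔ (F.ins p).map T.π = []
    rw [map_eq_nil_iff, ← F.mem_sources, hso, mem_append]
    have := p.2.1
    tauto
  have hA' : ∀ p : T.K, p.1 ∈ A' ↔ T.o (.inl p) = [] := fun p => by
    show _ ↔ (F.outs p).map T.π = []
    rw [map_eq_nil_iff, ← F.mem_sinks, hsi, mem_append]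
    have := p.2.2
    tauto
  have hS := Surgery.keep_append (x := x₀) (Z := Z) hAX (hso ▸ F.sources_nodup).of_append_left
    ((nodup_finRange _).map fun i j h => by cases h; rfl) (by simp [Z]) hA (by
      rintro (n | n) <;> simp [Z, T, Surgery.i])
  have hS' := Surgery.keep_append (x := x₀) (Z := Y.rotate (L.length - cs.length)) hAX'
    (hsi ▸ F.sinks_nodup).of_append_left
    (List.nodup_rotate.2 ((nodup_finRange _).map fun i j h => by cases h; rfl)) (by simp [Y]) hA' (by
      rintro (n | n) <;> simp [Y, T, Surgery.o])
  have hC := hT.carries hS hS' x₀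
  have hZc : Z.map T.pcol = L := by
    simp only [Z, List.map_map]
    exact List.map_get_finRange L
  have hYc : Y.map T.pcol = L := by
    simp only [Y, List.map_map]
    exact List.map_get_finRange L
  refine ⟨hT.diagram _ _ hS hS', Z, Y.rotate (L.length - cs.length), T.keep x₀, T.π, ?_, hC, hinj, ?_, rfl, rfl, ?_, ?_, ?_⟩
  · have hc : F.domain = F.range := hF
    unfold domain range at hc
    rw [hso, hsi, map_append, map_append] at hc
    have hl := hF.length_eq
    rw [hso, hsi, List.length_append, List.length_append, hB.len] at hl
    show (A.map (T.keep x₀) ++ Z).map T.pcol = (A'.map (T.keep x₀) ++ Y.rotate _).map T.pcol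
    rw [map_append, map_append, Surgery.map_pcol_keep hAX, Surgery.map_pcol_keep hAX',
      (append_inj hc (by simpa using hl)).1, hZc, List.map_rotate, hYc]
    congr 1
    have h1 : L.rotate cs.length = L := by rw [hL]; exact rotate_flatten_replicate _ _
    have h2 := List.rotate_rotate L cs.length (L.length - cs.length)
    rw [h1, Nat.add_sub_cancel' hdn, List.rotate_length] at h2
    exact h2.symm
  · refine ⟨fun p hp => ?_, hC.injOn, ?_⟩
    · rw [Surgery.keep_mem p hp]
      refine ⟨fun h => ?_, fun h => ?_⟩
      · obtain ⟨_, _, h⟩ := mem_map.1 h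
        cases h
      · obtain ⟨_, _, h⟩ := mem_map.1 (mem_rotate.1 h)
        cases h
    · rintro (p | n | n) ⟨hz, hz'⟩
      · exact ⟨p, p.2, Surgery.keep_mem p.1 p.2⟩
      · exact absurd (mem_map.2 ⟨n, mem_finRange _, rfl⟩) hz
      · exact absurd (mem_rotate.2 (mem_map.2 ⟨n, mem_finRange _, rfl⟩)) hz'
  · refine ⟨?_, ?_, ?_, ?_, ?_⟩
    · exact ((length_map _).trans length_finRange).trans hn
    · exact ((List.length_rotate _ _).trans ((length_map _).trans length_finRange)).trans hn
    · exact fun x hx => (hS.2 x).1 (mem_append_right _ hx)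
    · exact fun x hx => (hS'.2 x).1 (mem_append_right _ hx)
    · refine Eq.mpr (congrArg _ hY) ?_
      refine List.forall₂_map_left_iff.2 (List.forall₂_map_right_iff.2 (forall₂_same.2 fun j _ => ?_))
      exact ⟨.inr j, rfl, rfl⟩
  · rw [← hL]; exact hZc
  · refine fun z => ⟨fun hz => ?_, fun hz => ?_⟩
    · obtain ⟨j, _, rfl⟩ := mem_map.1 hz
      exact ⟨.inr j, rfl⟩
    · obtain ⟨j, _, rfl⟩ := mem_map.1 (mem_rotate.1 hz)
      exact ⟨.inr j, rfl⟩

/-- `F'` is obtained from `F` by moving `p` from below the sources `X` to below the sinks `X'`. -/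
structure Fire (F F' : StrandDiagram Γ) (p : F.Point) (A A' X X' : List F.Point) (φ : F.Point → F'.Point)
    (π : F.Strand → F'.Strand) (Z Z' : List F'.Point) : Prop where
  carries : F.Carries F' {q | q ∉ X ∧ q ∉ X' ∧ q ≠ p} φ π
  inj : Set.InjOn π {s | s ∉ F.ins p}
  bij : Set.BijOn φ {q | q = p ∨ q ∉ X ∧ (q ∈ X' → F.IsMerge q)} {z | z ∉ Z ∧ z ∉ Z'}
  sources : F'.sources = A.map φ ++ Z
  sinks : F'.sinks = A'.map φ ++ Z'
  pcol : F'.pcol (φ p) = F.pcol p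
  scol : ∀ s ∈ F.outs p, F'.scol (π s) = F.scol s
  length : (F'.outs (φ p)).length = (F.outs p).length
  new : Forall₂ (fun z s => F'.outs z = [π s]) Z (F.outs p)
  new' : Forall₂ (fun z s => F'.ins z = [s]) Z' (F'.outs (φ p))
  old : Forall₂ (fun b t => (F.IsMerge b → F'.pcol (φ b) = F.pcol b ∧
    F'.ins (φ b) = (F.ins b).map π ∧ F'.outs (φ b) = [t]) ∧
    (¬ F.IsMerge b → ∀ s ∈ F.ins b, π s = t)) X' (F'.ins (φ p))
  memA : ∀ a ∈ A, a ∉ X ∧ a ∉ X' ∧ a ≠ p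
  memA' : ∀ a ∈ A', a ∉ X ∧ a ∉ X' ∧ a ≠ p

open Classical in
set_option maxHeartbeats 1000000 in
lemma exists_fire (hF : F.Closed) {p : F.Point} (hp : F.net.alive p) (hpo : F.outs p ≠ [])
    {A A' X X' : List F.Point} (hso : F.sources = A ++ X) (hsi : F.sinks = A' ++ X')
    (hA : A.length = A'.length) (hX : X = [p] ∧ F.ins p = [] ∨
      F.ins p ≠ [] ∧ Forall₂ (fun x s => F.outs x = [s]) X (F.ins p)) :
    ∃ (F' : StrandDiagram Γ) (φ : F.Point → F'.Point) (π : F.Strand → F'.Strand)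
      (Z Z' : List F'.Point), F'.Closed ∧ F.Fire F' p A A' X X' φ π Z Z' := by
  have hd : 0 < (F.outs p).length := length_pos_iff.2 hpo
  have hXs : ∀ x ∈ X, F.ins x = [] := fun x hx => (F.mem_sources x).1 (by simp [hso, hx])
  have hXs' : ∀ x ∈ X', F.outs x = [] := fun x hx => (F.mem_sinks x).1 (by simp [hsi, hx])
  have hpX' : p ∉ X' := fun h => hpo (hXs' p h)
  have hnX' : ∀ s, F.ini s ∉ X' := fun s h => ini_ne (hXs' _ h) rfl
  have hnX : ∀ s, F.ter s ∉ X := fun s h => ter_ne (hXs _ h) rfl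
  have hX1 : ∀ s, F.ini s ∈ X → F.ini s = p ∨ s ∈ F.ins p := fun s h => by
    rcases hX with ⟨rfl, _⟩ | ⟨_, hX⟩
    · exact .inl (by simpa using h)
    · obtain ⟨i, hi, he⟩ := mem_iff_getElem.1 h
      have := hX.get hi (hX.length_eq ▸ hi)
      have h2 := mem_outs_ini s
      rw [← he, show F.outs X[i] = _ from this, mem_singleton] at h2
      exact .inr (h2 ▸ getElem_mem _)
  have hX2 : ∀ s ∈ F.ins p, F.ini s ∈ X := fun s h => by
    rcases hX with ⟨_, h'⟩ | ⟨_, hX⟩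
    · rw [h'] at h; cases h
    · obtain ⟨i, hi, rfl⟩ := mem_iff_getElem.1 h
      have := hX.get (hX.length_eq ▸ hi) hi
      rw [show F.ini (F.ins p)[i] = X[i]'(hX.length_eq ▸ hi) from ini_of_eq this]
      exact getElem_mem _
  have hopn : ∀ s, F.ini s = p → s ∉ F.ins p := fun s h h' => ini_ne_ter s (h.trans (ter_of_mem h').symm)
  have hb : ∀ b ∈ X', ¬ F.IsMerge b → ∃ t, F.ins b = [t] ∧ t ∉ F.ins p ∧ F.scol t = F.pcol b := fun b hb hm => by
    have h0 := hXs' b hb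
    have : F.IsUnivalentSink b := by
      rcases F.types b with h | h | h | h | h
      · have := h.2; simp [h0] at this
      · exact h
      · have := h.2; simp [h0] at this
      · exact absurd h hm
      · have := h.2; simp [h0] at this
    obtain ⟨t, ht⟩ := length_eq_one_iff.1 this.2
    refine ⟨t, ht, fun h => hpX' ?_, F.univalentSink_col b this t (by simp [ht])⟩
    rw [← ter_of_mem h, ter_of_eq ht]; exact hb
  let L := {b // b ∈ X' ∧ F.IsMerge b}
  let S := {s // s ∉ F.ins p} ⊕ Fin (F.outs p).length ⊕ L
  let π : F.Strand → S := fun s => if h : s ∉ F.ins p then .inl ⟨s, h⟩ else .inr (.inl ⟨0, hd⟩)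
  let τ : F.Point → S := fun b => if h : b ∈ X' ∧ F.IsMerge b then .inr (.inr ⟨b, h⟩) else
    ((F.ins b).map π).headD (.inr (.inl ⟨0, hd⟩))
  let T : F.Surgery :=
    { K := {q | q ∉ X ∧ q ∉ X' ∧ q ≠ p}
      N := Unit ⊕ (Fin (F.outs p).length ⊕ Fin (F.outs p).length) ⊕ L
      S := S
      fN := inferInstance
      fS := inferInstance
      π := π
      pc := Sum.elim (fun _ => F.pcol p) (Sum.elim (Sum.elim (fun j => F.scol ((F.outs p).get j))
        fun j => F.scol ((F.outs p).get j)) fun b => F.pcol b)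
      sc := Sum.elim (fun s => F.scol s) (Sum.elim (fun j => F.scol ((F.outs p).get j)) fun b => F.pcol b)
      no := Sum.elim (fun _ => (List.finRange _).map fun j => .inr (.inl j))
        (Sum.elim (Sum.elim (fun j => [π ((F.outs p).get j)]) fun _ => []) fun b => [.inr (.inr b)])
      ni := Sum.elim (fun _ => X'.map τ)
        (Sum.elim (Sum.elim (fun _ => []) fun j => [.inr (.inl j)]) fun b => (F.ins b).map π) }
  have hπ : ∀ s (h : s ∉ F.ins p), π s = .inl ⟨s, h⟩ := fun s h => dif_pos h
  have hinj : Set.InjOn π {s | s ∉ F.ins p} := fun s hs t ht he => by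
    rw [hπ s hs, hπ t ht] at he
    exact congrArg Subtype.val (Sum.inl.inj he)
  have hτ1 : ∀ b (h : b ∈ X' ∧ F.IsMerge b), τ b = .inr (.inr ⟨b, h⟩) := fun b h => dif_pos h
  have hτ2 : ∀ b t, ¬ F.IsMerge b → F.ins b = [t] → τ b = π t := fun b t h ht => by
    have : τ b = ((F.ins b).map π).headD (.inr (.inl ⟨0, hd⟩)) := dif_neg fun h' => h h'.2
    rw [this, ht]; rfl
  have hKo : ∀ s, F.ini s ∈ T.K → s ∉ F.ins p := fun s h h' => h.1 (hX2 s h')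
  have hKi : ∀ s, F.ter s ∈ T.K → s ∉ F.ins p := fun s h h' => h.2.2 (ter_of_mem h')
  have hbp : ∀ (b : L) s, s ∈ F.ins b → s ∉ F.ins p := fun b s h h' =>
    hpX' ((ter_of_mem h).symm.trans (ter_of_mem h') ▸ b.2.1)
  have hτsc : ∀ b ∈ X', T.sc (τ b) = F.pcol b := fun b hbX => by
    by_cases h : F.IsMerge b
    · rw [hτ1 b ⟨hbX, h⟩]; rfl
    · obtain ⟨t, h1, h2, h3⟩ := hb b hbX h
      rw [hτ2 b t h h1, hπ t h2]; exact h3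
  have hτm : ∀ b ∈ X', (∃ h, τ b = .inr (.inr ⟨b, h⟩)) ∨ ∃ t h, τ b = .inl ⟨t, h⟩ ∧ F.ter t = b ∧ ¬ F.IsMerge b :=
    fun b hbX => by
    by_cases h : F.IsMerge b
    · exact .inl ⟨⟨hbX, h⟩, hτ1 b _⟩
    · obtain ⟨t, h1, h2, _⟩ := hb b hbX h
      exact .inr ⟨t, h2, by rw [hτ2 b t h h1, hπ t h2], ter_of_eq h1, h⟩
  have hcl : X.map F.pcol = X'.map F.pcol := by
    have hc : F.domain = F.range := hF
    unfold domain range at hc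
    rw [hso, hsi, map_append, map_append] at hc
    exact (append_inj hc (by simpa using hA)).2
  have hXXl : X.length = X'.length := by simpa using congrArg List.length hcl
  have hosc : (List.finRange (F.outs p).length).map (fun j => F.scol ((F.outs p).get j)) = (F.outs p).map F.scol := by
    conv_rhs => rw [← List.map_get_finRange (F.outs p), List.map_map]
    rfl
  have hX'n : X'.Nodup := by have := F.sinks_nodup; rw [hsi] at this; exact this.of_append_right
  have hi1 : ∀ q j, (.inr (.inl j) : S) ∈ T.i q → q = .inr (.inr (.inl (.inr j))) := by
    rintro (q | u | (k | k) | b) j hq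
    · obtain ⟨v, h1, h2⟩ := Surgery.mem_i_inl.1 hq
      rw [show T.π v = _ from hπ v (hKi v (h1 ▸ q.2))] at h2; cases h2
    · obtain ⟨b, h1, h2⟩ := mem_map.1 (show _ ∈ X'.map τ from hq)
      rcases hτm b h1 with ⟨_, h⟩ | ⟨_, _, h, _⟩ <;> rw [h] at h2 <;> cases h2
    · cases hq
    · have : (.inr (.inl j) : S) = .inr (.inl k) := mem_singleton.1 hq
      cases this; rfl
    · obtain ⟨v, h1, h2⟩ := mem_map.1 (show _ ∈ (F.ins b).map π from hq)
      rw [hπ v (hbp b v h1)] at h2; cases h2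
  have hi2 : ∀ q b, (.inr (.inr b) : S) ∈ T.i q → q = .inr (.inl ()) := by
    rintro (q | u | (k | k) | b') b hq
    · obtain ⟨v, h1, h2⟩ := Surgery.mem_i_inl.1 hq
      rw [show T.π v = _ from hπ v (hKi v (h1 ▸ q.2))] at h2; cases h2
    · rfl
    · cases hq
    · have : (.inr (.inr b) : S) = .inr (.inl k) := mem_singleton.1 hq
      cases this
    · obtain ⟨v, h1, h2⟩ := mem_map.1 (show _ ∈ (F.ins b').map π from hq)
      rw [hπ v (hbp b' v h1)] at h2; cases h2
  have hi3 : ∀ n (s : {s // s ∉ F.ins p}), (.inl s : S) ∈ T.ni n →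
      n = .inl () ∧ F.ter s ∈ X' ∧ ¬ F.IsMerge (F.ter s) ∨ ∃ h, n = .inr (.inr ⟨F.ter s, h⟩) := by
    rintro (u | (k | k) | b) s hq
    · obtain ⟨b, h1, h2⟩ := mem_map.1 (show _ ∈ X'.map τ from hq)
      rcases hτm b h1 with ⟨_, h⟩ | ⟨t, ht, h, h3, h4⟩ <;> rw [h] at h2 <;> cases h2
      subst h3; exact .inl ⟨rfl, h1, h4⟩
    · cases hq
    · cases mem_singleton.1 hq
    · obtain ⟨v, h1, h2⟩ := mem_map.1 (show _ ∈ (F.ins b).map π from hq)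
      rw [hπ v (hbp b v h1)] at h2; cases h2
      obtain ⟨b, hb'⟩ := b
      have := ter_of_mem h1
      subst this
      exact .inr ⟨hb', rfl⟩
  have hT : T.Valid :=
    { scol := fun s hs => by
        have : s ∉ F.ins p := hs.elim (hKo s) (hKi s)
        rw [show T.π s = _ from hπ s this]; rfl
      oinj := hinj.mono hKo
      onodup := by
        rintro (u | (k | k) | b)
        · exact (nodup_finRange _).map fun i j h => by cases h; rfl
        all_goals simp [T]
      odisj := by
        rintro (u | (k | k) | b) s hs h <;> rw [show T.π s = _ from hπ s (hKo s hs)] at h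
        · obtain ⟨_, _, h⟩ := mem_map.1 h; cases h
        · have h1 := ini_of_mem (get_mem (F.outs p) k)
          have h' := mem_singleton.1 h
          rw [hπ _ (hopn _ h1)] at h'
          cases h'
          exact hs.2.2 h1
        · cases h
        · cases mem_singleton.1 h
      ouniq := by
        have h1 := fun k => ini_of_mem (get_mem (F.outs p) k)
        have h2 := fun k => hπ _ (hopn _ (h1 k))
        have h3 : ∀ s n, s ∈ T.no n → (∃ k, n = .inr (.inl (.inl k)) ∧ s = π ((F.outs p).get k)) ∨
            (n = .inl () ∧ ∃ j, s = .inr (.inl j)) ∨ ∃ b, n = .inr (.inr b) ∧ s = .inr (.inr b) := by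
          rintro s (u | (k | k) | b) h
          · obtain ⟨j, _, rfl⟩ := mem_map.1 h
            exact .inr (.inl ⟨rfl, j, rfl⟩)
          · exact .inl ⟨k, rfl, mem_singleton.1 h⟩
          · cases h
          · exact .inr (.inr ⟨b, rfl, mem_singleton.1 h⟩)
        intro s n n' h h'
        rcases h3 s n h with ⟨k, rfl, rfl⟩ | ⟨rfl, j, rfl⟩ | ⟨b, rfl, rfl⟩ <;>
        rcases h3 _ n' h' with ⟨k', rfl, e⟩ | ⟨rfl, j', e⟩ | ⟨b', rfl, e⟩ <;> first | rw [h2] at e | skip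
        · rw [h2] at e
          rw [(List.nodup_iff_injective_get.1 (F.outs_nodup p)) (congrArg Subtype.val (Sum.inl.inj e))]
        all_goals cases e
        all_goals rfl
      oex := by
        rintro (s | j | b)
        · by_cases h : F.ini s = p
          · obtain ⟨k, hk⟩ := List.get_of_mem ((F.mem_outs p s).2 h)
            refine .inr ⟨.inr (.inl (.inl k)), mem_singleton.2 ?_⟩
            rw [hk, hπ s s.2]
          · exact .inl ⟨s, ⟨fun h' => (hX1 s h').elim h s.2, hnX' s, h⟩, hπ _ _⟩
        · exact .inr ⟨.inl (), mem_map.2 ⟨j, mem_finRange _, rfl⟩⟩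
        · exact .inr ⟨.inr (.inr b), mem_singleton.2 rfl⟩
      iinj := hinj.mono hKi
      inodup := by
        rintro (u | (k | k) | b)
        · refine hX'n.map_on fun b h b' h' he => ?_
          rcases hτm b h with ⟨_, e⟩ | ⟨t, _, e, h1, _⟩ <;> rcases hτm b' h' with ⟨_, e'⟩ | ⟨t', _, e', h1', _⟩ <;>
          rw [e, e'] at he <;> cases he
          · rfl
          · exact h1.symm.trans h1'
        · exact List.nodup_nil
        · exact List.nodup_singleton _
        · exact (F.ins_nodup b).map_on fun s h t h' he => hinj (hbp b s h) (hbp b t h') he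
      idisj := fun n s hs h => by
        rw [show T.π s = _ from hπ s (hKi s hs)] at h
        rcases hi3 n _ h with ⟨_, h, _⟩ | ⟨h, _⟩
        exacts [hs.2.1 h, hs.2.1 h.1]
      iuniq := by
        rintro (s | j | b) n n' h h'
        · rcases hi3 n s h with ⟨rfl, _, h1⟩ | ⟨h1, rfl⟩ <;> rcases hi3 n' s h' with ⟨rfl, _, h1'⟩ | ⟨h1', rfl⟩
          · rfl
          · exact absurd h1'.2 h1
          · exact absurd h1.2 h1'
          · rfl
        · exact Sum.inr.inj ((hi1 (.inr n) j h).trans (hi1 (.inr n') j h').symm)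
        · exact Sum.inr.inj ((hi2 (.inr n) b h).trans (hi2 (.inr n') b h').symm)
      iex := by
        rintro (s | j | b)
        · by_cases h : F.ter s ∈ X'
          · by_cases hm : F.IsMerge (F.ter s)
            · exact .inr ⟨.inr (.inr ⟨_, h, hm⟩), mem_map.2 ⟨s, mem_ins_ter _, hπ _ _⟩⟩
            · obtain ⟨t, h1, h2, _⟩ := hb _ h hm
              have h3 := mem_ins_ter s.1
              rw [h1, mem_singleton] at h3
              refine .inr ⟨.inl (), mem_map.2 ⟨_, h, ?_⟩⟩
              rw [hτ2 _ _ hm h1, ← h3, hπ]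
          · exact .inl ⟨s, ⟨hnX s, h, fun h' => s.2 ((F.mem_ins p s).2 h')⟩, hπ _ _⟩
        · exact .inr ⟨.inr (.inl (.inr j)), mem_singleton.2 rfl⟩
        · exact .inr ⟨.inl (), mem_map.2 ⟨b, b.2.1, hτ1 b b.2⟩⟩
      height := by
        obtain ⟨H, h1⟩ := F.exists_height
        obtain ⟨M, hM⟩ : ∃ M, ∀ q, H q < M := by
          obtain ⟨M, hM⟩ := (Set.finite_range H).bddAbove
          exact ⟨M + 1, fun q => Nat.lt_succ_of_le (hM ⟨q, rfl⟩)⟩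
        refine ⟨Sum.elim (fun q => H q + 1) (Sum.elim (fun _ => M + 2)
          (Sum.elim (Sum.elim (fun _ => 0) fun _ => M + 3) fun _ => M + 1)), ?_⟩
        rintro s (q | u | (k | k) | b) q' hq hq'
        · obtain ⟨v, h2, rfl⟩ := Surgery.mem_o_inl.1 hq
          have := hM q
          rcases q' with q' | u | (k | k) | b
          · obtain ⟨w, h3, h4⟩ := Surgery.mem_i_inl.1 hq'
            have := hinj (hKi w (h3 ▸ q'.2)) (hKo v (h2 ▸ q.2)) h4
            subst this
            have := h1 w; rw [h2, h3] at this
            exact Nat.succ_lt_succ this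
          · simp only [Sum.elim_inl, Sum.elim_inr]; omega
          · cases hq'
          · simp only [Sum.elim_inl, Sum.elim_inr]; omega
          · simp only [Sum.elim_inl, Sum.elim_inr]; omega
        · obtain ⟨j, _, rfl⟩ := mem_map.1 hq
          rw [hi1 q' j hq']; simp
        · rcases q' with q' | u | (k | k) | b
          · exact Nat.succ_pos _
          · exact Nat.succ_pos _
          · cases hq'
          · exact Nat.succ_pos _
          · exact Nat.succ_pos _
        · cases hq
        · rw [mem_singleton.1 hq] at hq'
          rw [hi2 q' b hq']; simp
      types := by
        rintro (u | (k | k) | b)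
        · have h1 := F.isLocal p
          have h2 : (X'.map τ).map T.sc = X.map F.pcol := by
            rw [hcl, List.map_map]; exact map_congr_left hτsc
          have h3 : ((List.finRange (F.outs p).length).map fun j => (.inr (.inl j) : S)).map T.sc = (F.outs p).map F.scol := by
            rw [List.map_map]; exact hosc
          show Γ.Local (F.pcol p) ((X'.map τ).map T.sc) (((List.finRange (F.outs p).length).map fun j => (.inr (.inl j) : S)).map T.sc)
          rw [h2, h3]
          rcases hX with ⟨rfl, h4⟩ | ⟨_, hX⟩
          · have h5 : F.IsSplit p := hp.resolve_right fun h => h.ins_ne h4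
            exact .inr (.inr (.inl ⟨.inr rfl, by simpa using h5.2, (F.split_col p h5).1⟩))
          · have h5 : X.map F.pcol = (F.ins p).map F.scol := by
              refine ext_getElem (by simpa using hX.length_eq) fun i hi hi' => ?_
              rw [length_map] at hi hi'
              have h6 := hX.get hi hi'
              rw [getElem_map, getElem_map]
              exact (F.univalentSource_col _ ⟨hXs _ (getElem_mem _), by rw [show F.outs X[i] = _ from h6]; rfl⟩ _
                (mem_of_eq_singleton h6)).symm
            rwa [h5]
        · refine .inl ⟨rfl, ?_⟩
          show [T.sc (π _)] = _
          rw [hπ _ (hopn _ (ini_of_mem (get_mem _ _)))]; rfl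
        · exact .inr (.inl ⟨rfl, rfl⟩)
        · refine .inr (.inr (.inr (.inl ⟨.inr rfl, ?_⟩)))
          have : ((F.ins b).map π).map T.sc = (F.ins b).map F.scol := by
            rw [List.map_map]
            exact map_congr_left fun s hs => by rw [Function.comp_apply, hπ s (hbp b s hs)]; rfl
          show 2 ≤ (((F.ins b).map π).map T.sc).length ∧ ((F.ins b).map π).map T.sc = _
          rw [this]
          exact ⟨by simpa using b.2.2.2, (F.merge_col b b.2.2).1⟩ }
  let x : F.Point → T.K ⊕ T.N := fun q =>
    if h : q ∈ X' ∧ F.IsMerge q then .inr (.inr (.inr ⟨q, h⟩)) else .inr (.inl ())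
  have hxp : T.keep x p = .inr (.inl ()) := by
    rw [Surgery.keep_not_mem p fun h : p ∈ T.K => h.2.2 rfl]
    exact dif_neg fun h => hpX' h.1
  have hxb : ∀ b (h : b ∈ X' ∧ F.IsMerge b), T.keep x b = .inr (.inr (.inr ⟨b, h⟩)) := fun b h => by
    rw [Surgery.keep_not_mem b fun h' : b ∈ T.K => h'.2.1 h.1]
    exact dif_pos h
  have hxk : ∀ q, q ∉ X → q ∉ X' → q ≠ p → ∃ h, T.keep x q = .inl ⟨q, h⟩ := fun q h1 h2 h3 =>
    ⟨⟨h1, h2, h3⟩, Surgery.keep_mem q _⟩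
  let Z : List (T.K ⊕ T.N) := (List.finRange _).map fun j => .inr (.inr (.inl (.inl j)))
  let Z' : List (T.K ⊕ T.N) := (List.finRange _).map fun j => .inr (.inr (.inl (.inr j)))
  have hpA : ∀ a ∈ A, a ∈ T.K := fun a ha => by
    have h1 := F.sources_nodup
    have h2 : F.ins a = [] := (F.mem_sources a).1 (by simp [hso, ha])
    rw [hso] at h1
    have h3 := List.disjoint_of_nodup_append h1 ha
    refine ⟨h3, fun h => outs_ne_nil_of_ins h2 (hXs' a h), fun h => ?_⟩
    rcases hX with ⟨rfl, _⟩ | ⟨h4, _⟩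
    · exact h3 (by simp [h])
    · exact h4 (h ▸ h2)
  have hpA' : ∀ a ∈ A', a ∈ T.K := fun a ha => by
    have h1 := F.sinks_nodup
    have h2 : F.outs a = [] := (F.mem_sinks a).1 (by simp [hsi, ha])
    rw [hsi] at h1
    refine ⟨fun h => outs_ne_nil_of_ins (hXs a h) h2, List.disjoint_of_nodup_append h1 ha, ?_⟩
    rintro rfl; exact hpo h2
  have hAi : ∀ q : T.K, q.1 ∈ A ↔ T.i (.inl q) = [] := fun q => by
    show _ ↔ (F.ins q).map T.π = []
    rw [map_eq_nil_iff, ← F.mem_sources, hso, mem_append]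
    have := q.2.1
    tauto
  have hAo : ∀ q : T.K, q.1 ∈ A' ↔ T.o (.inl q) = [] := fun q => by
    show _ ↔ (F.outs q).map T.π = []
    rw [map_eq_nil_iff, ← F.mem_sinks, hsi, mem_append]
    have := q.2.2.1
    tauto
  have hS := Surgery.keep_append (x := x) (Z := Z) hpA (hso ▸ F.sources_nodup).of_append_left
    ((nodup_finRange _).map fun i j h => by cases h; rfl) (by simp [Z]) hAi (by
      rintro (u | (j | j) | b)
      · refine iff_of_false (by simp [Z, T]) fun h => ?_
        have h0 := congrArg List.length (show X'.map τ = [] from h)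
        rw [length_map, ← hXXl] at h0
        rcases hX with ⟨rfl, _⟩ | ⟨h4, hX⟩
        · simp at h0
        · rw [hX.length_eq] at h0; exact h4 (List.eq_nil_of_length_eq_zero h0)
      · exact iff_of_true (mem_map.2 ⟨j, mem_finRange _, rfl⟩) rfl
      · exact iff_of_false (by simp [Z, T]) (cons_ne_nil _ _)
      · exact iff_of_false (by simp [Z, T]) fun h => b.2.2.ins_ne (map_eq_nil_iff.1 h))
  have hS' := Surgery.keep_append (x := x) (Z := Z') hpA' (hsi ▸ F.sinks_nodup).of_append_left
    ((nodup_finRange _).map fun i j h => by cases h; rfl) (by simp [Z']) hAo (by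
      rintro (u | (j | j) | b)
      · refine iff_of_false (by simp [Z', T]) fun h => ?_
        have h0 := map_eq_nil_iff.1 (show (List.finRange (F.outs p).length).map _ = [] from h)
        rw [List.finRange_eq_nil_iff] at h0
        omega
      · exact iff_of_false (by simp [Z', T]) (cons_ne_nil _ _)
      · exact iff_of_true (mem_map.2 ⟨j, mem_finRange _, rfl⟩) rfl
      · exact iff_of_false (by simp [Z', T]) (cons_ne_nil _ _))
  have hC := hT.carries hS hS' x
  have hZc : Z.map T.pcol = Z'.map T.pcol := by simp only [Z, Z', List.map_map]; rfl
  refine ⟨hT.diagram _ _ hS hS', T.keep x, π, Z, Z', ?_, hC, hinj, ⟨?_, ?_, ?_⟩, rfl, rfl, ?_, ?_, ?_, ?_, ?_, ?_, hpA, hpA'⟩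
  · have hc : F.domain = F.range := hF
    unfold domain range at hc
    rw [hso, hsi, map_append, map_append] at hc
    show (A.map (T.keep x) ++ Z).map T.pcol = (A'.map (T.keep x) ++ Z').map T.pcol
    rw [map_append, map_append, Surgery.map_pcol_keep hpA, Surgery.map_pcol_keep hpA',
      (append_inj hc (by simpa using hA)).1, hZc]
  · have hn : ∀ z, (∀ j, z ≠ .inr (.inr (.inl j))) → z ∉ Z ∧ z ∉ Z' := fun z hz =>
      ⟨fun h => by obtain ⟨j, _, h⟩ := mem_map.1 h; exact hz _ h.symm,
        fun h => by obtain ⟨j, _, h⟩ := mem_map.1 h; exact hz _ h.symm⟩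
    rintro q (rfl | ⟨h1, h2⟩)
    · exact hn _ fun j h => by rw [hxp] at h; cases h
    · by_cases hq : q = p
      · exact hn _ fun j h => by rw [hq, hxp] at h; cases h
      by_cases h3 : q ∈ X'
      · exact hn _ fun j h => by rw [hxb q ⟨h3, h2 h3⟩] at h; cases h
      · obtain ⟨_, h4⟩ := hxk q h1 h3 hq
        exact hn _ fun j h => by rw [h4] at h; cases h
  · have hc : ∀ q, q = p ∨ q ∉ X ∧ (q ∈ X' → F.IsMerge q) → (q = p ∧ T.keep x q = .inr (.inl ())) ∨
        (∃ h, T.keep x q = .inr (.inr (.inr ⟨q, h⟩))) ∨ ∃ h, T.keep x q = .inl ⟨q, h⟩ := fun q hq => by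
      by_cases h : q = p
      · exact .inl ⟨h, h ▸ hxp⟩
      · obtain ⟨h1, h2⟩ := hq.resolve_left h
        by_cases h3 : q ∈ X'
        · exact .inr (.inl ⟨_, hxb q ⟨h3, h2 h3⟩⟩)
        · exact .inr (.inr (hxk q h1 h3 h))
    intro q hq q' hq' he
    rcases hc q hq with ⟨h1, h⟩ | ⟨_, h⟩ | ⟨_, h⟩ <;> rcases hc q' hq' with ⟨h1', h'⟩ | ⟨_, h'⟩ | ⟨_, h'⟩ <;>
    rw [h, h'] at he <;> cases he
    · exact h1.trans h1'.symm
    · rfl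
    · rfl
  · rintro (q | u | (j | j) | b) hz
    · exact ⟨q, .inr ⟨q.2.1, fun h => absurd h q.2.2.1⟩, Surgery.keep_mem q.1 q.2⟩
    · exact ⟨p, .inl rfl, hxp⟩
    · exact absurd (mem_map.2 ⟨j, mem_finRange _, rfl⟩) hz.1
    · exact absurd (mem_map.2 ⟨j, mem_finRange _, rfl⟩) hz.2
    · exact ⟨b, .inr ⟨fun h => outs_ne_nil_of_ins (hXs _ h) (hXs' _ b.2.1), fun _ => b.2.2⟩, hxb b b.2⟩
  · show T.pcol (T.keep x p) = _
    rw [hxp]; rfl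
  · intro s hs
    show T.sc (π s) = _
    rw [hπ s (hopn s (ini_of_mem hs))]; rfl
  · show (T.o (T.keep x p)).length = _
    rw [hxp]
    exact (length_map _).trans length_finRange
  · have h : Forall₂ (fun z s => T.o z = [π s]) Z ((List.finRange _).map (F.outs p).get) :=
      List.forall₂_map_left_iff.2 (List.forall₂_map_right_iff.2 (forall₂_same.2 fun j _ => rfl))
    rwa [List.map_get_finRange] at h
  · show Forall₂ _ Z' (T.o (T.keep x p))
    rw [hxp]
    exact List.forall₂_map_left_iff.2 (List.forall₂_map_right_iff.2 (forall₂_same.2 fun j _ => rfl))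
  · show Forall₂ _ X' (T.i (T.keep x p))
    rw [hxp]
    refine List.forall₂_map_right_iff.2 (forall₂_same.2 fun b hbX => ⟨fun hm => ?_, fun hm s hs => ?_⟩)
    · show T.pcol (T.keep x b) = _ ∧ T.i (T.keep x b) = _ ∧ T.o (T.keep x b) = _
      rw [hxb b ⟨hbX, hm⟩, hτ1 b ⟨hbX, hm⟩]
      exact ⟨rfl, rfl, rfl⟩
    · obtain ⟨t, h1, h2, _⟩ := hb b hbX hm
      rw [h1, mem_singleton] at hs
      rw [hτ2 b t hm h1, hs]

/-- The same diagram with another order of its sources and sinks. -/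
def reorder (F : StrandDiagram Γ) (l l' : List F.Point) (h : l.Perm F.sources) (h' : l'.Perm F.sinks) :
    StrandDiagram Γ where
  toStrandGraph := { F.toStrandGraph with
    sources := l
    sources_nodup := h.nodup_iff.2 F.sources_nodup
    mem_sources := fun p => h.mem_iff.trans (F.mem_sources p)
    sinks := l'
    sinks_nodup := h'.nodup_iff.2 F.sinks_nodup
    mem_sinks := fun p => h'.mem_iff.trans (F.mem_sinks p) }
  acyclic := F.acyclic
  types := F.types
  univalentSource_col := F.univalentSource_col
  univalentSink_col := F.univalentSink_col
  split_col := F.split_col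
  merge_col := F.merge_col
  degenerate_col := F.degenerate_col

lemma pcol_eq_of_base (hF : F.Closed) {l l' : List F.Point} (hl : l.length = l'.length)
    (h : ∀ q ∈ l.zip l', F.Base q.1 q.2) : l.map F.pcol = l'.map F.pcol := by
  refine ext_getElem (by simpa using hl) fun i hi hi' => ?_
  rw [length_map] at hi hi'
  rw [getElem_map, getElem_map]
  exact hF.base_col (h (l[i], l'[i]) (mem_iff_getElem.2 ⟨i, by simp [hi, hi'], by simp⟩))

open Classical in
/-- The base line may be permuted so that given base points come last. -/
lemma exists_reorder (hF : F.Closed) {X : List F.Point} (hX : X.Nodup) (hXs : ∀ x ∈ X, F.ins x = []) :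
    ∃ (A A' X' : List F.Point) (h : (A ++ X).Perm F.sources) (h' : (A' ++ X').Perm F.sinks),
      A.length = A'.length ∧ Forall₂ F.Base X X' ∧ (F.reorder _ _ h h').Closed ∧
      F.BaseLinePermutation (F.reorder _ _ h h') ∧ F.net.Iso (F.reorder _ _ h h').net id fun _ => 0 := by
  have hs : ∀ x ∈ X, ∃ b, F.Base x b := fun x hx => hF.exists_sink (hXs x hx)
  obtain ⟨σ, hσ⟩ : ∃ σ : F.Point → F.Point, ∀ x ∈ X, F.Base x (σ x) :=
    ⟨fun x => if h : x ∈ X then (hs x h).choose else x, fun x h => by simp only [h, dif_pos]; exact (hs x h).choose_spec⟩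
  let Q := F.sources.zip F.sinks
  let P := X.map fun x => (x, σ x)
  have hl := hF.length_eq
  have hf : Q.map Prod.fst = F.sources := List.map_fst_zip hl.le
  have hg : Q.map Prod.snd = F.sinks := List.map_snd_zip hl.ge
  have hQ : Q.Nodup := Nodup.of_map Prod.fst (by rw [hf]; exact F.sources_nodup)
  have hP : (Q.filter (· ∈ P)).Perm P := by
    refine (List.perm_ext_iff_of_nodup (hQ.filter _) (hX.map fun x y h => congrArg Prod.fst h)).2 fun q => ?_
    rw [List.mem_filter, decide_eq_true_eq]
    refine ⟨And.right, fun h => ⟨?_, h⟩⟩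
    obtain ⟨x, hx, rfl⟩ := mem_map.1 h
    exact hσ x hx
  have hperm : (Q.filter (fun q => ¬ q ∈ P) ++ P).Perm Q :=
    (List.Perm.append_left _ hP.symm).trans (List.perm_append_comm.trans
      (by have := List.filter_append_perm (fun q => decide (q ∈ P)) Q; simpa using this))
  have e1 : P.map Prod.fst = X := List.map_map.trans (map_id X)
  have e2 : P.map Prod.snd = X.map σ := List.map_map
  have h1 : ((Q.filter fun q => ¬ q ∈ P).map Prod.fst ++ X).Perm F.sources := by
    have := hperm.map Prod.fst; rwa [map_append, e1, hf] at this
  have h2 : ((Q.filter fun q => ¬ q ∈ P).map Prod.snd ++ X.map σ).Perm F.sinks := by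
    have := hperm.map Prod.snd; rwa [map_append, e2, hg] at this
  have hz : ((Q.filter fun q => ¬ q ∈ P).map Prod.fst ++ X).zip ((Q.filter fun q => ¬ q ∈ P).map Prod.snd ++ X.map σ) =
      Q.filter (fun q => ¬ q ∈ P) ++ P := by
    rw [zip_append (by simp)]
    congr 1
    · exact (List.zip_of_prod rfl rfl).symm
    · exact (List.zip_of_prod e1 e2).symm
  have hlen : ((Q.filter fun q => ¬ q ∈ P).map Prod.fst ++ X).length =
      ((Q.filter fun q => ¬ q ∈ P).map Prod.snd ++ X.map σ).length := by simp
  have hcl : (F.reorder _ _ h1 h2).Closed := pcol_eq_of_base hF hlen fun q hq => hperm.mem_iff.1 (hz ▸ hq)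
  have hC : F.Carries (F.reorder _ _ h1 h2) Set.univ id id :=
    ⟨Set.injOn_id _, fun _ _ => rfl, fun p _ => (map_id (F.outs p)).symm, fun p _ => (map_id (F.ins p)).symm,
      fun _ _ _ _ => rfl, fun _ _ _ _ => rfl⟩
  have hp : (((Q.filter fun q => ¬ q ∈ P).map Prod.fst ++ X).zip ((Q.filter fun q => ¬ q ∈ P).map Prod.snd ++ X.map σ)).Perm
      ((F.sources.map id).zip (F.sinks.map id)) := by
    rw [map_id, map_id, hz]; exact hperm
  exact ⟨_, _, _, h1, h2, by simp, List.forall₂_map_right_iff.2 (forall₂_same.2 hσ), hcl,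
    ⟨id, id, hC, Function.bijective_id, hp⟩, BaseLinePermutation.iso hF hcl hC Function.bijective_id hp⟩

lemma Fire.splitShift {p : F.Point} {A A' : List F.Point} {a b : F.Point} {φ π Z Z'}
    (h : F.Fire F' p A A' [a] [b] φ π Z Z') (hp : F.IsSplit p) (hso : F.sources = A ++ [a])
    (hsi : F.sinks = A' ++ [b]) (hA : A.length = A'.length)
    (ha : p = a ∨ ∃ s, F.outs a = [s] ∧ F.ins p = [s]) :
    ∃ t, F.SplitShift F' A [] A' [] a b p Z Z' φ π t := by
  have h1 := h.old
  obtain ⟨t, l, ⟨h2, h3⟩, h4, h5⟩ := List.forall₂_cons_left_iff.1 h1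
  rw [List.forall₂_nil_left_iff.1 h4] at h5
  refine ⟨t, hso, hsi, hA, hp, ha, ?_, h.scol, h.pcol, h5, h.new, h.new', fun hb => ?_, h2, ?_,
    by simpa using h.sources, by simpa using h.sinks⟩
  · have := h.carries
    have e : {q | q ∉ [a] ∧ q ∉ [b] ∧ q ≠ p} = ({a, b, p}ᶜ : Set F.Point) := by ext q; simp
    rwa [e] at this
  · exact h3 fun hm => by have := hb.2; have := hm.2; omega
  · have := h.bij
    have e : {q | q = p ∨ q ∉ [a] ∧ (q ∈ [b] → F.IsMerge q)} = {q | q = p ∨ q ≠ a ∧ (q = b → F.IsMerge b)} := by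
      ext q
      simp only [mem_singleton]
      exact or_congr Iff.rfl (and_congr Iff.rfl (forall_congr' fun hq => by rw [hq]))
    rwa [e] at this

lemma Fire.mergeShift {p : F.Point} {A A' X X' : List F.Point} {φ π Z Z'}
    (h : F.Fire F' p A A' X X' φ π Z Z') (hp : F.IsMerge p) (hso : F.sources = A ++ X)
    (hsi : F.sinks = A' ++ X') (hA : A.length = A'.length) (hXX : X.length = X'.length) (hpo : F.outs p ≠ [])
    (hX : Forall₂ (fun x s => F.outs x = [s]) X (F.ins p)) (hX' : ∀ b ∈ X', ∃ s, F.ins b = [s]) :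
    ∃ z' z ψ π' t, F'.flip.SplitShift F.flip (A'.map φ) [] (A.map φ) [] z' z (φ p) X' X ψ π' t ∧
      ψ (φ p) = p ∧ ∀ q ∉ X, q ∉ X' → q ≠ p → ψ (φ q) = q := by
  obtain ⟨o, ho⟩ := hp.outs_cases.resolve_left hpo
  have hXs : ∀ x ∈ X, F.ins x = [] := fun x hx => (F.mem_sources x).1 (by simp [hso, hx])
  have hXs' : ∀ x ∈ X', F.outs x = [] := fun x hx => (F.mem_sinks x).1 (by simp [hsi, hx])
  have hm : ∀ b ∈ X', ¬ F.IsMerge b := fun b hb h => by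
    obtain ⟨s, hs⟩ := hX' b hb; have := h.2; simp [hs] at this
  have hpX : p ∉ X := fun h => hp.ins_ne (hXs p h)
  have hpX' : p ∉ X' := fun h => hpo (hXs' p h)
  have hop : o ∉ F.ins p := fun h' => ini_ne_ter o
    ((ini_of_eq ho).trans (ter_of_mem h').symm)
  obtain ⟨z, l, h2, h3, h4⟩ := List.forall₂_cons_right_iff.1 (ho ▸ h.new)
  rw [List.forall₂_nil_right_iff.1 h3] at h4
  subst h4
  have h5 := h.length
  rw [ho] at h5
  obtain ⟨o', ho'⟩ := length_eq_one_iff.1 h5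
  obtain ⟨z', l, h6, h7, h8⟩ := List.forall₂_cons_right_iff.1 (ho' ▸ h.new')
  rw [List.forall₂_nil_right_iff.1 h7] at h8
  subst h8
  have hJ : {q | q = p ∨ q ∉ X ∧ (q ∈ X' → F.IsMerge q)} = {q | q ∉ X' ∧ q ∉ X} := by
    ext q
    constructor
    · rintro (rfl | ⟨h1, h2⟩)
      exacts [⟨hpX', hpX⟩, ⟨fun h => hm q h (h2 h), h1⟩]
    · exact fun h => .inr ⟨h.2, fun h' => absurd h' h.1⟩
  have hb := h.bij
  rw [hJ] at hb
  have : Nonempty F.Point := ⟨p⟩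
  have : Nonempty F.Strand := ⟨o⟩
  have hini : ∀ s, F.ini s ∈ X → s ∈ F.ins p := fun s h => by
    obtain ⟨i, hi, he⟩ := mem_iff_getElem.1 h
    have := hX.get hi (hX.length_eq ▸ hi)
    have h2 := mem_outs_ini s
    rw [← he, show F.outs X[i] = _ from this, mem_singleton] at h2
    exact h2 ▸ getElem_mem _
  have hini' : ∀ s, F.ini s ∉ X' := fun s h => ini_ne (hXs' _ h) rfl
  have hinX : ∀ s ∈ F.ins p, F.ini s ∈ X := fun s h => by
    obtain ⟨i, hi, rfl⟩ := mem_iff_getElem.1 h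
    have := hX.get (hX.length_eq ▸ hi) hi
    rw [show F.ini (F.ins p)[i] = X[i]'(hX.length_eq ▸ hi) from ini_of_eq this]
    exact getElem_mem _
  obtain ⟨ψ, π', h9, h10, h11⟩ := h.carries.symm (J := {q | q ∉ X' ∧ q ∉ X}) (Q := {s | s ∉ F.ins p})
    (fun q hq => ⟨hq.2.1, hq.1⟩) hb.injOn (by
      rintro s (hs | hs) h'
      · exact hs.1 (hinX s h')
      · exact hs.2.2 (ter_of_mem h')) h.inj
  have hold := List.forall₂_iff_get.1 h.old
  have hscol : ∀ s ∉ F.ins p, F'.scol (π s) = F.scol s := fun s hs => by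
    by_cases hi : F.ini s = p
    · exact h.scol s ((F.mem_outs p s).2 hi)
    · exact h.carries.scol_outs (F.ini s) ⟨fun h => hs (hini s h), hini' s, hi⟩ s (mem_outs_ini s)
  have hin : ∀ b (_ : b ∈ X') s, F.ins b = [s] → s ∉ F.ins p := fun b hb s hs h' => hpX' (by
    rw [← ter_of_mem h', ter_of_eq hs]; exact hb)
  have hnew : Forall₂ (fun x s => F.ins x = [π' s] ∧ F.scol (π' s) = F'.scol s) X' (F'.ins (φ p)) := by
    refine List.forall₂_iff_get.2 ⟨hold.1, fun i h1 h2 => ?_⟩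
    have hbX : X'.get ⟨i, h1⟩ ∈ X' := get_mem _ _
    obtain ⟨s, hs⟩ := hX' _ hbX
    have h3 := (hold.2 i h1 h2).2 (hm _ hbX) s (mem_of_eq_singleton hs)
    have h4 := hin _ hbX s hs
    rw [← h3, h11 s h4, hscol s h4]
    exact ⟨hs, rfl⟩
  have hinj : ∀ q, q ∉ X → q ∉ X' → q ≠ p → ψ (φ q) = q := fun q h1 h2 _ => h10 q ⟨h2, h1⟩
  refine ⟨z', z, ψ, π', o, ⟨?_, ?_, ?_, ⟨?_, ?_⟩, .inr ⟨o', h6, ho'⟩, ?_, ?_, ?_, ?_, ?_, ?_, ?_, ?_, ?_, ?_, ?_⟩,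
    h10 p ⟨hpX', hpX⟩, hinj⟩
  · exact h.sinks
  · exact h.sources
  · exact (length_map _).trans (hA.symm.trans (length_map _).symm)
  · show (F'.outs (φ p)).length ≤ 1; simp [ho']
  · show 2 ≤ (F'.ins (φ p)).length
    rw [← hold.1, ← hXX, hX.length_eq]; exact hp.2
  · have e : ({z', z, φ p}ᶜ : Set F'.Point) = φ '' {q | q ∉ X ∧ q ∉ X' ∧ q ≠ p} := by
      ext y
      simp only [Set.mem_compl_iff, Set.mem_insert_iff, Set.mem_singleton_iff, not_or]
      constructor
      · rintro ⟨h1, h2, h3⟩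
        obtain ⟨q, hq, rfl⟩ := hb.surjOn (show y ∈ {y | y ∉ [z] ∧ y ∉ [z']} by simp [h1, h2])
        exact ⟨q, ⟨hq.2, hq.1, fun h => h3 (h ▸ rfl)⟩, rfl⟩
      · rintro ⟨q, hq, rfl⟩
        have := hb.mapsTo (show q ∈ {q | q ∉ X' ∧ q ∉ X} from ⟨hq.2.1, hq.1⟩)
        simp only [mem_singleton, Set.mem_ofPred_eq] at this
        exact ⟨this.2, this.1, fun h => hq.2.2 (hb.injOn ⟨hq.2.1, hq.1⟩ ⟨hpX', hpX⟩ h)⟩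
    exact Eq.mp (congrArg (fun K => F'.flip.Carries F.flip K ψ π') e.symm) h9.flip
  · intro s hs
    obtain ⟨i, hi, rfl⟩ := mem_iff_getElem.1 (show s ∈ F'.ins (φ p) from hs)
    exact (hnew.get (hold.1 ▸ hi) hi).2
  · show F.pcol (ψ (φ p)) = F'.pcol (φ p)
    rw [h10 p ⟨hpX', hpX⟩, h.pcol]
  · show F.outs (ψ (φ p)) = [o]
    rw [h10 p ⟨hpX', hpX⟩, ho]
  · exact hnew.imp fun _ _ h => h.1
  · show Forall₂ (fun x s => F.outs x = [s]) X (F.ins (ψ (φ p)))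
    rw [h10 p ⟨hpX', hpX⟩]; exact hX
  · refine fun _ (s : F'.Strand) (hs : s ∈ F'.outs z) => ?_
    rw [h2, mem_singleton] at hs
    rw [hs, h11 o hop]
  · intro hz
    have : 2 ≤ (F'.outs z).length := hz.2
    rw [h2] at this; simp at this
  · have hb' : Set.BijOn ψ {y | y ∉ [z] ∧ y ∉ [z']} {q | q ∉ X' ∧ q ∉ X} := by
      refine Set.BijOn.symm ⟨fun y hy => ?_, fun q hq => h10 q hq⟩ hb
      obtain ⟨q, hq, rfl⟩ := hb.surjOn hy
      rw [h10 q hq]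
    have e : {y | y = φ p ∨ y ≠ z' ∧ (y = z → F'.flip.IsMerge z)} = {y | y ∉ [z] ∧ y ∉ [z']} := by
      have hnm : ¬ F'.flip.IsMerge z := fun hz => by
        have : 2 ≤ (F'.outs z).length := hz.2
        rw [h2] at this; simp at this
      ext y
      simp only [hnm, mem_singleton, Set.mem_ofPred_eq]
      have := hb.mapsTo (show p ∈ {q | q ∉ X' ∧ q ∉ X} from ⟨hpX', hpX⟩)
      simp only [mem_singleton, Set.mem_ofPred_eq] at this
      constructor
      · rintro (rfl | h)
        exacts [this, ⟨h.2, h.1⟩]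
      · exact fun h => .inr ⟨h.2, h.1⟩
    rw [← e] at hb'
    exact hb'
  · show F.sinks = ((A'.map φ).map ψ : List F.Point) ++ X' ++ ([] : List F.Point)
    rw [hsi, List.append_nil, List.map_map, map_congr_left (g := id) fun q hq => ?_]
    · rw [map_id]
    · obtain ⟨h1, h2, h3⟩ := h.memA' q hq; exact hinj q h1 h2 h3
  · show F.sources = ((A.map φ).map ψ : List F.Point) ++ X ++ ([] : List F.Point)
    rw [hso, List.append_nil, List.map_map, map_congr_left (g := id) fun q hq => ?_]
    · rw [map_id]
    · obtain ⟨h1, h2, h3⟩ := h.memA q hq; exact hinj q h1 h2 h3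

/-- The splits and merges on the base line. -/
def outer (F : StrandDiagram Γ) : Set F.Point := {p | F.net.alive p ∧ (F.ins p = [] ∨ F.outs p = [])}

def NoDegenerate (F : StrandDiagram Γ) : Prop := ∀ p, ¬ F.IsDegenerate p

lemma Fire.cases {p : F.Point} {A A' X X' : List F.Point} {φ π Z Z'}
    (h : F.Fire F' p A A' X X' φ π Z Z') (y : F'.Point) :
    (F'.ins y = [] ∧ (F'.outs y).length = 1) ∨ (F'.outs y = [] ∧ (F'.ins y).length = 1) ∨
    (y = φ p ∧ (F'.ins y).length = X'.length ∧ (F'.outs y).length = (F.outs p).length) ∨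
    (2 ≤ (F'.ins y).length ∧ (F'.outs y).length = 1) ∨
    ∃ q, q ≠ p ∧ y = φ q ∧ (F'.ins y).length = (F.ins q).length ∧ (F'.outs y).length = (F.outs q).length := by
  by_cases hZ : y ∈ Z
  · refine .inl ⟨(F'.mem_sources y).1 (by simp [h.sources, hZ]), ?_⟩
    obtain ⟨i, hi, rfl⟩ := mem_iff_getElem.1 hZ
    have := h.new.get hi (h.new.length_eq ▸ hi)
    rw [show F'.outs Z[i] = _ from this]; rfl
  by_cases hZ' : y ∈ Z'
  · refine .inr (.inl ⟨(F'.mem_sinks y).1 (by simp [h.sinks, hZ']), ?_⟩)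
    obtain ⟨i, hi, rfl⟩ := mem_iff_getElem.1 hZ'
    have := h.new'.get hi (h.new'.length_eq ▸ hi)
    rw [show F'.ins Z'[i] = _ from this]; rfl
  obtain ⟨q, hq, rfl⟩ := h.bij.surjOn (show y ∈ {z | z ∉ Z ∧ z ∉ Z'} from ⟨hZ, hZ'⟩)
  by_cases hqp : q = p
  · subst hqp
    exact .inr (.inr (.inl ⟨rfl, h.old.length_eq.symm, h.length⟩))
  obtain ⟨h1, h2⟩ := hq.resolve_left hqp
  by_cases hqX : q ∈ X'
  · obtain ⟨i, hi, rfl⟩ := mem_iff_getElem.1 hqX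
    obtain ⟨h3, h4, h5⟩ := (h.old.get hi (h.old.length_eq ▸ hi)).1 (h2 hqX)
    refine .inr (.inr (.inr (.inl ⟨?_, ?_⟩)))
    · rw [show F'.ins (φ X'[i]) = _ from h4, length_map]; exact (h2 hqX).2
    · rw [show F'.outs (φ X'[i]) = _ from h5]; rfl
  · refine .inr (.inr (.inr (.inr ⟨q, hqp, rfl, ?_, ?_⟩)))
    · rw [h.carries.ins q ⟨h1, hqX, hqp⟩, length_map]
    · rw [h.carries.outs q ⟨h1, hqX, hqp⟩, length_map]

lemma Fire.good {p : F.Point} {A A' X X' : List F.Point} {φ π Z Z'}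
    (h : F.Fire F' p A A' X X' φ π Z Z') (h0 : X' ≠ []) (hpo : F.outs p ≠ [])
    (hp : 2 ≤ X'.length ∨ 2 ≤ (F.outs p).length) (hF : F.NoDegenerate) :
    F'.NoDegenerate ∧ F'.outer ⊆ φ '' (F.outer \ {p}) := by
  have h0' := length_pos_iff.2 h0
  have hpo' := length_pos_iff.2 hpo
  constructor
  · rintro y ⟨h3, h4⟩
    rcases h.cases y with ⟨h1, h2⟩ | ⟨h1, h2⟩ | ⟨_, h1, h2⟩ | ⟨h1, h2⟩ | ⟨q, _, _, h1, h2⟩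
    · simp [h1] at h3
    · simp [h1] at h4
    · omega
    · omega
    · exact hF q ⟨h1.symm.trans h3, h2.symm.trans h4⟩
  · rintro y ⟨h3, h4⟩
    rw [alive_iff] at h3
    rw [← length_eq_zero_iff, ← length_eq_zero_iff] at h4
    rcases h.cases y with ⟨h1, h2⟩ | ⟨h1, h2⟩ | ⟨_, h1, h2⟩ | ⟨h1, h2⟩ | ⟨q, hq, rfl, h1, h2⟩
    · simp [h1] at h3; omega
    · simp [h1] at h3; omega
    · omega
    · omega
    · rw [h1, h2] at h3 h4
      refine ⟨q, ⟨⟨alive_iff.2 h3, ?_⟩, hq⟩, rfl⟩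
      rwa [length_eq_zero_iff, length_eq_zero_iff] at h4

end StrandDiagram

namespace ClosedStrandDiagram

open StrandDiagram

variable {X Y Z : ClosedStrandDiagram Γ}

open Classical in
/-- `Y` is similar to `X`, and the point `p` has been moved one sheet down. -/
def Lowers (X Y : ClosedStrandDiagram Γ) (p : X.Pt) (e : X.Pt → Y.Pt) : Prop :=
  X.Similar Y ∧ X.cut.net.loops = Y.cut.net.loops ∧ ∃ f, Net.PortIso X.cut.net Y.cut.net e f ∧
    ∀ q, X.cut.net.alive q → f q = if q = p then -1 else 0

lemma exists_lower_split {F : StrandDiagram Γ} (hF : F.Closed) {p : F.Point} (hp : F.IsSplit p)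
    (ha : F.ins p = [] ∨ ∃ a s, F.ins a = [] ∧ F.outs a = [s] ∧ F.ins p = [s]) (hN : F.NoDegenerate) :
    ∃ (Y : ClosedStrandDiagram Γ) (e : F.Point → Y.Pt), Lowers ⟨F, hF⟩ Y p e ∧ Y.cut.NoDegenerate ∧
      Y.cut.outer ⊆ e '' (F.outer \ {p}) := by
  obtain ⟨a, ha1, ha2⟩ : ∃ a, F.ins a = [] ∧ (p = a ∨ ∃ s, F.outs a = [s] ∧ F.ins p = [s]) := by
    rcases ha with h | ⟨a, s, h1, h2, h3⟩
    exacts [⟨p, h, .inl rfl⟩, ⟨a, h1, .inr ⟨s, h2, h3⟩⟩]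
  obtain ⟨A, A', X', hl, hl', hA, hX', hcl, hblp, hiso⟩ :=
    exists_reorder hF (X := [a]) (List.nodup_singleton a) (by simpa using ha1)
  obtain ⟨b, hb⟩ : ∃ b, X' = [b] := length_eq_one_iff.1 hX'.length_eq.symm
  subst hb
  obtain ⟨F', φ, π, Z, Z', hF', hfire⟩ := exists_fire hcl (p := p) (.inl hp) hp.outs_ne
    (X := [a]) (X' := [b]) rfl rfl hA (by
      rcases ha2 with rfl | ⟨s, h1, h2⟩
      · exact .inl ⟨rfl, ha1⟩
      · refine .inr ⟨show F.ins p ≠ [] from h2 ▸ cons_ne_nil _ _, ?_⟩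
        rw [show (F.reorder _ _ hl hl').ins p = _ from h2]
        exact .cons h1 .nil)
  obtain ⟨t, ht⟩ := hfire.splitShift hp rfl rfl hA ha2
  have hi := ht.iso hcl hF'
  refine ⟨⟨F', hF'⟩, φ, ⟨?_, hiso.loops.trans hi.loops, _, hiso.port.trans hcl.wf hF'.wf hi.port, fun q _ => ?_⟩,
    hfire.good (cons_ne_nil _ _) hp.outs_ne (.inr hp.2) hN⟩
  · have h0 : Similar ⟨F, hF⟩ ⟨_, hcl⟩ := EqvGen.rel _ _ (.inr (.inr hblp))
    refine h0.trans _ _ _ (EqvGen.rel _ _ (.inl (.inl ?_)))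
    exact (expandingSplitShift_iff (F := F.reorder _ _ hl hl') (F' := F')).2 ⟨_, _, _, _, _, _, _, _, _, _, _, _, ht⟩
  · exact zero_add _

open Classical in
lemma exists_lower_merge {F : StrandDiagram Γ} (hF : F.Closed) {p : F.Point} (hp : F.IsMerge p)
    (hpo : F.outs p ≠ []) (ha : ∀ s ∈ F.ins p, F.ins (F.ini s) = [] ∧ F.outs (F.ini s) = [s])
    (hN : F.NoDegenerate) (hO : F.outer = ∅) :
    ∃ (Y : ClosedStrandDiagram Γ) (e : F.Point → Y.Pt), Lowers ⟨F, hF⟩ Y p e ∧ Y.cut.NoDegenerate ∧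
      Y.cut.outer ⊆ e '' (F.outer \ {p}) := by
  have hX : Forall₂ (fun x s => F.outs x = [s]) ((F.ins p).map F.ini) (F.ins p) :=
    List.forall₂_map_left_iff.2 (forall₂_same.2 fun s hs => (ha s hs).2)
  have hXn : ((F.ins p).map F.ini).Nodup := (F.ins_nodup p).map_on fun s hs t ht he => by
    have := (ha s hs).2; rw [he, (ha t ht).2] at this; simpa using this.symm
  obtain ⟨A, A', X', hl, hl', hA, hX', hcl, hblp, hiso⟩ := exists_reorder hF hXn fun x hx => by
      obtain ⟨s, hs, rfl⟩ := mem_map.1 hx; exact (ha s hs).1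
  obtain ⟨F', φ, π, Z, Z', hF', hfire⟩ := exists_fire hcl (p := p) (.inr hp) hpo
    (X := (F.ins p).map F.ini) (X' := X') rfl rfl hA (.inr ⟨hp.ins_ne, hX⟩)
  have hX's : ∀ b ∈ X', F.outs b = [] := fun b hb => (F.mem_sinks b).1 (hl'.mem_iff.1 (mem_append_right _ hb))
  obtain ⟨z', z, ψ, π', t, ht, hψp, hψ⟩ := hfire.mergeShift hp rfl rfl hA hX'.length_eq hpo hX fun (b : F.Point) hb => by
    show ∃ s, F.ins b = [s]
    have h0 := hX's b hb
    have h1 : ¬ F.net.alive b := fun h => by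
      have : b ∈ F.outer := ⟨h, .inr h0⟩
      rw [hO] at this; exact this
    rw [alive_iff] at h1
    have h2 : F.ins b ≠ [] := fun h => outs_ne_nil_of_ins h h0
    have := length_pos_iff.2 h2
    exact length_eq_one_iff.1 (show (F.ins b).length = 1 by omega)
  have hi := ht.iso hF'.flip hcl.flip
  have hpi := portIso_of_flip hF' hcl hi.port
  have : Nonempty F'.Point := ⟨φ p⟩
  obtain ⟨e, he1, he2, he3⟩ := hpi.symm hF'.wf hcl.wf
  have hpa : F'.net.alive (φ p) := .inr ht.split
  have heφ : e p = φ p := by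
    have := he1 _ hpa; rwa [hψp] at this
  have hlen : X'.length = (F.ins p).length := by rw [← hX'.length_eq, length_map]
  have hp2 : 2 ≤ X'.length := hlen ▸ hp.2
  have hg := hfire.good (List.ne_nil_of_length_pos (Nat.zero_lt_of_lt hp2)) hpo (.inl hp2) hN
  have hout : F'.outer ⊆ ∅ := fun y hy => by
    obtain ⟨q, hq, rfl⟩ := hg.2 hy
    have : q ∈ F.outer := hq.1
    rw [hO] at this; exact this
  refine ⟨⟨F', hF'⟩, e, ⟨?_, ?_, _, hiso.port.trans hcl.wf hF'.wf he3, fun q hq => ?_⟩, hg.1,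
    hout.trans (Set.empty_subset _)⟩
  · have h0 : Similar ⟨F, hF⟩ ⟨_, hcl⟩ := EqvGen.rel _ _ (.inr (.inr hblp))
    refine h0.trans _ _ _ (EqvGen.rel _ _ (.inr (.inl (.inr ?_))))
    exact (expandingSplitShift_iff (F := F'.flip) (F' := (F.reorder _ _ hl hl').flip)).2 ⟨_, _, _, _, _, _, _, _, _, _, _, _, ht⟩
  · refine hiso.loops.trans ?_
    rw [← loops_flip hcl, ← loops_flip hF']; exact hi.loops.symm
  · have : (e q = φ p) ↔ q = p := by
      rw [← heφ]
      exact ⟨fun h => by rw [← he2 q hq, h, he2 p (.inr hp)], fun h => h ▸ rfl⟩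
    have h4 : (if e q = φ p then (-1 : ℤ) else 0) = if q = p then -1 else 0 := if_congr this rfl rfl
    show 0 + - -(ite _ _ _) = _
    rw [neg_neg, zero_add]
    exact h4

/-- All splits and merges are internal, and no point is degenerate. -/
def Plain (X : ClosedStrandDiagram Γ) : Prop := X.cut.NoDegenerate ∧ X.cut.outer = ∅

lemma Plain.inner (h : X.Plain) {p} (hp : X.cut.net.alive p) : X.cut.ins p ≠ [] ∧ X.cut.outs p ≠ [] := by
  have : p ∉ X.cut.outer := h.2 ▸ Set.notMem_empty p
  exact ⟨fun h => this ⟨hp, .inl h⟩, fun h => this ⟨hp, .inr h⟩⟩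

/-- A point that is not a split or a merge is a univalent source or sink. -/
lemma Plain.univalent (h : X.Plain) {p} (hp : ¬ X.cut.net.alive p) :
    (X.cut.ins p = [] ∧ ∃ s, X.cut.outs p = [s]) ∨ (X.cut.outs p = [] ∧ ∃ s, X.cut.ins p = [s]) := by
  rcases X.cut.types p with h1 | h1 | h1 | h1 | h1
  · exact .inl ⟨h1.1, length_eq_one_iff.1 h1.2⟩
  · exact .inr ⟨h1.1, length_eq_one_iff.1 h1.2⟩
  · exact absurd (.inl h1) hp
  · exact absurd (.inr h1) hp
  · exact absurd h1 (h.1 p)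

lemma Plain.exists_lower (h : X.Plain) {p} (hp : X.cut.net.alive p)
    (hi : ∀ s ∈ X.cut.ins p, ¬ X.cut.net.alive (X.cut.ini s)) : ∃ Y e, Lowers X Y p e ∧ Y.Plain := by
  have hs : ∀ s ∈ X.cut.ins p, X.cut.ins (X.cut.ini s) = [] ∧ X.cut.outs (X.cut.ini s) = [s] := fun s hs => by
    have := mem_outs_ini s
    rcases h.univalent (hi s hs) with ⟨h1, t, h2⟩ | ⟨h1, _⟩
    · rw [h2, mem_singleton] at this
      exact ⟨h1, this ▸ h2⟩
    · rw [h1] at this; cases this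
  suffices H : ∃ (Y : ClosedStrandDiagram Γ) (e : X.Pt → Y.Pt), Lowers X Y p e ∧ Y.cut.NoDegenerate ∧
      Y.cut.outer ⊆ e '' (X.cut.outer \ {p}) by
    obtain ⟨Y, e, h1, h2, h3⟩ := H
    refine ⟨Y, e, h1, h2, ?_⟩
    rwa [h.2, Set.empty_sdiff, Set.image_empty, Set.subset_empty_iff] at h3
  rcases hp with hp' | hp'
  · obtain ⟨s, h1⟩ := hp'.ins_cases.resolve_left (h.inner (.inl hp')).1
    have h2 := hs s (mem_of_eq_singleton h1)
    exact exists_lower_split X.closed hp' (.inr ⟨_, s, h2.1, h2.2, h1⟩) h.1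
  · exact exists_lower_merge X.closed hp' (h.inner (.inr hp')).2 hs h.1 h.2

/-- The upside-down diagram. -/
def flip (X : ClosedStrandDiagram Γ) : ClosedStrandDiagram Γ := ⟨X.cut.flip, X.closed.flip⟩

lemma Similar.flip (h : X.Similar Y) : X.flip.Similar Y.flip := by
  have key : ∀ A B : ClosedStrandDiagram Γ, ExpandingShift A B → ExpandingShift A.flip B.flip := fun A B h => h.symm
  induction h with
  | rel A B h =>
    rcases h with h | h | ⟨φ, π, h1, h2, h3⟩
    · exact EqvGen.rel _ _ (.inl (key _ _ h))
    · exact EqvGen.rel _ _ (.inr (.inl (key _ _ h)))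
    · refine EqvGen.rel _ _ (.inr (.inr ⟨φ, π, h1.flip, h2, ?_⟩))
      have := h3.map Prod.swap
      rwa [zip_swap, zip_swap] at this
  | refl => exact EqvGen.refl _
  | symm _ _ _ ih => exact ih.symm
  | trans _ _ _ _ _ ih₁ ih₂ => exact ih₁.trans _ _ _ ih₂

lemma exists_plain (X : ClosedStrandDiagram Γ) (h : X.cut.NoDegenerate) : ∃ Y, X.Similar Y ∧ Y.Plain := by
  obtain ⟨n, hn⟩ : ∃ n, X.cut.outer.ncard = n := ⟨_, rfl⟩
  induction n using Nat.strong_induction_on generalizing X with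
  | _ n ih =>
    have hlt : ∀ (Y : ClosedStrandDiagram Γ) (p : X.Pt) (e : X.Pt → Y.Pt), p ∈ X.cut.outer →
        Y.cut.outer ⊆ e '' (X.cut.outer \ {p}) → Y.cut.outer.ncard < n := fun Y p e hp hs => by
      have h1 := Set.ncard_le_ncard hs (Set.toFinite _)
      have h2 := Set.ncard_image_le (f := e) (Set.toFinite (X.cut.outer \ {p}))
      have h3 := Set.ncard_sdiff_singleton_lt_of_mem hp (Set.toFinite _)
      omega
    by_cases h0 : X.cut.outer = ∅
    · exact ⟨X, EqvGen.refl _, h, h0⟩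
    obtain ⟨p, hp⟩ := Set.nonempty_iff_ne_empty.2 h0
    rcases hp.1 with hs | hm
    · obtain ⟨Y, e, h1, h2, h3⟩ := exists_lower_split X.closed hs (.inl (hp.2.resolve_right hs.outs_ne)) h
      obtain ⟨Z, h4, h5⟩ := ih _ (hlt Y p e hp h3) Y h2 rfl
      exact ⟨Z, h1.1.trans _ _ _ h4, h5⟩
    · obtain ⟨Y, e, h1, h2, h3⟩ := exists_lower_split X.closed.flip (p := p) hm
        (.inl (hp.2.resolve_left hm.ins_ne)) fun q hq => h q ⟨hq.2, hq.1⟩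
      have ho : ∀ F : StrandDiagram Γ, F.flip.outer = F.outer := fun F => by
        ext q; exact and_congr or_comm or_comm
      obtain ⟨Z, h4, h5⟩ := ih Y.flip.cut.outer.ncard (hlt Y.flip p e hp (by
        rw [ho] at h3; exact (ho Y.cut).le.trans h3)) Y.flip (fun q hq => h2 q ⟨hq.2, hq.1⟩) rfl
      exact ⟨Z, h1.1.flip.trans _ _ _ h4, h5⟩

lemma SemiReduced.of_similar (h : X.SemiReduced) (h' : X.Similar Y) : Y.SemiReduced :=
  fun Z W hZ => h Z W (h'.trans _ _ _ hZ)

lemma SemiReduced.noDegenerate (h : X.SemiReduced) : X.cut.NoDegenerate := fun p hp => by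
  obtain ⟨F', h1, h2⟩ := exists_reduction0 X.closed hp
  exact h X ⟨F', h1⟩ (EqvGen.refl _) (.inl h2)

end ClosedStrandDiagram

namespace StrandDiagram

variable {F : StrandDiagram Γ}

lemma level_le {x y} (h : ReflTransGen F.Gen x y) : x.2 ≤ y.2 := by
  induction h with
  | refl => exact le_rfl
  | tail _ hg ih => refine ih.trans ?_; rcases hg with _ | _ | _ <;> simp

/-- The strand segments from a split or merge come first. -/
lemma start_of_rel (hF : F.Closed) {s n y} (hs : F.net.alive (F.ini s)) (h : F.net.Rel (.inl s, n) y) :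
    ReflTransGen F.Gen (.inl s, n) y := by
  rcases hF.wf.total h with h | h
  · exact h
  · rw [Net.eq_of_reflTransGen (fun z => Gen.start_not hs rfl) h]

lemma end_of_rel (hF : F.Closed) {s n x} (hs : F.net.alive (F.ter s)) (h : F.net.Rel x (.inl s, n)) :
    ReflTransGen F.Gen x (.inl s, n) := by
  rcases hF.wf.total h with h | h
  · exact h
  · rw [Net.eq_of_reflTransGen' (fun z => Gen.end_not hs rfl) h]

end StrandDiagram

namespace ClosedStrandDiagram

open StrandDiagram

variable {X Y : ClosedStrandDiagram Γ}

lemma Plain.eq_of_level (hX : X.Plain) {s n y} (h : ReflTransGen X.cut.Gen (.inl s, n) y) (hy : y.2 ≤ n) :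
    (.inl s, n) = y := by
  rcases h.cases_head with h | ⟨z, hg, h⟩
  · exact h
  · have := level_le h
    rcases hg with _ | _ | ⟨p, _, t, _, h1, h2⟩
    · simp only at this; omega
    · exact absurd ⟨by simp [h1], by simp [h2]⟩ (hX.1 p)

lemma Plain.eq_of_rel (hX : X.Plain) {s t n} (h : X.cut.net.Rel (.inl s, n) (.inl t, n)) : s = t := by
  rcases X.wf.total h with h | h
  · have := hX.eq_of_level h le_rfl; simpa using this
  · have := hX.eq_of_level h le_rfl; simpa using this.symm

/-- The ports of a split or a merge. -/
lemma Plain.port_narrow (hX : X.Plain) {p} (hp : X.cut.net.alive p) :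
    ∃ s, X.cut.port p 0 = (.inl s, 0) ∧ (X.cut.IsSplit p → X.cut.ins p = [s]) ∧
      (X.cut.IsMerge p → X.cut.outs p = [s]) := by
  have := hX.inner hp
  rcases hp with hp | hp
  · obtain ⟨s, hs⟩ := hp.ins_cases.resolve_left this.1
    exact ⟨s, by rw [hp.port_zero, hs], fun _ => hs, fun h => absurd h hp.not_merge⟩
  · obtain ⟨s, hs⟩ := hp.outs_cases.resolve_left this.2
    exact ⟨s, by rw [hp.port_zero, hs], fun h => absurd hp h.not_merge, fun _ => hs⟩

open Classical in
/-- A semi-reduced diagram has no reductions over several sheets. -/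
lemma Plain.irred (hX : X.Plain) (hS : X.SemiReduced) : X.cut.net.Irred := by
  rintro _ ⟨v, w, m, many, hr, -⟩
  obtain ⟨n, hn⟩ : ∃ n, m.natAbs = n := ⟨_, rfl⟩
  induction n using Nat.strong_induction_on generalizing X m with
  | _ n ih =>
    have hv : X.cut.IsSplit v := hr.sv
    have hw : X.cut.IsMerge w := hr.aw.resolve_left hr.sw
    have hnext : ∀ p, X.cut.net.alive p → (∀ s ∈ X.cut.ins p, ¬ X.cut.net.alive (X.cut.ini s)) →
        ¬ (m + (if w = p then -1 else 0) - (if v = p then -1 else 0)).natAbs < n := fun p hp hi hlt => by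
      obtain ⟨Y, e, ⟨h1, -, f, h2, h3⟩, h4⟩ := hX.exists_lower hp hi
      have h5 := h2.redex Y.wf hr
      rw [h3 v hr.av, h3 w hr.aw] at h5
      exact ih _ hlt h4 (hS.of_similar h1) _ _ _ h5 rfl
    have hne := hr.ne
    cases many with
    | true =>
      have hdead : ∀ k (hk : k < (X.cut.outs v).length) (hk' : k < (X.cut.ins w).length),
          X.cut.net.Rel (.inl (X.cut.outs v)[k], 0) (.inl (X.cut.ins w)[k], m) := fun k hk hk' => by
        have := hr.dead (k + 1) (by rw [hv.deg]; exact hk) (by simp [Net.Live])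
        rw [show X.cut.net.port v (k + 1) = _ from hv.port_succ (getElem?_eq_getElem hk),
          show X.cut.net.port w (k + 1) = _ from hw.port_succ (getElem?_eq_getElem hk'), sh_mk, zero_add] at this
        exact this
      have hlen : (X.cut.outs v).length = (X.cut.ins w).length := by
        rw [← hv.deg, ← hw.deg]; exact hr.deg.symm
      rcases lt_trichotomy m 0 with hm | hm | hm
      · have h2 : 0 < (X.cut.outs v).length := lt_of_lt_of_le Nat.two_pos hv.2
        have := hdead 0 h2 (hlen ▸ h2)
        have h3 := level_le (start_of_rel X.closed (by rw [ini_of_mem (getElem_mem _)]; exact hr.av) this)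
        simp only at h3; omega
      · subst hm
        obtain ⟨F', h1, h2⟩ := exists_reduction1 X.closed hv hw hr.col
          (ext_getElem hlen fun k hk hk' => hX.eq_of_rel (hdead k hk hk')) (hX.inner hr.av).1 (hX.inner hr.aw).2
        exact hS X ⟨F', h1⟩ (EqvGen.refl _) (.inr (.inl h2))
      · refine hnext w hr.aw (fun s hs ha => ?_) (by rw [if_pos rfl, if_neg hne]; omega)
        obtain ⟨k, hk, rfl⟩ := mem_iff_getElem.1 hs
        have h3 := level_le (start_of_rel X.closed ha (hdead k (hlen ▸ hk) hk).symm)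
        simp only at h3; omega
    | false =>
      obtain ⟨s, h1, h2, -⟩ := hX.port_narrow hr.av
      obtain ⟨t, h3, -, h4⟩ := hX.port_narrow hr.aw
      replace h2 := h2 hv
      replace h4 := h4 hw
      have hdead : X.cut.net.Rel (.inl s, 0) (.inl t, m) := by
        have := hr.dead 0 (Nat.zero_le _) (by simp [Net.Live])
        rwa [show X.cut.net.port v 0 = _ from h1, show X.cut.net.port w 0 = _ from h3, sh_mk, zero_add] at this
      rcases lt_trichotomy m 0 with hm | hm | hm
      · refine hnext v hr.av (fun u hu ha => ?_) (by rw [if_pos rfl, if_neg hne.symm]; omega)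
        rw [h2, mem_singleton] at hu
        have h3 := level_le (start_of_rel X.closed ha (hu ▸ hdead))
        simp only at h3; omega
      · subst hm
        obtain rfl := hX.eq_of_rel hdead
        obtain ⟨F', h5, h6⟩ := exists_reduction2 X.closed hw hv h4 h2
        exact hS X ⟨F', h5⟩ (EqvGen.refl _) (.inr (.inr h6))
      · have h3 := level_le (start_of_rel X.closed (by rw [ini_of_eq h4]; exact hr.aw) hdead.symm)
        simp only at h3; omega

end ClosedStrandDiagram

lemma Multiset.exists_list_le_of_le_map {α β : Type*} {f : α → β} {l : List β} {m : Multiset α}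
    (h : (l : Multiset β) ≤ m.map f) : ∃ l' : List α, (l' : Multiset α) ≤ m ∧ l'.map f = l := by
  induction l generalizing m with
  | nil => exact ⟨[], Multiset.zero_le _, rfl⟩
  | cons b l ih =>
    obtain ⟨a, ha, rfl⟩ := Multiset.mem_map.1 (Multiset.mem_of_le h (List.mem_cons_self))
    obtain ⟨m, rfl⟩ := Multiset.exists_cons_of_mem ha
    rw [Multiset.map_cons, ← Multiset.cons_coe, Multiset.cons_le_cons_iff] at h
    obtain ⟨l', h1, rfl⟩ := ih h
    exact ⟨a :: l', by rw [← Multiset.cons_coe]; exact Multiset.cons_le_cons _ h1, rfl⟩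

namespace Net

variable {N : Net Γ}

lemma WF.rel_self_congr (hN : N.WF) {s t} (h : N.Same s t) (n : ℤ) :
    N.Rel (s, 0) (s, n) ↔ N.Rel (t, 0) (t, n) := by
  obtain ⟨m, hm⟩ := h
  have h1 : N.Rel (s, n) (sh m (t, n)) := by simpa [add_comm] using hN.rel_sh' n hm
  rw [← zero_add m, ← sh_mk] at hm
  rw [← hN.rel_sh m (x := (t, 0))]
  exact ⟨fun h => hm.symm.trans (h.trans h1), fun h => hm.trans (h.trans h1.symm)⟩

lemma WF.winding_congr (hN : N.WF) {s t} (h : N.Same s t) : N.winding s = N.winding t := by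
  unfold winding
  simp only [hN.rel_self_congr h]

lemma WF.rel_self_iff (hN : N.WF) {s} (hs : N.IsLoop s) :
    0 < N.winding s ∧ ∀ n : ℤ, N.Rel (s, 0) (s, n) ↔ (N.winding s : ℤ) ∣ n := by
  have hw : 0 < N.winding s ∧ N.Rel (s, 0) (s, (N.winding s : ℤ)) := Nat.sInf_mem hs.2
  let H : AddSubgroup ℤ :=
    { carrier := {n | N.Rel (s, 0) (s, n)}
      zero_mem' := .refl _
      add_mem' := fun {a b} ha hb => by
        have := hN.rel_sh' b ha
        rw [sh_mk, sh_mk, zero_add] at this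
        exact Rel.trans hb this
      neg_mem' := fun {a} ha => by
        have := (hN.rel_sh' (-a) ha).symm
        rwa [sh_mk, sh_mk, zero_add, add_neg_cancel] at this }
  refine ⟨hw.1, fun n => ⟨fun h => ?_, ?_⟩⟩
  · by_contra hd
    have h1 : n % N.winding s ∈ H := by
      rw [Int.emod_def, mul_comm]
      exact H.sub_mem h (by simpa using H.zsmul_mem hw.2 (n / N.winding s))
    have h0 : (0 : ℤ) < N.winding s := by exact_mod_cast hw.1
    obtain ⟨r, hr⟩ := Int.eq_ofNat_of_zero_le (Int.emod_nonneg n h0.ne')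
    have h2 := Int.emod_lt_of_pos n h0
    have h3 : n % N.winding s ≠ 0 := fun h => hd (Int.dvd_of_emod_eq_zero h)
    rw [hr] at h1 h2 h3
    have : N.winding s ≤ r := Nat.sInf_le ⟨by omega, h1⟩
    omega
  · rintro ⟨c, rfl⟩
    have := H.zsmul_mem hw.2 c
    rwa [smul_eq_mul, mul_comm] at this

lemma WF.isLoop_of_rel (hN : N.WF) {s} {m : ℕ} (hm : 0 < m) (h : N.Rel (s, 0) (s, (m : ℤ))) : N.IsLoop s := by
  refine ⟨fun p k n hp hk hr => ?_, m, hm, h⟩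
  have h1 := hN.rel_sh' m hr
  rw [sh_mk, zero_add, sh_sh] at h1
  have h2 := (hr.symm.trans h).trans h1
  rw [hN.rel_sh_left] at h2
  have := hN.port_self hp hk h2
  omega

end Net

namespace StrandDiagram

variable {F : StrandDiagram Γ}

/-- The strand `s` ends at the base point where `t` begins. -/
def Next (F : StrandDiagram Γ) (s t : F.Strand) : Prop := ∃ a b, F.Base a b ∧ F.ins b = [s] ∧ F.outs a = [t]

lemma Next.rel {s t} (h : F.Next s t) (n : ℤ) : F.net.Rel (.inl s, n) (.inl t, n + 1) := by
  obtain ⟨a, b, h1, h2, h3⟩ := h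
  exact (Gen.snk' n h1 h2).trans (Gen.src' (n + 1) h1.ins h3)

end StrandDiagram

namespace ClosedStrandDiagram

open StrandDiagram

variable {X Y : ClosedStrandDiagram Γ}

lemma Plain.exists_outs (hX : X.Plain) {a} (ha : X.cut.ins a = []) : ¬ X.cut.net.alive a ∧ ∃ s, X.cut.outs a = [s] := by
  have h1 : ¬ X.cut.net.alive a := fun h => (hX.inner h).1 ha
  refine ⟨h1, ?_⟩
  rcases hX.univalent h1 with h | ⟨h, -⟩
  exacts [h.2, absurd h (outs_ne_nil_of_ins ha)]

lemma Plain.exists_ins (hX : X.Plain) {b} (hb : X.cut.outs b = []) : ¬ X.cut.net.alive b ∧ ∃ s, X.cut.ins b = [s] := by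
  have h1 : ¬ X.cut.net.alive b := fun h => (hX.inner h).2 hb
  refine ⟨h1, ?_⟩
  rcases hX.univalent h1 with ⟨h, -⟩ | h
  exacts [absurd hb (outs_ne_nil_of_ins h), h.2]

lemma Plain.of_ini (hX : X.Plain) {s} (h : ¬ X.cut.net.alive (X.cut.ini s)) :
    X.cut.ins (X.cut.ini s) = [] ∧ X.cut.outs (X.cut.ini s) = [s] := by
  have := mem_outs_ini s
  rcases hX.univalent h with ⟨h1, t, h2⟩ | ⟨h1, -⟩
  · rw [h2, mem_singleton] at this
    exact ⟨h1, this ▸ h2⟩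
  · rw [h1] at this; cases this

lemma Plain.of_ter (hX : X.Plain) {s} (h : ¬ X.cut.net.alive (X.cut.ter s)) :
    X.cut.outs (X.cut.ter s) = [] ∧ X.cut.ins (X.cut.ter s) = [s] := by
  have := mem_ins_ter s
  rcases hX.univalent h with ⟨h1, -⟩ | ⟨h1, t, h2⟩
  · rw [h1] at this; cases this
  · rw [h2, mem_singleton] at this
    exact ⟨h1, this ▸ h2⟩

lemma Plain.exists_next (hX : X.Plain) {s} (h : ¬ X.cut.net.alive (X.cut.ter s)) : ∃ t, X.cut.Next s t := by
  obtain ⟨h1, h2⟩ := hX.of_ter h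
  obtain ⟨a, ha⟩ := X.closed.exists_source h1
  obtain ⟨-, t, ht⟩ := hX.exists_outs ha.ins
  exact ⟨t, a, _, ha, h2, ht⟩

lemma Plain.exists_prev (hX : X.Plain) {s} (h : ¬ X.cut.net.alive (X.cut.ini s)) : ∃ t, X.cut.Next t s := by
  obtain ⟨h1, h2⟩ := hX.of_ini h
  obtain ⟨b, hb⟩ := X.closed.exists_sink h1
  obtain ⟨-, t, ht⟩ := hX.exists_ins hb.outs
  exact ⟨t, _, b, hb, ht, h2⟩

lemma Plain.next_of_rel (hX : X.Plain) {s t n} (h : X.cut.net.Rel (.inl s, n) (.inl t, n + 1)) : X.cut.Next s t := by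
  rcases X.wf.total h with h | h
  · rcases h.cases_head with h | ⟨z, hg, h⟩
    · simp at h
    · rcases hg with _ | ⟨a, b, _, _, h1, h2⟩ | ⟨p, _, t, _, h1, h2⟩
      · obtain ⟨-, u, hu⟩ := hX.exists_outs h1.ins
        rcases h.cases_head with h | ⟨z, hg, h⟩
        · simp at h
        · rcases hg with ⟨_, _, _, h3, h4⟩ | _ | _
          have := hX.eq_of_level h le_rfl
          obtain rfl : _ = t := by simpa using this
          exact ⟨a, b, h1, h2, h4⟩
      · exact absurd ⟨by simp [h1], by simp [h2]⟩ (hX.1 p)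
  · have := level_le h
    simp at this

lemma Plain.forward (hX : X.Plain) (s) (n : ℕ) :
    (∃ u, ∃ m < n, X.cut.net.alive (X.cut.ter u) ∧ X.cut.net.Rel (.inl s, 0) (.inl u, (m : ℤ))) ∨
      ∃ t, X.cut.net.Rel (.inl s, 0) (.inl t, (n : ℤ)) := by
  induction n with
  | zero => exact .inr ⟨s, .refl _⟩
  | succ n ih =>
    rcases ih with ⟨u, m, hm, h⟩ | ⟨t, ht⟩
    · exact .inl ⟨u, m, by omega, h⟩
    · by_cases h : X.cut.net.alive (X.cut.ter t)
      · exact .inl ⟨t, n, by omega, h, ht⟩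
      · obtain ⟨u, hu⟩ := hX.exists_next h
        exact .inr ⟨u, by push_cast; exact ht.trans (hu.rel _)⟩

lemma Plain.backward (hX : X.Plain) (s) (n : ℕ) :
    (∃ u, ∃ m : ℕ, X.cut.net.alive (X.cut.ini u) ∧ X.cut.net.Rel (.inl s, 0) (.inl u, -(m : ℤ))) ∨
      ∃ t, X.cut.net.Rel (.inl s, 0) (.inl t, -(n : ℤ)) := by
  induction n with
  | zero => exact .inr ⟨s, .refl _⟩
  | succ n ih =>
    rcases ih with h | ⟨t, ht⟩
    · exact .inl h
    · by_cases h : X.cut.net.alive (X.cut.ini t)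
      · exact .inl ⟨t, n, h, ht⟩
      · obtain ⟨u, hu⟩ := hX.exists_prev h
        refine .inr ⟨u, ht.trans ?_⟩
        have := (hu.rel (-((n + 1 : ℕ) : ℤ))).symm
        rwa [show -((n + 1 : ℕ) : ℤ) + 1 = -n by push_cast; ring] at this

lemma Plain.port_ini (hX : X.Plain) {s} (h : X.cut.net.alive (X.cut.ini s)) :
    ∃ k ≤ X.cut.net.deg (X.cut.ini s), X.cut.net.port (X.cut.ini s) k = (.inl s, 0) := by
  have hs := mem_outs_ini s
  rcases id h with h1 | h1
  · obtain ⟨k, hk, he⟩ := mem_iff_getElem.1 hs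
    exact ⟨k + 1, by rw [h1.deg]; exact hk, h1.port_succ (by rw [getElem?_eq_getElem hk, he])⟩
  · obtain ⟨t, h2, -, h3⟩ := hX.port_narrow h
    rw [h3 h1, mem_singleton] at hs
    exact ⟨0, Nat.zero_le _, hs ▸ h2⟩

lemma Plain.port_ter (hX : X.Plain) {s} (h : X.cut.net.alive (X.cut.ter s)) :
    ∃ k ≤ X.cut.net.deg (X.cut.ter s), (X.cut.IsSplit (X.cut.ter s) ↔ k = 0) ∧ X.cut.net.port (X.cut.ter s) k = (.inl s, 0) := by
  have hs := mem_ins_ter s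
  rcases id h with h1 | h1
  · obtain ⟨t, h2, h3, -⟩ := hX.port_narrow h
    rw [h3 h1, mem_singleton] at hs
    exact ⟨0, Nat.zero_le _, iff_of_true h1 rfl, hs ▸ h2⟩
  · obtain ⟨k, hk, he⟩ := mem_iff_getElem.1 hs
    exact ⟨k + 1, by rw [h1.deg]; exact hk, iff_of_false (fun h => h.not_merge h1) k.succ_ne_zero,
      h1.port_succ (by rw [getElem?_eq_getElem hk, he])⟩

lemma Plain.of_isLoop (hX : X.Plain) {s} (h : X.cut.net.IsLoop (.inl s)) :
    ¬ X.cut.net.alive (X.cut.ini s) ∧ ¬ X.cut.net.alive (X.cut.ter s) := by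
  refine ⟨fun ha => ?_, fun ha => ?_⟩
  · obtain ⟨k, hk, he⟩ := hX.port_ini ha
    exact h.1 _ k 0 ha hk (by rw [he, sh_zero]; exact .refl _)
  · obtain ⟨k, hk, -, he⟩ := hX.port_ter ha
    exact h.1 _ k 0 ha hk (by rw [he, sh_zero]; exact .refl _)

/-- A strand of the closed diagram begins at a split or a merge, or it is a loop. -/
lemma Plain.start_or_loop (hX : X.Plain) (s) :
    (∃ u, ∃ m : ℕ, X.cut.net.alive (X.cut.ini u) ∧ X.cut.net.Rel (.inl s, 0) (.inl u, -(m : ℤ))) ∨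
      X.cut.net.IsLoop (.inl s) := by
  by_contra! hcon
  have h := fun n => (hX.backward s n).resolve_left fun ⟨u, m, h1, h2⟩ => hcon.1 u m h1 h2
  choose f hf using h
  have := X.cut.finite_strand
  obtain ⟨i, j, hij, he⟩ := Finite.exists_ne_map_eq_of_infinite f
  obtain ⟨i, j, hij, he⟩ : ∃ i j, i < j ∧ f i = f j := by
    rcases hij.lt_or_gt with h | h
    exacts [⟨i, j, h, he⟩, ⟨j, i, h, he.symm⟩]
  have h1 := X.wf.rel_sh' (j - i) (hf j)
  rw [sh_mk, sh_mk, zero_add, show -(j : ℤ) + (j - i) = -i by ring, ← he] at h1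
  have h2 := (hf i).trans h1.symm
  refine hcon.2 (X.wf.isLoop_of_rel (m := j - i) (by omega) ?_)
  rwa [Nat.cast_sub hij.le]

/-- A loop passes through the base line at every level. -/
lemma Plain.loop_level (hX : X.Plain) {s} (h : X.cut.net.IsLoop (.inl s)) (n : ℤ) :
    ∃ t, X.cut.net.Rel (.inl s, 0) (.inl t, n) := by
  obtain ⟨m, hm, hr⟩ := h.2
  have hd : ∀ c : ℤ, X.cut.net.Rel (.inl s, 0) (.inl s, m * c) := fun c =>
    ((X.wf.rel_self_iff h).2 _).2 ((((X.wf.rel_self_iff h).2 _).1 hr).mul_right c)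
  obtain ⟨l, hl⟩ := Int.eq_ofNat_of_zero_le (show 0 ≤ n + m * |n| by
    have h1 := neg_abs_le n
    have h2 : |n| ≤ m * |n| := le_mul_of_one_le_left (abs_nonneg n) (by exact_mod_cast hm)
    linarith)
  rcases hX.forward s l with ⟨u, k, -, h1, h2⟩ | ⟨t, ht⟩
  · have := X.wf.isLoop_congr (X.wf.same_of_rel h2) h
    exact absurd h1 (hX.of_isLoop this).2
  · refine ⟨t, (hd (-|n|)).trans ?_⟩
    have := X.wf.rel_sh' (m * -|n|) ht
    rw [sh_mk, sh_mk, zero_add, ← hl] at this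
    rwa [show n + m * |n| + m * -|n| = n by ring] at this

/-- Strands representing given loops. -/
lemma Plain.exists_loops (hX : X.Plain) {L : List (V × ℕ)} (hL : (L : Multiset (V × ℕ)) ≤ X.cut.net.loops) :
    ∃ ss : List X.cut.Strand, (∀ s ∈ ss, X.cut.net.IsLoop (.inl s)) ∧
      ss.map (fun s => (X.cut.scol s, X.cut.net.winding (.inl s))) = L ∧
      (∀ i j (hi : i < ss.length) (hj : j < ss.length), X.cut.net.Same (.inl ss[i]) (.inl ss[j]) → i = j) ∧
      ((L : Multiset (V × ℕ)) = X.cut.net.loops → ∀ s, X.cut.net.IsLoop (.inl s) → ∃ t ∈ ss, X.cut.net.Same (.inl t) (.inl s)) := by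
  classical
  obtain ⟨qs, h1, h2⟩ := Multiset.exists_list_le_of_le_map hL
  have hq : ∀ q ∈ qs, ∃ s : X.cut.Strand, Quot.mk X.cut.net.Same (.inl s) = q ∧ X.cut.net.IsLoop (.inl s) := fun q hq => by
    obtain ⟨t, rfl, -, hl⟩ := (Set.Finite.mem_toFinset _).1 (Multiset.mem_of_le h1 hq)
    rcases t with s | a
    · exact ⟨s, rfl, hl⟩
    · by_cases ha : X.cut.ins a = []
      · obtain ⟨-, s, hs⟩ := hX.exists_outs ha
        have : X.cut.net.Same (.inr a) (.inl s) := ⟨0, Gen.src' 0 ha hs⟩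
        exact ⟨s, (Quot.sound this).symm, X.wf.isLoop_congr this hl⟩
      · exact absurd hl (Net.not_isLoop_of_isolated (Closed.isolated ha))
  obtain ⟨ss, rfl⟩ : qs ∈ Set.range (List.map fun s : X.cut.Strand => Quot.mk X.cut.net.Same (.inl s)) := by
    rw [Set.range_list_map]
    exact fun q h => ⟨_, (hq q h).choose_spec.1⟩
  have hsame : ∀ s, X.cut.net.Same (.inl s) (Quot.mk X.cut.net.Same (.inl s)).out := fun s => X.wf.same_out _
  refine ⟨ss, fun s hs => ?_, ?_, fun i j hi hj h => ?_, fun h s hs => ?_⟩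
  · obtain ⟨t, h3, h4⟩ := hq _ (mem_map_of_mem hs)
    exact X.wf.isLoop_congr (X.wf.mk_eq.1 h3) h4
  · rw [← h2, List.map_map]
    refine map_congr_left fun s _ => ?_
    obtain ⟨n, hn⟩ := hsame s
    exact Prod.ext (X.wf.rel_col hn) (X.wf.winding_congr (hsame s))
  · have hnd := Multiset.nodup_of_le h1 (Finset.nodup _)
    refine ((Multiset.coe_nodup.1 hnd).getElem_inj_iff (hi := by simpa using hi) (hj := by simpa using hj)).1 ?_
    simpa using Quot.sound h
  · have h3 := Multiset.eq_of_le_of_card_le h1 (by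
      have := congrArg Multiset.card h
      rw [← h2] at this
      simpa [Net.loops, Net.loopsIn] using this.ge)
    have h4 : Quot.mk X.cut.net.Same (.inl s) ∈ ss.map fun s : X.cut.Strand => Quot.mk X.cut.net.Same (.inl s) := by
      rw [← Multiset.mem_coe, h3]
      exact (Set.Finite.mem_toFinset _).2 ⟨_, rfl, trivial, hs⟩
    obtain ⟨t, ht, he⟩ := mem_map.1 h4
    exact ⟨t, ht, X.wf.mk_eq.1 he⟩

lemma Plain.exists_port (hX : X.Plain) {p k} (hp : X.cut.net.alive p) (hk : k ≤ X.cut.net.deg p) :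
    ∃ s, X.cut.port p k = (.inl s, 0) := by
  by_cases hs : X.cut.IsSplit p ↔ k = 0
  · rcases port_end hp hk hs with ⟨s, h, -⟩ | ⟨-, h, -⟩
    exacts [⟨s, h⟩, absurd h (hX.inner hp).1]
  · rcases X.closed.port_start hp hk (by tauto) with ⟨s, h, -⟩ | ⟨a, -, h, -⟩
    exacts [⟨s, h⟩, absurd h.outs (hX.inner hp).2]

lemma _root_.Net.PortIso.scol_port {N N' : Net Γ} (hN : N.WF) (hN' : N'.WF) {e f} (h : N.PortIso N' e f)
    {p k} (hp : N.alive p) (hk : k ≤ N.deg p) : N'.scol (N'.port (e p) k).1 = N.scol (N.port p k).1 := by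
  have he := h.alive hp
  cases k with
  | zero => rw [hN.col_zero p hp, hN'.col_zero _ he, h.col p hp]
  | succ k =>
    have h1 := hN.col_succ p hp k hk
    have h2 := hN'.col_succ _ he k (by rwa [h.deg hp])
    rw [h.col p hp, h1] at h2
    exact (Option.some_inj.1 h2).symm

/-- Diagrams with isomorphic nets and the same loops have corresponding strands. -/
lemma Plain.exists_strandMap (hX : X.Plain) (hY : Y.Plain) {e f} (h : X.cut.net.PortIso Y.cut.net e f)
    (hf : ∀ p, X.cut.net.alive p → f p = 0) (hl : X.cut.net.loops = Y.cut.net.loops) :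
    ∃ π : X.cut.Strand → Y.cut.Strand,
      (∀ s t n, X.cut.net.Rel (.inl s, 0) (.inl t, n) ↔ Y.cut.net.Rel (.inl (π s), 0) (.inl (π t), n)) ∧
      (∀ s, Y.cut.scol (π s) = X.cut.scol s) ∧
      ∀ p k s, X.cut.net.alive p → k ≤ X.cut.net.deg p → X.cut.port p k = (.inl s, 0) →
        Y.cut.port (e p) k = (.inl (π s), 0) := by
  have hL := Multiset.coe_toList X.cut.net.loops
  obtain ⟨ss, h1, h2, h3, h4⟩ := hX.exists_loops hL.le
  obtain ⟨ss', h1', h2', h3', -⟩ := hY.exists_loops (hL.trans hl).le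
  have hlen : ss.length = ss'.length := by
    have := congrArg List.length (h2.trans h2'.symm); simpa using this
  have hi : ∀ i (hi : i < ss.length), X.cut.scol ss[i] = Y.cut.scol (ss'[i]'(hlen ▸ hi)) ∧
      X.cut.net.winding (.inl ss[i]) = Y.cut.net.winding (.inl (ss'[i]'(hlen ▸ hi))) := fun i hi => by
    have := congrArg (fun l => l[i]?) (h2.trans h2'.symm)
    simpa [hi, hlen ▸ hi] using this
  let R : (X.cut.Strand ⊕ X.cut.Point) × ℤ → (Y.cut.Strand ⊕ Y.cut.Point) × ℤ → Prop := fun x x' =>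
    (∃ p k, X.cut.net.alive p ∧ k ≤ X.cut.net.deg p ∧ x = X.cut.port p k ∧ x' = Y.cut.port (e p) k) ∨
      ∃ (i : ℕ) (hi : i < ss.length), x = (.inl ss[i], 0) ∧ x' = (.inl (ss'[i]'(hlen ▸ hi)), 0)
  have hR : ∀ {x x' y y'}, R x x' → R y y' → ∀ n, X.cut.net.Rel x (sh n y) ↔ Y.cut.net.Rel x' (sh n y') := by
    have hno : ∀ {Z : ClosedStrandDiagram Γ} {s p k} n, Z.cut.net.IsLoop (.inl s) → Z.cut.net.alive p →
        k ≤ Z.cut.net.deg p → ¬ Z.cut.net.Rel (.inl s, 0) (sh n (Z.cut.net.port p k)) := fun n h hp hk =>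
      h.1 _ _ n hp hk
    have hno' : ∀ {Z : ClosedStrandDiagram Γ} {s p k} n, Z.cut.net.IsLoop (.inl s) → Z.cut.net.alive p →
        k ≤ Z.cut.net.deg p → ¬ Z.cut.net.Rel (Z.cut.net.port p k) (sh n (.inl s, 0)) := fun {Z s p k} n h hp hk hr => by
      rw [Net.rel_comm, ← sh_zero (Z.cut.net.port p k), Z.wf.rel_sh_left] at hr
      exact hno _ h hp hk hr
    rintro _ _ _ _ (⟨p, k, hp, hk, rfl, rfl⟩ | ⟨i, hi1, rfl, rfl⟩) (⟨q, l, hq, hl, rfl, rfl⟩ | ⟨j, hj1, rfl, rfl⟩) n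
    · have := h.rel p q k l n hp hq hk hl
      rwa [hf p hp, hf q hq, sh_zero, add_zero] at this
    · exact iff_of_false (hno' n (h1 _ (getElem_mem _)) hp hk)
        (hno' n (h1' _ (getElem_mem _)) (h.alive hp) (by rwa [h.deg hp]))
    · exact iff_of_false (hno n (h1 _ (getElem_mem _)) hq hl)
        (hno n (h1' _ (getElem_mem _)) (h.alive hq) (by rwa [h.deg hq]))
    · rw [sh_mk, sh_mk, zero_add]
      by_cases hij : i = j
      · subst hij
        rw [(X.wf.rel_self_iff (h1 _ (getElem_mem _))).2, (Y.wf.rel_self_iff (h1' _ (getElem_mem _))).2,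
          (hi i hi1).2]
      · exact iff_of_false (fun hr => hij (h3 _ _ _ _ ⟨n, hr⟩)) fun hr => hij (h3' _ _ _ _ ⟨n, hr⟩)
  have hneg : ∀ {Z : ClosedStrandDiagram Γ} {s t n}, Z.cut.net.Rel (.inl t, 0) (.inl s, n) →
      Z.cut.net.Rel (.inl s, 0) (sh (-n) (.inl t, 0)) := fun {Z s t n} hr => by
    have := (Z.wf.rel_sh' (-n) hr).symm
    rwa [sh_mk, add_neg_cancel] at this
  have hex : ∀ s, ∃ s' x x' n, R x x' ∧ X.cut.net.Rel (.inl s, 0) (sh n x) ∧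
      Y.cut.net.Rel (.inl s', 0) (sh n x') := fun s => by
    rcases hX.start_or_loop s with ⟨u, m, hu, hr⟩ | hs
    · obtain ⟨k, hk, he⟩ := hX.port_ini hu
      obtain ⟨u', hu'⟩ := hY.exists_port (h.alive hu) (show k ≤ _ by rwa [h.deg hu])
      have hp : R (.inl u, 0) (.inl u', 0) := .inl ⟨_, k, hu, hk, he.symm, hu'.symm⟩
      rcases hY.forward u' m with ⟨w, j, hj, hw, hr'⟩ | ⟨s', hr'⟩
      · obtain ⟨l, hl, hwl, he'⟩ := hY.port_ter hw
        obtain ⟨q, hq, hqw⟩ := h.bij.surjOn hw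
        rw [← hqw] at hl hwl he'
        rw [h.deg hq] at hl
        rw [show Y.cut.IsSplit (e q) ↔ X.cut.IsSplit q from h.split q hq] at hwl
        obtain ⟨w', h5, h6⟩ : ∃ w', X.cut.port q l = (.inl w', 0) ∧ X.cut.ter w' = q := by
          rcases port_end hq hl hwl with ⟨w', h5, h6, -⟩ | ⟨-, h5, -⟩
          exacts [⟨w', h5, h6⟩, absurd h5 (hX.inner hq).1]
        have hq' : R (.inl w', 0) (.inl w, 0) := .inl ⟨q, l, hq, hl, h5.symm, he'.symm⟩
        have h7 := (hR hp hq' j).2 (by simpa using hr')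
        have h8 := X.wf.rel_sh' (-m) h7
        rw [sh_sh, sh_mk, sh_mk, zero_add, zero_add] at h8
        have := level_le (end_of_rel X.closed (h6.symm ▸ hq) (hr.trans h8))
        simp only at this; omega
      · exact ⟨s', _, _, -m, hp, by simpa using hr, hneg hr'⟩
    · obtain ⟨t, ht, n, hn⟩ := h4 hL s hs
      obtain ⟨i, hi, rfl⟩ := mem_iff_getElem.1 ht
      obtain ⟨s', hs'⟩ := hY.loop_level (h1' (ss'[i]'(hlen ▸ hi)) (getElem_mem _)) n
      exact ⟨s', _, _, -n, .inr ⟨i, hi, rfl, rfl⟩, hneg hn, hneg hs'⟩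
  choose π x x' a hxx hx hx' using hex
  have key : ∀ {s y y'} n, R y y' → (X.cut.net.Rel (.inl s, 0) (sh n y) ↔ Y.cut.net.Rel (.inl (π s), 0) (sh n y')) :=
    fun {s y y'} n hy => by
      have h5 := hR (hxx s) hy (n - a s)
      rw [← X.wf.rel_sh_left, ← Y.wf.rel_sh_left] at h5
      exact ⟨fun h => (hx' s).trans (h5.1 ((hx s).symm.trans h)), fun h => (hx s).trans (h5.2 ((hx' s).symm.trans h))⟩
  refine ⟨π, fun s t n => ?_, fun s => ?_, fun p k s hp hk hs => ?_⟩
  · have h5 := key (s := s) (a t + n) (hxx t)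
    have h6 := X.wf.rel_sh' n (hx t)
    have h7 := Y.wf.rel_sh' n (hx' t)
    rw [sh_sh, sh_mk, zero_add] at h6 h7
    exact ⟨fun h => (h5.1 (h.trans h6)).trans h7.symm, fun h => (h5.2 (h.trans h7)).trans h6.symm⟩
  · refine (Y.wf.rel_col (hx' s)).trans (Eq.trans ?_ (X.wf.rel_col (hx s)).symm)
    rw [sh_fst, sh_fst]
    rcases hxx s with ⟨p, k, hp, hk, h5, h6⟩ | ⟨i, hi1, h5, h6⟩ <;> rw [h5, h6]
    · exact h.scol_port X.wf Y.wf hp hk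
    · exact (hi i hi1).1.symm
  · obtain ⟨t, ht⟩ := hY.exists_port (h.alive hp) (show k ≤ _ by rwa [h.deg hp])
    have := (key (s := s) 0 (.inl ⟨p, k, hp, hk, rfl, rfl⟩)).1 (by rw [hs]; exact .refl _)
    rw [ht, sh_zero] at this
    rw [ht, hY.eq_of_rel this]

lemma Plain.permutation (hX : X.Plain) (hY : Y.Plain) [Nonempty X.Pt] {e f}
    (h : X.cut.net.PortIso Y.cut.net e f) (hf : ∀ p, X.cut.net.alive p → f p = 0)
    (hl : X.cut.net.loops = Y.cut.net.loops) : X.cut.BaseLinePermutation Y.cut := by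
  classical
  obtain ⟨π, hπ, hcol, hport⟩ := hX.exists_strandMap hY h hf hl
  have hinj : ∀ {X Y : ClosedStrandDiagram Γ} (hX : X.Plain) {π : X.cut.Strand → Y.cut.Strand}
      (_ : ∀ s t n, X.cut.net.Rel (.inl s, 0) (.inl t, n) ↔ Y.cut.net.Rel (.inl (π s), 0) (.inl (π t), n)),
      Function.Injective π := fun hX π hπ s t he => hX.eq_of_rel ((hπ s t 0).2 (he ▸ .refl _))
  have hbij : Function.Bijective π := by
    obtain ⟨e', h1, h2, h3⟩ := h.symm X.wf Y.wf
    obtain ⟨π', hπ', -⟩ := hY.exists_strandMap hX h3 (fun q hq => by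
      rw [hf _ (by obtain ⟨p, hp, rfl⟩ := h.bij.surjOn hq; rw [h1 p hp]; exact hp), neg_zero]) hl.symm
    have := X.cut.finite_strand
    have := Y.cut.finite_strand
    exact (Nat.bijective_iff_injective_and_card π).2 ⟨hinj hX hπ,
      (Nat.card_le_card_of_injective π (hinj hX hπ)).antisymm (Nat.card_le_card_of_injective π' (hinj hY hπ'))⟩
  have hnext : ∀ s t, X.cut.Next s t ↔ Y.cut.Next (π s) (π t) := fun s t =>
    ⟨fun h => hY.next_of_rel ((hπ s t (0 + 1)).1 (h.rel 0)), fun h => hX.next_of_rel ((hπ s t (0 + 1)).2 (h.rel 0))⟩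
  have halive : ∀ p, X.cut.net.alive p → Y.cut.outs (e p) = (X.cut.outs p).map π ∧
      Y.cut.ins (e p) = (X.cut.ins p).map π := fun p hp => by
    have hp' := h.alive hp
    have hd := h.deg hp
    obtain ⟨s, h1, h2, h3⟩ := hX.port_narrow hp
    obtain ⟨s', h1', h2', h3'⟩ := hY.port_narrow hp'
    rw [hport p 0 s hp (Nat.zero_le _) h1] at h1'
    obtain rfl : π s = s' := by simpa using h1'
    have hwide : ∀ {l : List X.cut.Strand} {l' : List Y.cut.Strand}, X.cut.net.deg p = l.length →
        Y.cut.net.deg (e p) = l'.length →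
        (∀ {k t}, l[k]? = some t → X.cut.port p (k + 1) = (.inl t, 0)) →
        (∀ {k t}, l'[k]? = some t → Y.cut.port (e p) (k + 1) = (.inl t, 0)) → l' = l.map π := fun {l l'} d d' g g' => by
      refine ext_getElem (by rw [length_map]; omega) fun k hk hk' => ?_
      rw [length_map] at hk'
      have h4 := hport p (k + 1) _ hp (by omega) (g (getElem?_eq_getElem hk'))
      rw [g' (getElem?_eq_getElem hk)] at h4
      simpa using h4
    rcases hp with hs | hm
    · have hs' : Y.cut.IsSplit (e p) := (h.split p (.inl hs)).2 hs
      exact ⟨hwide hs.deg hs'.deg hs.port_succ hs'.port_succ, by rw [h2 hs, h2' hs']; rfl⟩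
    · have hm' : Y.cut.IsMerge (e p) := hp'.resolve_left fun h' => ((h.split p (.inr hm)).1 h').not_merge hm
      exact ⟨by rw [h3 hm, h3' hm']; rfl, hwide hm.deg hm'.deg hm.port_succ hm'.port_succ⟩
  have hini : ∀ {s}, Y.cut.net.alive (Y.cut.ini (π s)) → X.cut.net.alive (X.cut.ini s) := fun {s} hs => by
    obtain ⟨q, hq, he⟩ := h.bij.surjOn hs
    have := mem_outs_ini (π s)
    rw [← he, (halive q hq).1, List.mem_map_of_injective hbij.1] at this
    rwa [ini_of_mem this]
  have hter : ∀ {s}, Y.cut.net.alive (Y.cut.ter (π s)) → X.cut.net.alive (X.cut.ter s) := fun {s} hs => by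
    obtain ⟨q, hq, he⟩ := h.bij.surjOn hs
    have := mem_ins_ter (π s)
    rw [← he, (halive q hq).2, List.mem_map_of_injective hbij.1] at this
    rwa [ter_of_mem this]
  have hφ : ∀ p, ∃ p', Y.cut.pcol p' = X.cut.pcol p ∧ Y.cut.outs p' = (X.cut.outs p).map π ∧
      Y.cut.ins p' = (X.cut.ins p).map π := fun p => by
    by_cases hp : X.cut.net.alive p
    · exact ⟨e p, h.col p hp, halive p hp⟩
    · rcases hX.univalent hp with ⟨h1, s, h2⟩ | ⟨h1, s, h2⟩
      · obtain rfl := ini_of_eq h2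
        obtain ⟨h3, h4⟩ := hY.of_ini (mt hini hp)
        refine ⟨_, ?_, by rw [h4, h2]; rfl, by rw [h3, h1]; rfl⟩
        rw [← X.cut.univalentSource_col _ ⟨h1, by simp [h2]⟩ s (mem_of_eq_singleton h2),
          ← Y.cut.univalentSource_col _ ⟨h3, by simp [h4]⟩ _ (mem_of_eq_singleton h4), hcol]
      · obtain rfl := ter_of_eq h2
        obtain ⟨h3, h4⟩ := hY.of_ter (mt hter hp)
        refine ⟨_, ?_, by rw [h3, h1]; rfl, by rw [h4, h2]; rfl⟩
        rw [← X.cut.univalentSink_col _ ⟨h1, by simp [h2]⟩ s (mem_of_eq_singleton h2),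
          ← Y.cut.univalentSink_col _ ⟨h3, by simp [h4]⟩ _ (mem_of_eq_singleton h4), hcol]
  choose φ hφc hφo hφi using hφ
  have hφini : ∀ s, Y.cut.ini (π s) = φ (X.cut.ini s) := fun s =>
    ini_of_mem (by rw [hφo]; exact mem_map_of_mem (mem_outs_ini s))
  have hφter : ∀ s, Y.cut.ter (π s) = φ (X.cut.ter s) := fun s =>
    ter_of_mem (by rw [hφi]; exact mem_map_of_mem (mem_ins_ter s))
  have hφinj : Function.Injective φ := fun p q he => by
    by_cases hp : X.cut.ins p = []
    · obtain ⟨s, hs⟩ := exists_mem_of_ne_nil _ (outs_ne_nil_of_ins hp)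
      have := mem_map_of_mem (f := π) hs
      rw [← hφo, he, hφo, List.mem_map_of_injective hbij.1] at this
      rw [← ini_of_mem hs, ini_of_mem this]
    · obtain ⟨s, hs⟩ := exists_mem_of_ne_nil _ hp
      have := mem_map_of_mem (f := π) hs
      rw [← hφi, he, hφi, List.mem_map_of_injective hbij.1] at this
      rw [← ter_of_mem hs, ter_of_mem this]
  refine ⟨φ, π, ⟨hφinj.injOn, fun p _ => hφc p, fun p _ => hφo p, fun p _ => hφi p, fun _ _ s _ => hcol s,
    fun _ _ s _ => hcol s⟩, ⟨hφinj, fun y => ?_⟩, ?_⟩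
  · by_cases hy : Y.cut.ins y = []
    · obtain ⟨s', hs⟩ := exists_mem_of_ne_nil _ (outs_ne_nil_of_ins hy)
      obtain ⟨s, rfl⟩ := hbij.2 s'
      exact ⟨_, (hφini s).symm.trans (ini_of_mem hs)⟩
    · obtain ⟨s', hs⟩ := exists_mem_of_ne_nil _ hy
      obtain ⟨s, rfl⟩ := hbij.2 s'
      exact ⟨_, (hφter s).symm.trans (ter_of_mem hs)⟩
  · have hbase : ∀ {Z : ClosedStrandDiagram Γ} (_ : Z.Plain) {a b}, Z.cut.Base a b →
        ∃ s t, Z.cut.Next s t ∧ Z.cut.ter s = b ∧ Z.cut.ini t = a := fun {Z} hZ {a b} hab => by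
      obtain ⟨-, t, ht⟩ := hZ.exists_outs hab.ins
      obtain ⟨-, s, hs⟩ := hZ.exists_ins hab.outs
      exact ⟨s, t, ⟨a, b, hab, hs, ht⟩, ter_of_eq hs, ini_of_eq ht⟩
    have hnb : ∀ {Z : ClosedStrandDiagram Γ} {s t}, Z.cut.Next s t → Z.cut.Base (Z.cut.ini t) (Z.cut.ter s) := by
      rintro Z s t ⟨a, b, h1, h2, h3⟩
      rwa [ini_of_eq h3, ter_of_eq h2]
    have hnd : ∀ Z : ClosedStrandDiagram Γ, (Z.cut.sources.zip Z.cut.sinks).Nodup := fun Z =>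
      Nodup.of_map Prod.fst (by rw [List.map_fst_zip Z.closed.length_eq.le]; exact Z.cut.sources_nodup)
    rw [zip_map]
    refine (List.perm_ext_iff_of_nodup (hnd Y) ((hnd X).map (hφinj.prodMap hφinj))).2 fun ⟨x, y⟩ => ?_
    rw [mem_map]
    constructor
    · intro hxy
      obtain ⟨s', t', h1, rfl, rfl⟩ := hbase hY hxy
      obtain ⟨s, rfl⟩ := hbij.2 s'
      obtain ⟨t, rfl⟩ := hbij.2 t'
      exact ⟨_, hnb ((hnext s t).2 h1), by rw [hφini, hφter]; rfl⟩
    · rintro ⟨⟨a, b⟩, hab, he⟩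
      obtain ⟨s, t, h1, rfl, rfl⟩ := hbase hX hab
      rw [← he]
      have := hnb ((hnext s t).1 h1)
      rwa [hφini, hφter] at this

lemma Plain.similar_of_nonneg (hY : Y.Plain) [Nonempty Y.Pt] (n : ℕ) (hX : X.Plain) {e g}
    (h : Y.cut.net.PortIso X.cut.net e g) (hg : ∀ q, Y.cut.net.alive q → 0 ≤ g q)
    (hn : ∑ q ∈ (Set.toFinite {q | Y.cut.net.alive q}).toFinset, (g q).toNat = n)
    (hl : Y.cut.net.loops = X.cut.net.loops) : Y.Similar X := by
  induction n using Nat.strong_induction_on generalizing X g with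
  | _ n ih =>
    by_cases h0 : ∀ q, Y.cut.net.alive q → g q = 0
    · exact EqvGen.rel _ _ (.inr (.inr (hY.permutation hX h h0 hl)))
    obtain ⟨ht, hht⟩ := exists_height X.cut
    push Not at h0
    obtain ⟨q, ⟨hq, hq0⟩, hmin⟩ := (measure fun q => ht (e q)).wf.has_min {q | Y.cut.net.alive q ∧ g q ≠ 0}
      h0
    have hlow : ∀ s ∈ X.cut.ins (e q), ¬ X.cut.net.alive (X.cut.ini s) := fun s hs ha => by
      have hs' := ter_of_mem hs
      obtain ⟨k, hk, h1⟩ := hX.port_ini ha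
      obtain ⟨l, hl, h2, h3⟩ := hX.port_ter (s := s) (by rw [hs']; exact h.alive hq)
      obtain ⟨q', hq', he⟩ := h.bij.surjOn ha
      rw [hs', h.deg hq] at hl
      rw [hs', show X.cut.IsSplit (e q) ↔ Y.cut.IsSplit q from h.split q hq] at h2
      rw [hs'] at h3
      rw [← he, h.deg hq'] at hk
      rw [← he] at h1
      have h4 := (h.rel q' q k l (g q' - g q) hq' hq hk hl).2 (by
        rw [h1, h3, sub_add_cancel]; exact .refl _)
      obtain ⟨u, h5⟩ := hY.exists_port hq' hk
      rcases port_end hq hl h2 with ⟨u', h6, h7, -⟩ | ⟨-, h6, -⟩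
      · rw [show Y.cut.net.port q' k = _ from h5, show Y.cut.net.port q l = _ from h6, sh_mk, zero_add] at h4
        have h8 := level_le (end_of_rel Y.closed (h7.symm ▸ hq) h4)
        simp only at h8
        have h9 := hg q hq
        refine hmin q' ⟨hq', by omega⟩ ?_
        show ht (e q') < ht (e q)
        rw [← hs', he]; exact hht s
      · exact (hY.inner hq).1 h6
    obtain ⟨Z, e', ⟨h1, h2, f, h3, h4⟩, hZ⟩ := hX.exists_lower (h.alive hq) hlow
    have hgf : ∀ p, Y.cut.net.alive p → 0 ≤ g p + f (e p) ∧ g p + f (e p) ≤ g p ∧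
        (p = q → g p + f (e p) < g p) := fun p hp => by
      have := hg p hp
      rw [h4 _ (h.alive hp)]
      split_ifs with hc
      · have := h.bij.injOn hp hq hc
        subst this
        refine ⟨by omega, by omega, fun _ => by omega⟩
      · exact ⟨by omega, by omega, fun hc' => absurd (congrArg e hc') hc⟩
    refine (ih _ ?_ hZ (h.trans X.wf Z.wf h3) (fun p hp => (hgf p hp).1) rfl (hl.trans h2)).trans _ _ _ (h1.symm _ _)
    rw [← hn]
    refine Finset.sum_lt_sum (fun p hp => ?_) ⟨q, (Set.Finite.mem_toFinset _).2 hq, ?_⟩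
    · have hp' : p ∈ {q | Y.cut.net.alive q} := (Set.Finite.mem_toFinset _).1 hp
      have := hgf p hp'; omega
    · have := hgf q hq; have := this.2.2 rfl; omega

/-- A plain diagram is determined by its net, up to similarity. -/
lemma Plain.similar (hY : Y.Plain) (hX : X.Plain) [Nonempty Y.Pt] {e g}
    (h : Y.cut.net.PortIso X.cut.net e g) (hl : Y.cut.net.loops = X.cut.net.loops) : Y.Similar X := by
  have := Y.cut.finite_point
  obtain ⟨b, hb⟩ := (Set.finite_range g).bddBelow
  refine hY.similar_of_nonneg _ hX ((Net.PortIso.refl _ Y.wf (-b)).trans Y.wf X.wf h) (fun q _ => ?_) rfl hl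
  have := hb ⟨q, rfl⟩
  show 0 ≤ -b + g q
  omega

lemma map_range_mod {α : Type*} (f : ℕ → α) (d k : ℕ) :
    (List.range (k * d)).map (fun j => f (j % d)) = (List.replicate k ((List.range d).map f)).flatten := by
  induction k with
  | zero => simp
  | succ k ih =>
    rw [add_mul, one_mul, add_comm, List.range_add, map_append, List.map_map, List.replicate_succ,
      List.flatten_cons, ← ih]
    congr 1
    · exact map_congr_left fun i hi => by rw [Nat.mod_eq_of_lt (mem_range.1 hi)]
    · exact map_congr_left fun i _ => by simp

/-- Given loops lie on base points in suitable positions. -/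
lemma Plain.exists_block (hX : X.Plain) {cs : List V} {k : ℕ} (hcs : cs ≠ [])
    (hl : ((cs.map fun c => (c, k) : List (V × ℕ)) : Multiset (V × ℕ)) ≤ X.cut.net.loops) :
    1 ≤ k ∧ ∃ P : List X.Pt, P.Nodup ∧ (∀ x ∈ P, X.cut.ins x = []) ∧
      P.map X.cut.pcol = (List.replicate k cs).flatten ∧
      ∀ P', Forall₂ X.cut.Base P P' → X.cut.FormLoops cs.length k P P' := by
  obtain ⟨ss, h1, h2, h3, -⟩ := hX.exists_loops hl
  obtain ⟨d, hd⟩ : ∃ d, cs.length = d := ⟨_, rfl⟩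
  have hsd : ss.length = d := by
    have := congrArg List.length h2; simpa [hd] using this
  have hd0 : 0 < d := hd ▸ length_pos_iff.2 hcs
  have hinh : Inhabited X.cut.Strand := ⟨ss[0]⟩
  obtain ⟨a, ha⟩ : ∃ a : ℕ → X.cut.Strand, ∀ i (hi : i < d), a i = ss[i] :=
    ⟨fun i => ss.getD i default, fun i hi => by simp [List.getD, hsd, hi]⟩
  have hal : ∀ i < d, X.cut.net.IsLoop (.inl (a i)) := fun i hi => ha i hi ▸ h1 _ (getElem_mem _)
  have haw : ∀ i (hi : i < d), X.cut.scol (a i) = cs[i] ∧ X.cut.net.winding (.inl (a i)) = k := fun i hi => by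
    have := congrArg (fun l => l[i]?) h2
    rw [ha i hi]
    simpa [hsd, hd, hi] using this
  have hk : 1 ≤ k := (haw 0 hd0).2 ▸ (X.wf.rel_self_iff (hal 0 hd0)).1
  have hak : ∀ i < d, ∀ n : ℤ, X.cut.net.Rel (.inl (a i), 0) (.inl (a i), n) ↔ (k : ℤ) ∣ n := fun i hi => by
    have := (X.wf.rel_self_iff (hal i hi)).2
    rwa [(haw i hi).2] at this
  have hnx : ∀ s, ∃ t, X.cut.net.IsLoop (.inl s) → X.cut.Next s t := fun s => by
    by_cases hs : X.cut.net.IsLoop (.inl s)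
    · obtain ⟨t, ht⟩ := hX.exists_next (hX.of_isLoop hs).2
      exact ⟨t, fun _ => ht⟩
    · exact ⟨s, fun h => absurd h hs⟩
  choose nx hnx using hnx
  have hit : ∀ i < d, ∀ m : ℕ, X.cut.net.IsLoop (.inl (nx^[m] (a i))) ∧
      X.cut.net.Rel (.inl (a i), 0) (.inl (nx^[m] (a i)), (m : ℤ)) := fun i hi m => by
    induction m with
    | zero => exact ⟨hal i hi, .refl _⟩
    | succ m ih =>
      rw [Function.iterate_succ_apply']
      have := (hnx _ ih.1).rel
      exact ⟨X.wf.isLoop_congr (X.wf.same_of_rel (this 0)) ih.1, by push_cast; exact ih.2.trans (this _)⟩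
  obtain ⟨x, hx⟩ : ∃ x : ℕ → X.cut.Strand, ∀ j, x j = nx^[j / d] (a (j % d)) := ⟨_, fun _ => rfl⟩
  have hmod : ∀ j, j % d < d := fun j => Nat.mod_lt j hd0
  have hxl : ∀ j, X.cut.net.IsLoop (.inl (x j)) := fun j => hx j ▸ (hit _ (hmod j) _).1
  have hxr : ∀ j, X.cut.net.Rel (.inl (a (j % d)), 0) (.inl (x j), ((j / d : ℕ) : ℤ)) := fun j =>
    hx j ▸ (hit _ (hmod j) _).2
  have hxi : ∀ j, X.cut.ins (X.cut.ini (x j)) = [] ∧ X.cut.outs (X.cut.ini (x j)) = [x j] := fun j =>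
    hX.of_ini (hX.of_isLoop (hxl j)).1
  have hinj : ∀ i < k * d, ∀ j < k * d, x i = x j → i = j := fun i hi j hj he => by
    have h4 := hxr i
    have h5 := hxr j
    have h6 : i % d = j % d := by
      refine h3 _ _ (hsd ▸ hmod i) (hsd ▸ hmod j) ?_
      rw [← ha _ (hmod i), ← ha _ (hmod j)]
      rw [he] at h4
      exact X.wf.same_equivalence.trans (X.wf.same_of_rel h4) (X.wf.same_equivalence.symm (X.wf.same_of_rel h5))
    have h7 := X.wf.rel_sh' ((i / d : ℕ) - (j / d : ℕ) : ℤ) h5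
    rw [sh_mk, sh_mk, zero_add, add_sub_cancel, ← he, ← h6] at h7
    have h8 := (hak _ (hmod i) _).1 (h4.trans h7.symm)
    have h9 : i / d < k := Nat.div_lt_of_lt_mul (by rwa [mul_comm] at hi)
    have h10 : j / d < k := Nat.div_lt_of_lt_mul (by rwa [mul_comm] at hj)
    have h11 := Int.eq_zero_of_abs_lt_dvd h8 (by
      have h12 := Int.natCast_nonneg (i / d)
      have h13 := Int.natCast_nonneg (j / d)
      rw [abs_lt]; omega)
    rw [← Nat.div_add_mod i d, ← Nat.div_add_mod j d, h6, show i / d = j / d by omega]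
  refine ⟨hk, (List.range (k * d)).map fun j => X.cut.ini (x j), List.nodup_range.map_on fun i hi j hj he => ?_,
    fun y hy => ?_, ?_, fun P' hP => ?_⟩
  · refine hinj i (mem_range.1 hi) j (mem_range.1 hj) ?_
    have := (hxi i).2
    rw [he, (hxi j).2] at this
    simpa using this.symm
  · obtain ⟨j, -, rfl⟩ := mem_map.1 hy
    exact (hxi j).1
  · have h4 : cs = (List.range d).map fun i => X.cut.scol (a i) :=
      ext_getElem (by simp [hd]) fun i hi _ => by simp [(haw i (hd ▸ hi)).1]
    rw [h4, ← map_range_mod, List.map_map]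
    refine map_congr_left fun j _ => ?_
    exact (X.cut.univalentSource_col _ ⟨(hxi j).1, by simp [(hxi j).2]⟩ _ (by simp [(hxi j).2])).symm.trans
      (X.wf.rel_col (hxr j)).symm
  · rw [hd]
    have hlen := hP.length_eq
    rw [length_map, List.length_range] at hlen
    have hb : ∀ j (hj : j < k * d), X.cut.Base (X.cut.ini (x j)) (P'[j]'(hlen ▸ hj)) := fun j hj => by
      have := hP.get (by simpa using hj) (hlen ▸ hj)
      simpa using this
    refine ⟨by simp, hlen.symm, fun y hy => ?_, fun y hy => ?_, List.forall₂_iff_get.2 ⟨by simp [hlen], fun j hj _ => ?_⟩⟩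
    · obtain ⟨j, -, rfl⟩ := mem_map.1 hy
      exact (hxi j).1
    · obtain ⟨j, hj, rfl⟩ := mem_iff_getElem.1 hy
      exact (hb j (hlen ▸ hj)).outs
    · rw [length_map, List.length_range] at hj
      obtain ⟨h4, h5, h6⟩ := block_mod hk hj
      have h7 : x ((j + d) % (k * d)) = nx (x j) := by
        have h8 := X.wf.rel_sh' ((j / d : ℕ) + 1 - ((j + d) % (k * d) / d : ℕ) : ℤ) (hxr ((j + d) % (k * d)))
        rw [sh_mk, sh_mk, zero_add, h5, add_sub_cancel] at h8
        have h9 := (hak _ (hmod j) ((j / d : ℕ) + 1 - ((j + d) % (k * d) / d : ℕ) : ℤ)).2 (by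
          rw [← dvd_neg, neg_sub, ← sub_sub]; exact h6)
        exact hX.eq_of_rel ((h9.trans h8).symm.trans ((hxr j).trans ((hnx _ (hxl j)).rel _)))
      obtain ⟨b, c, h8, h9, h10⟩ := hnx _ (hxl j)
      have h11 := hb _ h4
      rw [h7, ini_of_eq h10] at h11
      refine ⟨x j, by simpa using (hxi j).2, ?_⟩
      rw [h8.right h11] at h9
      simpa [List.getElem_rotate, ← hlen] using h9

/-- Replacing loops by other ones. -/
lemma Plain.exists_replace (hX : X.Plain) {cs ds : List V} {k : ℕ} (hcs : cs ≠ []) (hds : ds ≠ [])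
    (hl : ((cs.map fun c => (c, k) : List (V × ℕ)) : Multiset (V × ℕ)) ≤ X.cut.net.loops) :
    1 ≤ k ∧ ∃ (W Z : ClosedStrandDiagram Γ) (A A' P P' : List W.Pt) (Q Q' : List Z.Pt) (φ : W.Pt → Z.Pt)
      (π : W.cut.Strand → Z.cut.Strand) (e : X.Pt → W.Pt), X.Similar W ∧ X.cut.net.Iso W.cut.net e (fun _ => 0) ∧
      W.cut.sources = A ++ P ∧ W.cut.sinks = A' ++ P' ∧ A.length = A'.length ∧
      W.cut.FormLoops cs.length k P P' ∧ P.map W.cut.pcol = (List.replicate k cs).flatten ∧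
      W.cut.Carries Z.cut {p | p ∉ P ∧ p ∉ P'} φ π ∧ Set.InjOn π {s | W.cut.ini s ∉ P} ∧
      Set.BijOn φ {p | p ∉ P ∧ p ∉ P'} {x | x ∉ Q ∧ x ∉ Q'} ∧
      Z.cut.sources = A.map φ ++ Q ∧ Z.cut.sinks = A'.map φ ++ Q' ∧
      Z.cut.FormLoops ds.length k Q Q' ∧ Q.map Z.cut.pcol = (List.replicate k ds).flatten ∧ Z.Plain := by
  obtain ⟨hk, P, hP, hPi, hPc, hPl⟩ := hX.exists_block hcs hl
  obtain ⟨A, A', P', h, h', hA, hPP, hcl, hblp, hiso⟩ := exists_reorder X.closed hP hPi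
  have hloops := hPl _ hPP
  obtain ⟨F', Q, Q', φ, π, hF', hC, hπ, hb, hso, hsi, hQ, hQc, hQ1⟩ := exists_replaceBlock (F := X.cut.reorder _ _ h h')
    hcl (X := P) (X' := P') (A := A) (A' := A') ⟨hloops, A, [], A', [], by simp; rfl, by simp; rfl, hA⟩ rfl rfl hds hk
  have huni : ∀ z, z ∈ Q ∨ z ∈ Q' → ∃ s, F'.ins z = [] ∧ F'.outs z = [s] ∨ F'.ins z = [s] ∧ F'.outs z = [] := by
    rintro z (hz | hz)
    · obtain ⟨s, hs⟩ := (hQ1 z).1 hz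
      exact ⟨s, .inl ⟨hQ.2.2.1 z hz, hs⟩⟩
    · obtain ⟨s, hs⟩ := (hQ1 z).2 hz
      exact ⟨s, .inr ⟨hs, hQ.2.2.2.1 z hz⟩⟩
  refine ⟨hk, ⟨_, hcl⟩, ⟨F', hF'⟩, A, A', P, P', Q, Q', φ, π, id, EqvGen.rel _ _ (.inr (.inr hblp)), hiso, rfl, rfl, hA,
    hloops, hPc, hC, hπ, hb, hso, hsi, hQ, hQc, fun z hz => ?_, Set.eq_empty_iff_forall_notMem.2 fun z hz => ?_⟩ <;>
  by_cases hzQ : z ∈ Q ∨ z ∈ Q'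
  · obtain ⟨s, h1 | h1⟩ := huni z hzQ <;> have := hz.1 <;> have := hz.2 <;> simp [h1] at *
  · obtain ⟨p, hp, rfl⟩ := hb.surjOn (not_or.1 hzQ)
    refine hX.1 p ⟨?_, ?_⟩
    · have := hz.1; rw [hC.ins p hp, length_map] at this; exact this
    · have := hz.2; rw [hC.outs p hp, length_map] at this; exact this
  · obtain ⟨s, h1⟩ := huni z hzQ
    exact not_alive_of h1 hz.1
  · obtain ⟨p, hp, rfl⟩ := hb.surjOn (not_or.1 hzQ)
    have hi := hX.inner (p := p) ((hC.alive hp).1 hz.1)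
    rcases hz.2 with h1 | h1
    · rw [hC.ins p hp, map_eq_nil_iff] at h1; exact hi.1 h1
    · rw [hC.outs p hp, map_eq_nil_iff] at h1; exact hi.2 h1

/-- The loops of a plain diagram can be changed from `m` to `m'` by type 3 moves. -/
def Reaches (Γ : OrderedGraph V E) (m m' : Multiset (V × ℕ)) : Prop :=
  ∀ X : ClosedStrandDiagram Γ, X.Plain → X.cut.net.loops = m → ∃ Z : ClosedStrandDiagram Γ, Z.Plain ∧
    X.ThreeEquivalent Z ∧ (∃ e f, X.cut.net.PortIso Z.cut.net e f) ∧ Z.cut.net.loops = m'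

lemma reaches_of_loopMove (hdead : Γ.NoDeadEnds) {m m'} (h : Net.LoopMove Γ m m') :
    Reaches Γ m m' ∧ Reaches Γ m' m := by
  obtain ⟨v, k, r, rfl, rfl⟩ := h
  have hch : (Γ.children v).length = (Γ.out v).length := length_map _
  have hne : Γ.children v ≠ [] := fun h => by
    obtain ⟨e, he⟩ := hdead v
    have := (Γ.mem_out v e).2 he
    rw [map_eq_nil_iff.1 h] at this; cases this
  have hcol : ∀ {Z : ClosedStrandDiagram Γ} {Q : List Z.Pt}, Q.map Z.cut.pcol = (List.replicate k [v]).flatten →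
      ∀ z ∈ Q, Z.cut.pcol z = v := fun {Z Q} hQ z hz => by
    have := mem_map_of_mem (f := Z.cut.pcol) hz
    rw [hQ] at this
    obtain ⟨l, hl, h⟩ := List.mem_flatten.1 this
    rw [List.eq_of_mem_replicate hl] at h
    simpa using h
  constructor <;> intro X hX hl
  · obtain ⟨hk, W, Z, A, A', P, P', Q, Q', φ, π, e, hs, hi, h1, h2, h3, h4, h5, h6, h7, h8, h9, h10, h11, h12, hZ⟩ :=
      hX.exists_replace (cs := [v]) (ds := Γ.children v) (k := k) (cons_ne_nil _ _) hne
        (hl ▸ Multiset.le_add_left _ _)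
    have hPn : P ≠ [] := fun h => by
      have := h4.1; rw [h] at this; simp at this; omega
    obtain ⟨p, hp⟩ := exists_mem_of_ne_nil P hPn
    have hB : W.cut.LoopBlock 1 k P P' := ⟨h4, A, [], A', [], by simpa using h1, by simpa using h2, h3⟩
    have : Nonempty W.cut.Point := ⟨p⟩
    have : Nonempty W.cut.Strand := ⟨(hB.out hp).2.choose⟩
    have : Nonempty Z.cut.net.P := ⟨φ p⟩
    obtain ⟨ψ, π', g1, g2, -⟩ := h6.symm (J := {p | p ∉ P ∧ p ∉ P'}) (Q := {s | W.cut.ini s ∉ P}) subset_rfl h8.injOn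
      (fun s hs => by
        rcases hs with hs | hs
        exacts [hs.1, fun h => hs.2 (hB.ini_iff.1 h)]) h7
    rw [h8.image_eq] at g1
    have hmap : ∀ l : List W.Pt, (∀ p ∈ l, p ∉ P ∧ p ∉ P') → (l.map φ).map ψ = l := fun l hl => by
      rw [List.map_map]
      exact (map_congr_left fun p hp => g2 p (hl p hp)).trans (map_id l)
    have hA : ∀ p ∈ A, p ∉ P ∧ p ∉ P' := fun p hp => by
      have hn := W.cut.sources_nodup
      rw [h1, nodup_append] at hn
      refine ⟨fun h => hn.2.2 p hp p h rfl, fun h => ?_⟩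
      exact outs_ne_nil_of_ins ((W.cut.mem_sources p).1 (h1 ▸ List.mem_append_left _ hp)) (hB.inn h).1
    have hA' : ∀ p ∈ A', p ∉ P ∧ p ∉ P' := fun p hp => by
      have hn := W.cut.sinks_nodup
      rw [h2, nodup_append] at hn
      refine ⟨fun h => ?_, fun h => hn.2.2 p hp p h rfl⟩
      exact outs_ne_nil_of_ins (hB.out h).1 ((W.cut.mem_sinks p).1 (h2 ▸ List.mem_append_left _ hp))
    have hred : Z.cut.Reduction3At W.cut v k := ⟨A.map φ, Q, [], A'.map φ, Q', [], P, P', ψ, π', hk, by simpa using h9,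
      by simpa using h10, by simpa using h3, hch ▸ h11, h12, g1,
      ⟨fun x hx => by obtain ⟨p, hp, rfl⟩ := h8.surjOn hx; rw [g2 p hp]; exact hp, fun x hx y hy he => by
          obtain ⟨p, hp, rfl⟩ := h8.surjOn hx
          obtain ⟨q, hq, rfl⟩ := h8.surjOn hy
          rw [g2 p hp, g2 q hq] at he; rw [he], fun p hp => ⟨φ p, h8.mapsTo hp, g2 p hp⟩⟩,
      by rw [hmap A hA]; simpa using h1, by rw [hmap A' hA']; simpa using h2, h4, hcol h5⟩
    obtain ⟨e', f, L, p1, p2, p3⟩ := hred.portIso Z.closed W.closed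
    obtain ⟨e'', -, -, p4⟩ := p1.symm Z.wf W.wf
    rw [← hi.loops, hl, add_left_inj] at p3
    exact ⟨Z, hZ, (ThreeEquivalent.of_similar hs).trans _ _ _ (EqvGen.symm _ _ (EqvGen.rel _ _ (.inr ⟨v, k, hred⟩))),
      ⟨_, _, hi.port.trans W.wf Z.wf p4⟩, by rw [p2, p3]⟩
  · obtain ⟨hk, W, Z, A, A', P, P', Q, Q', φ, π, e, hs, hi, h1, h2, h3, h4, h5, h6, h7, h8, h9, h10, h11, h12, hZ⟩ :=
      hX.exists_replace (cs := Γ.children v) (ds := [v]) (k := k) hne (cons_ne_nil _ _)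
        (hl ▸ Multiset.le_add_left _ _)
    have hred : W.cut.Reduction3At Z.cut v k := ⟨A, P, [], A', P', [], Q, Q', φ, π, hk, by simpa using h1,
      by simpa using h2, h3, hch ▸ h4, h5, h6, h8, by simpa using h9, by simpa using h10, h11, hcol h12⟩
    obtain ⟨e', f, L, p1, p2, p3⟩ := hred.portIso W.closed Z.closed
    rw [← hi.loops, hl, add_left_inj] at p2
    exact ⟨Z, hZ, (ThreeEquivalent.of_similar hs).trans _ _ _ (EqvGen.rel _ _ (.inr ⟨v, k, hred⟩)),
      ⟨_, _, hi.port.trans W.wf Z.wf p1⟩, by rw [p3, p2]⟩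

lemma Reaches.trans {m m' m''} (h : Reaches Γ m m') (h' : Reaches Γ m' m'') : Reaches Γ m m'' := fun X hX hl => by
  obtain ⟨Y, hY, h1, ⟨e, f, h2⟩, h3⟩ := h X hX hl
  obtain ⟨Z, hZ, h4, ⟨e', f', h5⟩, h6⟩ := h' Y hY h3
  exact ⟨Z, hZ, h1.trans _ _ _ h4, ⟨_, _, h2.trans Y.wf Z.wf h5⟩, h6⟩

lemma reaches_of_loopEq (hdead : Γ.NoDeadEnds) {m m'} (h : Net.LoopEq Γ m m') :
    Reaches Γ m m' ∧ Reaches Γ m' m := by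
  induction h with
  | rel _ _ h => exact reaches_of_loopMove hdead h
  | refl m =>
    have : Reaches Γ m m := fun X hX hl => ⟨X, hX, EqvGen.refl _, ⟨_, _, Net.PortIso.refl _ X.wf 0⟩, hl⟩
    exact ⟨this, this⟩
  | symm _ _ _ ih => exact ih.symm
  | trans _ _ _ _ _ ih ih' => exact ⟨ih.1.trans ih'.1, ih'.2.trans ih.2⟩

lemma Plain.threeEquivalent (hdead : Γ.NoDeadEnds) (hX : X.Plain) (hY : Y.Plain) [Nonempty X.Pt] [Nonempty Y.Pt]
    (h : Net.Equiv3 X.cut.net Y.cut.net) : X.ThreeEquivalent Y := by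
  obtain ⟨e, f, h1, h2⟩ := h
  have hP : Nonempty X.cut.net.P := ‹Nonempty X.Pt›
  obtain ⟨Z, hZ, h3, ⟨e', f', h4⟩, h5⟩ := (reaches_of_loopEq hdead h2).1 X hX rfl
  obtain ⟨e₁, -, -, h6⟩ := h1.symm X.wf Y.wf
  exact h3.trans _ _ _ (ThreeEquivalent.of_similar ((hY.similar hZ (h6.trans X.wf Z.wf h4) h5.symm).symm))

end ClosedStrandDiagram

end

open ClosedStrandDiagram in
theorem mainTheorem3 {V E : Type*} [Finite V] [Finite E] [Nonempty V] (Γ : OrderedGraph V E)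
    (hdead : Γ.NoDeadEnds) (hred : Γ.NoRedundantEdges)
    (X Y : ClosedStrandDiagram Γ)
    (hX : X.SemiReduced) (hY : Y.SemiReduced) (hXY : X.Equivalent Y) :
    X.ThreeEquivalent Y := by
  have hemp := (hXY.linked hdead).1
  by_cases hP : Nonempty X.Pt
  · obtain ⟨X', h1, h2⟩ := exists_plain X hX.noDegenerate
    obtain ⟨Y', h3, h4⟩ := exists_plain Y hY.noDegenerate
    have hsim : ∀ {A B : ClosedStrandDiagram Γ}, A.Similar B → A.Equivalent B := fun h =>
      EqvGen.of_imp (fun _ _ h => EqvGen.rel _ _ (.inl h)) h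
    have heq : X'.Equivalent Y' := ((hsim h1).symm.trans _ _ _ hXY).trans _ _ _ (hsim h3)
    have hP' : Nonempty X'.Pt := ((hsim h1).linked hdead).1.1 hP
    have hQ' : Nonempty Y'.Pt := (heq.linked hdead).1.1 hP'
    have h5 := heq.equiv3 hdead (h2.irred (hX.of_similar h1)) (h4.irred (hY.of_similar h3)) hP'
    exact ((ThreeEquivalent.of_similar h1).trans _ _ _ (h2.threeEquivalent hdead h4 h5)).trans _ _ _
      (ThreeEquivalent.of_similar h3.symm)
  · exact ThreeEquivalent.of_similar (similar_of_isEmpty (not_nonempty_iff.1 hP) (not_nonempty_iff.1 (hemp.not.1 hP)))
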